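/- Let $\nu\in\{2,3\}$. We write $x\times v$ and $\operatorname{curl}$ for the usual operations in $\mathbb R^3$; in $\mathbb R^2$, for a vector $v$ and a scalar $w$, $\operatorname{curl}v=\partial_1v_2-\partial_2v_1$, $\;x\times w=(x_2w,-x_1w)$ and $\operatorname{curl}w=(\partial_2w,-\partial_1w)$. For a vector field $A:\mathbb R^\nu\to\mathbb R^\nu$, $\operatorname{curl}A=B$ in $\mathcal S'$ means $\int A\cdot\operatorname{curl}\phi\,dx=\int B\cdot\phi\,dx$ for all Schwartz functions $\phi$ (with values in $\mathbb R$ if $\nu=2$, in $\mathbb R^3$ if $\nu=3$), equality of two curls in $\mathcal S'$ is understood in the same way, and $\operatorname{div}A=d$ in $\mathcal S'$ means $\int A\cdot\nabla\phi\,dx=-\int d\,\phi\,dx$ for all real Schwartz functions $\phi$. A function $f$ on $\mathbb R^\nu$ *decays integrably* if $\int_0^\infty\sup\{|f(x)|:|x|\ge r\}\,dr<\infty$. A vector potential $A:\mathbb R^\nu\to\mathbb R^\nu$ is of *medium range* if it is continuous, $A(x)=O(|x|^{-\mu})$ as $|x|\to\infty$ for some $\mu>1/2$, and its longitudinal part $A(x)\cdot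 x/|x|$ decays integrably. It is *short-range* if it is continuous and $A$ decays integrably. A magnetic field $B:\mathbb R^2\to\mathbb R$ or $B:\mathbb R^3\to\mathbb R^3$ is of *medium decay* if $B\in L^p(\mathbb R^\nu)$ for some $p>\nu$, $|B(x)|\le C|x|^{-\mu}$ for some $\mu>3/2$ and almost all large $x$, and, if $\nu=3$, $\operatorname{div}B=0$ in $\mathcal S'$. For a magnetic field $B$ of medium decay consider - the *transversal gauge* $\displaystyle A(x)=-x\times\int_0^1 s\,B(sx)\,ds$; - the *Griesinger gauge* $\displaystyle A(x)=-\int_{\mathbb R^\nu}\int_0^1 h(z)\,(x-z)\times s\,B(sx+(1-s)z)\,ds\,dz$, for any $h\in C_0^\infty(\mathbb R^\nu,\mathbb R)$ with $\int h\,dx=1$; - the *Coulomb gauge* $\displaystyle A(x)=-\frac1{\omega_\nu}\int_{\mathbb R^\nu}\frac{x-y}{|x-y|^\nu}\times B(y)\,dy$, with $\omega_2=2\pi$, $\omega_3=4\pi$. **Theorem.** 1. If $A,A'$ are vector potentials of medium range with $\operatorname{curl}A'=\operatorname{curl}A$ in $\mathcal S'$, then there is a $C^1$-function $\lambda:\mathbb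 R^\nu\to\mathbb R$ with $A'=A+\nabla\lambda$. Moreover $\Lambda(x):=\lim_{r\to\infty}\lambda(rx)$ exists for all $x$, is homogeneous of degree $0$, and is continuous on $\mathbb R^\nu\setminus\{0\}$. 2. Let $B$ be of medium decay. The Griesinger gauge vector potential $A$ satisfies $\operatorname{curl}A=B$ in $\mathcal S'$ and is of medium range; moreover $A(x)=O(|x|^{-(\mu-1)})$ whenever $B(x)=O(|x|^{-\mu})$ with $3/2<\mu<2$. If $B$ is continuous, then the transversal gauge vector potential has the same properties, and it satisfies $x\cdot A(x)=0$. 3. Let $B$ be of medium decay with $B(x)=O(|x|^{-\mu})$ for some $\mu>2$. Then the Coulomb gauge vector potential $A$ satisfies $\operatorname{curl}A=B$ and $\operatorname{div}A=0$ in $\mathcal S'$, and is of medium range. Moreover, $|A(x)|\le C|x|^{-1}$ for all $x\ne0$ in the Coulomb gauge, in the Griesinger gauge and, if $B$ is continuous, in the transversal gauge. If $\nu=3$, then for every direction $\omega$ and almost every $c\in\mathbb R$, the flux integral of $\omega\cdot B$ over the plane $\{x:\omega\cdot x=c\}$ converges absolutely and vanishes, and the Coulomb gauge vector potential is short-range.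 If $\nu=2$, then $B$ is integrable, so that the flux $\Phi=\int_{\mathbb R^2}B\,dx$ is finite, and the Coulomb gauge vector potential is short-range if and only if $\Phi=0$. 4. If $B$ is of medium decay, there is a vector potential $A=A^s+A^r$ of medium range with $\operatorname{curl}A=B$ in $\mathcal S'$, such that $A^s$ is short-range and continuous, $A^r$ is $C^\infty$ and transversal ($x\cdot A^r(x)=0$) with $|\partial_iA^r_k(x)|\le C|x|^{-\mu'}$ for all $i,k$ and $x\neq0$, for some $\mu'>1$, and such that the distribution $\operatorname{div}A$ is given by a continuous function that decays integrably. -/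

import Mathlib

open MeasureTheory Filter Set Bornology Topology Asymptotics
open scoped ENNReal ContDiff SchwartzMap Gradient

noncomputable section

namespace VectorPotential

/-- Euclidean space of dimension `n`. -/
abbrev E (n : ℕ) : Type := EuclideanSpace ℝ (Fin n)

/-- The `i`-th partial derivative of `f` at `x`. -/
def pd {n : ℕ} {F : Type*} [NormedAddCommGroup F] [NormedSpace ℝ F]
    (i : Fin n) (f : E n → F) (x : E n) : F :=
  fderiv ℝ f x (EuclideanSpace.single i 1)

/-! ### Vector products and curls -/

/-- In the plane, the vector product `x × w = (x₂ w, -x₁ w)` of a vector and a scalar. -/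
def cross2 (x : E 2) (w : ℝ) : E 2 := !₂[x 1 * w, -(x 0 * w)]

/-- The vector product in space. -/
def cross3 (x v : E 3) : E 3 := WithLp.toLp 2 (crossProduct x.ofLp v.ofLp)

/-- In the plane, `curl w = (∂₂ w, -∂₁ w)` for a scalar function `w`. -/
def scalarCurl2 (w : E 2 → ℝ) (x : E 2) : E 2 := !₂[pd 1 w x, -pd 0 w x]

/-- The curl of a vector field in space. -/
def curl3 (v : E 3 → E 3) (x : E 3) : E 3 :=
  !₂[pd 1 v x 2 - pd 2 v x 1, pd 2 v x 0 - pd 0 v x 2, pd 0 v x 1 - pd 1 v x 0]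

/-- The action `φ ↦ ∫ A · curl φ dx` of the tempered distribution `curl A` on Schwartz functions,
for a vector field `A` in the plane. -/
def distCurl2 (A : E 2 → E 2) (φ : 𝓢(E 2, ℝ)) : ℝ :=
  ∫ x, inner ℝ (A x) (scalarCurl2 φ x)

/-- The action `φ ↦ ∫ A · curl φ dx` of the tempered distribution `curl A` on Schwartz
vector fields, for a vector field `A` in space. -/
def distCurl3 (A : E 3 → E 3) (φ : 𝓢(E 3, E 3)) : ℝ :=
  ∫ x, inner ℝ (A x) (curl3 φ x)

/-- `curl A = B` as tempered distributions in the plane. -/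
def HasDistCurl2 (A : E 2 → E 2) (B : E 2 → ℝ) : Prop :=
  ∀ φ : 𝓢(E 2, ℝ), distCurl2 A φ = ∫ x, B x * φ x

/-- `curl A = B` as tempered distributions in space. -/
def HasDistCurl3 (A B : E 3 → E 3) : Prop :=
  ∀ φ : 𝓢(E 3, E 3), distCurl3 A φ = ∫ x, inner ℝ (B x) (φ x)

/-- `div A = d` as tempered distributions. -/
def HasDistDiv {n : ℕ} (A : E n → E n) (d : E n → ℝ) : Prop :=
  ∀ φ : 𝓢(E n, ℝ), ∫ x, inner ℝ (A x) (gradient (φ : E n → ℝ) x) = -∫ x, d x * φ x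

/-! ### Decay conditions -/

/-- Integrable decay: `∫₀^∞ sup {|f x| : |x| ≥ r} dr < ∞`. -/
def DecaysIntegrably {n : ℕ} {F : Type*} [NormedAddCommGroup F] (f : E n → F) : Prop :=
  ∫⁻ r in Ioi (0 : ℝ), (⨆ (x : E n) (_ : r ≤ ‖x‖), ‖f x‖ₑ) < ⊤

/-- `|B x| ≤ C |x|^(-μ)` for (almost all) large `x`, as appropriate for a function that is
determined up to null sets. -/
def DecaysAE {n : ℕ} {F : Type*} [NormedAddCommGroup F] (B : E n → F) (μ : ℝ) : Prop :=
  ∃ C R : ℝ, ∀ᵐ x : E n, R ≤ ‖x‖ → ‖B x‖ ≤ C * ‖x‖ ^ (-μ)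

/-- Magnetic fields of medium decay in the plane. -/
structure MediumDecay2 (B : E 2 → ℝ) : Prop where
  memLp : ∃ p : ℝ≥0∞, 2 < p ∧ MemLp B p volume
  decay : ∃ μ : ℝ, 3 / 2 < μ ∧ DecaysAE B μ

/-- Magnetic fields of medium decay in space; these are divergence-free. -/
structure MediumDecay3 (B : E 3 → E 3) : Prop where
  memLp : ∃ p : ℝ≥0∞, 3 < p ∧ MemLp B p volume
  decay : ∃ μ : ℝ, 3 / 2 < μ ∧ DecaysAE B μ
  div_eq_zero : HasDistDiv B 0

/-- `f x = O(|x|^(-μ))` as `|x| → ∞`. -/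
def IsBigOInv {n : ℕ} (f : E n → E n) (μ : ℝ) : Prop :=
  f =O[cobounded (E n)] fun x => ‖x‖ ^ (-μ)

/-- Vector potentials of medium range. -/
structure MediumRange {n : ℕ} (A : E n → E n) : Prop where
  continuous : Continuous A
  decay : ∃ μ : ℝ, 1 / 2 < μ ∧ IsBigOInv A μ
  longitudinal : DecaysIntegrably fun x => inner ℝ (A x) x / ‖x‖

/-- Vector potentials of short range: continuous and decaying integrably. -/
structure ShortRange {n : ℕ} (A : E n → E n) : Prop where
  continuous : Continuous A
  decay : DecaysIntegrably A

/-- `A` is bounded by `C / |x|` on the whole space (except at the origin). -/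
def BoundedByInv {n : ℕ} (A : E n → E n) : Prop :=
  ∃ C : ℝ, ∀ x, x ≠ 0 → ‖A x‖ ≤ C * ‖x‖⁻¹

/-- `x · A x = 0` everywhere. -/
def IsTransversal {n : ℕ} (A : E n → E n) : Prop :=
  ∀ x, inner ℝ x (A x) = 0

/-- A mollifier: a smooth compactly supported function with integral `1`. -/
structure IsMollifier {n : ℕ} (h : E n → ℝ) : Prop where
  smooth : ContDiff ℝ ∞ h
  hasCompactSupport : HasCompactSupport h
  integral_eq_one : ∫ z, h z = 1

/-! ### The three gauges -/

/-- The transversal gauge in the plane. -/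
def transversal2 (B : E 2 → ℝ) (x : E 2) : E 2 :=
  -cross2 x (∫ s in (0 : ℝ)..1, s * B (s • x))

/-- The transversal gauge in space. -/
def transversal3 (B : E 3 → E 3) (x : E 3) : E 3 :=
  -cross3 x (∫ s in (0 : ℝ)..1, s • B (s • x))

/-- The Griesinger gauge in the plane, for the mollifier `h`. -/
def griesinger2 (h : E 2 → ℝ) (B : E 2 → ℝ) (x : E 2) : E 2 :=
  -∫ z, ∫ s in (0 : ℝ)..1, h z • cross2 (x - z) (s * B (s • x + (1 - s) • z))

/-- The Griesinger gauge in space, for the mollifier `h`. -/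
def griesinger3 (h : E 3 → ℝ) (B : E 3 → E 3) (x : E 3) : E 3 :=
  -∫ z, ∫ s in (0 : ℝ)..1, h z • cross3 (x - z) (s • B (s • x + (1 - s) • z))

/-- The Coulomb gauge in the plane. -/
def coulomb2 (B : E 2 → ℝ) (x : E 2) : E 2 :=
  -((1 / (2 * Real.pi)) • ∫ y, cross2 ((1 / ‖x - y‖ ^ 2) • (x - y)) (B y))

/-- The Coulomb gauge in space. -/
def coulomb3 (B : E 3 → E 3) (x : E 3) : E 3 :=
  -((1 / (4 * Real.pi)) • ∫ y, cross3 ((1 / ‖x - y‖ ^ 3) • (x - y)) (B y))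

/-! ### Auxiliary notions for the statement -/

/-- `Λ x = lim_{r → ∞} l (r x)` exists for all `x`; it is homogeneous of degree `0`, and it is
continuous away from the origin. -/
def HasRadialLimit {n : ℕ} (l Λ : E n → ℝ) : Prop :=
  (∀ x, Tendsto (fun r : ℝ => l (r • x)) atTop (𝓝 (Λ x))) ∧
    (∀ (c : ℝ) (x : E n), 0 < c → Λ (c • x) = Λ x) ∧ ContinuousOn Λ {0}ᶜ

/-- The flux of `B` vanishes through almost every plane: for every direction `b 2` and almost every
`c`, the normal component of `B` is integrable over the plane `{x | b 2 · x = c}`, with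
integral `0`. The plane is parametrized isometrically by the other two vectors of the orthonormal
basis `b`. -/
def FluxVanishesAEPlane (B : E 3 → E 3) : Prop :=
  ∀ b : OrthonormalBasis (Fin 3) ℝ (E 3), ∀ᵐ c : ℝ,
    Integrable (fun u : E 2 => inner ℝ (b 2) (B (u 0 • b 0 + u 1 • b 1 + c • b 2))) ∧
      ∫ u : E 2, inner ℝ (b 2) (B (u 0 • b 0 + u 1 • b 1 + c • b 2)) = 0

/-- The special gauge: `A = As + Ar` is of medium range, `As` is of short range and continuous,
`Ar` is transversal and smooth with `|∂ᵢ (Ar)ₖ| ≤ C |x|^(-μ)` for some `μ > 1`, and the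
distribution `div A` is a continuous function that decays integrably. -/
structure IsSpecialGauge {n : ℕ} (A As Ar : E n → E n) : Prop where
  mediumRange : MediumRange A
  eq_add : ∀ x, A x = As x + Ar x
  short : ShortRange As
  transversal : IsTransversal Ar
  smooth : ContDiff ℝ ∞ Ar
  deriv_decay : ∃ C μ : ℝ, 1 < μ ∧ ∀ (i k : Fin n) (x : E n), x ≠ 0 →
    |pd i Ar x k| ≤ C * ‖x‖ ^ (-μ)
  div : ∃ d : E n → ℝ, HasDistDiv A d ∧ Continuous d ∧ DecaysIntegrably d

end VectorPotential

end

open VectorPotential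

/-!
# Gauges for magnetic fields of medium decay

The plane and space are treated together: `CrossData` consists of a vector product with Lagrange's
identity in a form that is common to both, and `CrossData.inner_cr_cu` is this identity for a
product and a curl. The assertions are proved for `CrossData.HasCurl` and transferred to the
concrete curls through `planeCross` and `spaceCross`.

**Uniqueness.** The difference `D` of two medium range potentials of the same field is bounded,
continuous, and has vanishing distributional curl. Its mollifications are closed in the classical
sense, hence gradients, and the potentials converge locally in `C¹`
(`CrossData.exists_hasFDerivAt_of_curl_eq_zero`). The increments of the potential on rays are
integrals of the longitudinal part of `D`, which decays integrably; therefore the radial limits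
exist, uniformly on spheres, and depend continuously on the direction (`exists_hasRadialLimit`).

**Averaged radial gauges.** The Griesinger gauge averages the transversal gauges with base points
`z` over a mollifier, and the transversal gauge itself is the same average for the Dirac measure
at `0` (`CrossData.radialGauge`). The curl is computed by the Poincaré lemma: paired with a test
function, the integrand is the derivative of a dilation with respect to its parameter `s`, because
the divergence condition turns the second term in Lagrange's identity into a multiple of the
pairing of the field with the test function (`CrossData.integral_integral_inner_cr_cu`). By
Hölder's inequality the integrals are at most of the order `s^(-n/p)`, and the condition `p > n`
makes this integrable. The decay uses only the bounds collected in `RadialBound`. The integrand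
for the base point `z` is orthogonal to `x - z`, so that the longitudinal part of the average
gains a factor `1 / |x|` over the potential.

**The Coulomb gauge.** The kernel `w / |w|^n` inverts the radial derivative and is orthogonal to
rotations (`integral_kernel_mul_fderiv_self`, `integral_kernel_mul_fderiv_skew`); with Fubini's
theorem this gives the curl and the divergence. Continuity and decay are estimates for Riesz
potentials: Hölder's inequality near the singularity and the decay of the field elsewhere. In
space, the potential decays faster than `1 / |x|`. In the plane, it differs by a short-range term
from the potential of a point charge with the total flux (`CrossData.enorm_potential_sub_le`, by
an inversion), which is transversal and of exact order `1 / |x|`; therefore it is short-range if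
and only if the flux vanishes (`CrossData.shortRange_coulomb_plane_iff`). The fluxes through
parallel planes vanish because the divergence condition may be tested with functions of one
coordinate, whose derivative is arbitrary (`integral_mul_inner_eq_zero`); the cutoff that is
needed for this does not contribute in the limit, since the field decays faster than `|x|^(-2)`.

**The special gauge.** The Coulomb kernel of the source `y` is truncated smoothly at a distance of
the order `|y|^(1/2)` (`scaleTruncation`). The truncated potential `CrossData.potential` is still
divergence-free, and it gains a factor `|x|^(-1/2)`, so that it decays like `|x|^(-(μ - 1/2))` and
is short-range for `μ > 3/2`. Its curl differs from the field by `CrossData.remainder`, an average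
of the field over balls of radius `|x|^(1/2)`. This average is smooth, it decays like `|x|^(-μ)`,
and its derivative gains a factor `|x|^(-1/2)`; thus the derivatives of its transversal gauge
decay like `|x|^(-(μ - 1/2))`. The sum of the truncated potential and this transversal gauge is
the special gauge (`CrossData.exists_isSpecialGauge`).
-/

noncomputable section

namespace VectorPotential

section

/-! ### Radial integrals and scaling -/

variable {n : ℕ} {F : Type*} [NormedAddCommGroup F]

lemma lintegral_eq_mul_lintegral_comp_smul (f : E n → ℝ≥0∞) (z : E n) {s : ℝ} (hs : 0 < s) :
    ∫⁻ y, f y = ENNReal.ofReal (s ^ (n : ℝ)) * ∫⁻ y, f (z + s • y) := by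
  have h1 : ∫⁻ y, f (z + s • y) = ENNReal.ofReal |(s ^ n)⁻¹| * ∫⁻ y, f (z + y) := by
    have h2 := Measure.map_addHaar_smul (volume : Measure (E n)) hs.ne'
    rw [finrank_euclideanSpace_fin] at h2
    have h3 := (lintegral_map_equiv (μ := (volume : Measure (E n))) (fun y => f (z + y))
      (Homeomorph.smulOfNeZero s hs.ne').toMeasurableEquiv)
    have h4 : ⇑(Homeomorph.smulOfNeZero (α := E n) s hs.ne').toMeasurableEquiv = (s • ·) := rfl
    rw [h4, h2, lintegral_smul_measure] at h3
    simpa using h3.symm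
  rw [h1, lintegral_add_left_eq_self, ← mul_assoc, ← ENNReal.ofReal_mul (by positivity),
    abs_of_pos (by positivity), Real.rpow_natCast, mul_inv_cancel₀ (by positivity)]
  simp

lemma lintegral_comp_smul (f : E n → ℝ≥0∞) (z : E n) {s : ℝ} (hs : 0 < s) :
    ∫⁻ y, f (z + s • y) = ENNReal.ofReal (s ^ (-(n : ℝ))) * ∫⁻ y, f y := by
  rw [lintegral_eq_mul_lintegral_comp_smul f z hs, ← mul_assoc,
    ← ENNReal.ofReal_mul (by positivity), ← Real.rpow_add hs]
  simp

lemma exists_lintegral_ball_rpow_le (hn : 1 ≤ n) {a : ℝ} (ha : a < n) :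
    ∃ C : ℝ, 0 ≤ C ∧ ∀ r : ℝ, 0 < r →
      ∫⁻ w in Metric.ball (0 : E n) r, ENNReal.ofReal (‖w‖ ^ (-a)) ≤
        ENNReal.ofReal (C * r ^ (n - a)) := by
  have : Nonempty (Fin n) := ⟨⟨0, hn⟩⟩
  have hfin : ∫⁻ w in Metric.ball (0 : E n) 1, ENNReal.ofReal (‖w‖ ^ (-a)) < ⊤ := by
    have h : IntegrableOn (fun x : E n => ‖x‖ ^ (-a)) (Metric.ball 0 1) volume := by
      rw [integrableOn_fun_norm_addHaar volume (f := fun t : ℝ => t ^ (-a))]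
      have h1 : IntegrableOn (fun t : ℝ => t ^ ((n : ℝ) - 1 - a)) (Ioo 0 1) := by
        rw [intervalIntegral.integrableOn_Ioo_rpow_iff one_pos]; linarith
      refine h1.congr_fun (fun t ht => ?_) measurableSet_Ioo
      have : (((n - 1 : ℕ) : ℝ)) = (n : ℝ) - 1 := by push_cast [hn]; ring
      simp only [finrank_euclideanSpace_fin, smul_eq_mul]
      rw [← Real.rpow_natCast, this, ← Real.rpow_add ht.1, sub_eq_add_neg ((n : ℝ) - 1)]
    exact h.lintegral_lt_top
  refine ⟨_, ENNReal.toReal_nonneg (a := ∫⁻ w in Metric.ball (0 : E n) 1,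
    ENNReal.ofReal (‖w‖ ^ (-a))), fun r hr => le_of_eq ?_⟩
  rw [ENNReal.ofReal_mul ENNReal.toReal_nonneg, ENNReal.ofReal_toReal hfin.ne,
    ← lintegral_indicator Metric.isOpen_ball.measurableSet,
    ← lintegral_indicator Metric.isOpen_ball.measurableSet,
    lintegral_eq_mul_lintegral_comp_smul _ 0 hr, sub_eq_add_neg, Real.rpow_add hr,
    ENNReal.ofReal_mul (by positivity), mul_left_comm]
  congr 1
  rw [← lintegral_mul_const' _ _ ENNReal.ofReal_ne_top]
  refine lintegral_congr fun y => ?_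
  by_cases hy : ‖y‖ < 1
  · have : ‖r • y‖ < r := by
      rw [norm_smul, Real.norm_of_nonneg hr.le]; nlinarith
    rw [indicator_of_mem (by simpa using this), indicator_of_mem (by simpa using hy), zero_add,
      norm_smul, Real.norm_of_nonneg hr.le, Real.mul_rpow hr.le (norm_nonneg _),
      ENNReal.ofReal_mul (by positivity), mul_comm]
  · have : ¬ ‖r • y‖ < r := by
      rw [norm_smul, Real.norm_of_nonneg hr.le]; nlinarith
    rw [indicator_of_notMem (by simpa using this), indicator_of_notMem (by simpa using hy),
      zero_mul]

lemma exists_lintegral_compl_ball_rpow_le (hn : 1 ≤ n) {a : ℝ} (ha : (n : ℝ) < a) :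
    ∃ C : ℝ, 0 ≤ C ∧ ∀ r : ℝ, 0 < r →
      ∫⁻ w in (Metric.ball (0 : E n) r)ᶜ, ENNReal.ofReal (‖w‖ ^ (-a)) ≤
        ENNReal.ofReal (C * r ^ (n - a)) := by
  have : Nonempty (Fin n) := ⟨⟨0, hn⟩⟩
  have hfin : ∫⁻ w in (Metric.ball (0 : E n) 1)ᶜ, ENNReal.ofReal (‖w‖ ^ (-a)) < ⊤ := by
    have h : IntegrableOn (fun x : E n => ‖x‖ ^ (-a)) (Metric.ball 0 1)ᶜ volume := by
      have h1 : Integrable (fun x : E n => (Ici (1 : ℝ)).indicator (fun t => t ^ (-a)) ‖x‖) := by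
        rw [integrable_fun_norm_addHaar volume (f := (Ici (1 : ℝ)).indicator (fun t => t ^ (-a)))]
        have h1 : IntegrableOn (fun t : ℝ => t ^ ((n : ℝ) - 1 - a)) (Ici 1) := by
          rw [integrableOn_Ici_iff_integrableOn_Ioi, integrableOn_Ioi_rpow_iff one_pos]; linarith
        have h2 := (integrable_indicator_iff measurableSet_Ici).2 h1
        refine h2.integrableOn.congr_fun (fun t ht => ?_) measurableSet_Ioi
        have : (((n - 1 : ℕ) : ℝ)) = (n : ℝ) - 1 := by push_cast [hn]; ring
        simp only [finrank_euclideanSpace_fin, smul_eq_mul]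
        by_cases h : t ∈ Ici (1 : ℝ)
        · rw [indicator_of_mem h, indicator_of_mem h, ← Real.rpow_natCast, this,
            ← Real.rpow_add ht, sub_eq_add_neg ((n : ℝ) - 1)]
        · rw [indicator_of_notMem h, indicator_of_notMem h, mul_zero]
      rw [← integrable_indicator_iff Metric.isOpen_ball.measurableSet.compl]
      refine h1.congr (ae_of_all _ fun x => ?_)
      by_cases h : ‖x‖ < 1 <;> simp [indicator, h]
    exact h.lintegral_lt_top
  refine ⟨_, ENNReal.toReal_nonneg (a := ∫⁻ w in (Metric.ball (0 : E n) 1)ᶜ,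
    ENNReal.ofReal (‖w‖ ^ (-a))), fun r hr => le_of_eq ?_⟩
  rw [ENNReal.ofReal_mul ENNReal.toReal_nonneg, ENNReal.ofReal_toReal hfin.ne,
    ← lintegral_indicator Metric.isOpen_ball.measurableSet.compl,
    ← lintegral_indicator Metric.isOpen_ball.measurableSet.compl,
    lintegral_eq_mul_lintegral_comp_smul _ 0 hr, sub_eq_add_neg, Real.rpow_add hr,
    ENNReal.ofReal_mul (by positivity), mul_left_comm]
  congr 1
  rw [← lintegral_mul_const' _ _ ENNReal.ofReal_ne_top]
  refine lintegral_congr fun y => ?_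
  by_cases hy : ‖y‖ < 1
  · have : ‖r • y‖ < r := by
      rw [norm_smul, Real.norm_of_nonneg hr.le]; nlinarith
    rw [indicator_of_notMem (by simpa using this), indicator_of_notMem (by simpa using hy),
      zero_mul]
  · have : ¬ ‖r • y‖ < r := by
      rw [norm_smul, Real.norm_of_nonneg hr.le]; nlinarith
    rw [indicator_of_mem (by simpa using this), indicator_of_mem (by simpa using hy), zero_add,
      norm_smul, Real.norm_of_nonneg hr.le, Real.mul_rpow hr.le (norm_nonneg _),
      ENNReal.ofReal_mul (by positivity), mul_comm]

/-! ### Decay of functions -/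

lemma DecaysAE.exists_nonneg {B : E n → F} {μ : ℝ} (h : DecaysAE B μ) :
    ∃ C R : ℝ, 0 ≤ C ∧ 1 ≤ R ∧ ∀ᵐ x : E n, R ≤ ‖x‖ → ‖B x‖ ≤ C * ‖x‖ ^ (-μ) := by
  obtain ⟨C, R, h⟩ := h
  refine ⟨|C|, max R 1, abs_nonneg _, le_max_right _ _, h.mono fun x hx hR => ?_⟩
  refine (hx ((le_max_left _ _).trans hR)).trans ?_
  gcongr
  exact le_abs_self C

lemma DecaysAE.mono {B : E n → F} {μ ν : ℝ} (h : DecaysAE B μ) (hν : ν ≤ μ) : DecaysAE B ν := by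
  obtain ⟨C, R, hC, hR, h⟩ := h.exists_nonneg
  refine ⟨C, R, h.mono fun x hx hxR => (hx hxR).trans ?_⟩
  have : 1 ≤ ‖x‖ := hR.trans hxR
  gcongr

lemma exists_memLp_ofReal {B : E n → F} {p : ℝ≥0∞} (hp : n < p) (hB : MemLp B p) {μ : ℝ}
    (hμ : 1 < μ) (hdec : DecaysAE B μ) :
    ∃ q : ℝ, n < q ∧ MemLp B (ENNReal.ofReal q) := by
  by_cases hpt : p = ⊤
  · subst hpt
    refine ⟨n + 1, by linarith, ?_⟩
    obtain ⟨C, R, hC, hR, h⟩ := hdec.exists_nonneg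
    obtain ⟨K, hK⟩ : ∃ K : ℝ, ∀ᵐ x, ‖B x‖ ≤ K := by
      refine ⟨(eLpNorm B ⊤ volume).toReal, ?_⟩
      have := ae_le_eLpNormEssSup (f := B) (μ := volume)
      filter_upwards [this] with x hx
      rw [← eLpNorm_exponent_top] at hx
      have := ENNReal.toReal_mono hB.2.ne hx
      simpa using this
    have hdom : ∀ᵐ x, ‖B x‖ ≤ (|K| * (1 + R) ^ μ + C * 2 ^ μ) * (1 + ‖x‖) ^ (-μ) := by
      filter_upwards [h, hK] with x h1 h2
      have hx0 := norm_nonneg x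
      rw [add_mul]
      rcases le_or_gt R ‖x‖ with hx | hx
      · have h3 := h1 hx
        have h4 : ‖x‖ ^ (-μ) ≤ 2 ^ μ * (1 + ‖x‖) ^ (-μ) := by
          have h5 : (1 + ‖x‖) / 2 ≤ ‖x‖ := by linarith
          calc ‖x‖ ^ (-μ) ≤ ((1 + ‖x‖) / 2) ^ (-μ) :=
                Real.rpow_le_rpow_of_nonpos (by positivity) h5 (by linarith)
            _ = 2 ^ μ * (1 + ‖x‖) ^ (-μ) := by
                rw [Real.div_rpow (by positivity) (by positivity),
                  Real.rpow_neg (by positivity : (0:ℝ) ≤ 2)]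
                field_simp
        have : 0 ≤ |K| * (1 + R) ^ μ * (1 + ‖x‖) ^ (-μ) := by positivity
        nlinarith [mul_le_mul_of_nonneg_left h4 hC]
      · have h3 : 1 ≤ (1 + R) ^ μ * (1 + ‖x‖) ^ (-μ) := by
          rw [Real.rpow_neg (by positivity), ← div_eq_mul_inv, ← Real.div_rpow (by positivity)
            (by positivity)]
          apply Real.one_le_rpow _ (by linarith)
          rw [le_div_iff₀ (by positivity)]; linarith
        have : 0 ≤ C * 2 ^ μ * (1 + ‖x‖) ^ (-μ) := by positivity
        have h4 := le_abs_self K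
        nlinarith [mul_le_mul_of_nonneg_left h3 (abs_nonneg K)]
    have hmem : MemLp (fun x : E n => (1 + ‖x‖) ^ (-μ)) (ENNReal.ofReal (n + 1)) := by
      rw [← integrable_norm_rpow_iff]
      · have : Integrable (fun x : E n => (1 + ‖x‖) ^ (-(μ * (n + 1)))) := by
          apply integrable_one_add_norm
          rw [finrank_euclideanSpace_fin]; nlinarith [(Nat.cast_nonneg n : (0:ℝ) ≤ n)]
        refine this.congr (ae_of_all _ fun x => ?_)
        simp only
        rw [Real.norm_of_nonneg (by positivity), ENNReal.toReal_ofReal (by positivity),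
          ← Real.rpow_mul (by positivity)]
        ring_nf
      · have : Continuous fun x : E n => (1 + ‖x‖) ^ (-μ) := by
          refine Continuous.rpow_const (by fun_prop) fun x => Or.inl ?_
          have := norm_nonneg x; positivity
        exact this.aestronglyMeasurable
      · simp; positivity
      · simp
    refine MemLp.of_le_mul (c := |K| * (1 + R) ^ μ + C * 2 ^ μ) hmem hB.1 ?_
    filter_upwards [hdom] with x hx
    rwa [Real.norm_of_nonneg (by positivity : 0 ≤ (1 + ‖x‖) ^ (-μ))]
  · refine ⟨p.toReal, ?_, by rwa [ENNReal.ofReal_toReal hpt]⟩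
    have := (ENNReal.toReal_lt_toReal (by simp) hpt).2 hp
    simpa using this

lemma lintegral_enorm_mul_le {B : E n → F} {p : ℝ} (hp : 1 < p)
    (hB : MemLp B (ENNReal.ofReal p)) {g : E n → ℝ≥0∞} (hg : AEMeasurable g) :
    ∫⁻ y, g y * ‖B y‖ₑ ≤
      (∫⁻ y, g y ^ (p / (p - 1))) ^ (1 / (p / (p - 1))) * eLpNorm B (ENNReal.ofReal p) volume := by
  have hpq : (p / (p - 1)).HolderConjugate p := (Real.HolderConjugate.conjExponent hp).symm
  refine (ENNReal.lintegral_mul_le_Lp_mul_Lq volume hpq hg hB.1.enorm).trans_eq ?_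
  rw [eLpNorm_eq_lintegral_rpow_enorm_toReal (by simp; linarith) (by simp),
    ENNReal.toReal_ofReal (by linarith)]

/-- A function which is bounded, and `O(|x|^(-a))` at infinity for some `a > 1`, decays
integrably. -/
lemma decaysIntegrably_of_le {G : Type*} [NormedAddCommGroup G] {f : E n → G} {C R K a : ℝ}
    (ha : 1 < a) (hR : ∀ x, R ≤ ‖x‖ → ‖f x‖ ≤ C * ‖x‖ ^ (-a)) (hK : ∀ x, ‖f x‖ ≤ K) :
    DecaysIntegrably f := by
  set S := max R 1
  have hS : 0 < S := by positivity
  have key : ∀ r ∈ Ioi (0 : ℝ), (⨆ (x : E n) (_ : r ≤ ‖x‖), ‖f x‖ₑ) ≤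
      ENNReal.ofReal ((Ioc 0 S).indicator (fun _ => K) r +
        (Ioi S).indicator (fun r => |C| * r ^ (-a)) r) := by
    intro r hr
    refine iSup₂_le fun x hx => ?_
    rw [← ofReal_norm]
    refine ENNReal.ofReal_le_ofReal ?_
    rcases le_or_gt r S with h | h
    · rw [indicator_of_mem (show r ∈ Ioc 0 S from ⟨hr, h⟩), indicator_of_notMem (by simpa using h)]
      simpa using hK x
    · rw [indicator_of_notMem (by simp [h]), indicator_of_mem (by simpa using h), zero_add]
      refine (hR x (by linarith [le_max_left R 1])).trans ?_
      have : (0 : ℝ) < r := hr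
      have hx0 : 0 < ‖x‖ := by linarith
      calc C * ‖x‖ ^ (-a) ≤ |C| * ‖x‖ ^ (-a) := by gcongr; exact le_abs_self C
        _ ≤ |C| * r ^ (-a) := by
          gcongr 1
          exact Real.rpow_le_rpow_of_nonpos this hx (by linarith)
  refine (setLIntegral_mono' measurableSet_Ioi key).trans_lt ?_
  have hi : Integrable ((Ioc 0 S).indicator (fun _ => K) +
        (Ioi S).indicator (fun r => |C| * r ^ (-a))) := by
    refine Integrable.add ?_ ?_
    · rw [integrable_indicator_iff measurableSet_Ioc]
      simp
    · rw [integrable_indicator_iff measurableSet_Ioi]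
      exact (integrableOn_Ioi_rpow_of_lt (by linarith) hS).const_mul _
  exact hi.integrableOn.lintegral_lt_top

lemma antitone_iSup_enorm {G : Type*} [NormedAddCommGroup G] (f : E n → G) :
    Antitone fun r : ℝ => ⨆ (x : E n) (_ : r ≤ ‖x‖), ‖f x‖ₑ := fun _ _ hrs =>
  iSup₂_le fun x hx => le_iSup₂_of_le x (hrs.trans hx) le_rfl

lemma DecaysIntegrably.mono {G G' : Type*} [NormedAddCommGroup G] [NormedAddCommGroup G']
    {f : E n → G} {g : E n → G'} (hf : DecaysIntegrably f) (h : ∀ x, ‖g x‖ ≤ ‖f x‖) :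
    DecaysIntegrably g := by
  refine (lintegral_mono fun r => iSup₂_mono fun x _ => ?_).trans_lt hf
  rw [← ofReal_norm, ← ofReal_norm]
  exact ENNReal.ofReal_le_ofReal (h x)

lemma DecaysIntegrably.add {G : Type*} [NormedAddCommGroup G] {f g : E n → G}
    (hf : DecaysIntegrably f) (hg : DecaysIntegrably g) :
    DecaysIntegrably (fun x => f x + g x) := by
  have h : ∫⁻ r in Ioi (0 : ℝ), ((⨆ (x : E n) (_ : r ≤ ‖x‖), ‖f x‖ₑ) +
      (⨆ (x : E n) (_ : r ≤ ‖x‖), ‖g x‖ₑ)) < ⊤ := by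
    rw [lintegral_add_left (antitone_iSup_enorm f).measurable]
    exact ENNReal.add_lt_top.2 ⟨hf, hg⟩
  refine (lintegral_mono fun r => iSup₂_le fun x hx => ?_).trans_lt h
  exact (enorm_add_le _ _).trans (add_le_add (le_iSup₂_of_le x hx le_rfl)
    (le_iSup₂_of_le x hx le_rfl))

lemma DecaysIntegrably.neg {G : Type*} [NormedAddCommGroup G] {f : E n → G}
    (hf : DecaysIntegrably f) : DecaysIntegrably (fun x => -f x) :=
  hf.mono fun x => by simp

end

section

/-! ### Estimates for Riesz potentials -/

variable {n : ℕ} {F : Type*} [NormedAddCommGroup F]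

/-- Fields in `L^p` for some finite `p > n` which are `O(|x|^(-μ))` almost everywhere. -/
structure DecayField (B : E n → F) (μ : ℝ) : Prop where
  memLp : ∃ p : ℝ, n < p ∧ MemLp B (ENNReal.ofReal p)
  decay : DecaysAE B μ

/-- The Riesz potential `∫ |x - y|^(1 - n) |B y| dy`, which dominates the Coulomb gauge. -/
def riesz (B : E n → F) (x : E n) : ℝ≥0∞ :=
  ∫⁻ y, ENNReal.ofReal (‖x - y‖ ^ (-((n : ℝ) - 1))) * ‖B y‖ₑ

lemma lintegral_ball_comp_sub (g : E n → ℝ≥0∞) (x : E n) (r : ℝ) :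
    ∫⁻ y in Metric.ball x r, g (x - y) = ∫⁻ w in Metric.ball 0 r, g w := by
  rw [← lintegral_indicator Metric.isOpen_ball.measurableSet,
    ← lintegral_indicator Metric.isOpen_ball.measurableSet,
    ← lintegral_sub_left_eq_self ((Metric.ball (0 : E n) r).indicator g) x]
  refine lintegral_congr fun y => ?_
  by_cases h : ‖x - y‖ < r
  · rw [indicator_of_mem (by simpa [dist_eq_norm, norm_sub_rev] using h),
      indicator_of_mem (by simpa using h)]
  · rw [indicator_of_notMem (by simpa [dist_eq_norm, norm_sub_rev] using h),
      indicator_of_notMem (by simpa using h)]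

namespace DecayField

variable {B : E n → F} {μ : ℝ}

lemma aestronglyMeasurable (hB : DecayField B μ) : AEStronglyMeasurable B := by
  obtain ⟨p, -, h⟩ := hB.memLp
  exact h.1

lemma locallyIntegrable (hn : 1 ≤ n) (hB : DecayField B μ) : LocallyIntegrable B := by
  obtain ⟨p, hp, h⟩ := hB.memLp
  refine h.locallyIntegrable ?_
  rw [← ENNReal.ofReal_one]
  have : (1 : ℝ) ≤ n := by exact_mod_cast hn
  exact ENNReal.ofReal_le_ofReal (by linarith)

lemma lintegral_ball_lt_top (hn : 1 ≤ n) (hB : DecayField B μ) (x : E n) (r : ℝ) :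
    ∫⁻ y in Metric.ball x r, ‖B y‖ₑ < ⊤ :=
  (((hB.locallyIntegrable hn).integrableOn_isCompact (isCompact_closedBall x r)).mono_set
    Metric.ball_subset_closedBall).2

/-- By Hölder's inequality, the Riesz kernel is integrated over small balls uniformly in their
center; this is where `p > n` is needed. -/
lemma exists_lintegral_ball_le (hn : 2 ≤ n) (hB : DecayField B μ) :
    ∃ C κ : ℝ, 0 ≤ C ∧ 0 < κ ∧ ∀ (x : E n) (δ : ℝ), 0 < δ →
      ∫⁻ y in Metric.ball x δ, ENNReal.ofReal (‖x - y‖ ^ (-((n : ℝ) - 1))) * ‖B y‖ₑ ≤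
        ENNReal.ofReal (C * δ ^ κ) := by
  obtain ⟨p, hp, hBp⟩ := hB.memLp
  have hn' : (2 : ℝ) ≤ n := by exact_mod_cast hn
  set q := p / (p - 1)
  have hq : 0 < q := div_pos (by linarith) (by linarith)
  have hqn : ((n : ℝ) - 1) * q < n := by
    rw [← mul_div_assoc, div_lt_iff₀ (by linarith)]; nlinarith
  obtain ⟨C, hC, hCb⟩ := exists_lintegral_ball_rpow_le (n := n) (by omega) hqn
  refine ⟨C ^ (1 / q) * (eLpNorm B (ENNReal.ofReal p) volume).toReal,
    (n - (n - 1) * q) * (1 / q), by positivity, mul_pos (by linarith) (by positivity),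
    fun x δ hδ => ?_⟩
  have hm : Measurable fun y : E n => ENNReal.ofReal (‖x - y‖ ^ (-((n : ℝ) - 1))) := by fun_prop
  have h1 := lintegral_enorm_mul_le (by linarith) hBp
    (g := (Metric.ball x δ).indicator fun y => ENNReal.ofReal (‖x - y‖ ^ (-((n : ℝ) - 1))))
    (hm.indicator Metric.isOpen_ball.measurableSet).aemeasurable
  rw [← lintegral_indicator Metric.isOpen_ball.measurableSet]
  calc _ = _ := lintegral_congr fun y => by
          by_cases hy : y ∈ Metric.ball x δ <;> simp [hy]
    _ ≤ _ := h1
    _ ≤ _ := ?_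
  have h2 : ∫⁻ y, (Metric.ball x δ).indicator
      (fun y => ENNReal.ofReal (‖x - y‖ ^ (-((n : ℝ) - 1)))) y ^ q ≤
      ENNReal.ofReal (C * δ ^ (n - (n - 1) * q)) := by
    refine le_trans (le_of_eq ?_) (hCb δ hδ)
    rw [← lintegral_ball_comp_sub (fun w => ENNReal.ofReal (‖w‖ ^ (-(((n : ℝ) - 1) * q)))) x δ,
      ← lintegral_indicator Metric.isOpen_ball.measurableSet]
    refine lintegral_congr fun y => ?_
    by_cases hy : ‖x - y‖ < δ
    · have hy' : y ∈ Metric.ball x δ := by simpa [dist_eq_norm, norm_sub_rev] using hy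
      rw [indicator_of_mem hy', indicator_of_mem hy',
        ENNReal.ofReal_rpow_of_nonneg (by positivity) hq.le,
        ← Real.rpow_mul (norm_nonneg _), neg_mul]
    · have hy' : y ∉ Metric.ball x δ := by simpa [dist_eq_norm, norm_sub_rev] using hy
      rw [indicator_of_notMem hy', indicator_of_notMem hy', ENNReal.zero_rpow_of_pos hq]
  calc _ ≤ (ENNReal.ofReal (C * δ ^ (n - (n - 1) * q))) ^ (1 / q) *
        eLpNorm B (ENNReal.ofReal p) volume := by gcongr
    _ = _ := by
      rw [ENNReal.ofReal_rpow_of_nonneg (by positivity) (by positivity),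
        Real.mul_rpow hC (by positivity), ← Real.rpow_mul hδ.le, mul_right_comm,
        ENNReal.ofReal_mul (p := _ * _) (by positivity), ENNReal.ofReal_mul (by positivity),
        ENNReal.ofReal_toReal hBp.2.ne]

lemma exists_lintegral_ball_le_of_le (hn : 1 ≤ n) (hB : DecayField B μ) (hμ : 0 ≤ μ) {a : ℝ}
    (ha : a < n) :
    ∃ C R : ℝ, 0 ≤ C ∧ 1 ≤ R ∧ ∀ (x : E n) (r : ℝ), R ≤ ‖x‖ → 0 < r → r ≤ ‖x‖ / 2 →
      ∫⁻ y in Metric.ball x r, ENNReal.ofReal (‖x - y‖ ^ (-a)) * ‖B y‖ₑ ≤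
        ENNReal.ofReal (C * r ^ (n - a) * ‖x‖ ^ (-μ)) := by
  obtain ⟨C, R, hC, hR, hdec⟩ := hB.decay.exists_nonneg
  obtain ⟨K, hK, hKb⟩ := exists_lintegral_ball_rpow_le hn ha
  refine ⟨K * (C * 2 ^ μ), 2 * R, by positivity, by linarith, fun x r hx hr hrx => ?_⟩
  calc _ ≤ ∫⁻ y in Metric.ball x r, ENNReal.ofReal (‖x - y‖ ^ (-a)) *
        ENNReal.ofReal (C * 2 ^ μ * ‖x‖ ^ (-μ)) := by
        refine setLIntegral_mono_ae' Metric.isOpen_ball.measurableSet ?_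
        filter_upwards [hdec] with y hy hyx
        gcongr
        rw [← ofReal_norm]
        refine ENNReal.ofReal_le_ofReal ?_
        have h1 : ‖x‖ / 2 ≤ ‖y‖ := by
          have h2 := norm_sub_norm_le x y
          have h3 : ‖x - y‖ < r := by simpa [dist_eq_norm, norm_sub_rev] using hyx
          linarith
        refine (hy (by linarith)).trans ?_
        rw [mul_assoc]
        gcongr
        calc ‖y‖ ^ (-μ) ≤ (‖x‖ / 2) ^ (-μ) :=
              Real.rpow_le_rpow_of_nonpos (by linarith) h1 (by linarith)
          _ = _ := by
            rw [Real.div_rpow (by positivity) (by positivity),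
              Real.rpow_neg (by positivity : (0 : ℝ) ≤ 2)]
            field_simp
    _ ≤ ENNReal.ofReal (K * r ^ (n - a)) * ENNReal.ofReal (C * 2 ^ μ * ‖x‖ ^ (-μ)) := by
        rw [lintegral_mul_const' _ _ ENNReal.ofReal_ne_top,
          lintegral_ball_comp_sub (fun w => ENNReal.ofReal (‖w‖ ^ (-a)))]
        gcongr
        exact hKb r hr
    _ = _ := by
        rw [← ENNReal.ofReal_mul (by positivity)]
        congr 1; ring

lemma exists_riesz_le (hn : 2 ≤ n) (hB : DecayField B μ) (hμ : 1 < μ) :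
    ∃ C : ℝ, 0 ≤ C ∧ ∀ x : E n, riesz B x ≤ ENNReal.ofReal C := by
  have hn' : (2 : ℝ) ≤ n := by exact_mod_cast hn
  obtain ⟨C, R, hC, hR, hdec⟩ := hB.decay.exists_nonneg
  obtain ⟨C1, κ, hC1, hκ, h1⟩ := hB.exists_lintegral_ball_le hn
  obtain ⟨C2, hC2, h2⟩ := exists_lintegral_compl_ball_rpow_le (n := n) (by omega)
    (a := n - 1 + μ) (by linarith)
  have hM := (hB.lintegral_ball_lt_top (by omega) 0 R)
  set M := ∫⁻ y in Metric.ball 0 R, ‖B y‖ₑ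
  refine ⟨C1 + (M.toReal + C * (C2 + C2)), by positivity, fun x => ?_⟩
  rw [riesz, ← lintegral_add_compl _ (Metric.isOpen_ball (x := x) (ε := 1)).measurableSet,
    ENNReal.ofReal_add (by positivity) (by positivity)]
  gcongr
  · simpa using h1 x 1 one_pos
  set g : E n → ℝ≥0∞ := (Metric.ball 0 1)ᶜ.indicator fun w => ENNReal.ofReal (‖w‖ ^ (-(n - 1 + μ)))
  have hgm : Measurable g :=
    Measurable.indicator (by fun_prop) Metric.isOpen_ball.measurableSet.compl
  have hg : ∫⁻ y, g y ≤ ENNReal.ofReal C2 := by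
    have := h2 1 one_pos
    rw [← lintegral_indicator Metric.isOpen_ball.measurableSet.compl] at this
    simpa only [Real.one_rpow, mul_one] using this
  have hbig : ∀ a b : ℝ, 1 ≤ a → a ≤ b → b ^ (-((n : ℝ) - 1)) * a ^ (-μ) ≤ a ^ (-(n - 1 + μ)) ∧
      a ^ (-((n : ℝ) - 1)) * b ^ (-μ) ≤ a ^ (-(n - 1 + μ)) := by
    intro a b ha hab
    have ha0 : 0 < a := by linarith
    have : a ^ (-(n - 1 + μ)) = a ^ (-((n : ℝ) - 1)) * a ^ (-μ) := by
      rw [← Real.rpow_add ha0]; ring_nf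
    rw [this]
    constructor
    · gcongr 1
      exact Real.rpow_le_rpow_of_nonpos ha0 hab (by linarith)
    · gcongr 1
      exact Real.rpow_le_rpow_of_nonpos ha0 hab (by linarith)
  calc _ ≤ ∫⁻ y in (Metric.ball x 1)ᶜ, ((Metric.ball 0 R).indicator (fun y => ‖B y‖ₑ) y +
        ENNReal.ofReal C * (g y + g (x - y))) := by
        refine setLIntegral_mono_ae' Metric.isOpen_ball.measurableSet.compl ?_
        filter_upwards [hdec] with y hy hyx
        have hxy : 1 ≤ ‖x - y‖ := by simpa [dist_eq_norm, norm_sub_rev] using hyx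
        by_cases hyR : ‖y‖ < R
        · rw [indicator_of_mem (by simpa using hyR)]
          refine le_add_right ?_
          calc _ ≤ 1 * ‖B y‖ₑ := by
                gcongr
                rw [← ENNReal.ofReal_one]
                exact ENNReal.ofReal_le_ofReal
                  (Real.rpow_le_one_of_one_le_of_nonpos hxy (by linarith))
            _ = _ := one_mul _
        · rw [indicator_of_notMem (by simpa using hyR), zero_add]
          push Not at hyR
          have hy1 := hy hyR
          have hy2 : y ∈ (Metric.ball (0 : E n) 1)ᶜ := by simpa using hR.trans hyR
          have hy3 : x - y ∈ (Metric.ball (0 : E n) 1)ᶜ := by simpa using hxy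
          simp only [g]
          rw [indicator_of_mem hy2, indicator_of_mem hy3, ← ofReal_norm,
            ← ENNReal.ofReal_add (by positivity) (by positivity),
            ← ENNReal.ofReal_mul (by positivity), ← ENNReal.ofReal_mul (by positivity)]
          refine ENNReal.ofReal_le_ofReal ?_
          calc ‖x - y‖ ^ (-((n : ℝ) - 1)) * ‖B y‖
              ≤ ‖x - y‖ ^ (-((n : ℝ) - 1)) * (C * ‖y‖ ^ (-μ)) := by gcongr
            _ = C * (‖x - y‖ ^ (-((n : ℝ) - 1)) * ‖y‖ ^ (-μ)) := by ring
            _ ≤ _ := by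
              gcongr
              rcases le_total ‖y‖ ‖x - y‖ with h | h
              · exact ((hbig _ _ (hR.trans hyR) h).1).trans (le_add_of_nonneg_right (by positivity))
              · exact ((hbig _ _ hxy h).2).trans (le_add_of_nonneg_left (by positivity))
    _ ≤ ∫⁻ y, ((Metric.ball 0 R).indicator (fun y => ‖B y‖ₑ) y +
        ENNReal.ofReal C * (g y + g (x - y))) := setLIntegral_le_lintegral _ _
    _ = M + ENNReal.ofReal C * ((∫⁻ y, g y) + ∫⁻ y, g y) := by
        rw [lintegral_add_right' _ (by fun_prop), lintegral_const_mul' _ _ ENNReal.ofReal_ne_top,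
          lintegral_add_left' (by fun_prop), lintegral_sub_left_eq_self,
          lintegral_indicator Metric.isOpen_ball.measurableSet]
    _ ≤ ENNReal.ofReal M.toReal + ENNReal.ofReal C * (ENNReal.ofReal C2 + ENNReal.ofReal C2) := by
        rw [ENNReal.ofReal_toReal hM.ne]
        gcongr
    _ = _ := by
        rw [← ENNReal.ofReal_add hC2 hC2, ← ENNReal.ofReal_mul hC,
          ← ENNReal.ofReal_add ENNReal.toReal_nonneg (by positivity)]

lemma exists_riesz_le_rpow (hn : 2 ≤ n) (hB : DecayField B μ) (hμ : 1 < μ) (hμn : μ < n) :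
    ∃ C R : ℝ, 0 ≤ C ∧ 1 ≤ R ∧ ∀ x : E n, R ≤ ‖x‖ →
      riesz B x ≤ ENNReal.ofReal (C * ‖x‖ ^ (1 - μ)) := by
  have hn' : (2 : ℝ) ≤ n := by exact_mod_cast hn
  obtain ⟨C, R, hC, hR, hdec⟩ := hB.decay.exists_nonneg
  obtain ⟨C1, hC1, h1⟩ := exists_lintegral_ball_rpow_le (n := n) (by omega) (a := μ) hμn
  obtain ⟨C2, hC2, h2⟩ := exists_lintegral_compl_ball_rpow_le (n := n) (by omega)
    (a := n - 1 + μ) (by linarith)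
  obtain ⟨C3, hC3, h3⟩ := exists_lintegral_ball_rpow_le (n := n) (by omega) (a := (n : ℝ) - 1)
    (by linarith)
  have hM := (hB.lintegral_ball_lt_top (by omega) 0 R)
  set M := ∫⁻ y in Metric.ball 0 R, ‖B y‖ₑ
  refine ⟨2 ^ ((n : ℝ) - 1) * M.toReal +
    C * ((2 ^ ((n : ℝ) - 1) * C1 + C2) + (2 ^ μ * C3 + C2)), 2 * R, by positivity, by linarith,
    fun x hx => ?_⟩
  set r := ‖x‖
  have hr : 0 < r := by linarith
  -- The two bounds for the kernel, according to which of `y` and `x - y` is smaller.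
  set g : E n → ℝ≥0∞ := (Metric.ball 0 r)ᶜ.indicator fun w => ENNReal.ofReal (‖w‖ ^ (-(n - 1 + μ)))
  set g1 : E n → ℝ≥0∞ := (Metric.ball 0 r).indicator fun w =>
    ENNReal.ofReal (2 ^ ((n : ℝ) - 1) * r ^ (-((n : ℝ) - 1))) * ENNReal.ofReal (‖w‖ ^ (-μ))
  set g2 : E n → ℝ≥0∞ := (Metric.ball 0 r).indicator fun w =>
    ENNReal.ofReal (2 ^ μ * r ^ (-μ)) * ENNReal.ofReal (‖w‖ ^ (-((n : ℝ) - 1)))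
  have hgm : Measurable g :=
    Measurable.indicator (by fun_prop) Metric.isOpen_ball.measurableSet.compl
  have hgm1 : Measurable g1 :=
    Measurable.indicator (by fun_prop) Metric.isOpen_ball.measurableSet
  have hgm2 : Measurable g2 :=
    Measurable.indicator (by fun_prop) Metric.isOpen_ball.measurableSet
  have hg : ∫⁻ y, g y ≤ ENNReal.ofReal (C2 * r ^ (1 - μ)) := by
    have := h2 r hr
    rw [← lintegral_indicator Metric.isOpen_ball.measurableSet.compl] at this
    convert this using 3
    ring_nf
  have hg1 : ∫⁻ y, g1 y ≤ ENNReal.ofReal (2 ^ ((n : ℝ) - 1) * C1 * r ^ (1 - μ)) := by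
    simp only [g1]
    rw [lintegral_indicator Metric.isOpen_ball.measurableSet,
      lintegral_const_mul' _ _ ENNReal.ofReal_ne_top]
    refine (mul_le_mul_right (h1 r hr) _).trans_eq ?_
    rw [← ENNReal.ofReal_mul (by positivity), mul_mul_mul_comm, ← Real.rpow_add hr]
    ring_nf
  have hg2 : ∫⁻ y, g2 y ≤ ENNReal.ofReal (2 ^ μ * C3 * r ^ (1 - μ)) := by
    simp only [g2]
    rw [lintegral_indicator Metric.isOpen_ball.measurableSet,
      lintegral_const_mul' _ _ ENNReal.ofReal_ne_top]
    refine (mul_le_mul_right (h3 r hr) _).trans_eq ?_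
    rw [← ENNReal.ofReal_mul (by positivity), mul_mul_mul_comm, ← Real.rpow_add hr]
    ring_nf
  have hhalf : ∀ {s t : ℝ}, r ≤ s + t → s ≤ t → ∀ {b : ℝ}, 0 ≤ b → t ^ (-b) ≤ 2 ^ b * r ^ (-b) := by
    intro s t hst h b hb
    have : r / 2 ≤ t := by linarith
    calc t ^ (-b) ≤ (r / 2) ^ (-b) :=
          Real.rpow_le_rpow_of_nonpos (by linarith) this (by linarith)
      _ = _ := by
        rw [Real.div_rpow hr.le (by positivity),
          Real.rpow_neg (by positivity : (0 : ℝ) ≤ 2)]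
        field_simp
  calc riesz B x ≤ ∫⁻ y, ((Metric.ball 0 R).indicator (fun y =>
          ENNReal.ofReal (2 ^ ((n : ℝ) - 1) * r ^ (1 - μ)) * ‖B y‖ₑ) y +
        ENNReal.ofReal C * ((g1 y + g y) + (g2 (x - y) + g (x - y)))) := by
        refine lintegral_mono_ae ?_
        filter_upwards [hdec] with y hy
        have hxy : r ≤ ‖y‖ + ‖x - y‖ := by
          have := norm_add_le y (x - y); simpa using this
        by_cases hyR : ‖y‖ < R
        · rw [indicator_of_mem (by simpa using hyR)]
          refine le_add_right ?_
          gcongr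
          refine (hhalf hxy (by linarith) (by linarith)).trans ?_
          gcongr
          · linarith
          · linarith
        · rw [indicator_of_notMem (by simpa using hyR), zero_add]
          push Not at hyR
          have hy0 : 0 < ‖y‖ := by linarith
          calc _ ≤ ENNReal.ofReal (‖x - y‖ ^ (-((n : ℝ) - 1))) *
                ENNReal.ofReal (C * ‖y‖ ^ (-μ)) := by
                gcongr
                rw [← ofReal_norm]
                exact ENNReal.ofReal_le_ofReal (hy hyR)
            _ = ENNReal.ofReal C * ENNReal.ofReal (‖x - y‖ ^ (-((n : ℝ) - 1)) * ‖y‖ ^ (-μ)) := by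
                rw [← ENNReal.ofReal_mul (by positivity), ← ENNReal.ofReal_mul (by positivity)]
                ring_nf
            _ ≤ _ := by
              gcongr
              rcases le_or_gt ‖y‖ ‖x - y‖ with h | h
              · refine le_add_right ?_
                by_cases hyr : ‖y‖ < r
                · refine le_add_right ?_
                  simp only [g1]
                  rw [indicator_of_mem (by simpa using hyr), ← ENNReal.ofReal_mul (by positivity)]
                  refine ENNReal.ofReal_le_ofReal ?_
                  gcongr
                  exact hhalf hxy h (by linarith)
                · refine le_add_left ?_
                  simp only [g]
                  rw [indicator_of_mem (by simpa using hyr), neg_add, Real.rpow_add hy0]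
                  refine ENNReal.ofReal_le_ofReal ?_
                  gcongr 1
                  exact Real.rpow_le_rpow_of_nonpos hy0 h (by linarith)
              · refine le_add_left ?_
                by_cases hyr : ‖x - y‖ < r
                · refine le_add_right ?_
                  simp only [g2]
                  rw [indicator_of_mem (by simpa using hyr), ← ENNReal.ofReal_mul (by positivity),
                    mul_comm]
                  refine ENNReal.ofReal_le_ofReal ?_
                  gcongr
                  exact hhalf (by linarith) h.le (by linarith)
                · refine le_add_left ?_
                  simp only [g]
                  push Not at hyr
                  have hw : 0 < ‖x - y‖ := by linarith
                  rw [indicator_of_mem (by simpa using hyr), neg_add, Real.rpow_add hw]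
                  refine ENNReal.ofReal_le_ofReal ?_
                  gcongr 1
                  exact Real.rpow_le_rpow_of_nonpos hw h.le (by linarith)
    _ = ENNReal.ofReal (2 ^ ((n : ℝ) - 1) * r ^ (1 - μ)) * M +
        ENNReal.ofReal C * (((∫⁻ y, g1 y) + ∫⁻ y, g y) + ((∫⁻ y, g2 y) + ∫⁻ y, g y)) := by
        rw [lintegral_add_right' _ (by fun_prop), lintegral_const_mul' _ _ ENNReal.ofReal_ne_top,
          lintegral_add_left' (by fun_prop), lintegral_add_left' (by fun_prop),
          lintegral_add_left' (by fun_prop), lintegral_sub_left_eq_self,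
          lintegral_sub_left_eq_self g x, lintegral_indicator Metric.isOpen_ball.measurableSet,
          lintegral_const_mul' _ _ ENNReal.ofReal_ne_top]
    _ ≤ ENNReal.ofReal (2 ^ ((n : ℝ) - 1) * r ^ (1 - μ)) * ENNReal.ofReal M.toReal +
        ENNReal.ofReal C * ((ENNReal.ofReal (2 ^ ((n : ℝ) - 1) * C1 * r ^ (1 - μ)) +
          ENNReal.ofReal (C2 * r ^ (1 - μ))) + (ENNReal.ofReal (2 ^ μ * C3 * r ^ (1 - μ)) +
            ENNReal.ofReal (C2 * r ^ (1 - μ)))) := by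
        rw [ENNReal.ofReal_toReal hM.ne]
        gcongr
    _ = _ := by
        rw [← ENNReal.ofReal_add (by positivity) (by positivity),
          ← ENNReal.ofReal_add (by positivity) (by positivity),
          ← ENNReal.ofReal_add (by positivity) (by positivity),
          ← ENNReal.ofReal_mul (by positivity), ← ENNReal.ofReal_mul (by positivity),
          ← ENNReal.ofReal_add (by positivity) (by positivity)]
        congr 1; ring

end DecayField

end

section

/-! ### Vector products and curls -/

/-- The vector product in the plane or in space, as a bilinear map `cr` from vectors and values of
magnetic fields to vectors, together with the identities which are used. In the plane, the values
of magnetic fields are scalars and `P`, `Q` vanish; in space, `P` and `Q` are the identity. Thus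
`Q` turns a magnetic field into the vector field whose divergence has to vanish, and Lagrange's
identity takes the same form in both cases. -/
structure CrossData (n : ℕ) (F : Type*) [NormedAddCommGroup F] [InnerProductSpace ℝ F] where
  /-- The vector product. -/
  cr : E n →L[ℝ] F →L[ℝ] E n
  /-- The zero map in the plane, the identity in space. -/
  P : E n →L[ℝ] F
  /-- The zero map in the plane, the identity in space. -/
  Q : F →L[ℝ] E n
  norm_cr_le : ∀ w b, ‖cr w b‖ ≤ ‖w‖ * ‖b‖
  inner_cr_swap : ∀ w b v, inner ℝ (cr w b) v = -inner ℝ (cr v b) w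
  P_Q : ∀ b, P (Q b) = ((n : ℝ) - 2) • b
  inner_P : ∀ v b, inner ℝ (P v) b = inner ℝ v (Q b)
  cr_P_swap : ∀ v w, cr v (P w) = -cr w (P v)
  inner_cr_cr : ∀ w b v f, inner ℝ (cr w b) (cr v f) =
    inner ℝ v w * inner ℝ b f - inner ℝ (P w) f * inner ℝ v (Q b)
  exists_inner_cr : ∀ i k : Fin n, i ≠ k → ∃ f, ∀ v g, inner ℝ v (cr g f) = v i * g k - v k * g i

variable {n : ℕ} {F : Type*} [NormedAddCommGroup F] [InnerProductSpace ℝ F]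

namespace CrossData

variable (K : CrossData n F)

/-- The curl of a field as a linear function of its derivative. -/
def cu : (E n →L[ℝ] F) →L[ℝ] E n :=
  ∑ i, (K.cr (EuclideanSpace.single i 1)).comp
    (ContinuousLinearMap.apply ℝ F (EuclideanSpace.single i (1 : ℝ)))

lemma cu_apply (L : E n →L[ℝ] F) :
    K.cu L = ∑ i, K.cr (EuclideanSpace.single i 1) (L (EuclideanSpace.single i 1)) := by
  simp [cu]

lemma sum_smul_single (w : E n) : ∑ i, w i • EuclideanSpace.single i (1 : ℝ) = w := by
  have := (EuclideanSpace.basisFun (Fin n) ℝ).sum_repr w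
  simpa using this

/-- Lagrange's identity for a vector product and a curl. -/
lemma inner_cr_cu (w : E n) (b : F) (L : E n →L[ℝ] F) :
    inner ℝ (K.cr w b) (K.cu L) = inner ℝ b (L w) - inner ℝ (K.P w) (L (K.Q b)) := by
  rw [cu_apply, inner_sum]
  simp_rw [K.inner_cr_cr, Finset.sum_sub_distrib]
  congr 1
  · conv_rhs => rw [← sum_smul_single w, map_sum, inner_sum]
    refine Finset.sum_congr rfl fun i _ => ?_
    rw [map_smul, inner_smul_right, EuclideanSpace.inner_single_left]; simp
  · conv_rhs => rw [← sum_smul_single (K.Q b), map_sum, inner_sum]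
    refine Finset.sum_congr rfl fun i _ => ?_
    rw [map_smul, inner_smul_right, EuclideanSpace.inner_single_left]; simp [mul_comm]

lemma cu_smulRight (g : E n) (f : F) :
    K.cu ((innerSL ℝ g).smulRight f) = K.cr g f := by
  rw [cu_apply]
  conv_rhs => rw [← sum_smul_single g, map_sum, sum_apply]
  refine Finset.sum_congr rfl fun i _ => ?_
  simp [EuclideanSpace.inner_single_right]

lemma inner_cr_self (w : E n) (b : F) : inner ℝ w (K.cr w b) = 0 := by
  have := K.inner_cr_swap w b w
  rw [real_inner_comm]; linarith

/-- `curl A = B` as tempered distributions. -/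
def HasCurl (A : E n → E n) (B : E n → F) : Prop :=
  ∀ φ : 𝓢(E n, F), ∫ x, inner ℝ (A x) (K.cu (fderiv ℝ φ x)) = ∫ x, inner ℝ (B x) (φ x)

/-- In space, `div B = 0` as tempered distributions; no condition in the plane. -/
def IsDivFree (B : E n → F) : Prop :=
  ∀ ψ : 𝓢(E n, ℝ), ∫ y, fderiv ℝ ψ y (K.Q (B y)) = 0

end CrossData

/-! ### Curl-free fields are gradients -/

lemma MediumRange.exists_bound {A : E n → E n} (hA : MediumRange A) :
    ∃ C : ℝ, 0 ≤ C ∧ ∀ x, ‖A x‖ ≤ C := by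
  obtain ⟨μ, hμ, h⟩ := hA.decay
  obtain ⟨c, hc⟩ := h.bound
  obtain ⟨R, hR⟩ : ∃ R : ℝ, ∀ x : E n, R ≤ ‖x‖ → ‖A x‖ ≤ c * ‖‖x‖ ^ (-μ)‖ := by
    rw [(hasBasis_cobounded_norm (E := E n)).eventually_iff] at hc
    obtain ⟨R, -, hR⟩ := hc
    exact ⟨R, fun x hx => hR hx⟩
  obtain ⟨C, hC⟩ := (isCompact_closedBall (0 : E n) (max R 1)).exists_bound_of_continuousOn
    hA.continuous.continuousOn
  refine ⟨max |C| |c|, by positivity, fun x => ?_⟩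
  rcases le_or_gt ‖x‖ (max R 1) with hx | hx
  · exact (hC x (by simpa using hx)).trans ((le_abs_self C).trans (le_max_left _ _))
  · have h1 : 1 ≤ ‖x‖ := (le_max_right R 1).trans hx.le
    refine (hR x ((le_max_left R 1).trans hx.le)).trans (le_trans ?_ (le_max_right _ _))
    calc c * ‖‖x‖ ^ (-μ)‖ ≤ |c| * 1 := by
          gcongr
          · exact le_abs_self c
          · rw [Real.norm_of_nonneg (by positivity)]
            exact Real.rpow_le_one_of_one_le_of_nonpos h1 (by linarith)
      _ = _ := mul_one _

/-- Distributional curl-freeness, tested against the mollifier `g (x - ·)`. -/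
lemma CrossData.integral_fderiv_mul_eq_of_curl_eq_zero (K : CrossData n F) {D : E n → E n}
    (hD : Continuous D)
    (h : ∀ φ : 𝓢(E n, F), ∫ x, inner ℝ (D x) (K.cu (fderiv ℝ φ x)) = 0) {g : E n → ℝ}
    (hgs : ContDiff ℝ ∞ g) (hgc : HasCompactSupport g) (x : E n) (i j : Fin n) :
    ∫ t, fderiv ℝ g (x - t) (EuclideanSpace.single i 1) * D t j =
      ∫ t, fderiv ℝ g (x - t) (EuclideanSpace.single j 1) * D t i := by
  rcases eq_or_ne i j with rfl | hij
  · rfl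
  obtain ⟨f, hf⟩ := K.exists_inner_cr i j hij
  have hs : ContDiff ℝ ∞ fun t => g (x - t) • f :=
    (hgs.comp (contDiff_const.sub contDiff_id)).smul contDiff_const
  have hcs : HasCompactSupport fun t => g (x - t) • f :=
    (hgc.comp_homeomorph (Homeomorph.subLeft x)).smul_right
  have h1 := h (hcs.toSchwartzMap hs)
  have h2 : ∀ t, inner ℝ (D t) (K.cu (fderiv ℝ (hcs.toSchwartzMap hs) t)) =
      fderiv ℝ g (x - t) (EuclideanSpace.single i 1) * D t j -
      fderiv ℝ g (x - t) (EuclideanSpace.single j 1) * D t i := by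
    intro t
    obtain ⟨m, hm⟩ : ∃ m : E n, -fderiv ℝ g (x - t) = innerSL ℝ m :=
      ⟨(InnerProductSpace.toDual ℝ (E n)).symm (-fderiv ℝ g (x - t)), by
        ext v; simp [InnerProductSpace.toDual_symm_apply]⟩
    have h3 : HasFDerivAt (hcs.toSchwartzMap hs) ((innerSL ℝ m).smulRight f) t := by
      have h4 : HasFDerivAt g (fderiv ℝ g (x - t)) (x - t) :=
        (hgs.differentiable (by simp) _).hasFDerivAt
      have h5 := (h4.comp t ((hasFDerivAt_id t).const_sub x)).smul_const f
      rw [← hm]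
      convert! h5 using 1
      ext; simp
    have hgi : ∀ i, fderiv ℝ g (x - t) (EuclideanSpace.single i 1) = -(m i) := by
      intro i
      have := congrArg (fun q : E n →L[ℝ] ℝ => q (EuclideanSpace.single i 1)) hm
      simp [EuclideanSpace.inner_single_right] at this
      linarith
    rw [h3.fderiv, K.cu_smulRight, hf, hgi, hgi]
    ring
  have hint : ∀ i j : Fin n, Integrable fun t =>
      fderiv ℝ g (x - t) (EuclideanSpace.single i 1) * D t j := by
    intro i j
    have hc : Continuous fun t => fderiv ℝ g t := hgs.continuous_fderiv (by simp)
    have hcs := hgc.fderiv (𝕜 := ℝ)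
    have : HasCompactSupport fun t => fderiv ℝ g (x - t) (EuclideanSpace.single i 1) :=
      (hcs.comp_homeomorph (Homeomorph.subLeft x)).comp_left
        (g := fun l : E n →L[ℝ] ℝ => l (EuclideanSpace.single i 1)) (by simp)
    exact Continuous.integrable_of_hasCompactSupport (by fun_prop) this.mul_right
  rw [integral_congr_ae (ae_of_all _ h2), integral_sub (hint i j) (hint j i), sub_eq_zero] at h1
  exact h1

/-- The mollification of a continuous field with vanishing distributional curl is closed. -/
lemma CrossData.fderiv_convolution_symm_of_curl_eq_zero (K : CrossData n F) {D : E n → E n}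
    (hD : Continuous D)
    (h : ∀ φ : 𝓢(E n, F), ∫ x, inner ℝ (D x) (K.cu (fderiv ℝ φ x)) = 0) {g : E n → ℝ}
    (hgs : ContDiff ℝ ∞ g) (hgc : HasCompactSupport g) {W : E n → (E n →L[ℝ] ℝ)}
    (hW : W = convolution (fun x => innerSL ℝ (D x)) g
      (ContinuousLinearMap.lsmul ℝ ℝ : ℝ →L[ℝ] (E n →L[ℝ] ℝ) →L[ℝ] (E n →L[ℝ] ℝ)).flip volume) :
    Differentiable ℝ W ∧ ∀ x u v, fderiv ℝ W x u v = fderiv ℝ W x v u := by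
  have hDc : Continuous fun x => innerSL ℝ (D x) := (innerSL ℝ).continuous.comp hD
  have hder := fun x => HasCompactSupport.hasFDerivAt_convolution_right (μ := volume)
    (ContinuousLinearMap.lsmul ℝ ℝ : ℝ →L[ℝ] (E n →L[ℝ] ℝ) →L[ℝ] (E n →L[ℝ] ℝ)).flip hgc
    (hDc.locallyIntegrable (μ := volume)) (hgs.of_le (by simp)) x
  simp only [← hW] at hder
  have hc : Continuous fun t => fderiv ℝ g t := hgs.continuous_fderiv (by simp)
  have hcs := hgc.fderiv (𝕜 := ℝ)
  have hfd : ∀ x u v, fderiv ℝ W x u v = ∫ t, fderiv ℝ g (x - t) u * inner ℝ (D t) v := by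
    intro x u v
    rw [(hder x).fderiv, convolution_precompR_apply _ (hDc.locallyIntegrable (μ := volume)) hcs hc]
    have hint : Integrable fun t => fderiv ℝ g (x - t) u • innerSL ℝ (D t) := by
      have : HasCompactSupport fun t => fderiv ℝ g (x - t) u :=
        (hcs.comp_homeomorph (Homeomorph.subLeft x)).comp_left
          (g := fun l : E n →L[ℝ] ℝ => l u) (by simp)
      exact Continuous.integrable_of_hasCompactSupport (by fun_prop) this.smul_right
    exact ContinuousLinearMap.integral_apply hint v
  refine ⟨fun x => (hder x).differentiableAt, fun x u v => ?_⟩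
  rw [← CrossData.sum_smul_single u, ← CrossData.sum_smul_single v]
  simp only [map_sum, map_smul, sum_apply, smul_apply, smul_eq_mul]
  simp_rw [Finset.mul_sum]
  rw [Finset.sum_comm]
  refine Finset.sum_congr rfl fun i _ => Finset.sum_congr rfl fun j _ => ?_
  have := K.integral_fderiv_mul_eq_of_curl_eq_zero hD h hgs hgc x j i
  rw [hfd, hfd]
  simp only [EuclideanSpace.inner_single_right, one_mul, conj_trivial]
  rw [this]; ring

/-- A bounded continuous field `D` with `curl D = 0` in the distributional sense is a gradient:
its mollifications are closed in the classical sense, so that they have potentials by the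
Poincaré lemma, and these potentials converge locally in `C¹`. -/
lemma CrossData.exists_hasFDerivAt_of_curl_eq_zero (K : CrossData n F) {D : E n → E n}
    (hD : Continuous D) {C : ℝ} (hC : ∀ x, ‖D x‖ ≤ C)
    (h : ∀ φ : 𝓢(E n, F), ∫ x, inner ℝ (D x) (K.cu (fderiv ℝ φ x)) = 0) :
    ∃ l : E n → ℝ, ∀ x, HasFDerivAt l (innerSL ℝ (D x)) x := by
  have hW : Continuous fun x => innerSL ℝ (D x) := (innerSL ℝ).continuous.comp hD
  let ρ : ℕ → ContDiffBump (0 : E n) := fun k =>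
    ⟨1 / (2 * (k + 1)), 1 / (k + 1), by positivity, by
      rw [one_div_lt_one_div (by positivity) (by positivity)]
      have : (0 : ℝ) ≤ k := k.cast_nonneg
      linarith⟩
  have hρ : Tendsto (fun k => (ρ k).rOut) atTop (𝓝 0) := tendsto_one_div_add_atTop_nhds_zero_nat
  have hρs : ∀ k, ContDiff ℝ ∞ ((ρ k).normed volume) := fun k => (ρ k).contDiff_normed
  have hρc : ∀ k, HasCompactSupport ((ρ k).normed volume) := fun k => (ρ k).hasCompactSupport_normed
  let L := (ContinuousLinearMap.lsmul ℝ ℝ : ℝ →L[ℝ] (E n →L[ℝ] ℝ) →L[ℝ] (E n →L[ℝ] ℝ))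
  let W : ℕ → E n → (E n →L[ℝ] ℝ) := fun k =>
    convolution (fun x => innerSL ℝ (D x)) ((ρ k).normed volume) L.flip volume
  have hflip : ∀ k, W k = convolution ((ρ k).normed volume) (fun x => innerSL ℝ (D x)) L volume :=
    fun k => convolution_flip L
  have hcl := fun k => K.fderiv_convolution_symm_of_curl_eq_zero hD h (hρs k) (hρc k) (W := W k) rfl
  have hpot : ∀ k, ∃ f : E n → ℝ, ∀ x, HasFDerivAt f (W k x) x := by
    intro k
    obtain ⟨f, hf⟩ := convex_univ.exists_forall_hasFDerivAt_of_fderiv_symmetric 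
      isOpen_univ (fun x _ => ((hcl k).1 x).differentiableWithinAt)
      (fun x _ u v => (hcl k).2 x u v)
    exact ⟨f, fun x => hf x (mem_univ x)⟩
  choose f hf using hpot
  have hWc : ∀ k, Continuous (W k) := fun k => (hcl k).1.continuous
  have hdist : ∀ k x, dist (W k x) (innerSL ℝ (D x)) ≤ 2 * C := by
    intro k x
    rw [hflip]
    refine (ρ k).dist_normed_convolution_le hW.aestronglyMeasurable fun y _ => ?_
    rw [dist_eq_norm, ← map_sub, innerSL_apply_norm]
    refine (norm_sub_le _ _).trans ?_
    linarith [hC x, hC y]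
  refine ⟨fun x => ∫ s in (0 : ℝ)..1, inner ℝ (D (s • x)) x, fun x => ?_⟩
  refine hasFDerivAt_of_tendstoLocallyUniformlyOn (l := atTop) (s := univ)
    (f := fun k x => f k x - f k 0) (f' := W) (g' := fun x => innerSL ℝ (D x)) isOpen_univ
    ?_ (fun k x _ => (hf k x).sub_const _) ?_ (mem_univ x)
  · rw [tendstoLocallyUniformlyOn_univ, Metric.tendstoLocallyUniformly_iff]
    intro ε hε x
    obtain ⟨δ, hδ, hδx⟩ :=
      Metric.continuousAt_iff.1 (hW.continuousAt (x := x)) (ε / 4) (by positivity)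
    refine ⟨Metric.ball x (δ / 2), Metric.ball_mem_nhds _ (by positivity), ?_⟩
    filter_upwards [hρ.eventually_lt_const (show 0 < δ / 2 by positivity)] with k hk y hy
    rw [dist_comm, hflip]
    refine lt_of_le_of_lt ((ρ k).dist_normed_convolution_le (ε := ε / 2)
      hW.aestronglyMeasurable fun z hz => ?_) (by linarith)
    have hy' : dist y x < δ / 2 := hy
    have hz' : dist z y < (ρ k).rOut := hz
    have h1 := hδx (show dist y x < δ by linarith)
    have h2 := hδx (show dist z x < δ by linarith [dist_triangle z y x])
    linarith [dist_triangle_right (innerSL ℝ (D z)) (innerSL ℝ (D y)) (innerSL ℝ (D x))]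
  · intro x _
    have h1 : ∀ k, f k x - f k 0 = ∫ s in (0 : ℝ)..1, W k (s • x) x := by
      intro k
      have h2 : ∀ s ∈ uIcc (0 : ℝ) 1, HasDerivAt (fun s : ℝ => f k (s • x)) (W k (s • x) x) s := by
        intro s _
        have h3 : HasDerivAt (fun s : ℝ => s • x) x s := by
          simpa using (hasDerivAt_id s).smul_const x
        exact (hf k (s • x)).comp_hasDerivAt s h3
      have hc : Continuous fun s : ℝ => W k (s • x) x := by
        have := hWc k
        fun_prop
      rw [intervalIntegral.integral_eq_sub_of_hasDerivAt h2 (hc.intervalIntegrable _ _)]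
      simp
    simp_rw [h1]
    refine intervalIntegral.tendsto_integral_filter_of_dominated_convergence
      (fun _ => (3 * C) * ‖x‖) ?_ ?_ (by simp) ?_
    · refine Eventually.of_forall fun k => ?_
      have := hWc k
      exact Continuous.aestronglyMeasurable (by fun_prop)
    · refine Eventually.of_forall fun k => ae_of_all _ fun s _ => ?_
      refine (ContinuousLinearMap.le_opNorm _ _).trans ?_
      gcongr
      have h2 := hdist k (s • x)
      have h3 : ‖innerSL ℝ (D (s • x))‖ ≤ C := by rw [innerSL_apply_norm]; exact hC _
      rw [dist_eq_norm] at h2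
      have := norm_le_norm_add_norm_sub (innerSL ℝ (D (s • x))) (W k (s • x))
      rw [norm_sub_rev] at this
      linarith
    · refine ae_of_all _ fun s _ => ?_
      have h2 := ContDiffBump.convolution_tendsto_right_of_continuous (μ := volume) hρ hW (s • x)
      have h3 : Tendsto (fun k => W k (s • x)) atTop (𝓝 (innerSL ℝ (D (s • x)))) := by
        simpa only [hflip] using h2
      have h4 := ((ContinuousLinearMap.apply ℝ ℝ x).continuous.tendsto _).comp h3
      exact h4

/-! ### Radial limits of gauge functions -/

lemma tendsto_lintegral_Ioi_atTop {f : ℝ → ℝ≥0∞} (hf : ∫⁻ r in Ioi (0 : ℝ), f r < ⊤) :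
    Tendsto (fun a : ℝ => ∫⁻ r in Ioi (max a 0), f r) atTop (𝓝 0) := by
  have h1 : Tendsto (fun a : ℝ => ((volume.restrict (Ioi 0)).withDensity f) (Ioi a)) atTop
      (𝓝 (((volume.restrict (Ioi 0)).withDensity f) (⋂ a : ℝ, Ioi a))) := by
    refine tendsto_measure_iInter_atTop (fun a => measurableSet_Ioi.nullMeasurableSet)
      (fun a b hab => Ioi_subset_Ioi hab) ⟨0, ?_⟩
    rw [withDensity_apply _ measurableSet_Ioi, Measure.restrict_restrict measurableSet_Ioi]
    simpa using hf.ne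
  have h2 : (⋂ a : ℝ, Ioi a) = ∅ := by
    ext x
    simp only [mem_iInter, mem_Ioi, mem_empty_iff_false, iff_false, not_forall, not_lt]
    exact ⟨x, le_rfl⟩
  rw [h2, measure_empty] at h1
  refine h1.congr fun a => ?_
  rw [withDensity_apply _ measurableSet_Ioi, Measure.restrict_restrict measurableSet_Ioi,
    Ioi_inter_Ioi]

/-- Integrability of the longitudinal part of a gradient `D = ∇l` provides the radial limits
of `l`. -/
lemma exists_hasRadialLimit {D : E n → E n} (hD : Continuous D) {l : E n → ℝ}
    (hl : ∀ x, HasFDerivAt l (innerSL ℝ (D x)) x)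
    (hlong : DecaysIntegrably fun x => inner ℝ (D x) x / ‖x‖) :
    ∃ Λ : E n → ℝ, HasRadialLimit l Λ := by
  set S : ℝ → ℝ≥0∞ := fun r => ⨆ (x : E n) (_ : r ≤ ‖x‖), ‖inner ℝ (D x) x / ‖x‖‖ₑ
  have hS : ∫⁻ r in Ioi (0 : ℝ), S r < ⊤ := hlong
  have hT0 := tendsto_lintegral_Ioi_atTop hS
  set T : ℝ → ℝ≥0∞ := fun a => ∫⁻ r in Ioi (max a 0), S r
  have key : ∀ (x : E n) (c : ℝ), x ≠ 0 → 1 ≤ c → ‖l (c • x) - l x‖ₑ ≤ T ‖x‖ := by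
    intro x c hx hc
    have hx0 : 0 < ‖x‖ := norm_pos_iff.2 hx
    set u := (‖x‖⁻¹ : ℝ) • x
    have hu : ‖u‖ = 1 := by simp [u, norm_smul, hx0.ne']
    have hxu : x = ‖x‖ • u := by simp [u, smul_smul, hx0.ne']
    have hd : ∀ r : ℝ, HasDerivAt (fun r : ℝ => l (r • u)) (inner ℝ (D (r • u)) u) r := by
      intro r
      have h3 : HasDerivAt (fun s : ℝ => s • u) u r := by
        simpa using (hasDerivAt_id r).smul_const u
      exact (hl (r • u)).comp_hasDerivAt r h3
    have hcont : Continuous fun r : ℝ => inner ℝ (D (r • u)) u := by fun_prop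
    have hle : ‖x‖ ≤ c * ‖x‖ := by nlinarith
    have h1 : l (c • x) - l x = ∫ r in ‖x‖..(c * ‖x‖), inner ℝ (D (r • u)) u := by
      rw [intervalIntegral.integral_eq_sub_of_hasDerivAt (fun r _ => hd r)
        (hcont.intervalIntegrable _ _), mul_smul, ← hxu]
    rw [h1, intervalIntegral.integral_of_le hle]
    refine (enorm_integral_le_lintegral_enorm _).trans ?_
    have h2 : ∫⁻ r in Ioc ‖x‖ (c * ‖x‖), ‖inner ℝ (D (r • u)) u‖ₑ ≤
        ∫⁻ r in Ioc ‖x‖ (c * ‖x‖), S r := by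
      refine setLIntegral_mono' measurableSet_Ioc fun r hr => ?_
      have hr0 : 0 < r := hx0.trans hr.1
      have hru : ‖r • u‖ = r := by rw [norm_smul, hu, Real.norm_of_nonneg hr0.le, mul_one]
      refine le_iSup₂_of_le (r • u) hru.ge (le_of_eq ?_)
      rw [hru, real_inner_smul_right (D (r • u)) u r, mul_div_cancel_left₀ _ hr0.ne']
    refine h2.trans (lintegral_mono_set ?_)
    rw [max_eq_left hx0.le]
    exact Ioc_subset_Ioi_self
  have hTanti : Antitone T := fun a b hab =>
    lintegral_mono_set (Ioi_subset_Ioi (max_le_max_right 0 hab))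
  have hlim : ∀ x, ∃ y, Tendsto (fun r : ℝ => l (r • x)) atTop (𝓝 y) := by
    intro x
    rcases eq_or_ne x 0 with rfl | hx
    · exact ⟨l 0, by simp⟩
    have hx0 : 0 < ‖x‖ := norm_pos_iff.2 hx
    apply cauchySeq_tendsto_of_complete
    rw [Metric.cauchySeq_iff']
    intro ε hε
    obtain ⟨N, hN⟩ := ((hT0.eventually_lt_const
      (show (0 : ℝ≥0∞) < ENNReal.ofReal ε by simpa using hε)).and
      (eventually_gt_atTop 0)).exists_forall_of_atTop
    refine ⟨max 1 (N / ‖x‖), fun m hm => ?_⟩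
    set M := max 1 (N / ‖x‖)
    have hM : 0 < M := by positivity
    have h1 := key (M • x) (m / M) (smul_ne_zero hM.ne' hx) (by rw [le_div_iff₀ hM]; simpa using hm)
    have h2 : N ≤ ‖M • x‖ := by
      rw [norm_smul, Real.norm_of_nonneg hM.le, ← div_le_iff₀ hx0]
      exact le_max_right _ _
    have h3 := h1.trans_lt (hN _ h2).1
    rw [smul_smul, div_mul_cancel₀ _ hM.ne', ← ofReal_norm] at h3
    rw [dist_eq_norm]
    exact (ENNReal.ofReal_lt_ofReal_iff hε).1 h3
  choose Λ hΛ using hlim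
  refine ⟨Λ, hΛ, fun c x hc => ?_, ?_⟩
  · refine tendsto_nhds_unique (hΛ (c • x)) ?_
    have := (hΛ x).comp (tendsto_id.atTop_mul_const hc)
    refine this.congr fun r => ?_
    simp [smul_smul]
  · intro x hx
    have hx0 : 0 < ‖x‖ := norm_pos_iff.2 hx
    have hlc : Continuous l := continuous_iff_continuousAt.2 fun x => (hl x).continuousAt
    set U := {y : E n | ‖x‖ / 2 < ‖y‖}
    have hU : IsOpen U := isOpen_lt continuous_const continuous_norm
    have hxU : x ∈ U := by simp only [U, mem_ofPred_eq]; linarith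
    have hunif : TendstoUniformlyOn (fun (r : ℝ) y => l (r • y)) Λ atTop U := by
      rw [Metric.tendstoUniformlyOn_iff]
      intro ε hε
      obtain ⟨N, hN⟩ := (hT0.eventually_lt_const
        (show (0 : ℝ≥0∞) < ENNReal.ofReal (ε / 2) by simpa using hε)).exists_forall_of_atTop
      filter_upwards [eventually_ge_atTop (max 1 (N / (‖x‖ / 2)))] with r hr y hy
      have hr1 : 1 ≤ r := (le_max_left _ _).trans hr
      have hy' : ‖x‖ / 2 < ‖y‖ := hy
      have hy0 : y ≠ 0 := norm_pos_iff.1 (by linarith)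
      have hNr : N ≤ ‖r • y‖ := by
        have h1 : N / (‖x‖ / 2) ≤ r := (le_max_right _ _).trans hr
        rw [div_le_iff₀ (by positivity)] at h1
        rw [norm_smul, Real.norm_of_nonneg (by linarith)]
        nlinarith
      have hbd : ∀ᶠ m : ℝ in atTop, dist (l (m • y)) (l (r • y)) ≤ ε / 2 := by
        filter_upwards [eventually_ge_atTop r] with m hm
        have h1 := key (r • y) (m / r) (smul_ne_zero (by linarith) hy0)
          (by rw [le_div_iff₀ (by linarith)]; simpa using hm)
        have h3 := h1.trans_lt (hN _ hNr)
        rw [smul_smul, div_mul_cancel₀ _ (by linarith), ← ofReal_norm] at h3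
        rw [dist_eq_norm]
        exact ((ENNReal.ofReal_lt_ofReal_iff (by linarith)).1 h3).le
      have := le_of_tendsto ((hΛ y).dist tendsto_const_nhds) hbd
      linarith
    have hc := hunif.continuousOn (Eventually.of_forall fun r =>
      (hlc.comp (continuous_const_smul r)).continuousOn).frequently
    exact (hc.continuousAt (hU.mem_nhds hxU)).continuousWithinAt

/-- Two medium range potentials with the same curl differ by a gradient with radial limits. -/
theorem CrossData.exists_gauge (K : CrossData n F) {A A' : E n → E n} (hA : MediumRange A)
    (hA' : MediumRange A') (h : ∀ φ : 𝓢(E n, F), ∫ x, inner ℝ (A' x) (K.cu (fderiv ℝ φ x)) =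
      ∫ x, inner ℝ (A x) (K.cu (fderiv ℝ φ x))) :
    ∃ l : E n → ℝ, ContDiff ℝ 1 l ∧ (∀ x, A' x = A x + gradient l x) ∧
      ∃ Λ : E n → ℝ, HasRadialLimit l Λ := by
  obtain ⟨C, hC0, hC⟩ := hA.exists_bound
  obtain ⟨C', hC0', hC'⟩ := hA'.exists_bound
  have hD : Continuous fun x => A' x - A x := hA'.continuous.sub hA.continuous
  have hint : ∀ {A : E n → E n}, Continuous A → ∀ {C : ℝ}, (∀ x, ‖A x‖ ≤ C) →
      ∀ φ : 𝓢(E n, F), Integrable fun x => inner ℝ (A x) (K.cu (fderiv ℝ φ x)) := by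
    intro A hAc C hAC φ
    have h1 :=
      ((SchwartzMap.fderivCLM ℝ (E n) F φ).integrable (μ := volume)).norm.const_mul (C * ‖K.cu‖)
    have h2 : Continuous (fderiv ℝ φ) := (φ.smooth ⊤).continuous_fderiv (by simp)
    refine h1.mono' (by fun_prop) (ae_of_all _ fun x => ?_)
    refine (norm_inner_le_norm _ _).trans ?_
    rw [mul_assoc]
    gcongr
    · exact (norm_nonneg _).trans (hAC x)
    · exact hAC x
    · exact K.cu.le_opNorm _
  obtain ⟨l, hl⟩ := K.exists_hasFDerivAt_of_curl_eq_zero hD (C := C' + C)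
    (fun x => (norm_sub_le _ _).trans (add_le_add (hC' x) (hC x))) (fun φ => by
      simp_rw [inner_sub_left]
      rw [integral_sub (hint hA'.continuous hC' φ) (hint hA.continuous hC φ), h, sub_self])
  refine ⟨l, ?_, fun x => ?_, exists_hasRadialLimit hD hl ?_⟩
  · rw [contDiff_one_iff_fderiv]
    refine ⟨fun x => (hl x).differentiableAt, ?_⟩
    rw [show fderiv ℝ l = fun x => innerSL ℝ (A' x - A x) from funext fun x => (hl x).fderiv]
    exact (innerSL ℝ).continuous.comp hD
  · have : HasGradientAt l (A' x - A x) x := hl x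
    rw [this.gradient]; abel
  · refine (hA'.longitudinal.add hA.longitudinal.neg).mono fun x => le_of_eq ?_
    rw [inner_sub_left, sub_div, sub_eq_add_neg]

end

section

/-! ### Schwartz functions and Hölder's inequality -/

variable {n : ℕ} {F : Type*} [NormedAddCommGroup F]

/-- A weight which dominates every Schwartz function and belongs to all `L^q`, `q ≥ 1`. -/
def weight (y : E n) : ℝ := (1 + ‖y‖) ^ (-((n : ℝ) + 1))

lemma weight_pos (y : E n) : 0 < weight y := by
  have := norm_nonneg y
  unfold weight; positivity

lemma continuous_weight : Continuous (weight : E n → ℝ) :=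
  Continuous.rpow_const (by fun_prop) fun x => Or.inl (by have := norm_nonneg x; positivity)

lemma integrable_weight : Integrable (weight : E n → ℝ) := by
  apply integrable_one_add_norm
  rw [finrank_euclideanSpace_fin]; linarith

lemma exists_schwartz_le_weight {G : Type*} [NormedAddCommGroup G] [NormedSpace ℝ G]
    (φ : 𝓢(E n, G)) (k : ℕ) :
    ∃ C : ℝ, 0 ≤ C ∧ ∀ y, (1 + ‖y‖) ^ k * ‖φ y‖ ≤ C * weight y := by
  have h := fun y => SchwartzMap.one_add_le_sup_seminorm_apply (𝕜 := ℝ) (m := (k + (n + 1), 0))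
    (k := k + (n + 1)) (n := 0) le_rfl le_rfl φ y
  refine ⟨2 ^ (k + (n + 1)) * ((Finset.Iic (k + (n + 1), 0)).sup
    fun m => SchwartzMap.seminorm ℝ m.1 m.2) φ,
    mul_nonneg (by positivity) (apply_nonneg _ _), fun y => ?_⟩
  have hy := norm_nonneg y
  have h2 := h y
  rw [norm_iteratedFDeriv_zero, pow_add] at h2
  have h3 : weight y = ((1 + ‖y‖) ^ (n + 1))⁻¹ := by
    rw [weight, Real.rpow_neg (by positivity), ← Real.rpow_natCast]; push_cast; rfl
  rw [h3, ← div_eq_mul_inv, le_div_iff₀ (by positivity)]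
  calc _ = (1 + ‖y‖) ^ k * (1 + ‖y‖) ^ (n + 1) * ‖φ y‖ := by ring
    _ ≤ _ := h2

lemma quasiMeasurePreserving_add_smul (z : E n) {s : ℝ} (hs : s ≠ 0) :
    Measure.QuasiMeasurePreserving (fun y : E n => z + s • y) volume volume := by
  have h1 : Measure.QuasiMeasurePreserving (fun y : E n => s • y) volume volume := by
    refine ⟨measurable_const_smul s, ?_⟩
    rw [Measure.map_addHaar_smul _ hs]
    exact Measure.smul_absolutelyContinuous
  exact ((measurePreserving_add_left volume z).quasiMeasurePreserving).comp h1

lemma integral_comp_add_smul {G : Type*} [NormedAddCommGroup G] [NormedSpace ℝ G] (f : E n → G)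
    (z : E n) {s : ℝ} (hs : 0 < s) :
    ∫ y, f (z + s • y) = (s ^ n)⁻¹ • ∫ y, f y := by
  rw [Measure.integral_comp_smul volume (fun y => f (z + y)), integral_add_left_eq_self,
    finrank_euclideanSpace_fin, abs_of_pos (by positivity)]

lemma memLp_comp_add_smul {B : E n → F} {p : ℝ} (hp : 0 < p) (hB : MemLp B (ENNReal.ofReal p))
    (z : E n) {s : ℝ} (hs : 0 < s) :
    MemLp (fun y => B (z + s • y)) (ENNReal.ofReal p) ∧
      eLpNorm (fun y => B (z + s • y)) (ENNReal.ofReal p) volume =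
        ENNReal.ofReal (s ^ (-(n / p))) * eLpNorm B (ENNReal.ofReal p) volume := by
  have h : eLpNorm (fun y => B (z + s • y)) (ENNReal.ofReal p) volume =
      ENNReal.ofReal (s ^ (-(n / p))) * eLpNorm B (ENNReal.ofReal p) volume := by
    rw [eLpNorm_eq_lintegral_rpow_enorm_toReal (by simpa using hp) (by simp),
      eLpNorm_eq_lintegral_rpow_enorm_toReal (by simpa using hp) (by simp),
      ENNReal.toReal_ofReal hp.le, lintegral_comp_smul (fun y => ‖B y‖ₑ ^ p) z hs,
      ENNReal.mul_rpow_of_nonneg _ _ (by positivity),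
      ENNReal.ofReal_rpow_of_nonneg (by positivity) (by positivity), ← Real.rpow_mul hs.le]
    congr 3; ring
  refine ⟨⟨hB.1.comp_quasiMeasurePreserving (quasiMeasurePreserving_add_smul z hs.ne'), ?_⟩, h⟩
  rw [h]
  exact ENNReal.mul_lt_top ENNReal.ofReal_lt_top hB.2

/-- Hölder's inequality for a dilated field: the constant grows like `s^(-n/p)`, which is
integrable at `s = 0`. -/
lemma exists_lintegral_weight_mul_le {B : E n → F} {p : ℝ} (hp : 1 < p)
    (hB : MemLp B (ENNReal.ofReal p)) :
    ∃ C : ℝ, 0 ≤ C ∧ ∀ (z : E n) (s : ℝ), 0 < s →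
      ∫⁻ y, ENNReal.ofReal (weight y) * ‖B (z + s • y)‖ₑ ≤ ENNReal.ofReal (C * s ^ (-(n / p))) := by
  set q := p / (p - 1)
  have hq1 : 1 ≤ q := by rw [one_le_div (by linarith)]; linarith
  set I := ∫⁻ y : E n, ENNReal.ofReal (weight y) ^ q
  have hI : I ≠ ⊤ := by
    have h1 : I ≤ ∫⁻ y : E n, ENNReal.ofReal (weight y) := by
      refine lintegral_mono fun y => ?_
      have h2 : weight y ≤ 1 := Real.rpow_le_one_of_one_le_of_nonpos
        (by linarith [norm_nonneg y]) (by have : (0:ℝ) ≤ n := n.cast_nonneg; linarith)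
      rw [ENNReal.ofReal_rpow_of_nonneg (weight_pos y).le (by linarith)]
      refine ENNReal.ofReal_le_ofReal ?_
      exact (Real.rpow_le_rpow_of_exponent_ge (weight_pos y) h2 hq1).trans_eq (Real.rpow_one _)
    exact (h1.trans_lt integrable_weight.lintegral_lt_top).ne
  refine ⟨(I ^ (1 / q) * eLpNorm B (ENNReal.ofReal p) volume).toReal, ENNReal.toReal_nonneg,
    fun z s hs => ?_⟩
  obtain ⟨h1, h2⟩ := memLp_comp_add_smul (by linarith) hB z hs
  refine (lintegral_enorm_mul_le hp h1
    continuous_weight.measurable.ennreal_ofReal.aemeasurable).trans ?_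
  rw [h2, ENNReal.ofReal_mul ENNReal.toReal_nonneg, ENNReal.ofReal_toReal, mul_left_comm, mul_comm]
  exact (ENNReal.mul_lt_top (ENNReal.rpow_lt_top_of_nonneg (by positivity) hI) hB.2).ne

/-! ### Integrals with smooth compactly supported kernels -/

variable [InnerProductSpace ℝ F]

/-- Smoothness of `x ↦ ∫ k x y (f y) dy` for a smooth kernel, if `y` stays bounded on the support of
the kernel as long as `x` does. -/
lemma contDiff_integral_clm {G : Type*} [NormedAddCommGroup G] [NormedSpace ℝ G] {m : ℕ∞}
    {f : E n → F} (hf : LocallyIntegrable f) {k : E n → E n → (F →L[ℝ] G)}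
    (hk : ContDiff ℝ m (fun q : E n × E n => k q.1 q.2))
    (hsupp : ∀ R : ℝ, ∃ S : ℝ, ∀ x y, ‖x‖ < R → S < ‖y‖ → k x y = 0) :
    ContDiff ℝ m (fun x => ∫ y, k x y (f y)) := by
  rw [contDiff_iff_contDiffAt]
  intro x₀
  obtain ⟨S, hS⟩ := hsupp (‖x₀‖ + 1)
  have hU : IsOpen {x : E n | ‖x‖ < ‖x₀‖ + 1} := isOpen_lt continuous_norm continuous_const
  have h := contDiffOn_convolution_right_with_param_comp (μ := (volume : Measure (E n)))
    (n := m) (ContinuousLinearMap.apply ℝ G : F →L[ℝ] (F →L[ℝ] G) →L[ℝ] G)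
    (s := {x : E n | ‖x‖ < ‖x₀‖ + 1}) (v := fun _ => (0 : E n)) contDiffOn_const (f := f)
    (g := fun x u => k x (-u)) hU (isCompact_closedBall (0 : E n) S)
    (fun x u hx hu => hS x (-u) hx (by simpa using hu)) hf
    (by
      have : ContDiff ℝ m (fun q : E n × E n => k q.1 (-q.2)) :=
        hk.comp (contDiff_fst.prodMk contDiff_snd.neg)
      exact this.contDiffOn)
  have h2 := h.contDiffAt (hU.mem_nhds (by simp : x₀ ∈ {x : E n | ‖x‖ < ‖x₀‖ + 1}))
  refine h2.congr_of_eventuallyEq (Eventually.of_forall fun x => ?_)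
  simp [convolution]

/-! ### Pairings of Schwartz functions -/

/-- The real inner product as a continuous bilinear map. -/
def innerB (F : Type*) [NormedAddCommGroup F] [InnerProductSpace ℝ F] : F →L[ℝ] F →L[ℝ] ℝ :=
  (innerₗ F).mkContinuous₂ 1 fun x y => by simpa using norm_inner_le_norm (𝕜 := ℝ) x y

@[simp] lemma innerB_apply (x y : F) : innerB F x y = inner ℝ x y := rfl

namespace CrossData

variable (K : CrossData n F)

/-- The Schwartz function `⟪P w, φ w⟫`. -/
def pairP (φ : 𝓢(E n, F)) : 𝓢(E n, ℝ) :=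
  SchwartzMap.bilinLeftCLM (innerB F) (K.P.hasTemperateGrowth) φ

lemma pairP_apply (φ : 𝓢(E n, F)) (w : E n) : K.pairP φ w = inner ℝ (K.P w) (φ w) := by
  simp [pairP, real_inner_comm]

end CrossData

/-- The Schwartz function `φ (z + s y)`. -/
def dilate {G : Type*} [NormedAddCommGroup G] [NormedSpace ℝ G] (φ : 𝓢(E n, G)) (z : E n) (s : ℝ)
    (hs : s ≠ 0) : 𝓢(E n, G) :=
  SchwartzMap.compCLMOfContinuousLinearEquiv ℝ
    (LinearEquiv.smulOfNeZero ℝ (E n) s hs).toContinuousLinearEquiv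
    (SchwartzMap.compSubConstCLM ℝ (-z) φ)

@[simp] lemma dilate_apply {G : Type*} [NormedAddCommGroup G] [NormedSpace ℝ G] (φ : 𝓢(E n, G))
    (z : E n) (s : ℝ) (hs : s ≠ 0) (y : E n) : dilate φ z s hs y = φ (z + s • y) := by
  simp [dilate, add_comm]

end

section

/-! ### The Poincaré lemma for distributions -/

variable {n : ℕ} {F : Type*} [NormedAddCommGroup F]

lemma integrable_of_norm_le_weight {G : Type*} [NormedAddCommGroup G] {B : E n → F} {p : ℝ}
    (hp : 1 < p) (hB : MemLp B (ENNReal.ofReal p)) {f : E n → G} (hf : AEStronglyMeasurable f)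
    {z : E n} {s C : ℝ} (hs : 0 < s) (hC : ∀ y, ‖f y‖ ≤ C * weight y * ‖B (z + s • y)‖) :
    Integrable f := by
  obtain ⟨C', hC', h⟩ := exists_lintegral_weight_mul_le hp hB
  refine ⟨hf, ?_⟩
  calc ∫⁻ y, ‖f y‖ₑ
    ≤ ∫⁻ y, ENNReal.ofReal |C| * (ENNReal.ofReal (weight y) * ‖B (z + s • y)‖ₑ) := by
        refine lintegral_mono fun y => ?_
        rw [← ofReal_norm, ← ofReal_norm, ← mul_assoc, ← ENNReal.ofReal_mul (abs_nonneg _),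
          ← ENNReal.ofReal_mul (mul_nonneg (abs_nonneg _) (weight_pos y).le)]
        refine ENNReal.ofReal_le_ofReal ((hC y).trans ?_)
        have := (weight_pos y).le
        gcongr
        exact le_abs_self C
    _ ≤ ENNReal.ofReal |C| * ENNReal.ofReal (C' * s ^ (-(n / p))) := by
        rw [lintegral_const_mul' _ _ ENNReal.ofReal_ne_top]
        gcongr
        exact h z s hs
    _ < ⊤ := ENNReal.mul_lt_top ENNReal.ofReal_lt_top ENNReal.ofReal_lt_top

variable [InnerProductSpace ℝ F]

lemma aestronglyMeasurable_clm_apply {α G H : Type*} [MeasurableSpace α] {ν : Measure α}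
    [NormedAddCommGroup G] [NormedSpace ℝ G] [NormedAddCommGroup H] [NormedSpace ℝ H]
    {L : α → G →L[ℝ] H} {f : α → G} (hL : AEStronglyMeasurable L ν)
    (hf : AEStronglyMeasurable f ν) : AEStronglyMeasurable (fun x => L x (f x)) ν :=
  (ContinuousLinearMap.id ℝ (G →L[ℝ] H)).aestronglyMeasurable_comp₂ hL hf

namespace CrossData

variable (K : CrossData n F)

lemma IsDivFree.comp_add {K : CrossData n F} {B : E n → F} (h : K.IsDivFree B) (z : E n) :
    K.IsDivFree fun y => B (z + y) := by
  intro ψ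
  have h1 := h (SchwartzMap.compSubConstCLM ℝ z ψ)
  rw [← integral_add_left_eq_self _ z] at h1
  rw [← h1]
  refine integral_congr_ae (ae_of_all _ fun y => ?_)
  have h2 : HasFDerivAt (SchwartzMap.compSubConstCLM ℝ z ψ) (fderiv ℝ ψ y) (z + y) := by
    have h3 : HasFDerivAt ψ (fderiv ℝ ψ y) ((z + y) - z) := by
      rw [add_sub_cancel_left]; exact ψ.hasFDerivAt y
    have := h3.comp (z + y) ((hasFDerivAt_id (z + y)).sub_const z)
    refine (this.congr_fderiv (by ext; simp)).congr_of_eventuallyEq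
      (Eventually.of_forall fun w => by simp)
  simp only [h2.fderiv]

/-- The radial derivative which arises from the curl of a transversal gauge; the divergence
condition turns the second term of Lagrange's identity into `n - 2` times the pairing of field and
test function. -/
lemma integral_inner_cr_cu_eq {B : E n → F} {p : ℝ} (hp : 1 < p) (hB : MemLp B (ENNReal.ofReal p))
    (hdiv : K.IsDivFree B) (φ : 𝓢(E n, F)) {s : ℝ} (hs : 0 < s) :
    ∫ y, inner ℝ (K.cr y (B (s • y))) (K.cu (fderiv ℝ φ y)) =
      ∫ y, inner ℝ (B (s • y)) (fderiv ℝ φ y y + ((n : ℝ) - 2) • φ y) := by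
  obtain ⟨C1, hC1, h1⟩ := exists_schwartz_le_weight φ 0
  obtain ⟨C2, hC2, h2⟩ := exists_schwartz_le_weight (SchwartzMap.fderivCLM ℝ (E n) F φ) 1
  simp only [SchwartzMap.fderivCLM_apply, pow_one, pow_zero, one_mul] at h1 h2
  have hBm : AEStronglyMeasurable fun y => B (s • y) := by
    simpa using (memLp_comp_add_smul (by linarith) hB 0 hs).1.1
  have hφ' : Continuous (fderiv ℝ φ) := (φ.smooth ⊤).continuous_fderiv (by simp)
  have hy : ∀ y : E n, ‖y‖ * ‖fderiv ℝ φ y‖ ≤ C2 * weight y := fun y =>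
    le_trans (by gcongr; linarith) (h2 y)
  have i1 : Integrable fun y => inner ℝ (B (s • y)) (fderiv ℝ φ y y) := by
    refine integrable_of_norm_le_weight hp hB (z := 0) (C := C2)
      (hBm.inner (by fun_prop : Continuous fun y => fderiv ℝ φ y y).aestronglyMeasurable) hs
      fun y => ?_
    rw [zero_add, mul_comm]
    refine (norm_inner_le_norm _ _).trans ?_
    gcongr
    exact ((fderiv ℝ φ y).le_opNorm y).trans ((mul_comm _ _).trans_le (hy y))
  have i2 : Integrable fun y => inner ℝ (B (s • y)) (φ y) := by
    refine integrable_of_norm_le_weight hp hB (z := 0) (C := C1)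
      (hBm.inner φ.continuous.aestronglyMeasurable) hs fun y => ?_
    rw [zero_add, mul_comm]
    refine (norm_inner_le_norm _ _).trans ?_
    gcongr
    exact h1 y
  have i3 : Integrable fun y => inner ℝ (K.P y) (fderiv ℝ φ y (K.Q (B (s • y)))) := by
    refine integrable_of_norm_le_weight hp hB (z := 0) (C := ‖K.P‖ * ‖K.Q‖ * C2) ?_ hs fun y => ?_
    · refine AEStronglyMeasurable.inner (by fun_prop) ?_
      exact aestronglyMeasurable_clm_apply hφ'.aestronglyMeasurable
        (K.Q.continuous.comp_aestronglyMeasurable hBm)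
    · rw [zero_add]
      calc _ ≤ (‖K.P‖ * ‖y‖) * (‖fderiv ℝ φ y‖ * (‖K.Q‖ * ‖B (s • y)‖)) := by
            refine (norm_inner_le_norm _ _).trans ?_
            gcongr
            · exact K.P.le_opNorm y
            · refine ((fderiv ℝ φ y).le_opNorm _).trans ?_
              gcongr
              exact K.Q.le_opNorm _
        _ = ‖K.P‖ * ‖K.Q‖ * (‖y‖ * ‖fderiv ℝ φ y‖) * ‖B (s • y)‖ := by ring
        _ ≤ ‖K.P‖ * ‖K.Q‖ * (C2 * weight y) * ‖B (s • y)‖ := by gcongr _ * ?_ * _; exact hy y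
        _ = _ := by ring
  have key : (((n : ℝ) - 2) * ∫ y, inner ℝ (B (s • y)) (φ y)) +
      ∫ y, inner ℝ (K.P y) (fderiv ℝ φ y (K.Q (B (s • y)))) = 0 := by
    have h3 := hdiv (K.pairP (dilate φ 0 s⁻¹ (inv_ne_zero hs.ne')))
    have h4 := integral_comp_add_smul (fun w => fderiv ℝ (K.pairP (dilate φ 0 s⁻¹
      (inv_ne_zero hs.ne'))) w (K.Q (B w))) 0 hs
    rw [h3, smul_zero] at h4
    rw [← h4, ← integral_const_mul, ← integral_add (i2.const_mul _) i3]
    refine integral_congr_ae (ae_of_all _ fun y => ?_)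
    have h5 : HasFDerivAt (fun w => φ (0 + s⁻¹ • w)) (s⁻¹ • fderiv ℝ φ y) (s • y) := by
      have h6 : HasFDerivAt φ (fderiv ℝ φ y) (0 + s⁻¹ • s • y) := by
        rw [zero_add, smul_smul, inv_mul_cancel₀ hs.ne', one_smul]; exact φ.hasFDerivAt y
      have := h6.comp (s • y) (((hasFDerivAt_id (s • y)).const_smul s⁻¹).const_add 0)
      refine this.congr_fderiv ?_
      ext v; simp
    have h6 := HasFDerivAt.inner ℝ (K.P.hasFDerivAt (x := s • y)) h5
    have h7 := h6.congr_of_eventuallyEq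
      (f₁ := K.pairP (dilate φ 0 s⁻¹ (inv_ne_zero hs.ne')))
      (Eventually.of_forall fun w => by rw [K.pairP_apply, dilate_apply])
    simp only [zero_add, h7.fderiv]
    simp only [ContinuousLinearMap.comp_apply, ContinuousLinearMap.prod_apply,
      fderivInnerCLM_apply, smul_apply, map_smul, smul_smul, inv_mul_cancel₀ hs.ne', one_smul,
      K.P_Q, inner_smul_left, inner_smul_right, conj_trivial]
    rw [← mul_assoc, inv_mul_cancel₀ hs.ne', one_mul]
    ring
  calc _ = ∫ y, (inner ℝ (B (s • y)) (fderiv ℝ φ y y) -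
        inner ℝ (K.P y) (fderiv ℝ φ y (K.Q (B (s • y))))) := by
        simp_rw [K.inner_cr_cu]
    _ = ∫ y, (inner ℝ (B (s • y)) (fderiv ℝ φ y y) +
        ((n : ℝ) - 2) * inner ℝ (B (s • y)) (φ y)) := by
        rw [integral_sub i1 i3, integral_add i1 (i2.const_mul _), integral_const_mul]
        linarith
    _ = _ := by simp_rw [inner_add_right, inner_smul_right]

/-- The Poincaré lemma with base point `0`: the radial derivative is integrated by Fubini's theorem
and the fundamental theorem of calculus. -/
lemma integral_integral_inner_cr_cu_zero (hn : 2 ≤ n) {B : E n → F} {p : ℝ} (hp : n < p)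
    (hB : MemLp B (ENNReal.ofReal p)) (hdiv : K.IsDivFree B) (φ : 𝓢(E n, F)) :
    ∫ s in Ioo (0 : ℝ) 1, ∫ y, s * inner ℝ (K.cr y (B (s • y))) (K.cu (fderiv ℝ φ y)) =
      -∫ y, inner ℝ (B y) (φ y) := by
  have hn' : (2 : ℝ) ≤ n := by exact_mod_cast hn
  have hp1 : 1 < p := by linarith
  obtain ⟨C1, hC1, h1⟩ := exists_schwartz_le_weight φ 0
  obtain ⟨C2, hC2, h2⟩ := exists_schwartz_le_weight (SchwartzMap.fderivCLM ℝ (E n) F φ) 1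
  simp only [SchwartzMap.fderivCLM_apply, pow_one, pow_zero, one_mul] at h1 h2
  have hφ' : Continuous (fderiv ℝ φ) := (φ.smooth ⊤).continuous_fderiv (by simp)
  set c : E n → F := fun y => fderiv ℝ φ y y + ((n : ℝ) - 2) • φ y
  have hc : Continuous c := by
    have := φ.continuous
    fun_prop
  set C := C2 + ((n : ℝ) - 2) * C1
  have hC : 0 ≤ C := add_nonneg hC2 (mul_nonneg (by linarith) hC1)
  have hcC : ∀ y, ‖c y‖ ≤ C * weight y := by
    intro y
    have h3 : ‖fderiv ℝ φ y y‖ ≤ C2 * weight y :=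
      ((fderiv ℝ φ y).le_opNorm y).trans ((mul_comm _ _).trans_le
        (le_trans (by gcongr; linarith) (h2 y)))
    have h4 : ‖((n : ℝ) - 2) • φ y‖ ≤ ((n : ℝ) - 2) * (C1 * weight y) := by
      rw [norm_smul, Real.norm_of_nonneg (by linarith)]
      exact mul_le_mul_of_nonneg_left (h1 y) (by linarith)
    refine (norm_add_le _ _).trans ?_
    simp only [C]; linarith
  obtain ⟨C', hC', hw⟩ := exists_lintegral_weight_mul_le hp1 hB
  set f : ℝ → E n → ℝ := fun s w => s * (s ^ n)⁻¹ * inner ℝ (B w) (c (s⁻¹ • w))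
  have hf : Integrable (Function.uncurry f) ((volume.restrict (Ioo (0 : ℝ) 1)).prod volume) := by
    have hm : AEStronglyMeasurable (Function.uncurry f)
        ((volume.restrict (Ioo (0 : ℝ) 1)).prod volume) := by
      have hm1 : Measurable fun q : ℝ × E n => q.1⁻¹ • q.2 := by fun_prop
      have hm2 : Measurable fun q : ℝ × E n => q.1 * (q.1 ^ n)⁻¹ := by fun_prop
      exact hm2.aestronglyMeasurable.mul
        (hB.1.comp_snd.inner (hc.comp_aestronglyMeasurable hm1.aestronglyMeasurable))
    refine ⟨hm, ?_⟩
    rw [HasFiniteIntegral, lintegral_prod _ hm.enorm]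
    calc _ ≤ ∫⁻ s in Ioo (0 : ℝ) 1, ENNReal.ofReal (C * C') := by
          refine setLIntegral_mono' measurableSet_Ioo fun s hs => ?_
          rw [lintegral_eq_mul_lintegral_comp_smul _ 0 hs.1]
          calc _ ≤ ENNReal.ofReal (s ^ (n : ℝ)) * ∫⁻ y, ENNReal.ofReal (s * (s ^ n)⁻¹ * C) *
                (ENNReal.ofReal (weight y) * ‖B (0 + s • y)‖ₑ) := by
                have hs0 := hs.1
                gcongr with y
                rw [← ofReal_norm, ← ofReal_norm, ← mul_assoc, ← ENNReal.ofReal_mul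
                  (by positivity), ← ENNReal.ofReal_mul
                    (mul_nonneg (by positivity) (weight_pos y).le)]
                refine ENNReal.ofReal_le_ofReal ?_
                simp only [Function.uncurry, f, zero_add]
                rw [norm_mul, Real.norm_of_nonneg (by positivity), smul_smul,
                  inv_mul_cancel₀ hs.1.ne', one_smul]
                calc _ ≤ s * (s ^ n)⁻¹ * (‖B (s • y)‖ * (C * weight y)) := by
                      gcongr
                      exact (norm_inner_le_norm _ _).trans (by gcongr; exact hcC y)
                  _ = _ := by ring
            _ ≤ ENNReal.ofReal (s ^ (n : ℝ)) * (ENNReal.ofReal (s * (s ^ n)⁻¹ * C) *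
                ENNReal.ofReal (C' * s ^ (-(n / p)))) := by
                rw [lintegral_const_mul' _ _ ENNReal.ofReal_ne_top]
                gcongr
                exact hw 0 s hs.1
            _ ≤ _ := by
                have hs0 := hs.1
                rw [← ENNReal.ofReal_mul (by positivity), ← ENNReal.ofReal_mul (by positivity)]
                refine ENNReal.ofReal_le_ofReal ?_
                have h5 : s * s ^ (-(n / p)) ≤ 1 := by
                  rw [← Real.rpow_one_add' hs0.le]
                  · exact Real.rpow_le_one hs0.le hs.2.le (by
                      have : n / p < 1 := by rw [div_lt_one (by linarith)]; exact hp
                      linarith)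
                  · have : n / p < 1 := by rw [div_lt_one (by linarith)]; exact hp
                    linarith
                rw [Real.rpow_natCast]
                calc _ = C * C' * (s * s ^ (-(n / p))) := by field_simp
                  _ ≤ C * C' * 1 := by gcongr
                  _ = _ := mul_one _
      _ < ⊤ := by simp
  have hin : ∀ s ∈ Ioo (0 : ℝ) 1,
      ∫ y, s * inner ℝ (K.cr y (B (s • y))) (K.cu (fderiv ℝ φ y)) = ∫ w, f s w := by
    intro s hs
    have h3 := integral_comp_add_smul (fun w => s * inner ℝ (B w) (c (s⁻¹ • w))) 0 hs.1
    rw [integral_const_mul, K.integral_inner_cr_cu_eq hp1 hB hdiv φ hs.1, ← integral_const_mul]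
    simp only [zero_add, smul_smul, inv_mul_cancel₀ hs.1.ne', one_smul] at h3
    rw [h3, smul_eq_mul, ← integral_const_mul]
    refine integral_congr_ae (ae_of_all _ fun w => ?_)
    simp only [f]; ring
  rw [setIntegral_congr_fun measurableSet_Ioo hin, integral_integral_swap hf, ← integral_neg]
  refine integral_congr_ae ?_
  have hne : ∀ᵐ w : E n, w ≠ 0 := by
    have : Nonempty (Fin n) := ⟨⟨0, by omega⟩⟩
    exact Measure.ae_ne volume 0
  filter_upwards [hf.prod_left_ae, hne] with w hw hw0
  have hw1 : 0 < ‖w‖ := norm_pos_iff.2 hw0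
  set g : ℝ → ℝ := fun s => s ^ (2 - n : ℤ) * inner ℝ (B w) (φ (s⁻¹ • w))
  have hg : ∀ s : ℝ, 0 < s → HasDerivAt g (-(f s w)) s := by
    intro s hs
    have e1 := hasDerivAt_zpow (2 - n : ℤ) s (Or.inl hs.ne')
    have e2 : HasDerivAt (fun s : ℝ => s⁻¹ • w) (-(s ^ 2)⁻¹ • w) s :=
      (hasDerivAt_inv hs.ne').smul_const w
    have e3 := (φ.hasFDerivAt (s⁻¹ • w)).comp_hasDerivAt s e2
    have e4 := ((innerSL ℝ (B w)).hasFDerivAt).comp_hasDerivAt s e3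
    refine (e1.mul e4).congr_deriv ?_
    simp only [f, c, innerSL_apply_apply, Function.comp_apply, map_smul, inner_smul_right,
      inner_add_right]
    generalize inner ℝ (B w) ((fderiv ℝ φ (s⁻¹ • w)) w) = X
    have z1 : s ^ (2 - n : ℤ) = s ^ 2 * (s ^ n)⁻¹ := by
      rw [zpow_sub₀ hs.ne']; norm_cast
    have z2 : s ^ (2 - n - 1 : ℤ) = s * (s ^ n)⁻¹ := by
      rw [show (2 - n - 1 : ℤ) = 1 - n by ring, zpow_sub₀ hs.ne', zpow_one]; norm_cast
    rw [z1, z2]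
    push_cast
    have z3 : s ^ 2 * (s ^ 2)⁻¹ = 1 := mul_inv_cancel₀ (by positivity)
    have z4 : s * s⁻¹ = 1 := mul_inv_cancel₀ hs.ne'
    linear_combination (s ^ n)⁻¹ * X * z4 - (s ^ n)⁻¹ * X * z3
  have h0 : Tendsto g (𝓝[>] 0) (𝓝 0) := by
    obtain ⟨C3, hC3, h3⟩ := exists_schwartz_le_weight φ n
    have hbd : ∀ s ∈ Ioi (0 : ℝ), ‖g s‖ ≤ ‖B w‖ * C3 * (‖w‖ ^ n)⁻¹ * s ^ 2 := by
      intro s hs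
      have hs0 : 0 < s := hs
      have h4 : ‖φ (s⁻¹ • w)‖ ≤ C3 * (s ^ n * (‖w‖ ^ n)⁻¹) := by
        have h5 := h3 (s⁻¹ • w)
        have h6 : weight (s⁻¹ • w) ≤ 1 := Real.rpow_le_one_of_one_le_of_nonpos
          (by linarith [norm_nonneg (s⁻¹ • w)]) (by linarith)
        have h7 : (‖w‖ / s) ^ n * ‖φ (s⁻¹ • w)‖ ≤ C3 := by
          calc _ ≤ (1 + ‖s⁻¹ • w‖) ^ n * ‖φ (s⁻¹ • w)‖ := by
                gcongr
                rw [norm_smul, Real.norm_of_nonneg (by positivity), div_eq_inv_mul]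
                linarith
            _ ≤ C3 * 1 := h5.trans (by gcongr)
            _ = _ := mul_one _
        rw [div_pow, div_mul_eq_mul_div, div_le_iff₀ (by positivity)] at h7
        rw [← mul_assoc, ← div_eq_mul_inv, le_div_iff₀ (by positivity)]
        linarith
      have z1 : s ^ (2 - n : ℤ) = s ^ 2 * (s ^ n)⁻¹ := by
        rw [zpow_sub₀ hs0.ne']; norm_cast
      simp only [g]
      rw [norm_mul, z1, Real.norm_of_nonneg (by positivity)]
      calc _ ≤ s ^ 2 * (s ^ n)⁻¹ * (‖B w‖ * (C3 * (s ^ n * (‖w‖ ^ n)⁻¹))) := by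
            gcongr
            exact (norm_inner_le_norm _ _).trans (by gcongr)
        _ = _ := by field_simp
    refine squeeze_zero_norm' (eventually_nhdsWithin_of_forall hbd) ?_
    have : Tendsto (fun s : ℝ => ‖B w‖ * C3 * (‖w‖ ^ n)⁻¹ * s ^ 2) (𝓝 0)
        (𝓝 (‖B w‖ * C3 * (‖w‖ ^ n)⁻¹ * 0 ^ 2)) := Continuous.tendsto (by fun_prop) 0
    simp only [ne_eq, OfNat.ofNat_ne_zero, not_false_eq_true, zero_pow, mul_zero] at this
    exact this.mono_left nhdsWithin_le_nhds
  have h1' : Tendsto g (𝓝[<] 1) (𝓝 (inner ℝ (B w) (φ w))) := by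
    have := ((hg 1 one_pos).continuousAt.tendsto).mono_left (nhdsWithin_le_nhds (s := Iio 1))
    simpa [g] using this
  have hint : IntervalIntegrable (fun s => -(f s w)) volume 0 1 := by
    rw [intervalIntegrable_iff_integrableOn_Ioo_of_le zero_le_one]
    exact hw.neg
  have hfin := intervalIntegral.integral_eq_sub_of_hasDerivAt_of_tendsto zero_lt_one
    (fun s hs => hg s hs.1) hint h0 h1'
  rw [intervalIntegral.integral_of_le zero_le_one, integral_Ioc_eq_integral_Ioo,
    integral_neg, sub_zero] at hfin
  linarith

/-- The Poincaré lemma with base point `z`. -/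
lemma integral_integral_inner_cr_cu (hn : 2 ≤ n) {B : E n → F} {p : ℝ} (hp : n < p)
    (hB : MemLp B (ENNReal.ofReal p)) (hdiv : K.IsDivFree B) (φ : 𝓢(E n, F)) (z : E n) :
    ∫ s in Ioo (0 : ℝ) 1, ∫ x, s * inner ℝ (K.cr (x - z) (B (s • x + (1 - s) • z)))
      (K.cu (fderiv ℝ φ x)) = -∫ y, inner ℝ (B y) (φ y) := by
  have hB' : MemLp (fun y => B (z + y)) (ENNReal.ofReal p) := by
    have hn' : (2 : ℝ) ≤ n := by exact_mod_cast hn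
    simpa using (memLp_comp_add_smul (by linarith) hB z one_pos).1
  have h := K.integral_integral_inner_cr_cu_zero hn hp hB' (hdiv.comp_add z)
    (SchwartzMap.compSubConstCLM ℝ (-z) φ)
  have h2 : ∀ y, fderiv ℝ (SchwartzMap.compSubConstCLM ℝ (-z) φ) y = fderiv ℝ φ (z + y) := by
    intro y
    have h3 : HasFDerivAt φ (fderiv ℝ φ (z + y)) (y - -z) := by
      rw [sub_neg_eq_add, add_comm y z]; exact φ.hasFDerivAt _
    have h4 := h3.comp y ((hasFDerivAt_id y).sub_const (-z))
    refine HasFDerivAt.fderiv ((h4.congr_fderiv (by ext; simp)).congr_of_eventuallyEq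
      (Eventually.of_forall fun w => by simp))
  have h3 : ∫ y, inner ℝ (B (z + y)) (SchwartzMap.compSubConstCLM ℝ (-z) φ y) =
      ∫ y, inner ℝ (B y) (φ y) := by
    rw [← integral_add_left_eq_self (fun y => inner ℝ (B y) (φ y)) z]
    refine integral_congr_ae (ae_of_all _ fun y => ?_)
    simp [add_comm]
  rw [h3] at h
  rw [← h]
  refine integral_congr_ae (ae_of_all _ fun s => ?_)
  simp only
  rw [← integral_add_left_eq_self (fun x => s * inner ℝ (K.cr (x - z) (B (s • x + (1 - s) • z)))
    (K.cu (fderiv ℝ φ x))) z]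
  refine integral_congr_ae (ae_of_all _ fun y => ?_)
  simp only
  rw [h2, add_sub_cancel_left, show s • (z + y) + (1 - s) • z = z + s • y by module]

end CrossData

end

section

/-! ### Averaged radial gauges -/

variable {n : ℕ} {F : Type*} [NormedAddCommGroup F] [InnerProductSpace ℝ F]

/-- The average of `‖B‖` over the points `s x + (1 - s) z`, which bounds the integrand of an
averaged radial gauge. -/
def radialAverage (ν : Measure (E n)) (h : E n → ℝ) (B : E n → F) (s : ℝ) (x : E n) : ℝ≥0∞ :=
  ∫⁻ z, ‖h z‖ₑ * ENNReal.ofReal (1 + ‖z‖) * ‖B (s • x + (1 - s) • z)‖ₑ ∂ν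

/-- The total of `radialAverage` along the ray. -/
def radialTotal (ν : Measure (E n)) (h : E n → ℝ) (B : E n → F) (x : E n) : ℝ≥0∞ :=
  ∫⁻ s in Ioo (0 : ℝ) 1, ENNReal.ofReal s * radialAverage ν h B s x

namespace CrossData

variable (K : CrossData n F)

/-- Transversal gauges with base point `z`, averaged with weight `h` over `z`. For Lebesgue measure
and a mollifier `h` this is the Griesinger gauge; for the Dirac measure at `0` and `h = 1` it is the
transversal gauge. -/
def radialGauge (ν : Measure (E n)) (h : E n → ℝ) (B : E n → F) (x : E n) : E n :=
  -∫ z, (∫ s in (0 : ℝ)..1, h z • K.cr (x - z) (s • B (s • x + (1 - s) • z))) ∂ν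

end CrossData

/-- The hypotheses under which the averaged radial gauge of a field of decay rate `μ` is analyzed:
the average along the ray has an integrable singularity at `s = 1`, and decays like the field. -/
structure RadialBound (K : CrossData n F) (ν : Measure (E n)) (h : E n → ℝ) (B : E n → F) (μ : ℝ) :
    Prop where
  measurable_weight : AEStronglyMeasurable h ν
  aestronglyMeasurable : ∀ x, AEStronglyMeasurable
    (fun q : E n × ℝ => B (q.2 • x + (1 - q.2) • q.1)) (ν.prod (volume.restrict (Ioo 0 1)))
  near : ∃ C κ : ℝ, 0 ≤ C ∧ 0 ≤ κ ∧ κ < 1 ∧ ∀ x, ∀ s ∈ Ioo (0 : ℝ) 1,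
    radialAverage ν h B s x ≤ ENNReal.ofReal (C * (1 - s) ^ (-κ))
  far : ∃ C R : ℝ, 0 ≤ C ∧ 1 ≤ R ∧ ∀ x, ∀ s ∈ Ioo (0 : ℝ) 1, R ≤ s * ‖x‖ →
    radialAverage ν h B s x ≤ ENNReal.ofReal (C * (s * ‖x‖) ^ (-μ))
  continuous : ∀ s ∈ Ioo (0 : ℝ) 1, Continuous fun x =>
    ∫ z, h z • K.cr (x - z) (B (s • x + (1 - s) • z)) ∂ν

lemma integrableOn_one_sub_rpow {κ : ℝ} (hκ : κ < 1) :
    IntegrableOn (fun s : ℝ => (1 - s) ^ (-κ)) (Ioo 0 1) := by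
  have h : IntervalIntegrable (fun s : ℝ => s ^ (-κ)) volume (1 - 1) (1 - 0) := by
    simpa using intervalIntegral.intervalIntegrable_rpow' (by linarith : -1 < -κ) (a := 0) (b := 1)
  have h2 := (h.comp_sub_left 1)
  simp only [sub_sub_cancel] at h2
  exact (intervalIntegrable_iff_integrableOn_Ioo_of_le zero_le_one).1 h2.symm

namespace RadialBound

variable {K : CrossData n F} {ν : Measure (E n)} {h : E n → ℝ} {B : E n → F} {μ : ℝ}

lemma exists_radialTotal_le (hb : RadialBound K ν h B μ) :
    ∃ C : ℝ, 0 ≤ C ∧ ∀ x, radialTotal ν h B x ≤ ENNReal.ofReal C := by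
  obtain ⟨C, κ, hC, hκ0, hκ, hle⟩ := hb.near
  have hi := (integrableOn_one_sub_rpow hκ).const_mul C
  refine ⟨∫ s in Ioo (0 : ℝ) 1, C * (1 - s) ^ (-κ), setIntegral_nonneg measurableSet_Ioo
    fun s hs => mul_nonneg hC (Real.rpow_nonneg (by linarith [hs.2]) _), fun x => ?_⟩
  rw [ofReal_integral_eq_lintegral_ofReal hi ((ae_restrict_iff' measurableSet_Ioo).2
    (ae_of_all _ fun s hs => mul_nonneg hC (Real.rpow_nonneg (by linarith [hs.2]) _)))]
  refine setLIntegral_mono' measurableSet_Ioo fun s hs => ?_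
  refine (mul_le_of_le_one_left' ?_).trans (hle x s hs)
  exact ENNReal.ofReal_le_one.2 hs.2.le

/-- The near and the far bound combined. -/
lemma exists_radialAverage_le (hb : RadialBound K ν h B μ) (hμ : 0 ≤ μ) :
    ∃ C R : ℝ, 0 ≤ C ∧ 1 ≤ R ∧ ∀ x, R ≤ ‖x‖ → ∀ s ∈ Ioo (0 : ℝ) 1,
      radialAverage ν h B s x ≤ ENNReal.ofReal (C * (1 + s * ‖x‖) ^ (-μ)) := by
  obtain ⟨C, κ, hC, hκ0, hκ, hle⟩ := hb.near
  obtain ⟨C', R, hC', hR, hle'⟩ := hb.far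
  refine ⟨C * 2 ^ κ * (1 + R) ^ μ + C' * 2 ^ μ, 2 * R, by positivity, by linarith,
    fun x hx s hs => ?_⟩
  have hs0 := hs.1
  have h0 : (0 : ℝ) < 1 + s * ‖x‖ := by positivity
  by_cases hsx : R ≤ s * ‖x‖
  · refine (hle' x s hs hsx).trans (ENNReal.ofReal_le_ofReal ?_)
    have h1 : (s * ‖x‖) ^ (-μ) ≤ 2 ^ μ * (1 + s * ‖x‖) ^ (-μ) := by
      have h2 : (2 * (s * ‖x‖)) ^ (-μ) ≤ (1 + s * ‖x‖) ^ (-μ) :=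
        Real.rpow_le_rpow_of_nonpos h0 (by linarith) (by linarith)
      rw [Real.mul_rpow (by norm_num) (by positivity), Real.rpow_neg (by norm_num)] at h2
      rwa [inv_mul_le_iff₀ (by positivity)] at h2
    calc _ ≤ C' * (2 ^ μ * (1 + s * ‖x‖) ^ (-μ)) := by gcongr
      _ ≤ (C * 2 ^ κ * (1 + R) ^ μ) * (1 + s * ‖x‖) ^ (-μ) +
        C' * (2 ^ μ * (1 + s * ‖x‖) ^ (-μ)) := le_add_of_nonneg_left (by positivity)
      _ = _ := by ring
  · push Not at hsx
    refine (hle x s hs).trans (ENNReal.ofReal_le_ofReal ?_)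
    have hs2 : s ≤ 1 / 2 := by
      by_contra hcon
      push Not at hcon
      nlinarith
    have h1 : (1 - s) ^ (-κ) ≤ 2 ^ κ := by
      calc _ ≤ (1 / 2 : ℝ) ^ (-κ) :=
            Real.rpow_le_rpow_of_nonpos (by norm_num) (by linarith) (by linarith)
        _ = _ := by rw [one_div, Real.inv_rpow (by norm_num), Real.rpow_neg (by norm_num), inv_inv]
    have h2 : 1 ≤ (1 + R) ^ μ * (1 + s * ‖x‖) ^ (-μ) := by
      rw [Real.rpow_neg h0.le, ← div_eq_mul_inv, one_le_div (by positivity)]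
      gcongr
    calc _ ≤ C * 2 ^ κ := by gcongr
      _ ≤ C * 2 ^ κ * ((1 + R) ^ μ * (1 + s * ‖x‖) ^ (-μ)) :=
          le_mul_of_one_le_right (by positivity) h2
      _ ≤ (C * 2 ^ κ * (1 + R) ^ μ) * (1 + s * ‖x‖) ^ (-μ) +
        C' * 2 ^ μ * (1 + s * ‖x‖) ^ (-μ) := by
          rw [← mul_assoc]; exact le_add_of_nonneg_right (by positivity)
      _ = _ := by ring

lemma exists_radialTotal_le_rpow (hb : RadialBound K ν h B μ) (hμ0 : 0 ≤ μ) (hμ : μ < 2) :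
    ∃ C R : ℝ, 0 ≤ C ∧ 1 ≤ R ∧ ∀ x, R ≤ ‖x‖ →
      radialTotal ν h B x ≤ ENNReal.ofReal (C * ‖x‖ ^ (-μ)) := by
  obtain ⟨C, R, hC, hR, hle⟩ := hb.exists_radialAverage_le hμ0
  have hi : IntegrableOn (fun s : ℝ => s ^ (1 - μ)) (Ioo 0 1) := by
    rw [← intervalIntegrable_iff_integrableOn_Ioo_of_le zero_le_one]
    exact intervalIntegral.intervalIntegrable_rpow' (by linarith)
  have hnn : ∀ s ∈ Ioo (0 : ℝ) 1, 0 ≤ s ^ (1 - μ) := fun s hs => Real.rpow_nonneg hs.1.le _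
  refine ⟨C * ∫ s in Ioo (0 : ℝ) 1, s ^ (1 - μ), R,
    mul_nonneg hC (setIntegral_nonneg measurableSet_Ioo hnn), hR, fun x hx => ?_⟩
  have hx0 : 0 < ‖x‖ := by linarith
  calc radialTotal ν h B x ≤ ∫⁻ s in Ioo (0 : ℝ) 1,
        ENNReal.ofReal (C * ‖x‖ ^ (-μ)) * ENNReal.ofReal (s ^ (1 - μ)) := by
        refine setLIntegral_mono' measurableSet_Ioo fun s hs => ?_
        have hs0 := hs.1
        have h1 := hle x hx s hs
        calc _ ≤ ENNReal.ofReal s * ENNReal.ofReal (C * (1 + s * ‖x‖) ^ (-μ)) := by gcongr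
          _ ≤ _ := by
            rw [← ENNReal.ofReal_mul hs0.le, ← ENNReal.ofReal_mul (by positivity)]
            refine ENNReal.ofReal_le_ofReal ?_
            have h2 : (1 + s * ‖x‖) ^ (-μ) ≤ (s * ‖x‖) ^ (-μ) :=
              Real.rpow_le_rpow_of_nonpos (by positivity) (by linarith) (by linarith)
            rw [Real.mul_rpow hs0.le hx0.le] at h2
            have h3 : s ^ (1 - μ) = s * s ^ (-μ) := by
              rw [sub_eq_add_neg, Real.rpow_add hs0, Real.rpow_one]
            rw [h3]
            calc s * (C * (1 + s * ‖x‖) ^ (-μ)) ≤ s * (C * (s ^ (-μ) * ‖x‖ ^ (-μ))) := by gcongr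
              _ = _ := by ring
    _ = _ := by
        rw [lintegral_const_mul' _ _ ENNReal.ofReal_ne_top,
          ← ofReal_integral_eq_lintegral_ofReal hi ((ae_restrict_iff' measurableSet_Ioo).2
            (ae_of_all _ hnn)), ← ENNReal.ofReal_mul (by positivity)]
        congr 1; ring

lemma exists_radialTotal_le_inv_sq (hb : RadialBound K ν h B μ) (hμ : 2 < μ) :
    ∃ C R : ℝ, 0 ≤ C ∧ 1 ≤ R ∧ ∀ x, R ≤ ‖x‖ →
      radialTotal ν h B x ≤ ENNReal.ofReal (C * (‖x‖ ^ 2)⁻¹) := by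
  obtain ⟨C, R, hC, hR, hle⟩ := hb.exists_radialAverage_le (by linarith)
  refine ⟨C / (μ - 2), R, div_nonneg hC (by linarith), hR, fun x hx => ?_⟩
  have hx0 : 0 < ‖x‖ := by linarith
  set r := ‖x‖
  have hd : ∀ s ∈ uIcc (0 : ℝ) 1, HasDerivAt (fun s : ℝ => -(C / (μ - 2) * (r ^ 2)⁻¹) *
      (1 + s * r) ^ (2 - μ)) (C * r⁻¹ * (1 + s * r) ^ (1 - μ)) s := by
    intro s hs
    rw [uIcc_of_le zero_le_one] at hs
    have h0 : 0 < 1 + s * r := by have := hs.1; positivity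
    have h1 : HasDerivAt (fun s : ℝ => 1 + s * r) r s := by
      simpa using ((hasDerivAt_id s).mul_const r).const_add 1
    have h2 := (h1.rpow_const (p := 2 - μ) (Or.inl h0.ne')).const_mul (-(C / (μ - 2) * (r ^ 2)⁻¹))
    refine h2.congr_deriv ?_
    rw [show 2 - μ - 1 = 1 - μ by ring]
    have h3 : μ - 2 ≠ 0 := by linarith
    field_simp
    ring
  have hcont : ContinuousOn (fun s : ℝ => C * r⁻¹ * (1 + s * r) ^ (1 - μ)) (uIcc 0 1) := by
    refine continuousOn_const.mul (ContinuousOn.rpow_const (by fun_prop) fun s hs => Or.inl ?_)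
    rw [uIcc_of_le zero_le_one] at hs
    have h0 : 0 < 1 + s * r := by have := hs.1; positivity
    exact h0.ne'
  have hint := hcont.intervalIntegrable (μ := volume)
  have hftc := intervalIntegral.integral_eq_sub_of_hasDerivAt hd hint
  rw [intervalIntegral.integral_of_le zero_le_one, integral_Ioc_eq_integral_Ioo] at hftc
  have hnn : ∀ s ∈ Ioo (0 : ℝ) 1, 0 ≤ C * r⁻¹ * (1 + s * r) ^ (1 - μ) := fun s hs => by
    have := hs.1; positivity
  calc radialTotal ν h B x ≤ ∫⁻ s in Ioo (0 : ℝ) 1,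
        ENNReal.ofReal (C * r⁻¹ * (1 + s * r) ^ (1 - μ)) := by
        refine setLIntegral_mono' measurableSet_Ioo fun s hs => ?_
        have hs0 := hs.1
        have h0 : 0 < 1 + s * r := by positivity
        calc _ ≤ ENNReal.ofReal s * ENNReal.ofReal (C * (1 + s * r) ^ (-μ)) := by
              gcongr; exact hle x hx s hs
          _ ≤ _ := by
            rw [← ENNReal.ofReal_mul hs0.le]
            refine ENNReal.ofReal_le_ofReal ?_
            rw [show (1 - μ) = 1 + -μ by ring, Real.rpow_add h0, Real.rpow_one]
            calc s * (C * (1 + s * r) ^ (-μ)) = C * r⁻¹ * ((s * r) * (1 + s * r) ^ (-μ)) := by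
                  field_simp
              _ ≤ _ := by gcongr; linarith
    _ = ENNReal.ofReal (∫ s in Ioo (0 : ℝ) 1, C * r⁻¹ * (1 + s * r) ^ (1 - μ)) := by
        rw [ofReal_integral_eq_lintegral_ofReal _ ((ae_restrict_iff' measurableSet_Ioo).2
            (ae_of_all _ hnn))]
        exact (intervalIntegrable_iff_integrableOn_Ioo_of_le zero_le_one).1 hint
    _ ≤ _ := by
        refine ENNReal.ofReal_le_ofReal ?_
        rw [hftc]
        have h4 : 0 ≤ C / (μ - 2) * (r ^ 2)⁻¹ * (1 + 1 * r) ^ (2 - μ) :=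
          mul_nonneg (mul_nonneg (div_nonneg hC (by linarith)) (by positivity)) (by positivity)
        simp only [zero_mul, add_zero, Real.one_rpow]
        linarith

end RadialBound

end

section

/-! ### Decay and continuity of averaged radial gauges -/

variable {n : ℕ} {F : Type*} [NormedAddCommGroup F] [InnerProductSpace ℝ F]

namespace CrossData

variable (K : CrossData n F)

lemma inner_cr_sub (x z : E n) (b : F) :
    inner ℝ (K.cr (x - z) b) x = -inner ℝ (K.cr z b) x := by
  rw [map_sub, sub_apply, inner_sub_left, real_inner_comm x (K.cr x b), K.inner_cr_self, zero_sub]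

end CrossData

namespace RadialBound

variable {K : CrossData n F} {ν : Measure (E n)} {h : E n → ℝ} {B : E n → F} {μ : ℝ}

lemma aestronglyMeasurable_integrand (hb : RadialBound K ν h B μ) (x : E n) :
    AEStronglyMeasurable (fun q : E n × ℝ =>
      h q.1 • K.cr (x - q.1) (q.2 • B (q.2 • x + (1 - q.2) • q.1)))
      (ν.prod (volume.restrict (Ioo 0 1))) := by
  refine hb.measurable_weight.comp_fst.smul (aestronglyMeasurable_clm_apply ?_ ?_)
  · have : Continuous fun q : E n × ℝ => K.cr (x - q.1) := by fun_prop
    exact this.aestronglyMeasurable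
  · exact continuous_snd.aestronglyMeasurable.smul (hb.aestronglyMeasurable x)

lemma ae_prod_mem : ∀ᵐ q : E n × ℝ ∂(ν.prod (volume.restrict (Ioo 0 1))), q.2 ∈ Ioo (0 : ℝ) 1 :=
  Measure.quasiMeasurePreserving_snd.ae (ae_restrict_mem measurableSet_Ioo)

variable [SFinite ν]

lemma lintegral_prod_eq (hb : RadialBound K ν h B μ) (x : E n) :
    ∫⁻ q : E n × ℝ, ENNReal.ofReal q.2 * (‖h q.1‖ₑ * ENNReal.ofReal (1 + ‖q.1‖) *
      ‖B (q.2 • x + (1 - q.2) • q.1)‖ₑ) ∂(ν.prod (volume.restrict (Ioo 0 1))) =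
    radialTotal ν h B x := by
  have hm : AEMeasurable (fun q : E n × ℝ => ENNReal.ofReal q.2 * (‖h q.1‖ₑ *
      ENNReal.ofReal (1 + ‖q.1‖) * ‖B (q.2 • x + (1 - q.2) • q.1)‖ₑ))
      (ν.prod (volume.restrict (Ioo 0 1))) := by
    have h1 : Measurable fun q : E n × ℝ => ENNReal.ofReal (1 + ‖q.1‖) := by fun_prop
    have h2 : Measurable fun q : E n × ℝ => ENNReal.ofReal q.2 := by fun_prop
    exact h2.aemeasurable.mul ((hb.measurable_weight.comp_fst.enorm.mul h1.aemeasurable).mul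
      (hb.aestronglyMeasurable x).enorm)
  rw [lintegral_prod_symm _ hm]
  simp only [radialTotal, radialAverage]
  refine lintegral_congr fun s => ?_
  rw [lintegral_const_mul' _ _ ENNReal.ofReal_ne_top]

lemma enorm_integrand_le (x z : E n) {s : ℝ} (hs : 0 ≤ s) :
    ‖h z • K.cr (x - z) (s • B (s • x + (1 - s) • z))‖ₑ ≤
      ENNReal.ofReal (1 + ‖x‖) * (ENNReal.ofReal s * (‖h z‖ₑ * ENNReal.ofReal (1 + ‖z‖) *
        ‖B (s • x + (1 - s) • z)‖ₑ)) := by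
  have hx := norm_nonneg x
  have hz := norm_nonneg z
  simp only [← ofReal_norm]
  rw [← ENNReal.ofReal_mul (by positivity), ← ENNReal.ofReal_mul (by positivity),
    ← ENNReal.ofReal_mul hs, ← ENNReal.ofReal_mul (by positivity)]
  refine ENNReal.ofReal_le_ofReal ?_
  rw [norm_smul]
  have h1 : ‖x - z‖ ≤ (1 + ‖x‖) * (1 + ‖z‖) := (norm_sub_le x z).trans (by nlinarith)
  calc _ ≤ ‖h z‖ * (‖x - z‖ * ‖s • B (s • x + (1 - s) • z)‖) := by
        gcongr; exact K.norm_cr_le _ _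
    _ ≤ ‖h z‖ * (((1 + ‖x‖) * (1 + ‖z‖)) * (s * ‖B (s • x + (1 - s) • z)‖)) := by
        rw [norm_smul, Real.norm_of_nonneg hs]; gcongr
    _ = _ := by ring

lemma integrable_integrand (hb : RadialBound K ν h B μ) (x : E n) :
    Integrable (fun q : E n × ℝ =>
      h q.1 • K.cr (x - q.1) (q.2 • B (q.2 • x + (1 - q.2) • q.1)))
      (ν.prod (volume.restrict (Ioo 0 1))) := by
  refine ⟨hb.aestronglyMeasurable_integrand x, ?_⟩
  obtain ⟨C, hC, hle⟩ := hb.exists_radialTotal_le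
  calc _ ≤ ∫⁻ q : E n × ℝ, ENNReal.ofReal (1 + ‖x‖) * (ENNReal.ofReal q.2 * (‖h q.1‖ₑ *
        ENNReal.ofReal (1 + ‖q.1‖) * ‖B (q.2 • x + (1 - q.2) • q.1)‖ₑ))
        ∂(ν.prod (volume.restrict (Ioo 0 1))) := by
        refine lintegral_mono_ae (ae_prod_mem.mono fun q hq => ?_)
        exact enorm_integrand_le (K := K) x q.1 hq.1.le
    _ ≤ ENNReal.ofReal (1 + ‖x‖) * ENNReal.ofReal C := by
        rw [lintegral_const_mul' _ _ ENNReal.ofReal_ne_top, hb.lintegral_prod_eq]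
        gcongr
        exact hle x
    _ < ⊤ := ENNReal.mul_lt_top ENNReal.ofReal_lt_top ENNReal.ofReal_lt_top

lemma radialGauge_eq_integral_prod (hb : RadialBound K ν h B μ) (x : E n) :
    K.radialGauge ν h B x = -∫ q : E n × ℝ,
      h q.1 • K.cr (x - q.1) (q.2 • B (q.2 • x + (1 - q.2) • q.1))
      ∂(ν.prod (volume.restrict (Ioo 0 1))) := by
  rw [integral_prod _ (hb.integrable_integrand x), CrossData.radialGauge]
  simp_rw [intervalIntegral.integral_of_le zero_le_one, integral_Ioc_eq_integral_Ioo]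

lemma enorm_radialGauge_le (hb : RadialBound K ν h B μ) (x : E n) :
    ‖K.radialGauge ν h B x‖ₑ ≤ ENNReal.ofReal (1 + ‖x‖) * radialTotal ν h B x := by
  rw [hb.radialGauge_eq_integral_prod, enorm_neg, ← hb.lintegral_prod_eq,
    ← lintegral_const_mul' _ _ ENNReal.ofReal_ne_top]
  refine (enorm_integral_le_lintegral_enorm _).trans ?_
  refine lintegral_mono_ae (ae_prod_mem.mono fun q hq => ?_)
  exact enorm_integrand_le (K := K) x q.1 hq.1.le

/-- The longitudinal part gains a factor `1 / |x|`, since `x - z` may be replaced by `-z`. -/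
lemma enorm_inner_radialGauge_le (hb : RadialBound K ν h B μ) (x : E n) :
    ‖inner ℝ (K.radialGauge ν h B x) x‖ₑ ≤ ENNReal.ofReal ‖x‖ * radialTotal ν h B x := by
  rw [hb.radialGauge_eq_integral_prod, inner_neg_left, enorm_neg, real_inner_comm,
    ← integral_inner (hb.integrable_integrand x), ← hb.lintegral_prod_eq,
    ← lintegral_const_mul' _ _ ENNReal.ofReal_ne_top]
  refine (enorm_integral_le_lintegral_enorm _).trans ?_
  refine lintegral_mono_ae (ae_prod_mem.mono fun q hq => ?_)
  rw [real_inner_comm, real_inner_smul_left, K.inner_cr_sub]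
  have hq0 := hq.1.le
  simp only [← ofReal_norm]
  rw [← ENNReal.ofReal_mul (by positivity), ← ENNReal.ofReal_mul (by positivity),
    ← ENNReal.ofReal_mul hq0, ← ENNReal.ofReal_mul (by positivity)]
  refine ENNReal.ofReal_le_ofReal ?_
  rw [norm_mul, norm_neg]
  calc _ ≤ ‖h q.1‖ * ((‖q.1‖ * (q.2 * ‖B (q.2 • x + (1 - q.2) • q.1)‖)) * ‖x‖) := by
        gcongr
        refine (norm_inner_le_norm _ _).trans ?_
        gcongr
        refine (K.norm_cr_le _ _).trans_eq ?_
        rw [norm_smul, Real.norm_of_nonneg hq0]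
    _ ≤ ‖h q.1‖ * (((1 + ‖q.1‖) * (q.2 * ‖B (q.2 • x + (1 - q.2) • q.1)‖)) * ‖x‖) := by
        gcongr; linarith
    _ = _ := by ring

/-- For fixed `s < 1` the average over `z` is continuous in `x`, and the integral over `s` is
dominated by the integrable singularity at `s = 1`. -/
lemma continuous_radialGauge [CompleteSpace F] (hb : RadialBound K ν h B μ) :
    Continuous (K.radialGauge ν h B) := by
  obtain ⟨C, κ, hC, hκ0, hκ, hle⟩ := hb.near
  have heq : K.radialGauge ν h B = fun x => -∫ s in Ioo (0 : ℝ) 1,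
      s • ∫ z, h z • K.cr (x - z) (B (s • x + (1 - s) • z)) ∂ν := by
    funext x
    rw [hb.radialGauge_eq_integral_prod, integral_prod_symm _ (hb.integrable_integrand x)]
    congr 1
    refine integral_congr_ae (ae_of_all _ fun s => ?_)
    simp only
    rw [← integral_smul]
    refine integral_congr_ae (ae_of_all _ fun z => ?_)
    simp only
    rw [map_smul, smul_comm]
  rw [heq]
  refine Continuous.neg (continuous_iff_continuousAt.2 fun x₀ => ?_)
  refine continuousAt_of_dominated (bound := fun s => (2 + ‖x₀‖) * (C * (1 - s) ^ (-κ)))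
    (Eventually.of_forall fun x => ?_) ?_ ?_ ?_
  · have h1 := (hb.integrable_integrand x).1.prod_swap.integral_prod_right'
    refine h1.congr (ae_of_all _ fun s => ?_)
    simp only [Prod.swap_prod_mk]
    rw [← integral_smul]
    refine integral_congr_ae (ae_of_all _ fun z => ?_)
    simp only [map_smul]
    rw [smul_comm]
  · filter_upwards [Metric.ball_mem_nhds x₀ one_pos] with x hx
    refine (ae_restrict_iff' measurableSet_Ioo).2 (ae_of_all _ fun s hs => ?_)
    have hx1 : ‖x‖ ≤ 1 + ‖x₀‖ := by
      have := norm_sub_norm_le x x₀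
      rw [mem_ball_iff_norm] at hx
      linarith
    have hs1 : 0 < 1 - s := by linarith [hs.2]
    have hs0 := hs.1
    have hn := norm_nonneg x₀
    rw [← ENNReal.ofReal_le_ofReal_iff (by positivity), ofReal_norm, ← integral_smul]
    refine (enorm_integral_le_lintegral_enorm _).trans ?_
    calc _ ≤ ∫⁻ z, ENNReal.ofReal (1 + ‖x‖) * (ENNReal.ofReal s * (‖h z‖ₑ *
          ENNReal.ofReal (1 + ‖z‖) * ‖B (s • x + (1 - s) • z)‖ₑ)) ∂ν := by
          refine lintegral_mono fun z => ?_
          rw [smul_comm, ← map_smul]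
          exact enorm_integrand_le (K := K) x z hs.1.le
      _ = ENNReal.ofReal (1 + ‖x‖) * (ENNReal.ofReal s * radialAverage ν h B s x) := by
          rw [lintegral_const_mul' _ _ ENNReal.ofReal_ne_top,
            lintegral_const_mul' _ _ ENNReal.ofReal_ne_top]
          rfl
      _ ≤ ENNReal.ofReal (2 + ‖x₀‖) * (1 * ENNReal.ofReal (C * (1 - s) ^ (-κ))) := by
          refine mul_le_mul' (ENNReal.ofReal_le_ofReal (by linarith)) (mul_le_mul' ?_ (hle x s hs))
          exact ENNReal.ofReal_le_one.2 hs.2.le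
      _ = _ := by rw [one_mul, ← ENNReal.ofReal_mul (by positivity)]
  · exact ((integrableOn_one_sub_rpow hκ).const_mul C).const_mul _
  · refine (ae_restrict_iff' measurableSet_Ioo).2 (ae_of_all _ fun s hs => ?_)
    exact ((hb.continuous s hs).const_smul s).continuousAt

lemma exists_norm_radialGauge_le (hb : RadialBound K ν h B μ) (hμ0 : 0 ≤ μ) (hμ : μ < 2) :
    ∃ C R : ℝ, 0 ≤ C ∧ 1 ≤ R ∧ ∀ x, R ≤ ‖x‖ → ‖K.radialGauge ν h B x‖ ≤ C * ‖x‖ ^ (-(μ - 1)) := by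
  obtain ⟨C, R, hC, hR, hle⟩ := hb.exists_radialTotal_le_rpow hμ0 hμ
  refine ⟨2 * C, R, by positivity, hR, fun x hx => ?_⟩
  have hx1 : 1 ≤ ‖x‖ := hR.trans hx
  rw [← ENNReal.ofReal_le_ofReal_iff (by positivity), ofReal_norm]
  refine (hb.enorm_radialGauge_le x).trans ?_
  calc _ ≤ ENNReal.ofReal (2 * ‖x‖) * ENNReal.ofReal (C * ‖x‖ ^ (-μ)) := by
        gcongr
        · linarith
        · exact hle x hx
    _ = _ := by
        rw [← ENNReal.ofReal_mul (by positivity), show -(μ - 1) = 1 + -μ by ring,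
          Real.rpow_add (by linarith), Real.rpow_one]
        congr 1; ring

lemma isBigOInv_radialGauge (hb : RadialBound K ν h B μ) (hμ0 : 0 ≤ μ) (hμ : μ < 2) :
    IsBigOInv (K.radialGauge ν h B) (μ - 1) := by
  obtain ⟨C, R, hC, hR, hle⟩ := hb.exists_norm_radialGauge_le hμ0 hμ
  refine Asymptotics.IsBigO.of_bound C ?_
  filter_upwards [tendsto_norm_cobounded_atTop.eventually_ge_atTop R] with x hx
  rw [Real.norm_of_nonneg (Real.rpow_nonneg (norm_nonneg x) _)]
  exact hle x hx

lemma mediumRange_radialGauge [CompleteSpace F] (hb : RadialBound K ν h B μ) (hμ0 : 3 / 2 < μ)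
    (hμ : μ < 2) : MediumRange (K.radialGauge ν h B) := by
  refine ⟨hb.continuous_radialGauge,
    ⟨μ - 1, by linarith, hb.isBigOInv_radialGauge (by linarith) hμ⟩,
    ?_⟩
  obtain ⟨C, R, hC, hR, hle⟩ := hb.exists_radialTotal_le_rpow (by linarith) hμ
  obtain ⟨C', hC', hle'⟩ := hb.exists_radialTotal_le
  have key : ∀ x c, 0 ≤ c → radialTotal ν h B x ≤ ENNReal.ofReal c →
      ‖inner ℝ (K.radialGauge ν h B x) x / ‖x‖‖ ≤ c := by
    intro x c hc h1
    rw [norm_div, norm_norm]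
    refine div_le_of_le_mul₀ (norm_nonneg _) hc ?_
    rw [← ENNReal.ofReal_le_ofReal_iff (by positivity), ofReal_norm]
    refine (hb.enorm_inner_radialGauge_le x).trans ?_
    rw [mul_comm c, ENNReal.ofReal_mul (norm_nonneg _)]
    gcongr
  refine decaysIntegrably_of_le (a := μ) (C := C) (R := R) (K := C') (by linarith) ?_ ?_
  · exact fun x hx => key x _ (by positivity) (hle x hx)
  · exact fun x => key x _ hC' (hle' x)

lemma boundedByInv_radialGauge (hb : RadialBound K ν h B μ) (hμ : 2 < μ) :
    BoundedByInv (K.radialGauge ν h B) := by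
  obtain ⟨C, R, hC, hR, hle⟩ := hb.exists_radialTotal_le_inv_sq hμ
  obtain ⟨C', hC', hle'⟩ := hb.exists_radialTotal_le
  refine ⟨2 * C + C' * (1 + R) * R, fun x hx => ?_⟩
  have hx0 : 0 < ‖x‖ := norm_pos_iff.2 hx
  have h0 : 0 ≤ C' * (1 + R) * R := by positivity
  rw [← ENNReal.ofReal_le_ofReal_iff (by positivity), ofReal_norm]
  refine (hb.enorm_radialGauge_le x).trans ?_
  by_cases hxR : R ≤ ‖x‖
  · calc _ ≤ ENNReal.ofReal (2 * ‖x‖) * ENNReal.ofReal (C * (‖x‖ ^ 2)⁻¹) := by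
          gcongr
          · linarith
          · exact hle x hxR
      _ ≤ _ := by
          rw [← ENNReal.ofReal_mul (by positivity)]
          refine ENNReal.ofReal_le_ofReal ?_
          calc _ = 2 * C * ‖x‖⁻¹ := by field_simp
            _ ≤ _ := by gcongr; linarith
  · push Not at hxR
    calc _ ≤ ENNReal.ofReal (1 + R) * ENNReal.ofReal C' := by
          gcongr
          exact hle' x
      _ ≤ _ := by
          rw [← ENNReal.ofReal_mul (by positivity)]
          refine ENNReal.ofReal_le_ofReal ?_
          rw [← div_eq_mul_inv, le_div_iff₀ hx0]
          calc (1 + R) * C' * ‖x‖ ≤ (1 + R) * C' * R := by gcongr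
            _ ≤ _ := by linarith

end RadialBound

end

section

/-! ### The curl of averaged radial gauges -/

variable {n : ℕ} {F : Type*} [NormedAddCommGroup F] [InnerProductSpace ℝ F]

namespace RadialBound

variable {K : CrossData n F} {ν : Measure (E n)} [SFinite ν] {h : E n → ℝ} {B : E n → F} {μ : ℝ}

lemma aestronglyMeasurable_pairing (hb : RadialBound K ν h B μ) (hB : AEStronglyMeasurable B)
    (φ : 𝓢(E n, F)) : AEStronglyMeasurable (fun t : E n × (E n × ℝ) => h t.2.1 * (t.2.2 *
      inner ℝ (K.cr (t.1 - t.2.1) (B (t.2.2 • t.1 + (1 - t.2.2) • t.2.1)))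
        (K.cu (fderiv ℝ φ t.1))))
      ((volume : Measure (E n)).prod (ν.prod (volume.restrict (Ioo (0 : ℝ) 1)))) := by
  have hq : Measure.QuasiMeasurePreserving (fun t : E n × (E n × ℝ) =>
      t.2.2 • t.1 + (1 - t.2.2) • t.2.1)
      ((volume : Measure (E n)).prod (ν.prod (volume.restrict (Ioo (0 : ℝ) 1)))) volume := by
    refine MeasureTheory.QuasiMeasurePreserving.prod_of_left (by fun_prop)
      (ae_prod_mem.mono fun q hq => ?_)
    simpa only [add_comm] using quasiMeasurePreserving_add_smul ((1 - q.2) • q.1) hq.1.ne'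
  have hφ' : Continuous (fderiv ℝ φ) := (φ.smooth ⊤).continuous_fderiv (by simp)
  have h1 : Continuous fun t : E n × (E n × ℝ) => K.cr (t.1 - t.2.1) := by fun_prop
  have h2 : Continuous fun t : E n × (E n × ℝ) => K.cu (fderiv ℝ φ t.1) := by fun_prop
  have h3 : Continuous fun t : E n × (E n × ℝ) => t.2.2 := by fun_prop
  exact (hb.measurable_weight.comp_fst.comp_snd).mul (h3.aestronglyMeasurable.mul
    ((aestronglyMeasurable_clm_apply h1.aestronglyMeasurable
      (hB.comp_quasiMeasurePreserving hq)).inner h2.aestronglyMeasurable))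

lemma integrable_pairing (hn : 2 ≤ n) (hb : RadialBound K ν h B μ) {p : ℝ} (hp : n < p)
    (hB : MemLp B (ENNReal.ofReal p)) (hh : ∫⁻ z, ‖h z‖ₑ * ENNReal.ofReal (1 + ‖z‖) ∂ν ≠ ⊤)
    (φ : 𝓢(E n, F)) : Integrable (fun t : E n × (E n × ℝ) => h t.2.1 * (t.2.2 *
      inner ℝ (K.cr (t.1 - t.2.1) (B (t.2.2 • t.1 + (1 - t.2.2) • t.2.1)))
        (K.cu (fderiv ℝ φ t.1))))
      ((volume : Measure (E n)).prod (ν.prod (volume.restrict (Ioo (0 : ℝ) 1)))) := by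
  have hn' : (2 : ℝ) ≤ n := by exact_mod_cast hn
  have hm := hb.aestronglyMeasurable_pairing hB.1 φ
  refine ⟨hm, ?_⟩
  obtain ⟨C1, hC1, h1⟩ := exists_schwartz_le_weight (SchwartzMap.fderivCLM ℝ (E n) F φ) 1
  simp only [SchwartzMap.fderivCLM_apply, pow_one] at h1
  obtain ⟨C, hC, h2⟩ := exists_lintegral_weight_mul_le (by linarith) hB
  rw [HasFiniteIntegral, lintegral_prod_symm _ hm.enorm]
  calc _ ≤ ∫⁻ q : E n × ℝ, ENNReal.ofReal (‖K.cu‖ * C1 * C) *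
        (‖h q.1‖ₑ * ENNReal.ofReal (1 + ‖q.1‖)) ∂(ν.prod (volume.restrict (Ioo (0 : ℝ) 1))) := by
        refine lintegral_mono_ae (ae_prod_mem.mono fun q hq => ?_)
        obtain ⟨z, s⟩ := q
        have hs0 : 0 < s := hq.1
        have hs1 : s < 1 := hq.2
        calc _ ≤ ∫⁻ x, (‖h z‖ₑ * ENNReal.ofReal (1 + ‖z‖)) * ENNReal.ofReal (s * (‖K.cu‖ * C1)) *
              (ENNReal.ofReal (weight x) * ‖B ((1 - s) • z + s • x)‖ₑ) := by
              refine lintegral_mono fun x => ?_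
              have hw := (weight_pos x).le
              simp only [← ofReal_norm]
              rw [← ENNReal.ofReal_mul (by positivity), ← ENNReal.ofReal_mul (by positivity),
                ← ENNReal.ofReal_mul (by positivity), ← ENNReal.ofReal_mul (by positivity)]
              refine ENNReal.ofReal_le_ofReal ?_
              rw [norm_mul, norm_mul, Real.norm_of_nonneg hs0.le, add_comm (s • x)]
              have h4 : ‖x - z‖ ≤ (1 + ‖z‖) * (1 + ‖x‖) := by
                refine (norm_sub_le x z).trans ?_
                nlinarith [norm_nonneg x, norm_nonneg z]
              calc _ ≤ ‖h z‖ * (s * ((‖x - z‖ * ‖B ((1 - s) • z + s • x)‖) *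
                    (‖K.cu‖ * ‖fderiv ℝ φ x‖))) := by
                    gcongr
                    refine (norm_inner_le_norm _ _).trans ?_
                    gcongr
                    · exact K.norm_cr_le _ _
                    · exact K.cu.le_opNorm _
                _ ≤ ‖h z‖ * (s * ((((1 + ‖z‖) * (1 + ‖x‖)) * ‖B ((1 - s) • z + s • x)‖) *
                    (‖K.cu‖ * ‖fderiv ℝ φ x‖))) := by gcongr
                _ = ‖h z‖ * (1 + ‖z‖) * s * ‖K.cu‖ * ((1 + ‖x‖) * ‖fderiv ℝ φ x‖) *
                    ‖B ((1 - s) • z + s • x)‖ := by ring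
                _ ≤ ‖h z‖ * (1 + ‖z‖) * s * ‖K.cu‖ * (C1 * weight x) *
                    ‖B ((1 - s) • z + s • x)‖ := by gcongr _ * ?_ * _; exact h1 x
                _ = _ := by ring
          _ ≤ (‖h z‖ₑ * ENNReal.ofReal (1 + ‖z‖)) * ENNReal.ofReal (s * (‖K.cu‖ * C1)) *
              ENNReal.ofReal (C * s ^ (-(n / p))) := by
              rw [lintegral_const_mul' _ _ (ENNReal.mul_ne_top (ENNReal.mul_ne_top enorm_ne_top
                ENNReal.ofReal_ne_top) ENNReal.ofReal_ne_top)]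
              gcongr
              exact h2 _ s hs0
          _ ≤ (‖h z‖ₑ * ENNReal.ofReal (1 + ‖z‖)) * ENNReal.ofReal (‖K.cu‖ * C1 * C) := by
              rw [mul_assoc, ← ENNReal.ofReal_mul (by positivity)]
              refine mul_le_mul' le_rfl (ENNReal.ofReal_le_ofReal ?_)
              have h5 : s * s ^ (-(n / p)) ≤ 1 := by
                have h6 : n / p < 1 := by rw [div_lt_one (by linarith)]; exact hp
                rw [← Real.rpow_one_add' hs0.le (by linarith)]
                exact Real.rpow_le_one hs0.le hs1.le (by linarith)
              calc _ = ‖K.cu‖ * C1 * C * (s * s ^ (-(n / p))) := by ring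
                _ ≤ ‖K.cu‖ * C1 * C * 1 := by gcongr
                _ = _ := mul_one _
          _ = _ := mul_comm _ _
    _ < ⊤ := by
        rw [lintegral_const_mul' _ _ ENNReal.ofReal_ne_top]
        refine ENNReal.mul_lt_top ENNReal.ofReal_lt_top ?_
        have hm2 : AEMeasurable (fun z => ‖h z‖ₑ * ENNReal.ofReal (1 + ‖z‖)) ν :=
          hb.measurable_weight.enorm.mul (by fun_prop : Measurable
            fun z : E n => ENNReal.ofReal (1 + ‖z‖)).aemeasurable
        rw [lintegral_prod _ hm2.comp_fst]
        simp only [lintegral_const, Measure.restrict_apply MeasurableSet.univ, univ_inter,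
          Real.volume_Ioo, sub_zero, ENNReal.ofReal_one, mul_one]
        exact hh.lt_top

/-- The curl is an average of the identities for the base points `z`. -/
lemma hasCurl_radialGauge (hn : 2 ≤ n) (hb : RadialBound K ν h B μ) {p : ℝ} (hp : n < p)
    (hB : MemLp B (ENNReal.ofReal p)) (hdiv : K.IsDivFree B)
    (hh : ∫⁻ z, ‖h z‖ₑ * ENNReal.ofReal (1 + ‖z‖) ∂ν ≠ ⊤) (hh1 : ∫ z, h z ∂ν = 1) :
    K.HasCurl (K.radialGauge ν h B) B := by
  intro φ
  have hT := hb.integrable_pairing hn hp hB hh φ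
  have hA : ∀ x, inner ℝ (K.radialGauge ν h B x) (K.cu (fderiv ℝ φ x)) =
      -∫ q : E n × ℝ, h q.1 * (q.2 * inner ℝ (K.cr (x - q.1) (B (q.2 • x + (1 - q.2) • q.1)))
        (K.cu (fderiv ℝ φ x))) ∂(ν.prod (volume.restrict (Ioo (0 : ℝ) 1))) := by
    intro x
    rw [hb.radialGauge_eq_integral_prod, inner_neg_left, real_inner_comm,
      ← integral_inner (hb.integrable_integrand x)]
    congr 1
    refine integral_congr_ae (ae_of_all _ fun q => ?_)
    simp only [map_smul, inner_smul_right]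
    rw [real_inner_comm]
  simp_rw [hA]
  rw [integral_neg, integral_integral_swap hT, integral_prod _ hT.integral_prod_right]
  simp only [integral_const_mul]
  have hP := fun z => K.integral_integral_inner_cr_cu hn hp hB hdiv φ z
  simp only [integral_const_mul] at hP
  simp_rw [hP]
  rw [integral_mul_const, hh1]
  ring

end RadialBound

/-! ### The Griesinger gauge and the transversal gauge -/

namespace IsMollifier

variable {h : E n → ℝ}

lemma exists_le_weight (hh : IsMollifier h) :
    ∃ C : ℝ, 0 ≤ C ∧ ∀ z, ‖h z‖ * (1 + ‖z‖) ≤ C * weight z := by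
  obtain ⟨C, hC, h1⟩ := exists_schwartz_le_weight (hh.hasCompactSupport.toSchwartzMap hh.smooth) 1
  refine ⟨C, hC, fun z => ?_⟩
  have := h1 z
  rw [pow_one, mul_comm] at this
  exact this

lemma lintegral_ne_top (hh : IsMollifier h) :
    ∫⁻ z, ‖h z‖ₑ * ENNReal.ofReal (1 + ‖z‖) ≠ ⊤ := by
  obtain ⟨C, hC, h1⟩ := hh.exists_le_weight
  refine ne_top_of_le_ne_top (integrable_weight.const_mul C).lintegral_lt_top.ne
    (lintegral_mono fun z => ?_)
  rw [← ofReal_norm, ← ENNReal.ofReal_mul (norm_nonneg _)]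
  exact ENNReal.ofReal_le_ofReal (h1 z)

end IsMollifier

lemma radialBound_mollifier [CompleteSpace F] (K : CrossData n F) (hn : 2 ≤ n) {h : E n → ℝ}
    (hh : IsMollifier h) {B : E n → F} {μ : ℝ} (hμ : 0 ≤ μ) (hB : DecayField B μ) :
    RadialBound K volume h B μ where
  measurable_weight := hh.smooth.continuous.aestronglyMeasurable
  aestronglyMeasurable x := by
    refine hB.aestronglyMeasurable.comp_quasiMeasurePreserving
      (MeasureTheory.QuasiMeasurePreserving.prod_of_left (by fun_prop) ?_)
    refine (ae_restrict_iff' measurableSet_Ioo).2 (ae_of_all _ fun s hs => ?_)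
    exact quasiMeasurePreserving_add_smul (s • x) (by linarith [hs.2] : (0:ℝ) < 1 - s).ne'
  near := by
    obtain ⟨p, hp, hBp⟩ := hB.memLp
    have hn' : (2 : ℝ) ≤ n := by exact_mod_cast hn
    obtain ⟨C1, hC1, h1⟩ := hh.exists_le_weight
    obtain ⟨C2, hC2, h2⟩ := exists_lintegral_weight_mul_le (by linarith) hBp
    refine ⟨C1 * C2, n / p, by positivity, div_nonneg (by positivity) (by linarith),
      by rw [div_lt_one (by linarith)]; exact hp, fun x s hs => ?_⟩
    have hs1 : 0 < 1 - s := by linarith [hs.2]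
    calc radialAverage volume h B s x ≤ ∫⁻ z, ENNReal.ofReal C1 *
          (ENNReal.ofReal (weight z) * ‖B (s • x + (1 - s) • z)‖ₑ) := by
          refine lintegral_mono fun z => ?_
          rw [← mul_assoc, ← ENNReal.ofReal_mul hC1, ← ofReal_norm (h z),
            ← ENNReal.ofReal_mul (norm_nonneg _)]
          exact mul_le_mul' (ENNReal.ofReal_le_ofReal (h1 z)) le_rfl
      _ ≤ ENNReal.ofReal C1 * ENNReal.ofReal (C2 * (1 - s) ^ (-(n / p))) := by
          rw [lintegral_const_mul' _ _ ENNReal.ofReal_ne_top]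
          gcongr
          exact h2 _ _ hs1
      _ = _ := by rw [← ENNReal.ofReal_mul hC1, mul_assoc]
  far := by
    obtain ⟨C, R, hC, hR, hdec⟩ := hB.decay.exists_nonneg
    obtain ⟨S, hS⟩ := hh.hasCompactSupport.isCompact.isBounded.subset_closedBall 0
    have hL := hh.lintegral_ne_top
    set L := ∫⁻ z, ‖h z‖ₑ * ENNReal.ofReal (1 + ‖z‖)
    refine ⟨L.toReal * (C * 2 ^ μ), max 1 (max (2 * S) (2 * R)), by positivity, le_max_left _ _,
      fun x s hs hsx => ?_⟩
    have hs1 : 0 < 1 - s := by linarith [hs.2]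
    have hs0 := hs.1
    have hsx1 : 1 ≤ s * ‖x‖ := (le_max_left _ _).trans hsx
    have hsx2 : 2 * S ≤ s * ‖x‖ := ((le_max_left _ _).trans (le_max_right _ _)).trans hsx
    have hsx3 : 2 * R ≤ s * ‖x‖ := ((le_max_right _ _).trans (le_max_right _ _)).trans hsx
    have hae := (quasiMeasurePreserving_add_smul (s • x) hs1.ne').ae hdec
    calc radialAverage volume h B s x ≤ ∫⁻ z, (‖h z‖ₑ * ENNReal.ofReal (1 + ‖z‖)) *
          ENNReal.ofReal (C * 2 ^ μ * (s * ‖x‖) ^ (-μ)) := by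
          refine lintegral_mono_ae (hae.mono fun z hz => ?_)
          by_cases hz0 : h z = 0
          · simp [hz0]
          have hzS : ‖z‖ ≤ S := by simpa using hS (subset_tsupport h hz0)
          have h1 : s * ‖x‖ / 2 ≤ ‖s • x + (1 - s) • z‖ := by
            have h2 := norm_sub_le_norm_add (s • x) ((1 - s) • z)
            rw [norm_smul, norm_smul, Real.norm_of_nonneg hs0.le, Real.norm_of_nonneg hs1.le] at h2
            have h3 : (1 - s) * ‖z‖ ≤ 1 * S :=
              mul_le_mul (by linarith) hzS (norm_nonneg _) zero_le_one
            linarith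
          refine mul_le_mul' le_rfl ?_
          rw [← ofReal_norm]
          refine ENNReal.ofReal_le_ofReal ((hz (by linarith)).trans ?_)
          rw [mul_assoc]
          gcongr
          calc _ ≤ (s * ‖x‖ / 2) ^ (-μ) :=
                Real.rpow_le_rpow_of_nonpos (by positivity) h1 (by linarith)
            _ = _ := by
              rw [div_eq_inv_mul, Real.mul_rpow (by norm_num) (by positivity),
                Real.inv_rpow (by norm_num), Real.rpow_neg (by norm_num), inv_inv]
      _ = ENNReal.ofReal L.toReal * ENNReal.ofReal (C * 2 ^ μ * (s * ‖x‖) ^ (-μ)) := by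
          rw [lintegral_mul_const' _ _ ENNReal.ofReal_ne_top, ENNReal.ofReal_toReal hL]
      _ = _ := by rw [← ENNReal.ofReal_mul ENNReal.toReal_nonneg]; congr 1; ring
  continuous s hs := by
    have hs1 : 0 < 1 - s := by linarith [hs.2]
    obtain ⟨S, hS⟩ := hh.hasCompactSupport.isCompact.isBounded.subset_closedBall 0
    have hk : ContDiff ℝ ((0 : ℕ∞) : WithTop ℕ∞) (fun q : E n × E n =>
        h ((1 - s)⁻¹ • (q.2 - s • q.1)) • K.cr (q.1 - (1 - s)⁻¹ • (q.2 - s • q.1))) := by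
      have := hh.smooth.continuous
      exact contDiff_zero.2 (by fun_prop)
    have hc := contDiff_integral_clm (hB.locallyIntegrable (by omega)) (k := fun x y =>
      h ((1 - s)⁻¹ • (y - s • x)) • K.cr (x - (1 - s)⁻¹ • (y - s • x))) hk (fun R => by
        refine ⟨(1 - s) * S + s * R, fun x y hx hy => ?_⟩
        suffices h ((1 - s)⁻¹ • (y - s • x)) = 0 by simp [this]
        by_contra hcon
        have h1 : ‖(1 - s)⁻¹ • (y - s • x)‖ ≤ S := by simpa using hS (subset_tsupport h hcon)
        rw [norm_smul, Real.norm_of_nonneg (by positivity), inv_mul_le_iff₀ hs1] at h1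
        have h2 := norm_sub_norm_le y (s • x)
        rw [norm_smul, Real.norm_of_nonneg hs.1.le] at h2
        have h3 : s * ‖x‖ ≤ s * R := mul_le_mul_of_nonneg_left hx.le hs.1.le
        linarith)
    refine (hc.continuous.const_smul ((1 - s) ^ n)⁻¹).congr fun x => ?_
    simp only [Pi.smul_apply]
    rw [← integral_comp_add_smul _ (s • x) hs1]
    refine integral_congr_ae (ae_of_all _ fun z => ?_)
    simp only [add_sub_cancel_left, smul_smul, inv_mul_cancel₀ hs1.ne', one_smul, smul_apply]

lemma exists_norm_le_of_continuous {G : Type*} [NormedAddCommGroup G] {B : E n → G}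
    (hB : Continuous B) {μ : ℝ}
    (hdec : DecaysAE B μ) : ∃ C R : ℝ, 0 ≤ C ∧ 1 ≤ R ∧ ∀ x, R ≤ ‖x‖ → ‖B x‖ ≤ C * ‖x‖ ^ (-μ) := by
  obtain ⟨C, R, hC, hR, h⟩ := hdec.exists_nonneg
  refine ⟨C, R + 1, hC, by linarith, fun x hx => ?_⟩
  by_contra hcon
  push Not at hcon
  have hcont : ContinuousOn (fun x : E n => ‖B x‖ - C * ‖x‖ ^ (-μ)) {x | R < ‖x‖} := by
    refine hB.norm.continuousOn.sub (continuousOn_const.mul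
      (continuousOn_id.norm.rpow_const fun y hy => Or.inl ?_))
    have : R < ‖y‖ := hy
    simp only [id]
    linarith
  have hopen := hcont.isOpen_inter_preimage (isOpen_lt continuous_const continuous_norm)
    (isOpen_Ioi (a := (0 : ℝ)))
  have hpos := hopen.measure_pos volume ⟨x, by simp; linarith, by simp; linarith⟩
  refine hpos.ne' (measure_mono_null (fun y hy => ?_) h)
  have h1 : R < ‖y‖ := hy.1
  have h2 : 0 < ‖B y‖ - C * ‖y‖ ^ (-μ) := hy.2
  intro h3
  linarith [h3 h1.le]

lemma radialBound_dirac (K : CrossData n F) {B : E n → F} (hB : Continuous B) {μ : ℝ} (hμ : 0 ≤ μ)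
    (hdec : DecaysAE B μ) : RadialBound K (Measure.dirac 0) (fun _ => 1) B μ := by
  obtain ⟨C, R, hC, hR, h1⟩ := exists_norm_le_of_continuous hB hdec
  have havg : ∀ s x, radialAverage (Measure.dirac (0 : E n)) (fun _ => 1) B s x =
      ENNReal.ofReal ‖B (s • x)‖ := by
    intro s x
    simp [radialAverage]
  refine ⟨aestronglyMeasurable_const, fun x => ?_, ?_, ?_, fun s hs => ?_⟩
  · exact (by fun_prop : Continuous
      fun q : E n × ℝ => B (q.2 • x + (1 - q.2) • q.1)).aestronglyMeasurable
  · obtain ⟨M, hM⟩ := (isCompact_closedBall (0 : E n) R).exists_bound_of_continuousOn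
      hB.continuousOn
    refine ⟨max M C, 0, hC.trans (le_max_right _ _), le_rfl, one_pos, fun x s hs => ?_⟩
    rw [havg, neg_zero, Real.rpow_zero, mul_one]
    refine ENNReal.ofReal_le_ofReal ?_
    by_cases hR2 : ‖s • x‖ ≤ R
    · exact (hM _ (by simpa using hR2)).trans (le_max_left _ _)
    · push Not at hR2
      refine ((h1 _ hR2.le).trans (mul_le_of_le_one_right hC ?_)).trans (le_max_right _ _)
      exact Real.rpow_le_one_of_one_le_of_nonpos (by linarith) (by linarith)
  · refine ⟨C, R, hC, hR, fun x s hs hsx => ?_⟩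
    have h2 : ‖s • x‖ = s * ‖x‖ := by rw [norm_smul, Real.norm_of_nonneg hs.1.le]
    rw [havg]
    refine ENNReal.ofReal_le_ofReal ?_
    rw [← h2] at hsx ⊢
    exact h1 _ hsx
  · simp only [integral_dirac]
    fun_prop

namespace CrossData

variable (K : CrossData n F)

lemma radialGauge_dirac (B : E n → F) (x : E n) :
    K.radialGauge (Measure.dirac 0) (fun _ => 1) B x =
      -∫ s in (0 : ℝ)..1, K.cr x (s • B (s • x)) := by
  simp [radialGauge]

lemma isTransversal_radialGauge_dirac (B : E n → F) :
    IsTransversal (K.radialGauge (Measure.dirac 0) (fun _ => 1) B) := by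
  intro x
  rw [radialGauge_dirac, inner_neg_right, neg_eq_zero]
  by_cases hi : IntervalIntegrable (fun s : ℝ => K.cr x (s • B (s • x))) volume 0 1
  · have h := (innerSL ℝ x).intervalIntegral_comp_comm hi
    simp only [innerSL_apply_apply, K.inner_cr_self] at h
    rw [← h]; simp
  · rw [intervalIntegral.integral_undef hi, inner_zero_right]

end CrossData

end

section

/-! ### Integrals of derivatives against the Coulomb kernel -/

variable {n : ℕ}

/-- The area `ω` of the unit sphere. -/
def sphereArea (n : ℕ) : ℝ := n * volume.real (Metric.ball (0 : E n) 1)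

lemma sphereArea_pos (hn : 1 ≤ n) : 0 < sphereArea n := by
  have h0 : (0 : ℝ) < n := by exact_mod_cast hn
  exact mul_pos h0 (ENNReal.toReal_pos (Metric.measure_ball_pos _ _ one_pos).ne'
    measure_ball_lt_top.ne)

lemma nontrivial_of_one_le (hn : 1 ≤ n) : Nontrivial (E n) := by
  have : Nonempty (Fin n) := ⟨⟨0, by omega⟩⟩
  infer_instance

lemma integrable_kernel_mul_weight (hn : 1 ≤ n) :
    Integrable (fun w : E n => (‖w‖ ^ n)⁻¹ * (‖w‖ * weight w)) := by
  have := nontrivial_of_one_le hn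
  have h := (integrable_fun_norm_addHaar (volume : Measure (E n))
    (f := fun r => (r ^ n)⁻¹ * (r * (1 + r) ^ (-((n : ℝ) + 1))))).2 ?_
  · exact h
  have h1 : Integrable fun r : ℝ => (1 + ‖r‖) ^ (-((n : ℝ) + 1)) :=
    integrable_one_add_norm (by simp; omega)
  refine h1.integrableOn.congr_fun (fun r hr => ?_) measurableSet_Ioi
  have hr0 : 0 < r := hr
  simp only [finrank_euclideanSpace_fin, smul_eq_mul]
  rw [Real.norm_of_nonneg hr0.le]
  obtain ⟨k, rfl⟩ : ∃ k, n = k + 1 := ⟨n - 1, by omega⟩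
  simp only [add_tsub_cancel_right]
  field_simp
  rw [pow_succ']

lemma integrable_kernel_mul_fderiv (hn : 1 ≤ n) (ψ : 𝓢(E n, ℝ)) (J : E n →L[ℝ] E n) :
    Integrable (fun w : E n => (‖w‖ ^ n)⁻¹ * fderiv ℝ ψ w (J w)) := by
  obtain ⟨C, hC, h⟩ := exists_schwartz_le_weight (SchwartzMap.fderivCLM ℝ (E n) ℝ ψ) 0
  simp only [SchwartzMap.fderivCLM_apply, pow_zero, one_mul] at h
  have hψ' : Continuous (fderiv ℝ ψ) := (ψ.smooth ⊤).continuous_fderiv (by simp)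
  refine ((integrable_kernel_mul_weight hn).const_mul (C * ‖J‖)).mono' ?_ (ae_of_all _ fun w => ?_)
  · have h1 : Measurable fun w : E n => (‖w‖ ^ n)⁻¹ := by fun_prop
    have h2 : Continuous fun w : E n => fderiv ℝ ψ w (J w) := by fun_prop
    exact h1.aestronglyMeasurable.mul h2.aestronglyMeasurable
  · rw [norm_mul, norm_inv, norm_pow, norm_norm]
    calc _ ≤ (‖w‖ ^ n)⁻¹ * ((C * weight w) * (‖J‖ * ‖w‖)) := by
          gcongr
          refine ((fderiv ℝ ψ w).le_opNorm _).trans (mul_le_mul (h w) (J.le_opNorm w)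
            (norm_nonneg _) (mul_nonneg hC (weight_pos w).le))
      _ = _ := by ring

/-- The fundamental theorem of calculus on rays: the Coulomb kernel inverts the radial
derivative. -/
lemma integral_kernel_mul_fderiv_self (hn : 1 ≤ n) (ψ : 𝓢(E n, ℝ)) :
    ∫ w, (‖w‖ ^ n)⁻¹ * fderiv ℝ ψ w w = -(sphereArea n * ψ 0) := by
  have := nontrivial_of_one_le hn
  set μ : Measure (E n) := volume
  set f : E n → ℝ := fun w => (‖w‖ ^ n)⁻¹ * fderiv ℝ ψ w w
  have hf : Integrable f μ := integrable_kernel_mul_fderiv hn ψ (ContinuousLinearMap.id ℝ _)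
  set g : Metric.sphere (0 : E n) 1 × Ioi (0 : ℝ) → ℝ := fun q => f ((q.2 : ℝ) • (q.1 : E n))
  have hmp := μ.measurePreserving_homeomorphUnitSphereProd
  have hgf : (g ∘ homeomorphUnitSphereProd (E n)) = f ∘ Subtype.val := by
    funext w
    have h2 : (homeomorphUnitSphereProd (E n)).symm (homeomorphUnitSphereProd (E n) w) = w := by
      simp
    have h3 := congrArg Subtype.val h2
    rw [homeomorphUnitSphereProd_symm_apply_coe] at h3
    simp only [Function.comp_apply, g, h3]
  have hg : Integrable g (μ.toSphere.prod (Measure.volumeIoiPow (n - 1))) := by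
    have h1 := hmp.integrable_comp_emb (g := g) (Homeomorph.measurableEmbedding _)
    rw [finrank_euclideanSpace_fin] at h1
    rw [← h1, hgf, ← integrableOn_iff_comap_subtypeVal (measurableSet_singleton _).compl]
    exact hf.integrableOn
  have hint : ∫ w, f w ∂μ = ∫ q, g q ∂(μ.toSphere.prod (Measure.volumeIoiPow (n - 1))) := by
    have h1 := hmp.integral_comp (Homeomorph.measurableEmbedding _) g
    rw [finrank_euclideanSpace_fin] at h1
    rw [← h1]
    have h2 := integral_subtype_comap (μ := μ) (measurableSet_singleton (0 : E n)).compl f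
    rw [restrict_compl_singleton] at h2
    rw [← h2]
    exact integral_congr_ae (ae_of_all _ fun w => (congrFun hgf w).symm)
  have hray : ∀ θ : Metric.sphere (0 : E n) 1,
      ∫ r, g (θ, r) ∂(Measure.volumeIoiPow (n - 1)) = -ψ 0 := by
    intro θ
    have hθ : ‖(θ : E n)‖ = 1 := by simp
    have h1 : ∫ r, g (θ, r) ∂(Measure.volumeIoiPow (n - 1)) =
        ∫ r in Ioi (0 : ℝ), fderiv ℝ ψ (r • (θ : E n)) θ := by
      simp only [Measure.volumeIoiPow, ENNReal.ofReal]
      rw [integral_withDensity_eq_integral_smul (by fun_prop),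
        ← integral_subtype_comap measurableSet_Ioi
          (fun r : ℝ => fderiv ℝ ψ (r • (θ : E n)) (θ : E n))]
      refine integral_congr_ae (ae_of_all _ fun r => ?_)
      have hr : 0 < (r : ℝ) := r.2
      simp only [g, f, NNReal.smul_def, smul_eq_mul, Real.coe_toNNReal _ (pow_nonneg hr.le _),
        norm_smul, hθ, mul_one, Real.norm_of_nonneg hr.le, map_smul]
      obtain ⟨k, hk⟩ : ∃ k, n = k + 1 := ⟨n - 1, by omega⟩
      rw [show n - 1 = k by omega]
      generalize fderiv ℝ ψ ((r : ℝ) • (θ : E n)) (θ : E n) = X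
      rw [show (r : ℝ) ^ n = (r : ℝ) ^ (k + 1) by rw [hk]]
      field_simp
      ring
    rw [h1]
    obtain ⟨C, hC, hb⟩ := exists_schwartz_le_weight (SchwartzMap.fderivCLM ℝ (E n) ℝ ψ) 0
    simp only [SchwartzMap.fderivCLM_apply, pow_zero, one_mul] at hb
    have hψ' : Continuous (fderiv ℝ ψ) := (ψ.smooth ⊤).continuous_fderiv (by simp)
    have hw : ∀ r : ℝ, weight (r • (θ : E n)) = (1 + ‖r‖) ^ (-((n : ℝ) + 1)) := by
      intro r; rw [weight, norm_smul, hθ, mul_one]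
    have h4 : Integrable fun r : ℝ => (1 + ‖r‖) ^ (-((n : ℝ) + 1)) :=
      integrable_one_add_norm (by simp; omega)
    have h2 := integral_Ioi_of_hasDerivAt_of_tendsto' (a := 0)
      (f := fun r : ℝ => ψ (r • (θ : E n))) (f' := fun r => fderiv ℝ ψ (r • (θ : E n)) θ) (m := 0)
      (fun r _ => by
        have h3 : HasDerivAt (fun r : ℝ => r • (θ : E n)) (θ : E n) r := by
          simpa using (hasDerivAt_id r).smul_const (θ : E n)
        exact (ψ.hasFDerivAt _).comp_hasDerivAt r h3) ?_ ?_
    · rw [h2]; simp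
    · refine Integrable.integrableOn ((h4.const_mul C).mono'
        (by fun_prop : Continuous _).aestronglyMeasurable (ae_of_all _ fun r => ?_))
      refine ((fderiv ℝ ψ _).le_opNorm _).trans ?_
      rw [hθ, mul_one, ← hw]
      exact hb _
    · have h5 : Tendsto (fun r : ℝ => r • (θ : E n)) atTop (cobounded (E n)) := by
        rw [← tendsto_norm_atTop_iff_cobounded]
        refine tendsto_atTop_mono (fun r => ?_) tendsto_id
        rw [norm_smul, hθ, mul_one]; exact le_abs_self r
      rw [Metric.cobounded_eq_cocompact] at h5
      exact (zero_at_infty ψ).comp h5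
  rw [hint, integral_prod _ hg]
  simp_rw [hray]
  rw [integral_const, Measure.toSphere_real_apply_univ, finrank_euclideanSpace_fin, smul_eq_mul,
    sphereArea]
  ring

lemma regularized_le {w : E n} (hw : w ≠ 0) {ε : ℝ} (hε : 0 ≤ ε) :
    (‖w‖ ^ 2 + ε) ^ (-((n : ℝ) / 2)) ≤ (‖w‖ ^ n)⁻¹ := by
  have h0 : 0 < ‖w‖ := norm_pos_iff.2 hw
  calc _ ≤ (‖w‖ ^ 2) ^ (-((n : ℝ) / 2)) :=
        Real.rpow_le_rpow_of_nonpos (by positivity) (by linarith) (by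
          have : (0 : ℝ) ≤ n := n.cast_nonneg
          linarith)
    _ = _ := by
        rw [← Real.rpow_natCast, ← Real.rpow_mul h0.le, ← Real.rpow_natCast, ← Real.rpow_neg h0.le]
        congr 1; push_cast; ring

/-- The Coulomb kernel is orthogonal to derivatives along rotations. -/
lemma integral_kernel_mul_fderiv_skew (hn : 1 ≤ n) (ψ : 𝓢(E n, ℝ)) (J : E n →L[ℝ] E n)
    (hJ : ∀ v, inner ℝ v (J v) = 0) : ∫ w, (‖w‖ ^ n)⁻¹ * fderiv ℝ ψ w (J w) = 0 := by
  have := nontrivial_of_one_le hn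
  set χ : Fin n → 𝓢(E n, ℝ) := fun i => SchwartzMap.smulLeftCLM ℝ (fun w => J w i) ψ
  have hJi : ∀ i, Function.HasTemperateGrowth (fun w => J w i) := fun i =>
    ((EuclideanSpace.proj i).comp J : E n →L[ℝ] ℝ).hasTemperateGrowth
  have hχ : ∀ i w, χ i w = J w i * ψ w := fun i w => by
    simp only [χ, SchwartzMap.smulLeftCLM_apply_apply (hJi i), smul_eq_mul]
  have hJe : ∀ i, J (EuclideanSpace.single i 1) i = 0 := by
    intro i
    have := hJ (EuclideanSpace.single i 1)
    simpa [EuclideanSpace.inner_single_left] using this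
  have hdχ : ∀ w, ∑ i, fderiv ℝ (χ i) w (EuclideanSpace.single i 1) = fderiv ℝ ψ w (J w) := by
    intro w
    conv_rhs => rw [← CrossData.sum_smul_single (J w), map_sum]
    refine Finset.sum_congr rfl fun i _ => ?_
    have h1 := (((EuclideanSpace.proj i).comp J : E n →L[ℝ] ℝ).hasFDerivAt (x := w)).mul
      (ψ.hasFDerivAt w)
    have h2 := h1.congr_of_eventuallyEq (f₁ := χ i) (Eventually.of_forall fun w => by
      rw [hχ]; rfl)
    rw [h2.fderiv]
    simp [hJe]
  have key : ∀ ε : ℝ, 0 < ε →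
      ∫ w, (‖w‖ ^ 2 + ε) ^ (-((n : ℝ) / 2)) * fderiv ℝ ψ w (J w) = 0 := by
    intro ε hε
    set c : E n → ℝ := fun w => (‖w‖ ^ 2 + ε) ^ (-((n : ℝ) / 2))
    have hc : ∀ w, HasFDerivAt c ((-((n : ℝ) / 2) * (‖w‖ ^ 2 + ε) ^ (-((n : ℝ) / 2) - 1)) •
        (2 • innerSL ℝ w)) w := by
      intro w
      have h1 : HasFDerivAt (fun w : E n => ‖w‖ ^ 2 + ε) (2 • innerSL ℝ w) w :=
        (hasStrictFDerivAt_norm_sq w).hasFDerivAt.add_const ε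
      exact h1.rpow_const (Or.inl (by positivity))
    have hcd : Differentiable ℝ c := fun w => (hc w).differentiableAt
    have hcb : ∀ w, ‖c w‖ ≤ ε ^ (-((n : ℝ) / 2)) := by
      intro w
      have hn0 : (0 : ℝ) ≤ n := n.cast_nonneg
      rw [Real.norm_of_nonneg (by positivity)]
      exact Real.rpow_le_rpow_of_nonpos hε (by nlinarith [norm_nonneg w]) (by linarith)
    have i1 : ∀ i, Integrable fun w => c w * fderiv ℝ (χ i) w (EuclideanSpace.single i 1) := by
      intro i
      have h2 : Integrable fun w => fderiv ℝ (χ i) w (EuclideanSpace.single i 1) :=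
        (SchwartzMap.fderivCLM ℝ (E n) ℝ (χ i)).integrable.apply_continuousLinearMap _
      exact h2.bdd_mul hcd.continuous.aestronglyMeasurable (ae_of_all _ hcb)
    have hfc : ∀ w v, fderiv ℝ c w v =
        -(n : ℝ) * (‖w‖ ^ 2 + ε) ^ (-((n : ℝ) / 2) - 1) * inner ℝ w v := by
      intro w v
      rw [(hc w).fderiv]
      simp only [smul_apply, innerSL_apply_apply, smul_eq_mul, nsmul_eq_mul]
      push_cast; ring
    have i2 : ∀ i, Integrable fun w => fderiv ℝ c w (EuclideanSpace.single i 1) * χ i w := by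
      intro i
      obtain ⟨C, hC, hb⟩ := exists_schwartz_le_weight (χ i) 1
      simp only [pow_one] at hb
      have hcc : Continuous fun w => fderiv ℝ c w (EuclideanSpace.single i 1) := by
        simp_rw [hfc]
        refine Continuous.mul (continuous_const.mul (Continuous.rpow_const (by fun_prop)
          fun w => Or.inl ?_)) (by fun_prop)
        have := norm_nonneg w
        positivity
      refine (integrable_weight.const_mul (n * ε ^ (-((n : ℝ) / 2) - 1) * C)).mono'
        (hcc.mul (χ i).continuous).aestronglyMeasurable (ae_of_all _ fun w => ?_)
      rw [hfc, norm_mul, norm_mul, norm_mul, norm_neg, Real.norm_of_nonneg (n.cast_nonneg),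
        Real.norm_of_nonneg (by positivity : 0 ≤ (‖w‖ ^ 2 + ε) ^ (-((n : ℝ) / 2) - 1))]
      have hn0 : (0 : ℝ) ≤ n := n.cast_nonneg
      have h3 : (‖w‖ ^ 2 + ε) ^ (-((n : ℝ) / 2) - 1) ≤ ε ^ (-((n : ℝ) / 2) - 1) :=
        Real.rpow_le_rpow_of_nonpos hε (by nlinarith [norm_nonneg w]) (by linarith)
      have h4 : ‖inner ℝ w (EuclideanSpace.single i (1 : ℝ))‖ ≤ 1 + ‖w‖ := by
        refine (norm_inner_le_norm _ _).trans ?_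
        simp
      calc _ ≤ n * ε ^ (-((n : ℝ) / 2) - 1) * (1 + ‖w‖) * ‖χ i w‖ := by gcongr
        _ = n * ε ^ (-((n : ℝ) / 2) - 1) * ((1 + ‖w‖) * ‖χ i w‖) := by ring
        _ ≤ n * ε ^ (-((n : ℝ) / 2) - 1) * (C * weight w) := by 
            exact mul_le_mul_of_nonneg_left (hb w) (by positivity)
        _ = _ := by ring
    have i3 : ∀ i, Integrable fun w => c w * χ i w := fun i =>
      (χ i).integrable.bdd_mul hcd.continuous.aestronglyMeasurable (ae_of_all _ hcb)
    have hibp := fun i => integral_mul_fderiv_eq_neg_fderiv_mul_of_integrable (i2 i) (i1 i) (i3 i)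
      (fun w _ => hcd w) (fun w _ => (χ i).differentiableAt)
    calc _ = ∫ w, ∑ i, c w * fderiv ℝ (χ i) w (EuclideanSpace.single i 1) := by
          simp_rw [← Finset.mul_sum, hdχ]; rfl
      _ = -∫ w, ∑ i, fderiv ℝ c w (EuclideanSpace.single i 1) * χ i w := by
          rw [integral_finsetSum _ fun i _ => i1 i, integral_finsetSum _ fun i _ => i2 i,
            ← Finset.sum_neg_distrib]
          exact Finset.sum_congr rfl fun i _ => hibp i
      _ = 0 := by
          rw [neg_eq_zero]
          refine integral_eq_zero_of_ae (ae_of_all _ fun w => ?_)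
          have h5 : ∑ i, fderiv ℝ c w (EuclideanSpace.single i 1) * χ i w =
              fderiv ℝ c w (J w) * ψ w := by
            conv_rhs => rw [← CrossData.sum_smul_single (J w), map_sum, Finset.sum_mul]
            refine Finset.sum_congr rfl fun i _ => ?_
            rw [hχ, map_smul, smul_eq_mul]; ring
          simp only [Pi.zero_apply]
          rw [h5, hfc, hJ]; ring
  have hlim : Tendsto (fun ε : ℝ => ∫ w : E n,
      (‖w‖ ^ 2 + ε) ^ (-((n : ℝ) / 2)) * fderiv ℝ ψ w (J w)) (𝓝[>] 0)
      (𝓝 (∫ w, (‖w‖ ^ n)⁻¹ * fderiv ℝ ψ w (J w))) := by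
    have hψ' : Continuous (fderiv ℝ ψ) := (ψ.smooth ⊤).continuous_fderiv (by simp)
    refine tendsto_integral_filter_of_dominated_convergence
      (fun w => ‖(‖w‖ ^ n)⁻¹ * fderiv ℝ ψ w (J w)‖) ?_ ?_
      (integrable_kernel_mul_fderiv hn ψ J).norm ?_
    · refine Eventually.of_forall fun ε => ?_
      have h1 : Measurable fun w : E n => (‖w‖ ^ 2 + ε) ^ (-((n : ℝ) / 2)) := by fun_prop
      have h2 : Continuous fun w : E n => fderiv ℝ ψ w (J w) := by fun_prop
      exact h1.aestronglyMeasurable.mul h2.aestronglyMeasurable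
    · filter_upwards [self_mem_nhdsWithin] with ε hε
      have hε0 : 0 < ε := hε
      filter_upwards [Measure.ae_ne volume (0 : E n)] with w hw
      rw [norm_mul, norm_mul]
      gcongr
      rw [Real.norm_of_nonneg (by positivity), Real.norm_of_nonneg (by positivity)]
      exact regularized_le hw hε0.le
    · filter_upwards [Measure.ae_ne volume (0 : E n)] with w hw
      have h0 : 0 < ‖w‖ := norm_pos_iff.2 hw
      refine Tendsto.mul_const _ ?_
      have h1 : Tendsto (fun ε : ℝ => (‖w‖ ^ 2 + ε) ^ (-((n : ℝ) / 2))) (𝓝 0)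
          (𝓝 ((‖w‖ ^ 2 + 0) ^ (-((n : ℝ) / 2)))) := by
        refine ContinuousAt.tendsto (f := fun ε : ℝ => (‖w‖ ^ 2 + ε) ^ (-((n : ℝ) / 2)))
          (ContinuousAt.rpow_const (by fun_prop) (Or.inl (by positivity)))
      have h2 : (‖w‖ ^ 2 + 0) ^ (-((n : ℝ) / 2)) = (‖w‖ ^ n)⁻¹ := by
        rw [add_zero, ← Real.rpow_natCast, ← Real.rpow_mul h0.le, ← Real.rpow_natCast,
          ← Real.rpow_neg h0.le]
        congr 1; push_cast; ring
      rw [h2] at h1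
      exact h1.mono_left nhdsWithin_le_nhds
  refine tendsto_nhds_unique hlim ?_
  refine tendsto_const_nhds.congr' ?_
  filter_upwards [self_mem_nhdsWithin] with ε hε
  exact (key ε hε).symm

end

section

/-! ### Coulomb potentials with a truncated kernel -/

variable {n : ℕ} {F : Type*} [NormedAddCommGroup F] [InnerProductSpace ℝ F]

/-- A factor `T y w` by which the Coulomb kernel at the displacement `w` from the source `y` is
multiplied. It is `1` for `w = 0` and radial in `w`, so that the curl is only changed by the
derivatives of `T`, and the divergence still vanishes. -/
structure Truncation (T : E n → E n → ℝ) : Prop where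
  contDiff : ContDiff ℝ ∞ fun q : E n × E n => T q.1 q.2
  growth_fst : ∀ w, Function.HasTemperateGrowth fun y => T y w
  growth_snd : ∀ y, Function.HasTemperateGrowth (T y)
  norm_le : ∀ y w, ‖T y w‖ ≤ 1
  apply_zero : ∀ y, T y 0 = 1
  radial : ∀ y w v, inner ℝ w v = 0 → fderiv ℝ (T y) w v = 0
  deriv_fst : ∃ C : ℝ, 0 ≤ C ∧ ∀ y w, ‖fderiv ℝ (fun y => T y w) y‖ ≤ C
  deriv_snd : ∃ C : ℝ, 0 ≤ C ∧ ∀ y w, ‖fderiv ℝ (T y) w w‖ ≤ C * ‖w‖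

namespace Truncation

variable {T : E n → E n → ℝ}

lemma fderiv_fst (hT : Truncation T) (y w : E n) : fderiv ℝ (fun y => T y w) y =
    (fderiv ℝ (fun q : E n × E n => T q.1 q.2) (y, w)).comp (ContinuousLinearMap.inl ℝ _ _) := by
  have h1 := (hT.contDiff.differentiable (by simp) (y, w)).hasFDerivAt
  exact (HasFDerivAt.comp (f := fun e => (e, w)) y h1 (hasFDerivAt_prodMk_left y w)).fderiv

lemma fderiv_snd (hT : Truncation T) (y w : E n) : fderiv ℝ (T y) w =
    (fderiv ℝ (fun q : E n × E n => T q.1 q.2) (y, w)).comp (ContinuousLinearMap.inr ℝ _ _) := by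
  have h1 := (hT.contDiff.differentiable (by simp) (y, w)).hasFDerivAt
  exact (HasFDerivAt.comp (f := fun e => (y, e)) w h1 (hasFDerivAt_prodMk_right y w)).fderiv

lemma continuous_fderiv_fst (hT : Truncation T) :
    Continuous fun q : E n × E n => fderiv ℝ (fun y => T y q.2) q.1 := by
  have h : Continuous (fderiv ℝ fun q : E n × E n => T q.1 q.2) :=
    hT.contDiff.continuous_fderiv (by simp)
  simp_rw [hT.fderiv_fst]
  fun_prop

lemma continuous_fderiv_snd (hT : Truncation T) :
    Continuous fun q : E n × E n => fderiv ℝ (T q.1) q.2 := by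
  have h : Continuous (fderiv ℝ fun q : E n × E n => T q.1 q.2) :=
    hT.contDiff.continuous_fderiv (by simp)
  simp_rw [hT.fderiv_snd]
  fun_prop

end Truncation

lemma truncation_one : Truncation (fun _ _ : E n => 1) where
  contDiff := contDiff_const
  growth_fst _ := Function.HasTemperateGrowth.const 1
  growth_snd _ := Function.HasTemperateGrowth.const 1
  norm_le _ _ := by simp
  apply_zero _ := rfl
  radial _ _ _ _ := by simp
  deriv_fst := ⟨0, le_rfl, fun _ _ => by simp⟩
  deriv_snd := ⟨0, le_rfl, fun _ _ => by simp⟩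

namespace CrossData

variable (K : CrossData n F)

/-- The vector potential in the Coulomb gauge, with the kernel multiplied by `T`. -/
def potential (T : E n → E n → ℝ) (B : E n → F) (x : E n) : E n :=
  -((1 / sphereArea n) • ∫ y, (T y (x - y) * (‖x - y‖ ^ n)⁻¹) • K.cr (x - y) (B y))

/-- The part of the field which is not accounted for by `potential`. -/
def remainder (T : E n → E n → ℝ) (B : E n → F) (x : E n) : F :=
  (1 / sphereArea n) • ∫ y, (‖x - y‖ ^ n)⁻¹ • (fderiv ℝ (fun z => T z (x - y)) y (K.Q (B y)) •
    K.P (x - y) - fderiv ℝ (T y) (x - y) (x - y) • B y)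

end CrossData

lemma kernel_le_rpow (w : E n) :
    (‖w‖ ^ n)⁻¹ * ‖w‖ ≤ ‖w‖ ^ (-((n : ℝ) - 1)) := by
  rcases eq_or_ne w 0 with rfl | hw
  · rw [norm_zero, mul_zero]; positivity
  · have h0 : 0 < ‖w‖ := norm_pos_iff.2 hw
    rw [← Real.rpow_natCast, ← Real.rpow_neg h0.le, show -((n : ℝ) - 1) = -n + 1 by ring,
      Real.rpow_add h0, Real.rpow_one]

/-- The pairing of a Riesz potential with a rapidly decreasing function converges absolutely. -/
lemma DecayField.integrable_prod_of_le {H : Type*} [NormedAddCommGroup H] {B : E n → H} {μ : ℝ}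
    (hn : 2 ≤ n) (hB : DecayField B μ)
    (hμ : 1 < μ) {G : Type*} [NormedAddCommGroup G] {f : E n × E n → G}
    (hf : AEStronglyMeasurable f ((volume : Measure (E n)).prod volume)) {C : ℝ}
    (hle : ∀ q, ‖f q‖ ≤ C * (((‖q.2‖ ^ n)⁻¹ * ‖q.2‖) * (‖B q.1‖ * weight (q.1 + q.2)))) :
    Integrable f ((volume : Measure (E n)).prod volume) := by
  refine ⟨hf, ?_⟩
  obtain ⟨C', hC', hR⟩ := hB.exists_riesz_le hn hμ
  rw [HasFiniteIntegral, lintegral_prod _ hf.enorm]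
  set g : E n → E n → ℝ≥0∞ := fun y x => ENNReal.ofReal (‖x - y‖ ^ (-((n : ℝ) - 1))) * ‖B y‖ₑ *
    ENNReal.ofReal (weight x)
  have hgm : AEMeasurable (Function.uncurry g) ((volume : Measure (E n)).prod volume) := by
    have h1 : Measurable fun q : E n × E n =>
      ENNReal.ofReal (‖q.2 - q.1‖ ^ (-((n : ℝ) - 1))) := by fun_prop
    have h2 : Measurable fun q : E n × E n => ENNReal.ofReal (weight q.2) :=
      (continuous_weight.measurable.comp measurable_snd).ennreal_ofReal
    exact (h1.aemeasurable.mul hB.aestronglyMeasurable.comp_fst.enorm).mul h2.aemeasurable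
  calc _ ≤ ∫⁻ y, ∫⁻ x, ENNReal.ofReal |C| * g y x := by
        refine lintegral_mono fun y => ?_
        rw [← lintegral_add_left_eq_self (fun x => ENNReal.ofReal |C| * g y x) y]
        refine lintegral_mono fun w => ?_
        simp only [g, add_sub_cancel_left]
        have hw := (weight_pos (y + w)).le
        rw [← ofReal_norm, ← ofReal_norm, ← ENNReal.ofReal_mul (by positivity),
          ← ENNReal.ofReal_mul (by positivity), ← ENNReal.ofReal_mul (by positivity)]
        refine ENNReal.ofReal_le_ofReal ((hle (y, w)).trans ?_)
        calc _ ≤ |C| * (‖w‖ ^ (-((n : ℝ) - 1)) * (‖B y‖ * weight (y + w))) := by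
              gcongr
              · exact le_abs_self C
              · exact kernel_le_rpow w
          _ = _ := by ring
    _ = ENNReal.ofReal |C| * ∫⁻ x, ∫⁻ y, g y x := by
        simp_rw [lintegral_const_mul' _ _ ENNReal.ofReal_ne_top]
        rw [lintegral_lintegral_swap hgm]
    _ ≤ ENNReal.ofReal |C| * ∫⁻ x : E n, ENNReal.ofReal C' * ENNReal.ofReal (weight x) := by
        gcongr with x
        simp only [g]
        rw [lintegral_mul_const' _ _ ENNReal.ofReal_ne_top]
        exact mul_le_mul' (hR x) le_rfl
    _ < ⊤ := by
        rw [lintegral_const_mul' _ _ ENNReal.ofReal_ne_top]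
        exact ENNReal.mul_lt_top ENNReal.ofReal_lt_top
          (ENNReal.mul_lt_top ENNReal.ofReal_lt_top integrable_weight.lintegral_lt_top)

lemma integral_integral_sub {G : Type*} [NormedAddCommGroup G] [NormedSpace ℝ G]
    {f : E n × E n → G} (hf : Integrable f ((volume : Measure (E n)).prod volume)) :
    ∫ x, ∫ y, f (y, x - y) = ∫ q, f q ∂((volume : Measure (E n)).prod volume) := by
  have hmp := measurePreserving_prod_neg_add_swap (volume : Measure (E n)) volume
  simp only [neg_add_eq_sub] at hmp
  have hi := hmp.integrable_comp_of_integrable hf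
  have h1 := integral_prod _ hi
  simp only [Function.comp_apply] at h1
  rw [← h1]
  conv_rhs => rw [← hmp.map_eq]
  rw [integral_map hmp.aemeasurable (by rw [hmp.map_eq]; exact hf.1)]

/-- The Schwartz function `g y ⟪b, φ (z + y)⟫`. -/
lemma exists_schwartz_mul_inner (φ : 𝓢(E n, F)) (z : E n) (b : F) {g : E n → ℝ}
    (hg : Function.HasTemperateGrowth g) :
    ∃ ψ : 𝓢(E n, ℝ), (∀ y, ψ y = g y * inner ℝ b (φ (z + y))) ∧
      ∀ y v, fderiv ℝ ψ y v = fderiv ℝ g y v * inner ℝ b (φ (z + y)) +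
        g y * inner ℝ b (fderiv ℝ φ (z + y) v) := by
  have h0 : ∀ y, SchwartzMap.smulLeftCLM ℝ g ((SchwartzMap.compSubConstCLM ℝ (-z) φ).postcompCLM
      (innerSL ℝ b)) y = g y * inner ℝ b (φ (z + y)) := fun y => by
    simp [SchwartzMap.smulLeftCLM_apply_apply hg, add_comm]
  refine ⟨_, h0, fun y v => ?_⟩
  have h1 : HasFDerivAt (fun y => φ (z + y)) (fderiv ℝ φ (z + y)) y := by
    have h2 := (φ.hasFDerivAt (z + y)).comp y ((hasFDerivAt_id y).const_add z)
    exact h2.congr_fderiv (by ext; simp)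
  have h2 := ((innerSL ℝ b).hasFDerivAt (x := φ (z + y))).comp y h1
  have h3 := ((hg.1.differentiable (by simp) y).hasFDerivAt).mul h2
  rw [(h3.congr_of_eventuallyEq (Eventually.of_forall h0)).fderiv]
  simp [mul_comm, add_comm]

namespace CrossData

variable (K : CrossData n F) {T : E n → E n → ℝ} {B : E n → F} {μ : ℝ}

lemma norm_kernel_le (hT : Truncation T) (x y : E n) :
    ‖(T y (x - y) * (‖x - y‖ ^ n)⁻¹) • K.cr (x - y) (B y)‖ ≤
      ‖x - y‖ ^ (-((n : ℝ) - 1)) * ‖B y‖ := by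
  rw [norm_smul, norm_mul, norm_inv, norm_pow, norm_norm]
  calc _ ≤ 1 * (‖x - y‖ ^ n)⁻¹ * (‖x - y‖ * ‖B y‖) := by
        gcongr
        · exact hT.norm_le _ _
        · exact K.norm_cr_le _ _
    _ = ((‖x - y‖ ^ n)⁻¹ * ‖x - y‖) * ‖B y‖ := by ring
    _ ≤ _ := by gcongr; exact kernel_le_rpow _

lemma enorm_kernel_le (hT : Truncation T) (x y : E n) :
    ‖(T y (x - y) * (‖x - y‖ ^ n)⁻¹) • K.cr (x - y) (B y)‖ₑ ≤
      ENNReal.ofReal (‖x - y‖ ^ (-((n : ℝ) - 1))) * ‖B y‖ₑ := by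
  rw [← ofReal_norm, ← ofReal_norm, ← ENNReal.ofReal_mul (by positivity)]
  exact ENNReal.ofReal_le_ofReal (K.norm_kernel_le hT x y)

lemma aestronglyMeasurable_kernel (hT : Truncation T) (hB : AEStronglyMeasurable B) (x : E n) :
    AEStronglyMeasurable fun y => (T y (x - y) * (‖x - y‖ ^ n)⁻¹) • K.cr (x - y) (B y) := by
  have h1 : Continuous fun y => T y (x - y) :=
    hT.contDiff.continuous.comp (by fun_prop : Continuous fun y => (y, x - y))
  have h2 : Measurable fun y : E n => (‖x - y‖ ^ n)⁻¹ := by fun_prop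
  have h3 : Continuous fun y : E n => K.cr (x - y) := by fun_prop
  exact (h1.aestronglyMeasurable.mul h2.aestronglyMeasurable).smul
    (aestronglyMeasurable_clm_apply h3.aestronglyMeasurable hB)

lemma integrable_kernel (hn : 2 ≤ n) (hT : Truncation T) (hB : DecayField B μ) (hμ : 1 < μ)
    (x : E n) :
    Integrable fun y => (T y (x - y) * (‖x - y‖ ^ n)⁻¹) • K.cr (x - y) (B y) := by
  obtain ⟨C, hC, h⟩ := hB.exists_riesz_le hn hμ
  refine ⟨K.aestronglyMeasurable_kernel hT hB.aestronglyMeasurable x, ?_⟩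
  exact (lintegral_mono fun y => K.enorm_kernel_le hT x y).trans_lt
    ((h x).trans_lt ENNReal.ofReal_lt_top)

lemma enorm_potential_le (hn : 2 ≤ n) (hT : Truncation T) (x : E n) :
    ‖K.potential T B x‖ₑ ≤ ENNReal.ofReal (1 / sphereArea n) * riesz B x := by
  have hω := sphereArea_pos (n := n) (by omega)
  rw [potential, enorm_neg, enorm_smul, ← ofReal_norm, Real.norm_of_nonneg (by positivity)]
  gcongr
  exact (enorm_integral_le_lintegral_enorm _).trans
    (lintegral_mono fun y => K.enorm_kernel_le hT x y)

lemma integrable_remainder_kernel (hn : 2 ≤ n) (hT : Truncation T) (hB : DecayField B μ)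
    (hμ : 1 < μ) (x : E n) :
    Integrable fun y => (‖x - y‖ ^ n)⁻¹ • (fderiv ℝ (fun z => T z (x - y)) y (K.Q (B y)) •
      K.P (x - y) - fderiv ℝ (T y) (x - y) (x - y) • B y) := by
  obtain ⟨C, hC, h⟩ := hB.exists_riesz_le hn hμ
  obtain ⟨C3, hC3, hT3⟩ := hT.deriv_fst
  obtain ⟨C4, hC4, hT4⟩ := hT.deriv_snd
  have hBm := hB.aestronglyMeasurable
  have h1 : Continuous fun y => fderiv ℝ (fun z => T z (x - y)) y :=
    hT.continuous_fderiv_fst.comp (by fun_prop : Continuous fun y => (y, x - y))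
  have h2 : Continuous fun y => fderiv ℝ (T y) (x - y) (x - y) :=
    (hT.continuous_fderiv_snd.comp (by fun_prop : Continuous fun y => (y, x - y))).clm_apply
      (by fun_prop)
  have h3 : Measurable fun y : E n => (‖x - y‖ ^ n)⁻¹ := by fun_prop
  have h4 : Continuous fun y : E n => K.P (x - y) := by fun_prop
  refine ⟨h3.aestronglyMeasurable.smul (((aestronglyMeasurable_clm_apply h1.aestronglyMeasurable
    (K.Q.continuous.comp_aestronglyMeasurable hBm)).smul h4.aestronglyMeasurable).sub
      (h2.aestronglyMeasurable.smul hBm)), ?_⟩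
  calc _ ≤ ∫⁻ y, ENNReal.ofReal (C3 * ‖K.Q‖ * ‖K.P‖ + C4) *
        (ENNReal.ofReal (‖x - y‖ ^ (-((n : ℝ) - 1))) * ‖B y‖ₑ) := by
        refine lintegral_mono fun y => ?_
        rw [← ofReal_norm, ← ofReal_norm, ← ENNReal.ofReal_mul (by positivity),
          ← ENNReal.ofReal_mul (by positivity)]
        refine ENNReal.ofReal_le_ofReal ?_
        rw [norm_smul, norm_inv, norm_pow, norm_norm]
        calc _ ≤ (‖x - y‖ ^ n)⁻¹ * ((C3 * (‖K.Q‖ * ‖B y‖)) * (‖K.P‖ * ‖x - y‖) +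
              (C4 * ‖x - y‖) * ‖B y‖) := by
              gcongr
              refine (norm_sub_le _ _).trans ?_
              rw [norm_smul, norm_smul]
              gcongr
              · exact (ContinuousLinearMap.le_opNorm _ _).trans
                  (mul_le_mul (hT3 _ _) (K.Q.le_opNorm _) (norm_nonneg _) hC3)
              · exact K.P.le_opNorm _
              · exact hT4 _ _
          _ = (C3 * ‖K.Q‖ * ‖K.P‖ + C4) * (((‖x - y‖ ^ n)⁻¹ * ‖x - y‖) * ‖B y‖) := by ring
          _ ≤ _ := by gcongr; exact kernel_le_rpow _
    _ < ⊤ := by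
        rw [lintegral_const_mul' _ _ ENNReal.ofReal_ne_top]
        exact ENNReal.mul_lt_top ENNReal.ofReal_lt_top ((h x).trans_lt ENNReal.ofReal_lt_top)

/-- Integration by parts in the Coulomb potential: in the first term of Lagrange's identity the
integration is over the displacement `w` for a fixed source `y`, and in the second term it is over
the source for a fixed displacement. -/
lemma integral_inner_potential_cu [CompleteSpace F] (hn : 2 ≤ n) (hT : Truncation T)
    (hB : DecayField B μ)
    (hμ : 1 < μ) (hdiv : K.IsDivFree B) (φ : 𝓢(E n, F)) :
    (∫ x, inner ℝ (K.potential T B x) (K.cu (fderiv ℝ φ x)) =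
      (∫ x, inner ℝ (B x) (φ x)) - ∫ x, inner ℝ (K.remainder T B x) (φ x)) := by
  have hω := sphereArea_pos (n := n) (by omega)
  have hφ' : Continuous (fderiv ℝ φ) := (φ.smooth ⊤).continuous_fderiv (by simp)
  have hφ := φ.continuous
  obtain ⟨C0, hC0, hb0⟩ := exists_schwartz_le_weight φ 0
  obtain ⟨C1, hC1, hb1⟩ := exists_schwartz_le_weight (SchwartzMap.fderivCLM ℝ (E n) F φ) 0
  simp only [SchwartzMap.fderivCLM_apply, pow_zero, one_mul] at hb0 hb1
  obtain ⟨C3, hC3, hT3⟩ := hT.deriv_fst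
  obtain ⟨C4, hC4, hT4⟩ := hT.deriv_snd
  have hT1 := hT.continuous_fderiv_fst
  have hT2 := hT.continuous_fderiv_snd
  have hB1 : AEStronglyMeasurable (fun q : E n × E n => B q.1)
    ((volume : Measure (E n)).prod volume) := hB.aestronglyMeasurable.comp_fst
  have hQ1 : AEStronglyMeasurable (fun q : E n × E n => K.Q (B q.1))
    ((volume : Measure (E n)).prod volume) := K.Q.continuous.comp_aestronglyMeasurable hB1
  have hm : AEStronglyMeasurable (fun q : E n × E n => (‖q.2‖ ^ n)⁻¹)
    ((volume : Measure (E n)).prod volume) :=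
    (by fun_prop : Measurable fun q : E n × E n => (‖q.2‖ ^ n)⁻¹).aestronglyMeasurable
  have hTm : AEStronglyMeasurable (fun q : E n × E n => T q.1 q.2)
    ((volume : Measure (E n)).prod volume) := hT.contDiff.continuous.aestronglyMeasurable
  have hPm : AEStronglyMeasurable (fun q : E n × E n => K.P q.2)
    ((volume : Measure (E n)).prod volume) :=
    (by fun_prop : Continuous fun q : E n × E n => K.P q.2).aestronglyMeasurable
  have hDm : AEStronglyMeasurable (fun q : E n × E n => fderiv ℝ φ (q.1 + q.2))
    ((volume : Measure (E n)).prod volume) :=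
    (by fun_prop : Continuous fun q : E n × E n => fderiv ℝ φ (q.1 + q.2)).aestronglyMeasurable
  have hφm : AEStronglyMeasurable (fun q : E n × E n => φ (q.1 + q.2))
    ((volume : Measure (E n)).prod volume) :=
    (by fun_prop : Continuous fun q : E n × E n => φ (q.1 + q.2)).aestronglyMeasurable
  set a₁ : E n × E n → ℝ := fun q => (‖q.2‖ ^ n)⁻¹ * (T q.1 q.2 *
    inner ℝ (B q.1) (fderiv ℝ φ (q.1 + q.2) q.2))
  set a₂ : E n × E n → ℝ := fun q => (‖q.2‖ ^ n)⁻¹ * (T q.1 q.2 *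
    inner ℝ (K.P q.2) (fderiv ℝ φ (q.1 + q.2) (K.Q (B q.1))))
  set r₁ : E n × E n → ℝ := fun q => (‖q.2‖ ^ n)⁻¹ * (fderiv ℝ (T q.1) q.2 q.2 *
    inner ℝ (B q.1) (φ (q.1 + q.2)))
  set r₂ : E n × E n → ℝ := fun q => (‖q.2‖ ^ n)⁻¹ *
    (fderiv ℝ (fun y => T y q.2) q.1 (K.Q (B q.1)) * inner ℝ (K.P q.2) (φ (q.1 + q.2)))
  have ha₁ : Integrable a₁ ((volume : Measure (E n)).prod volume) := by
    refine hB.integrable_prod_of_le hn hμ (C := C1) (hm.mul (hTm.mul (hB1.inner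
      (aestronglyMeasurable_clm_apply hDm measurable_snd.aestronglyMeasurable)))) fun q => ?_
    have hw := (weight_pos (q.1 + q.2)).le
    rw [norm_mul, norm_mul, norm_inv, norm_pow, norm_norm]
    calc _ ≤ (‖q.2‖ ^ n)⁻¹ * (1 * (‖B q.1‖ * ((C1 * weight (q.1 + q.2)) * ‖q.2‖))) := by
          gcongr
          · exact hT.norm_le _ _
          · refine (norm_inner_le_norm _ _).trans (mul_le_mul_of_nonneg_left ?_ (norm_nonneg _))
            exact ((fderiv ℝ φ _).le_opNorm _).trans
              (mul_le_mul_of_nonneg_right (hb1 _) (norm_nonneg _))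
      _ = _ := by ring
  have ha₂ : Integrable a₂ ((volume : Measure (E n)).prod volume) := by
    refine hB.integrable_prod_of_le hn hμ (C := ‖K.P‖ * C1 * ‖K.Q‖) (hm.mul (hTm.mul (hPm.inner
      (aestronglyMeasurable_clm_apply hDm hQ1)))) fun q => ?_
    have hw := (weight_pos (q.1 + q.2)).le
    rw [norm_mul, norm_mul, norm_inv, norm_pow, norm_norm]
    calc _ ≤ (‖q.2‖ ^ n)⁻¹ * (1 * ((‖K.P‖ * ‖q.2‖) *
          ((C1 * weight (q.1 + q.2)) * (‖K.Q‖ * ‖B q.1‖)))) := by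
          gcongr
          · exact hT.norm_le _ _
          · refine (norm_inner_le_norm _ _).trans (mul_le_mul (K.P.le_opNorm _) ?_
              (norm_nonneg _) (by positivity))
            exact ((fderiv ℝ φ _).le_opNorm _).trans
              (mul_le_mul (hb1 _) (K.Q.le_opNorm _) (norm_nonneg _) (by positivity))
      _ = _ := by ring
  have hr₁ : Integrable r₁ ((volume : Measure (E n)).prod volume) := by
    refine hB.integrable_prod_of_le hn hμ (C := C4 * C0) (hm.mul
      ((aestronglyMeasurable_clm_apply hT2.aestronglyMeasurable
        measurable_snd.aestronglyMeasurable).mul (hB1.inner hφm))) fun q => ?_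
    have hw := (weight_pos (q.1 + q.2)).le
    rw [norm_mul, norm_mul, norm_inv, norm_pow, norm_norm]
    calc _ ≤ (‖q.2‖ ^ n)⁻¹ * ((C4 * ‖q.2‖) * (‖B q.1‖ * (C0 * weight (q.1 + q.2)))) := by
          gcongr
          · exact hT4 _ _
          · exact (norm_inner_le_norm _ _).trans
              (mul_le_mul_of_nonneg_left (hb0 _) (norm_nonneg _))
      _ = _ := by ring
  have hr₂ : Integrable r₂ ((volume : Measure (E n)).prod volume) := by
    refine hB.integrable_prod_of_le hn hμ (C := C3 * ‖K.Q‖ * ‖K.P‖ * C0) (hm.mul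
      ((aestronglyMeasurable_clm_apply hT1.aestronglyMeasurable hQ1).mul
        (hPm.inner hφm))) fun q => ?_
    have hw := (weight_pos (q.1 + q.2)).le
    rw [norm_mul, norm_mul, norm_inv, norm_pow, norm_norm]
    calc _ ≤ (‖q.2‖ ^ n)⁻¹ * ((C3 * (‖K.Q‖ * ‖B q.1‖)) *
          ((‖K.P‖ * ‖q.2‖) * (C0 * weight (q.1 + q.2)))) := by
          gcongr
          · exact (ContinuousLinearMap.le_opNorm _ _).trans
              (mul_le_mul (hT3 _ _) (K.Q.le_opNorm _) (norm_nonneg _) hC3)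
          · exact (norm_inner_le_norm _ _).trans
              (mul_le_mul (K.P.le_opNorm _) (hb0 _) (norm_nonneg _) (by positivity))
      _ = _ := by ring
  have h1 : ∫ q, (a₁ + r₁) q ∂((volume : Measure (E n)).prod volume) =
      -(sphereArea n * ∫ y, inner ℝ (B y) (φ y)) := by
    rw [integral_prod _ (ha₁.add hr₁), ← integral_const_mul, ← integral_neg]
    refine integral_congr_ae (ae_of_all _ fun y => ?_)
    obtain ⟨ψ, h3, h4⟩ := exists_schwartz_mul_inner φ y (B y) (hT.growth_snd y)
    have h5 := integral_kernel_mul_fderiv_self (by omega) ψ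
    rw [h3, hT.apply_zero, add_zero, one_mul] at h5
    simp only
    rw [← h5]
    refine integral_congr_ae (ae_of_all _ fun w => ?_)
    simp only [a₁, r₁, h4, Pi.add_apply]
    ring
  have h2 : ∫ q, (a₂ + r₂) q ∂((volume : Measure (E n)).prod volume) = 0 := by
    rw [integral_prod_symm _ (ha₂.add hr₂)]
    refine integral_eq_zero_of_ae (ae_of_all _ fun w => ?_)
    obtain ⟨ψ, -, h4⟩ := exists_schwartz_mul_inner φ w (K.P w) (hT.growth_fst w)
    have h5 : ∫ y, (‖w‖ ^ n)⁻¹ * fderiv ℝ ψ y (K.Q (B y)) = 0 := by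
      rw [integral_const_mul, hdiv ψ, mul_zero]
    simp only [Pi.zero_apply]
    rw [← h5]
    refine integral_congr_ae (ae_of_all _ fun y => ?_)
    simp only [a₂, r₂, h4, Pi.add_apply]
    rw [add_comm w y]
    ring
  have hA : ∀ x, inner ℝ (K.potential T B x) (K.cu (fderiv ℝ φ x)) =
      -((1 / sphereArea n) * ∫ y, (a₁ - a₂) (y, x - y)) := by
    intro x
    rw [potential, inner_neg_left, inner_smul_left, real_inner_comm,
      ← integral_inner (K.integrable_kernel hn hT hB hμ x)]
    congr 2
    refine integral_congr_ae (ae_of_all _ fun y => ?_)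
    simp only [a₁, a₂, Pi.sub_apply, inner_smul_right, add_sub_cancel]
    rw [real_inner_comm, K.inner_cr_cu]
    ring
  have hR : ∀ x, inner ℝ (K.remainder T B x) (φ x) =
      (1 / sphereArea n) * ∫ y, (r₂ - r₁) (y, x - y) := by
    intro x
    rw [remainder, inner_smul_left, real_inner_comm,
      ← integral_inner (K.integrable_remainder_kernel hn hT hB hμ x)]
    congr 1
    refine integral_congr_ae (ae_of_all _ fun y => ?_)
    simp only [r₁, r₂, Pi.sub_apply, inner_smul_right, inner_sub_right, add_sub_cancel]
    rw [real_inner_comm (φ x), real_inner_comm (φ x)]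
    ring
  simp_rw [hA, hR]
  rw [integral_neg, integral_const_mul, integral_const_mul, integral_integral_sub (ha₁.sub ha₂),
    integral_integral_sub (hr₂.sub hr₁)]
  simp only [Pi.sub_apply]
  rw [integral_sub ha₁ ha₂, integral_sub hr₂ hr₁]
  rw [integral_add' ha₁ hr₁] at h1
  rw [integral_add' ha₂ hr₂] at h2
  field_simp
  linarith

lemma hasDistDiv_potential (hn : 2 ≤ n) (hT : Truncation T) (hB : DecayField B μ)
    (hμ : 1 < μ) : HasDistDiv (K.potential T B) 0 := by
  intro φ
  have hφ' : Continuous (fderiv ℝ φ) := (φ.smooth ⊤).continuous_fderiv (by simp)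
  obtain ⟨C, hC, hb⟩ := exists_schwartz_le_weight (SchwartzMap.fderivCLM ℝ (E n) ℝ φ) 0
  simp only [SchwartzMap.fderivCLM_apply, pow_zero, one_mul] at hb
  set f : E n × E n → ℝ := fun q => (‖q.2‖ ^ n)⁻¹ * (T q.1 q.2 *
    fderiv ℝ φ (q.1 + q.2) (K.cr q.2 (B q.1)))
  have hf : Integrable f ((volume : Measure (E n)).prod volume) := by
    refine hB.integrable_prod_of_le hn hμ (C := C) ?_ fun q => ?_
    · have h1 : Measurable fun q : E n × E n => (‖q.2‖ ^ n)⁻¹ := by fun_prop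
      have h2 : Continuous fun q : E n × E n => K.cr q.2 := by fun_prop
      have h3 : Continuous fun q : E n × E n => fderiv ℝ φ (q.1 + q.2) := by fun_prop
      exact h1.aestronglyMeasurable.mul (hT.contDiff.continuous.aestronglyMeasurable.mul
        (aestronglyMeasurable_clm_apply h3.aestronglyMeasurable
          (aestronglyMeasurable_clm_apply h2.aestronglyMeasurable
            hB.aestronglyMeasurable.comp_fst)))
    · have hw := (weight_pos (q.1 + q.2)).le
      rw [norm_mul, norm_mul, norm_inv, norm_pow, norm_norm]
      calc _ ≤ (‖q.2‖ ^ n)⁻¹ * (1 * ((C * weight (q.1 + q.2)) * (‖q.2‖ * ‖B q.1‖))) := by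
            gcongr
            · exact hT.norm_le _ _
            · exact ((fderiv ℝ φ _).le_opNorm _).trans (mul_le_mul (hb _) (K.norm_cr_le _ _)
                (norm_nonneg _) (by positivity))
        _ = _ := by ring
  have h1 : ∀ x, inner ℝ (K.potential T B x) (gradient φ x) =
      -((1 / sphereArea n) * ∫ y, f (y, x - y)) := by
    intro x
    rw [potential, inner_neg_left, inner_smul_left, real_inner_comm,
      ← integral_inner (K.integrable_kernel hn hT hB hμ x)]
    congr 2
    refine integral_congr_ae (ae_of_all _ fun y => ?_)
    simp only [f, inner_smul_right, inner_gradient_left, add_sub_cancel]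
    ring
  have h2 : ∀ y, ∫ w, f (y, w) = 0 := by
    intro y
    obtain ⟨ψ, -, h3⟩ := exists_schwartz_mul_inner φ y 1 (hT.growth_snd y)
    rw [← integral_kernel_mul_fderiv_skew (by omega) ψ (K.cr.flip (B y)) fun v => by
      simp [K.inner_cr_self]]
    refine integral_congr_ae (ae_of_all _ fun w => ?_)
    simp only [f]
    rw [h3, ContinuousLinearMap.flip_apply, hT.radial y w _ (K.inner_cr_self w (B y))]
    simp
  simp_rw [h1]
  rw [integral_neg, integral_const_mul, integral_integral_sub hf, integral_prod _ hf]
  simp [h2]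

end CrossData

end

section

/-! ### Continuity and decay of Coulomb potentials -/

variable {n : ℕ} {F : Type*} [NormedAddCommGroup F] [InnerProductSpace ℝ F]

namespace CrossData

variable (K : CrossData n F) {T : E n → E n → ℝ} {B : E n → F} {μ : ℝ}

/-- The kernel is cut off near its singularity at a distance `δ`. -/
lemma continuous_integral_cutoff (hn : 2 ≤ n) (hT : Truncation T) (hB : DecayField B μ)
    (hμ : 1 < μ) {δ : ℝ} (hδ : 0 < δ) :
    Continuous fun x => ∫ y, (T y (x - y) * (max ‖x - y‖ δ ^ n)⁻¹) • K.cr (x - y) (B y) := by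
  obtain ⟨C, hC, h⟩ := hB.exists_riesz_le hn hμ
  have hBm := hB.aestronglyMeasurable
  have := nontrivial_of_one_le (n := n) (by omega)
  have hn' : (2 : ℝ) ≤ n := by exact_mod_cast hn
  have hTc : Continuous fun q : E n × E n => T q.1 q.2 := hT.contDiff.continuous
  have hm0 : ∀ w : E n, 0 < max ‖w‖ δ := fun w => lt_max_of_lt_right hδ
  refine continuous_iff_continuousAt.2 fun x₀ => ?_
  refine continuousAt_of_dominated
    (bound := fun y => 2 ^ ((n : ℝ) - 1) * (‖x₀ - y‖ ^ (-((n : ℝ) - 1)) * ‖B y‖))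
    (Eventually.of_forall fun x => ?_) ?_ ?_ ?_
  · have h1 : Continuous fun y => T y (x - y) * (max ‖x - y‖ δ ^ n)⁻¹ :=
      (hTc.comp (by fun_prop : Continuous fun y => (y, x - y))).mul
        (Continuous.inv₀ (by fun_prop) fun y => (pow_pos (hm0 _) n).ne')
    have h3 : Continuous fun y : E n => K.cr (x - y) := by fun_prop
    exact h1.aestronglyMeasurable.smul (aestronglyMeasurable_clm_apply h3.aestronglyMeasurable hBm)
  · filter_upwards [Metric.ball_mem_nhds x₀ hδ] with x hx
    filter_upwards [Measure.ae_ne volume x₀] with y hy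
    have hxy : 0 < ‖x₀ - y‖ := norm_pos_iff.2 (sub_ne_zero.2 hy.symm)
    rw [mem_ball_iff_norm] at hx
    set m := max ‖x - y‖ δ
    have hm : 0 < m := hm0 _
    have h1 : ‖x₀ - y‖ ≤ 2 * m := by
      have h2 : ‖x₀ - y‖ ≤ ‖x - x₀‖ + ‖x - y‖ := by
        rw [← norm_neg (x - x₀)]
        exact (congrArg norm (by abel : x₀ - y = -(x - x₀) + (x - y))).trans_le (norm_add_le _ _)
      have h3 : ‖x - y‖ ≤ m := le_max_left _ _
      have h4 : δ ≤ m := le_max_right _ _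
      linarith
    have h2 : (m ^ n)⁻¹ * m = m ^ (-((n : ℝ) - 1)) := by
      rw [← Real.rpow_natCast, ← Real.rpow_neg hm.le, show -((n : ℝ) - 1) = -n + 1 by ring,
        Real.rpow_add hm, Real.rpow_one]
    have h3 : m ^ (-((n : ℝ) - 1)) ≤ 2 ^ ((n : ℝ) - 1) * ‖x₀ - y‖ ^ (-((n : ℝ) - 1)) := by
      have h4 : (2 * m) ^ (-((n : ℝ) - 1)) ≤ ‖x₀ - y‖ ^ (-((n : ℝ) - 1)) :=
        Real.rpow_le_rpow_of_nonpos hxy h1 (by linarith)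
      rw [Real.mul_rpow (by norm_num) hm.le, Real.rpow_neg (by norm_num)] at h4
      rwa [inv_mul_le_iff₀ (by positivity)] at h4
    rw [norm_smul, norm_mul, norm_inv, norm_pow, Real.norm_of_nonneg hm.le]
    calc _ ≤ 1 * (m ^ n)⁻¹ * (m * ‖B y‖) := by
          gcongr
          · exact hT.norm_le _ _
          · exact (K.norm_cr_le _ _).trans
              (mul_le_mul_of_nonneg_right (le_max_left _ _) (norm_nonneg _))
      _ = ((m ^ n)⁻¹ * m) * ‖B y‖ := by ring
      _ ≤ (2 ^ ((n : ℝ) - 1) * ‖x₀ - y‖ ^ (-((n : ℝ) - 1))) * ‖B y‖ := by rw [h2]; gcongr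
      _ = _ := by ring
  · refine Integrable.const_mul ⟨?_, ?_⟩ _
    · have h1 : Measurable fun y : E n => ‖x₀ - y‖ ^ (-((n : ℝ) - 1)) := by fun_prop
      exact h1.aestronglyMeasurable.mul hBm.norm
    · refine (lintegral_mono fun y => ?_).trans_lt ((h x₀).trans_lt ENNReal.ofReal_lt_top)
      rw [← ofReal_norm, ← ofReal_norm, ← ENNReal.ofReal_mul (by positivity),
        Real.norm_of_nonneg (by positivity)]
  · refine ae_of_all _ fun y => ?_
    have h1 : Continuous fun x => (T y (x - y) * (max ‖x - y‖ δ ^ n)⁻¹) • K.cr (x - y) (B y) := by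
      refine Continuous.smul ((hTc.comp (by fun_prop : Continuous fun x => (y, x - y))).mul
        (Continuous.inv₀ (by fun_prop) fun y => (pow_pos (hm0 _) n).ne')) (by fun_prop)
    exact h1.continuousAt

/-- The potential is the uniform limit of its regularizations at a distance `δ` from the
singularity, because the contribution of a ball of radius `δ` is `O(δ ^ κ)` uniformly in its
center. -/
lemma continuous_potential (hn : 2 ≤ n) (hT : Truncation T) (hB : DecayField B μ)
    (hμ : 1 < μ) : Continuous (K.potential T B) := by
  have hBm := hB.aestronglyMeasurable
  obtain ⟨C, κ, hC, hκ, hnear⟩ := hB.exists_lintegral_ball_le hn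
  have hunif : TendstoUniformly
      (fun (δ : ℝ) x => ∫ y, (T y (x - y) * (max ‖x - y‖ δ ^ n)⁻¹) • K.cr (x - y) (B y))
      (fun x => ∫ y, (T y (x - y) * (‖x - y‖ ^ n)⁻¹) • K.cr (x - y) (B y)) (𝓝[>] 0) := by
    rw [Metric.tendstoUniformly_iff]
    intro ε hε
    have hlim : Tendsto (fun δ : ℝ => C * δ ^ κ) (𝓝[>] 0) (𝓝 0) := by
      have h1 : Tendsto (fun δ : ℝ => C * δ ^ κ) (𝓝 0) (𝓝 (C * 0 ^ κ)) :=
        ((Real.continuousAt_rpow_const 0 κ (Or.inr hκ.le)).const_mul C)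
      rw [Real.zero_rpow hκ.ne', mul_zero] at h1
      exact h1.mono_left nhdsWithin_le_nhds
    filter_upwards [hlim.eventually_lt_const hε, self_mem_nhdsWithin] with δ hδε hδ x
    have hδ0 : 0 < δ := hδ
    refine lt_of_le_of_lt ?_ hδε
    have hm0 : ∀ w : E n, 0 < max ‖w‖ δ := fun w => lt_max_of_lt_right hδ0
    have i1 := K.integrable_kernel hn hT hB hμ x
    have hle : ∀ y, ‖(T y (x - y) * (max ‖x - y‖ δ ^ n)⁻¹) • K.cr (x - y) (B y)‖ ≤
        ‖(T y (x - y) * (‖x - y‖ ^ n)⁻¹) • K.cr (x - y) (B y)‖ := by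
      intro y
      rcases eq_or_ne (x - y) 0 with h0 | h0
      · rw [h0]; simp
      have := norm_pos_iff.2 h0
      rw [norm_smul, norm_smul, norm_mul, norm_mul, norm_inv, norm_inv, norm_pow, norm_pow,
        norm_norm, Real.norm_of_nonneg (hm0 _).le]
      gcongr
      exact le_max_left _ _
    have i2 : Integrable fun y => (T y (x - y) * (max ‖x - y‖ δ ^ n)⁻¹) • K.cr (x - y) (B y) := by
      refine i1.norm.mono' ?_ (ae_of_all _ hle)
      have h1 : Continuous fun y => T y (x - y) * (max ‖x - y‖ δ ^ n)⁻¹ :=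
        (hT.contDiff.continuous.comp (by fun_prop : Continuous fun y => (y, x - y))).mul
          (Continuous.inv₀ (by fun_prop) fun y => (pow_pos (hm0 _) n).ne')
      have h3 : Continuous fun y : E n => K.cr (x - y) := by fun_prop
      exact h1.aestronglyMeasurable.smul
        (aestronglyMeasurable_clm_apply h3.aestronglyMeasurable hBm)
    rw [dist_eq_norm, ← integral_sub i1 i2, ← ENNReal.ofReal_le_ofReal_iff (by positivity),
      ofReal_norm]
    refine (enorm_integral_le_lintegral_enorm _).trans (le_trans ?_ (hnear x δ hδ0))
    rw [← lintegral_indicator Metric.isOpen_ball.measurableSet]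
    refine lintegral_mono fun y => ?_
    by_cases hy : y ∈ Metric.ball x δ
    · rw [indicator_of_mem hy]
      refine le_trans ?_ (K.enorm_kernel_le hT x y)
      rw [← sub_smul, ← mul_sub, ← ofReal_norm, ← ofReal_norm]
      refine ENNReal.ofReal_le_ofReal ?_
      rw [norm_smul, norm_smul, norm_mul, norm_mul]
      rcases eq_or_ne (x - y) 0 with h0 | h0
      · rw [h0]; simp
      have hp := norm_pos_iff.2 h0
      have h5 : (max ‖x - y‖ δ ^ n)⁻¹ ≤ (‖x - y‖ ^ n)⁻¹ := by
        gcongr; exact le_max_left _ _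
      have h6 : 0 < (max ‖x - y‖ δ ^ n)⁻¹ := inv_pos.2 (pow_pos (hm0 _) n)
      gcongr
      rw [Real.norm_of_nonneg (by linarith), Real.norm_of_nonneg (by positivity)]
      linarith
    · rw [indicator_of_notMem hy]
      have h5 : max ‖x - y‖ δ = ‖x - y‖ := by
        rw [mem_ball_iff_norm', not_lt] at hy
        exact max_eq_left hy
      rw [h5]; simp
  have hcont := hunif.continuous (Eventually.frequently (by
    filter_upwards [self_mem_nhdsWithin] with δ hδ
    exact K.continuous_integral_cutoff hn hT hB hμ hδ))
  exact (hcont.const_smul (1 / sphereArea n)).neg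

lemma exists_norm_potential_le (hn : 2 ≤ n) (hT : Truncation T) (hB : DecayField B μ)
    (hμ : 1 < μ) : ∃ C : ℝ, 0 ≤ C ∧ ∀ x, ‖K.potential T B x‖ ≤ C := by
  obtain ⟨C, hC, h⟩ := hB.exists_riesz_le hn hμ
  have hω := sphereArea_pos (n := n) (by omega)
  refine ⟨1 / sphereArea n * C, by positivity, fun x => ?_⟩
  rw [← ENNReal.ofReal_le_ofReal_iff (by positivity), ofReal_norm,
    ENNReal.ofReal_mul (by positivity)]
  exact (K.enorm_potential_le hn hT x).trans (mul_le_mul' le_rfl (h x))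

lemma exists_norm_potential_le_rpow (hn : 2 ≤ n) (hT : Truncation T) (hB : DecayField B μ)
    (hμ : 1 < μ) (hμn : μ < n) :
    ∃ C R : ℝ, 0 ≤ C ∧ 1 ≤ R ∧ ∀ x, R ≤ ‖x‖ → ‖K.potential T B x‖ ≤ C * ‖x‖ ^ (1 - μ) := by
  obtain ⟨C, R, hC, hR, h⟩ := hB.exists_riesz_le_rpow hn hμ hμn
  have hω := sphereArea_pos (n := n) (by omega)
  refine ⟨1 / sphereArea n * C, R, by positivity, hR, fun x hx => ?_⟩
  rw [← ENNReal.ofReal_le_ofReal_iff (by positivity), ofReal_norm, mul_assoc,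
    ENNReal.ofReal_mul (by positivity)]
  exact (K.enorm_potential_le hn hT x).trans (mul_le_mul' le_rfl (h x hx))

end CrossData

end

section

/-! ### Asymptotics of the Coulomb gauge -/

variable {n : ℕ} {F : Type*} [NormedAddCommGroup F] [InnerProductSpace ℝ F]

lemma ShortRange.mediumRange {A : E n → E n} (h : ShortRange A) {μ : ℝ} (hμ : 1 / 2 < μ)
    (hA : IsBigOInv A μ) : MediumRange A := by
  refine ⟨h.continuous, ⟨μ, hμ, hA⟩, h.decay.mono fun x => ?_⟩
  rw [norm_div, norm_norm]
  exact div_le_of_le_mul₀ (norm_nonneg _) (norm_nonneg _) (norm_inner_le_norm _ _)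

lemma isBigOInv_of_le {A : E n → E n} {C R μ : ℝ} (h : ∀ x, R ≤ ‖x‖ → ‖A x‖ ≤ C * ‖x‖ ^ (-μ)) :
    IsBigOInv A μ := by
  refine Asymptotics.IsBigO.of_bound C ?_
  filter_upwards [tendsto_norm_cobounded_atTop.eventually_ge_atTop R] with x hx
  rw [Real.norm_of_nonneg (Real.rpow_nonneg (norm_nonneg x) _)]
  exact h x hx

lemma boundedByInv_of_le {A : E n → E n} {C R M : ℝ} (hM : ∀ x, ‖A x‖ ≤ M)
    (h : ∀ x, R ≤ ‖x‖ → ‖A x‖ ≤ C * ‖x‖⁻¹) : BoundedByInv A := by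
  refine ⟨max C (M * R), fun x hx => ?_⟩
  have hx0 : 0 < ‖x‖ := norm_pos_iff.2 hx
  have hM0 : 0 ≤ M := (norm_nonneg _).trans (hM x)
  by_cases hxR : R ≤ ‖x‖
  · exact (h x hxR).trans (by gcongr; exact le_max_left _ _)
  · push Not at hxR
    refine (hM x).trans ?_
    rw [← div_eq_mul_inv, le_div_iff₀ hx0]
    exact (mul_le_mul_of_nonneg_left hxR.le hM0).trans (le_max_right _ _)

namespace DecayField

variable {B : E n → F} {μ : ℝ}

lemma integrable {H : Type*} [NormedAddCommGroup H] {B : E n → H} (hn : 1 ≤ n)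
    (hB : DecayField B μ) (hμ : n < μ) : Integrable B := by
  obtain ⟨C, R, hC, hR, hdec⟩ := hB.decay.exists_nonneg
  obtain ⟨C2, hC2, h2⟩ := exists_lintegral_compl_ball_rpow_le (n := n) hn hμ
  refine ⟨hB.aestronglyMeasurable, ?_⟩
  have hR0 : 0 < R := by linarith
  rw [HasFiniteIntegral, ← lintegral_add_compl _ (Metric.isOpen_ball (x := (0 : E n))
    (ε := R)).measurableSet]
  refine ENNReal.add_lt_top.2 ⟨hB.lintegral_ball_lt_top hn 0 R, ?_⟩
  calc _ ≤ ∫⁻ y in (Metric.ball (0 : E n) R)ᶜ, ENNReal.ofReal C * ENNReal.ofReal (‖y‖ ^ (-μ)) := by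
        refine setLIntegral_mono_ae' Metric.isOpen_ball.measurableSet.compl
          (hdec.mono fun y hy hyR => ?_)
        rw [← ofReal_norm, ← ENNReal.ofReal_mul hC]
        exact ENNReal.ofReal_le_ofReal (hy (by simpa using hyR))
    _ < ⊤ := by
        rw [lintegral_const_mul' _ _ ENNReal.ofReal_ne_top]
        exact ENNReal.mul_lt_top ENNReal.ofReal_lt_top
          ((h2 R hR0).trans_lt ENNReal.ofReal_lt_top)

/-- Multiplication by `|y|` costs one power of decay. -/
lemma norm_smul (hn : 1 ≤ n) (hB : DecayField B μ) (hμ : 2 ≤ μ) :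
    DecayField (fun y => ‖y‖ • B y) (μ - 1) := by
  obtain ⟨p, hp, hBp⟩ := hB.memLp
  obtain ⟨C, R, hC, hR, hdec⟩ := hB.decay.exists_nonneg
  have hn' : (1 : ℝ) ≤ n := by exact_mod_cast hn
  have hp0 : 0 < p := by linarith
  have hpow : ∀ y : E n, R ≤ ‖y‖ → ‖B y‖ ≤ C * ‖y‖ ^ (-μ) → ‖‖y‖ • B y‖ ≤ C * ‖y‖ ^ (-(μ - 1)) := by
    intro y hy h
    have hy0 : 0 < ‖y‖ := by linarith
    rw [_root_.norm_smul, norm_norm, show -(μ - 1) = 1 + -μ by ring,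
      Real.rpow_add hy0, Real.rpow_one]
    calc _ ≤ ‖y‖ * (C * ‖y‖ ^ (-μ)) := by gcongr
      _ = _ := by ring
  refine ⟨⟨p, hp, ?_⟩, C, R, hdec.mono fun y hy hyR => hpow y hyR (hy hyR)⟩
  have hw : MemLp (fun y : E n => (1 + ‖y‖) ^ (-(1 : ℝ))) (ENNReal.ofReal p) := by
    have hc : Continuous fun y : E n => (1 + ‖y‖) ^ (-(1 : ℝ)) :=
      Continuous.rpow_const (by fun_prop) fun y => Or.inl (by positivity)
    rw [← integrable_norm_rpow_iff hc.aestronglyMeasurable (by simpa using hp0) (by simp),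
      ENNReal.toReal_ofReal hp0.le]
    have h1 : Integrable fun y : E n => (1 + ‖y‖) ^ (-p) :=
      integrable_one_add_norm (by rw [finrank_euclideanSpace_fin]; exact hp)
    refine h1.congr (ae_of_all _ fun y => ?_)
    simp only
    rw [Real.norm_of_nonneg (by positivity), ← Real.rpow_mul (by positivity)]
    congr 1; ring
  have hsum : MemLp (fun y => R * ‖B y‖ + 2 * C * (1 + ‖y‖) ^ (-(1 : ℝ))) (ENNReal.ofReal p) :=
    (hBp.norm.const_mul R).add (hw.const_mul (2 * C))
  refine hsum.mono' (continuous_norm.aestronglyMeasurable.smul hB.aestronglyMeasurable)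
    (hdec.mono fun y hy => ?_)
  have h0 : (0 : ℝ) < 1 + ‖y‖ := by positivity
  by_cases hyR : R ≤ ‖y‖
  · refine (hpow y hyR (hy hyR)).trans ?_
    have hy1 : 1 ≤ ‖y‖ := hR.trans hyR
    have h1 : ‖y‖ ^ (-(μ - 1)) ≤ 2 * (1 + ‖y‖) ^ (-(1 : ℝ)) := by
      calc _ ≤ ‖y‖ ^ (-(1 : ℝ)) := Real.rpow_le_rpow_of_exponent_le hy1 (by linarith)
        _ ≤ _ := by
          rw [Real.rpow_neg_one, Real.rpow_neg_one, ← div_eq_mul_inv, inv_eq_one_div,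
            div_le_div_iff₀ (by linarith) h0]
          linarith
    calc _ ≤ C * (2 * (1 + ‖y‖) ^ (-(1 : ℝ))) := by gcongr
      _ = 2 * C * (1 + ‖y‖) ^ (-(1 : ℝ)) := by ring
      _ ≤ _ := le_add_of_nonneg_left (by positivity)
  · push Not at hyR
    rw [_root_.norm_smul, norm_norm]
    exact (mul_le_mul_of_nonneg_right hyR.le (norm_nonneg _)).trans
      (le_add_of_nonneg_right (by positivity))

end DecayField

namespace CrossData

section Space

variable (K : CrossData n F) {T : E n → E n → ℝ} {B : E n → F} {μ : ℝ}

lemma shortRange_potential (hn : 2 ≤ n) (hT : Truncation T) (hB : DecayField B μ)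
    (hμ : 2 < μ) (hμn : μ < n) : ShortRange (K.potential T B) := by
  obtain ⟨C, R, hC, hR, h⟩ := K.exists_norm_potential_le_rpow hn hT hB (by linarith) hμn
  obtain ⟨M, hM, h2⟩ := K.exists_norm_potential_le hn hT hB (by linarith)
  refine ⟨K.continuous_potential hn hT hB (by linarith), ?_⟩
  exact decaysIntegrably_of_le (a := μ - 1) (by linarith)
    (fun x hx => by rw [neg_sub]; exact h x hx) h2

lemma mediumRange_potential (hn : 2 ≤ n) (hT : Truncation T) (hB : DecayField B μ)
    (hμ : 2 < μ) (hμn : μ < n) : MediumRange (K.potential T B) := by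
  obtain ⟨C, R, hC, hR, h⟩ := K.exists_norm_potential_le_rpow hn hT hB (by linarith) hμn
  exact (K.shortRange_potential hn hT hB hμ hμn).mediumRange (μ := μ - 1) (by linarith)
    (isBigOInv_of_le fun x hx => by rw [neg_sub]; exact h x hx)

lemma boundedByInv_potential (hn : 2 ≤ n) (hT : Truncation T) (hB : DecayField B μ)
    (hμ : 2 < μ) (hμn : μ < n) : BoundedByInv (K.potential T B) := by
  obtain ⟨C, R, hC, hR, h⟩ := K.exists_norm_potential_le_rpow hn hT hB (by linarith) hμn
  obtain ⟨M, hM, h2⟩ := K.exists_norm_potential_le hn hT hB (by linarith)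
  refine boundedByInv_of_le h2 (R := R) (C := C) fun x hx => (h x hx).trans ?_
  gcongr
  rw [← Real.rpow_neg_one]
  exact Real.rpow_le_rpow_of_exponent_le (hR.trans hx) (by linarith)

end Space

section Plane

variable (K : CrossData 2 F) {B : E 2 → F} {μ : ℝ}

/-- The Coulomb potential of a point charge with the total flux of `B`. -/
def fluxPotential (B : E 2 → F) (x : E 2) : E 2 :=
  -((1 / sphereArea 2) • (‖x‖ ^ 2)⁻¹ • K.cr x (∫ y, B y))

/-- The inversion `x ↦ x / |x|²` changes distances by the factor `1 / (|x| |y|)`; hence the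
difference is a Riesz potential of `|y| B y`. -/
lemma enorm_potential_sub_le [CompleteSpace F] (hB : DecayField B μ) (hμ : 2 < μ) {x : E 2}
    (hx : x ≠ 0) :
    ‖K.potential (fun _ _ => 1) B x - K.fluxPotential B x‖ₑ ≤
      ENNReal.ofReal (1 / sphereArea 2 * ‖x‖⁻¹) * riesz (fun y => ‖y‖ • B y) x := by
  have hω := sphereArea_pos (n := 2) (by omega)
  have hx0 : 0 < ‖x‖ := norm_pos_iff.2 hx
  have hBi := hB.integrable (by omega) (by push_cast; exact hμ)
  have i1 := K.integrable_kernel le_rfl truncation_one hB (by linarith) x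
  have i2 : Integrable fun y => (‖x‖ ^ 2)⁻¹ • K.cr x (B y) :=
    ((K.cr x).integrable_comp hBi).smul (‖x‖ ^ 2)⁻¹
  have heq : K.potential (fun _ _ => 1) B x - K.fluxPotential B x =
      -((1 / sphereArea 2) • ∫ y, ((1 * (‖x - y‖ ^ 2)⁻¹) • K.cr (x - y) (B y) -
        (‖x‖ ^ 2)⁻¹ • K.cr x (B y))) := by
    rw [integral_sub i1 i2, integral_smul, ContinuousLinearMap.integral_comp_comm _ hBi,
      potential, fluxPotential, smul_sub]
    abel
  rw [heq, enorm_neg, enorm_smul, ← ofReal_norm (1 / sphereArea 2),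
    Real.norm_of_nonneg (by positivity), ENNReal.ofReal_mul (by positivity), mul_assoc]
  refine mul_le_mul' le_rfl ((enorm_integral_le_lintegral_enorm _).trans ?_)
  rw [riesz, ← lintegral_const_mul' _ _ ENNReal.ofReal_ne_top]
  refine lintegral_mono_ae ?_
  have := nontrivial_of_one_le (n := 2) (by omega)
  filter_upwards [Measure.ae_ne volume x] with y hy
  have hxy : x - y ≠ 0 := sub_ne_zero.2 hy.symm
  have hxy0 : 0 < ‖x - y‖ := norm_pos_iff.2 hxy
  rw [← ofReal_norm, ← ofReal_norm, ← ENNReal.ofReal_mul (by positivity),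
    ← ENNReal.ofReal_mul (by positivity)]
  refine ENNReal.ofReal_le_ofReal ?_
  have hcr : (1 * (‖x - y‖ ^ 2)⁻¹) • K.cr (x - y) (B y) - (‖x‖ ^ 2)⁻¹ • K.cr x (B y) =
      K.cr ((‖x - y‖ ^ 2)⁻¹ • (x - y) - (‖x‖ ^ 2)⁻¹ • x) (B y) := by
    simp only [map_sub, map_smul, sub_apply, smul_apply, one_mul]
  rw [hcr]
  refine (K.norm_cr_le _ _).trans_eq ?_
  have hinv := dist_div_norm_sq_smul hxy hx 1
  rw [dist_eq_norm, dist_eq_norm, one_pow, sub_sub_cancel_left, norm_neg] at hinv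
  simp only [one_div, inv_pow] at hinv
  rw [hinv, _root_.norm_smul, norm_norm]
  norm_num
  rw [Real.rpow_neg_one]
  ring

lemma exists_norm_potential_sub_le [CompleteSpace F] (hB : DecayField B μ) (hμ : 2 < μ)
    (hμ3 : μ < 3) : ∃ C R : ℝ, 0 ≤ C ∧ 1 ≤ R ∧ ∀ x, R ≤ ‖x‖ →
      ‖K.potential (fun _ _ => 1) B x - K.fluxPotential B x‖ ≤ C * ‖x‖ ^ (-(μ - 1)) := by
  have hω := sphereArea_pos (n := 2) (by omega)
  obtain ⟨C, R, hC, hR, h⟩ := (hB.norm_smul (by omega) hμ.le).exists_riesz_le_rpow le_rfl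
    (by linarith) (by push_cast; linarith)
  refine ⟨1 / sphereArea 2 * C, R, by positivity, hR, fun x hx => ?_⟩
  have hx0 : 0 < ‖x‖ := by linarith
  rw [← ENNReal.ofReal_le_ofReal_iff (by positivity), ofReal_norm]
  refine (K.enorm_potential_sub_le hB hμ (norm_pos_iff.1 hx0)).trans
    ((mul_le_mul' le_rfl (h x hx)).trans_eq ?_)
  rw [← ENNReal.ofReal_mul (by positivity), show -(μ - 1) = -1 + (1 - (μ - 1)) by ring,
    Real.rpow_add hx0, Real.rpow_neg_one]
  congr 1; ring

lemma norm_fluxPotential_le (B : E 2 → F) (x : E 2) :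
    ‖K.fluxPotential B x‖ ≤ 1 / sphereArea 2 * ‖∫ y, B y‖ * ‖x‖⁻¹ := by
  have hω := sphereArea_pos (n := 2) (by omega)
  rw [fluxPotential, norm_neg, _root_.norm_smul, _root_.norm_smul, norm_inv, norm_pow, norm_norm,
    Real.norm_of_nonneg (by positivity)]
  rcases eq_or_ne x 0 with rfl | hx
  · simp
  have hx0 : 0 < ‖x‖ := norm_pos_iff.2 hx
  calc _ ≤ 1 / sphereArea 2 * ((‖x‖ ^ 2)⁻¹ * (‖x‖ * ‖∫ y, B y‖)) := by
        gcongr; exact K.norm_cr_le _ _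
    _ = _ := by field_simp

lemma inner_fluxPotential_self (B : E 2 → F) (x : E 2) : inner ℝ (K.fluxPotential B x) x = 0 := by
  rw [fluxPotential, inner_neg_left, inner_smul_left, inner_smul_left, real_inner_comm,
    K.inner_cr_self]
  simp

lemma exists_norm_coulomb_plane_le [CompleteSpace F] (hB : DecayField B μ) (hμ : 2 < μ)
    (hμ3 : μ < 3) : ∃ C R : ℝ, 1 ≤ R ∧ ∀ x, R ≤ ‖x‖ →
      ‖K.potential (fun _ _ => 1) B x‖ ≤ C * ‖x‖⁻¹ := by
  obtain ⟨C, R, hC, hR, h⟩ := K.exists_norm_potential_sub_le hB hμ hμ3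
  refine ⟨C + 1 / sphereArea 2 * ‖∫ y, B y‖, R, hR, fun x hx => ?_⟩
  rw [← sub_add_cancel (K.potential (fun _ _ => 1) B x) (K.fluxPotential B x), add_mul]
  refine (norm_add_le _ _).trans (add_le_add ((h x hx).trans ?_) (K.norm_fluxPotential_le B x))
  gcongr
  rw [← Real.rpow_neg_one]
  exact Real.rpow_le_rpow_of_exponent_le (hR.trans hx) (by linarith)

lemma boundedByInv_coulomb_plane [CompleteSpace F] (hB : DecayField B μ) (hμ : 2 < μ)
    (hμ3 : μ < 3) : BoundedByInv (K.potential (fun _ _ => 1) B) := by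
  obtain ⟨C, R, hR, h⟩ := K.exists_norm_coulomb_plane_le hB hμ hμ3
  obtain ⟨M, hM, h2⟩ := K.exists_norm_potential_le le_rfl truncation_one hB (by linarith)
  exact boundedByInv_of_le h2 h

/-- The potential may decay like `1 / |x|` only, but `fluxPotential` is transversal, so that the
longitudinal part inherits the better decay of the difference. -/
lemma mediumRange_coulomb_plane [CompleteSpace F] (hB : DecayField B μ) (hμ : 2 < μ)
    (hμ3 : μ < 3) : MediumRange (K.potential (fun _ _ => 1) B) := by
  obtain ⟨C, R, hR, h⟩ := K.exists_norm_coulomb_plane_le hB hμ hμ3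
  obtain ⟨C', R', hC', hR', h'⟩ := K.exists_norm_potential_sub_le hB hμ hμ3
  obtain ⟨M, hM, h2⟩ := K.exists_norm_potential_le le_rfl truncation_one hB (by linarith)
  refine ⟨K.continuous_potential le_rfl truncation_one hB (by linarith),
    ⟨1, by norm_num, isBigOInv_of_le (R := R) (C := C) fun x hx => ?_⟩,
    decaysIntegrably_of_le (a := μ - 1) (R := R') (C := C') (K := M) (by linarith) ?_ ?_⟩
  · rw [Real.rpow_neg_one]; exact h x hx
  · intro x hx
    rw [norm_div, norm_norm]
    refine div_le_of_le_mul₀ (norm_nonneg _) (by positivity) ?_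
    rw [← sub_zero (inner ℝ _ _), ← K.inner_fluxPotential_self B x, ← inner_sub_left]
    exact (norm_inner_le_norm _ _).trans (by gcongr; exact h' x hx)
  · intro x
    rw [norm_div, norm_norm]
    refine div_le_of_le_mul₀ (norm_nonneg _) hM ?_
    exact (norm_inner_le_norm _ _).trans (by gcongr; exact h2 x)

/-- Up to a short-range term, the Coulomb gauge is the flux divided by `ω |x|`, whose supremum over
`|x| ≥ r` is not integrable unless the flux vanishes. -/
lemma shortRange_coulomb_plane_iff [CompleteSpace F] (hB : DecayField B μ) (hμ : 2 < μ)
    (hμ3 : μ < 3) (hcr : ∀ w b, ‖K.cr w b‖ = ‖w‖ * ‖b‖) :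
    ShortRange (K.potential (fun _ _ => 1) B) ↔ ∫ y, B y = 0 := by
  have hω := sphereArea_pos (n := 2) (by omega)
  obtain ⟨C, R, hC, hR, h⟩ := K.exists_norm_potential_sub_le hB hμ hμ3
  obtain ⟨M, hM, h2⟩ := K.exists_norm_potential_le le_rfl truncation_one hB (by linarith)
  constructor
  · intro hs
    by_contra hΦ
    have hΦ0 : 0 < ‖∫ y, B y‖ := norm_pos_iff.2 hΦ
    set c := 1 / sphereArea 2 * ‖∫ y, B y‖
    have hc : 0 < c := by positivity
    set S : Set (E 2) := {x | R ≤ ‖x‖}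
    have d1 : DecaysIntegrably (S.indicator (K.potential (fun _ _ => 1) B)) :=
      hs.decay.mono fun x => norm_indicator_le_norm_self _ _
    have d2 : DecaysIntegrably (S.indicator fun x =>
        -(K.potential (fun _ _ => 1) B x - K.fluxPotential B x)) := by
      refine decaysIntegrably_of_le (a := μ - 1) (R := R) (C := C) (K := C) (by linarith)
        (fun x hx => ?_) (fun x => ?_)
      · rw [indicator_of_mem (show x ∈ S from hx), norm_neg]; exact h x hx
      · by_cases hx : x ∈ S
        · rw [indicator_of_mem hx, norm_neg]
          refine (h x hx).trans (mul_le_of_le_one_right hC ?_)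
          exact Real.rpow_le_one_of_one_le_of_nonpos (hR.trans hx) (by linarith)
        · rw [indicator_of_notMem hx, norm_zero]; exact hC
    have d3 := d1.add d2
    refine absurd d3 (not_lt.2 (top_le_iff.2 ?_))
    have hinf : ∫⁻ r in Ioi R, ENNReal.ofReal (c * r⁻¹) = ⊤ := by
      by_contra hcon
      refine not_integrableOn_Ioi_inv (a := R) ?_
      have h3 : IntegrableOn (fun r : ℝ => c * r⁻¹) (Ioi R) := by
        refine ⟨by fun_prop, ?_⟩
        rw [hasFiniteIntegral_iff_ofReal]
        · exact lt_top_iff_ne_top.2 hcon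
        · refine (ae_restrict_iff' measurableSet_Ioi).2 (ae_of_all _ fun r hr => ?_)
          have : 0 < r := by linarith [mem_Ioi.1 hr]
          simp only [Pi.zero_apply]; positivity
      have h4 := h3.const_mul c⁻¹
      refine h4.congr (ae_of_all _ fun r => ?_)
      simp only
      field_simp
    rw [← top_le_iff, ← hinf]
    refine (setLIntegral_mono' measurableSet_Ioi fun r hr => ?_).trans
      (lintegral_mono_set (Ioi_subset_Ioi (by linarith)))
    have hr0 : 0 < r := by linarith [mem_Ioi.1 hr]
    set x : E 2 := EuclideanSpace.single 0 r
    have hx : ‖x‖ = r := by simp [x, abs_of_pos hr0]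
    refine le_trans ?_ (le_iSup₂ (f := fun (x : E 2) (_ : r ≤ ‖x‖) => ‖_‖ₑ) x hx.ge)
    have hxS : x ∈ S := by
      change R ≤ ‖x‖
      rw [hx]; exact (mem_Ioi.1 hr).le
    simp only
    rw [indicator_of_mem hxS, indicator_of_mem hxS, neg_sub, add_sub_cancel, ← ofReal_norm]
    refine ENNReal.ofReal_le_ofReal (le_of_eq ?_)
    rw [fluxPotential, norm_neg, _root_.norm_smul, _root_.norm_smul, norm_inv, norm_pow, norm_norm,
      Real.norm_of_nonneg (by positivity), hcr, hx]
    simp only [c]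
    field_simp
  · intro hΦ
    refine ⟨K.continuous_potential le_rfl truncation_one hB (by linarith),
      decaysIntegrably_of_le (a := μ - 1) (R := R) (C := C) (by linarith) (fun x hx => ?_) h2⟩
    have h0 : K.fluxPotential B x = 0 := by simp [fluxPotential, hΦ]
    have h3 := h x hx
    rwa [h0, sub_zero] at h3

end Plane

end CrossData

end

section

/-! ### A smooth radial cutoff -/

variable {n : ℕ}

/-- A smooth radial cutoff, equal to `1` for `|w| ≤ 1` and to `0` for `|w|² ≥ 2`. -/
def cutoff (w : E n) : ℝ := Real.smoothTransition (2 - ‖w‖ ^ 2)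

lemma contDiff_cutoff : ContDiff ℝ ∞ (cutoff : E n → ℝ) :=
  (Real.smoothTransition.contDiff (n := ⊤)).comp (contDiff_const.sub (contDiff_norm_sq ℝ))

lemma cutoff_of_norm_le {w : E n} (hw : ‖w‖ ≤ 1) : cutoff w = 1 := by
  refine Real.smoothTransition.one_of_one_le ?_
  nlinarith [norm_nonneg w]

lemma cutoff_of_le_norm {w : E n} (hw : 2 ≤ ‖w‖ ^ 2) : cutoff w = 0 :=
  Real.smoothTransition.zero_of_nonpos (by linarith)

lemma norm_cutoff_le (w : E n) : ‖cutoff w‖ ≤ 1 := by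
  rw [cutoff, Real.norm_of_nonneg (Real.smoothTransition.nonneg _)]
  exact Real.smoothTransition.le_one _

lemma hasCompactSupport_cutoff : HasCompactSupport (cutoff : E n → ℝ) := by
  refine HasCompactSupport.intro (isCompact_closedBall (0 : E n) 2) fun w hw => ?_
  rw [mem_closedBall_zero_iff, not_le] at hw
  exact cutoff_of_le_norm (by nlinarith)

lemma fderiv_cutoff_of_norm_lt {w : E n} (hw : ‖w‖ < 1) : fderiv ℝ cutoff w = 0 := by
  have h : (cutoff : E n → ℝ) =ᶠ[𝓝 w] fun _ => 1 := by
    filter_upwards [(isOpen_lt continuous_norm continuous_const).mem_nhds hw] with v hv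
    exact cutoff_of_norm_le (le_of_lt hv)
  rw [h.fderiv_eq, fderiv_fun_const, Pi.zero_apply]

lemma fderiv_cutoff_of_lt_norm {w : E n} (hw : 2 < ‖w‖ ^ 2) : fderiv ℝ cutoff w = 0 := by
  have h : (cutoff : E n → ℝ) =ᶠ[𝓝 w] fun _ => 0 := by
    filter_upwards [(isOpen_lt continuous_const (by fun_prop :
      Continuous fun v : E n => ‖v‖ ^ 2)).mem_nhds hw] with v hv
    exact cutoff_of_le_norm (le_of_lt hv)
  rw [h.fderiv_eq, fderiv_fun_const, Pi.zero_apply]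

lemma continuous_fderiv_cutoff : Continuous (fderiv ℝ (cutoff : E n → ℝ)) :=
  contDiff_cutoff.continuous_fderiv (by simp)

lemma exists_norm_fderiv_cutoff_le :
    ∃ M : ℝ, 0 ≤ M ∧ ∀ w : E n, ‖fderiv ℝ cutoff w‖ ≤ M := by
  obtain ⟨M, hM⟩ := (hasCompactSupport_cutoff.fderiv (𝕜 := ℝ)).exists_bound_of_continuous
    (continuous_fderiv_cutoff (n := n))
  exact ⟨M, (norm_nonneg _).trans (hM 0), hM⟩

/-! ### The flux through planes -/

/-- Isometric coordinates of space adapted to the planes orthogonal to `b 2`. -/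
lemma measurePreserving_planes (b : OrthonormalBasis (Fin 3) ℝ (E 3)) :
    MeasurePreserving (fun q : E 2 × ℝ => q.1 0 • b 0 + q.1 1 • b 1 + q.2 • b 2)
      ((volume : Measure (E 2)).prod volume) volume := by
  have h1 : MeasurePreserving (Prod.map (WithLp.ofLp : E 2 → (Fin 2 → ℝ)) (id : ℝ → ℝ))
      ((volume : Measure (E 2)).prod volume) ((volume : Measure (Fin 2 → ℝ)).prod volume) :=
    (PiLp.volume_preserving_ofLp (Fin 2)).prod (MeasurePreserving.id volume)
  have h2 := (volume_preserving_piFinSuccAbove (fun _ : Fin 3 => ℝ) 2).symm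
  have h3 := PiLp.volume_preserving_toLp (Fin 3)
  have h4 := b.repr.symm.measurePreserving
  have h := h4.comp (h3.comp (h2.comp
    ((Measure.measurePreserving_swap (μ := (volume : Measure (Fin 2 → ℝ)))
      (ν := (volume : Measure ℝ))).comp h1)))
  refine (congrArg (fun f => MeasurePreserving f ((volume : Measure (E 2)).prod volume)
    (volume : Measure (E 3))) (funext fun q => ?_)).mpr h
  simp only [Function.comp_apply]
  rw [← b.sum_repr_symm, Fin.sum_univ_three]
  rfl

lemma inner_planes (b : OrthonormalBasis (Fin 3) ℝ (E 3)) (u : E 2) (c : ℝ) :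
    inner ℝ (b 2) (u 0 • b 0 + u 1 • b 1 + c • b 2) = c := by
  simp [inner_add_right, inner_smul_right, b.inner_eq_ite]

lemma norm_planes_sq (b : OrthonormalBasis (Fin 3) ℝ (E 3)) (u : E 2) (c : ℝ) :
    ‖u 0 • b 0 + u 1 • b 1 + c • b 2‖ ^ 2 = ‖u‖ ^ 2 + c ^ 2 := by
  rw [← real_inner_self_eq_norm_sq (u 0 • b 0 + u 1 • b 1 + c • b 2), EuclideanSpace.norm_sq_eq u]
  simp only [inner_add_right, inner_add_left, inner_smul_right, inner_smul_left, b.inner_eq_ite,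
    Fin.sum_univ_two, conj_trivial, Real.norm_eq_abs, sq_abs]
  simp
  ring

section Flux

variable {B : E 3 → E 3} {μ : ℝ} (b : OrthonormalBasis (Fin 3) ℝ (E 3))

/-- A field of decay `μ > 2` is integrable over slabs. -/
lemma integrableOn_slab (hB : DecayField B μ) (hμ : 2 < μ) (N : ℝ) :
    IntegrableOn B {x | |inner ℝ (b 2) x| ≤ N} := by
  obtain ⟨C, R, hC, hR, hdec⟩ := hB.decay.exists_nonneg
  set S : Set (E 3) := {x | |inner ℝ (b 2) x| ≤ N}
  have hS : MeasurableSet S := by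
    have : Continuous fun x : E 3 => |inner ℝ (b 2) x| := by fun_prop
    exact (isClosed_le this continuous_const).measurableSet
  have hball : MeasurableSet (Metric.ball (0 : E 3) R) := Metric.isOpen_ball.measurableSet
  refine ⟨hB.aestronglyMeasurable.restrict, ?_⟩
  rw [HasFiniteIntegral, ← lintegral_add_compl _ hball]
  refine ENNReal.add_lt_top.2 ⟨?_, ?_⟩
  · refine lt_of_le_of_lt ?_ (hB.lintegral_ball_lt_top (by norm_num) 0 R)
    exact lintegral_mono' (Measure.restrict_mono_measure Measure.restrict_le_self _) le_rfl
  rw [Measure.restrict_restrict hball.compl]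
  set g : E 3 → ℝ≥0∞ := ((Metric.ball (0 : E 3) R)ᶜ ∩ S).indicator
    fun x => ENNReal.ofReal (C * ‖x‖ ^ (-μ))
  have hg : Measurable g := Measurable.indicator (by fun_prop) (hball.compl.inter hS)
  calc _ ≤ ∫⁻ x, g x := by
        rw [lintegral_indicator (hball.compl.inter hS)]
        refine setLIntegral_mono_ae' (hball.compl.inter hS) (hdec.mono fun x hx hxS => ?_)
        rw [← ofReal_norm]
        exact ENNReal.ofReal_le_ofReal (hx (by simpa using hxS.1))
    _ = ∫⁻ q : E 2 × ℝ, g (q.1 0 • b 0 + q.1 1 • b 1 + q.2 • b 2)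
          ∂((volume : Measure (E 2)).prod volume) :=
        ((measurePreserving_planes b).lintegral_comp hg).symm
    _ ≤ ∫⁻ q : E 2 × ℝ, ENNReal.ofReal (C * 2 ^ μ * (1 + ‖q.1‖) ^ (-μ)) *
          (Icc (-N) N).indicator 1 q.2 ∂((volume : Measure (E 2)).prod volume) := by
        refine lintegral_mono fun q => ?_
        obtain ⟨u, c⟩ := q
        simp only [g]
        by_cases hq : u 0 • b 0 + u 1 • b 1 + c • b 2 ∈ (Metric.ball (0 : E 3) R)ᶜ ∩ S
        · rw [indicator_of_mem hq]
          have hc : c ∈ Icc (-N) N := by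
            have h1 : |inner ℝ (b 2) (u 0 • b 0 + u 1 • b 1 + c • b 2)| ≤ N := hq.2
            rw [inner_planes] at h1
            exact abs_le.1 h1
          rw [indicator_of_mem hc, Pi.one_apply, mul_one]
          refine ENNReal.ofReal_le_ofReal ?_
          have h2 := norm_planes_sq b u c
          have h3 : R ≤ ‖u 0 • b 0 + u 1 • b 1 + c • b 2‖ := by simpa using hq.1
          set r := ‖u 0 • b 0 + u 1 • b 1 + c • b 2‖
          have hr : 0 < r := by linarith
          have h4 : ‖u‖ ≤ r := by
            refine le_of_sq_le_sq ?_ hr.le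
            nlinarith [sq_nonneg c]
          have h5 : (2 * r) ^ (-μ) ≤ (1 + ‖u‖) ^ (-μ) :=
            Real.rpow_le_rpow_of_nonpos (by positivity) (by linarith) (by linarith)
          rw [Real.mul_rpow (by norm_num) hr.le, Real.rpow_neg (by norm_num),
            inv_mul_le_iff₀ (by positivity)] at h5
          rw [mul_assoc]
          gcongr
        · rw [indicator_of_notMem hq]; exact zero_le
    _ < ⊤ := by
        have hi : Integrable fun u : E 2 => (1 + ‖u‖) ^ (-μ) :=
          integrable_one_add_norm (by rw [finrank_euclideanSpace_fin]; exact_mod_cast hμ)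
        rw [lintegral_prod_mul
          (f := fun u : E 2 => ENNReal.ofReal (C * 2 ^ μ * (1 + ‖u‖) ^ (-μ)))
          (g := (Icc (-N) N).indicator 1) (by fun_prop)
          (measurable_one.indicator measurableSet_Icc).aemeasurable]
        refine ENNReal.mul_lt_top (hi.const_mul (C * 2 ^ μ)).lintegral_lt_top ?_
        rw [lintegral_indicator_one measurableSet_Icc]
        exact measure_Icc_lt_top

/-- The divergence condition, tested with a function of the coordinate `b 2` alone: it is multiplied
by a cutoff, whose contribution vanishes in the limit since the field decays faster than
`|x|^(-2)`. -/
lemma integral_mul_inner_eq_zero (hB : DecayField B μ) (hμ : 2 < μ) (hdiv : HasDistDiv B 0)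
    {g : ℝ → ℝ} (hg : ContDiff ℝ ∞ g) (hgc : HasCompactSupport g) :
    ∫ x, g (inner ℝ (b 2) x) * inner ℝ (b 2) (B x) = 0 := by
  obtain ⟨C, R, hC, hR, hdec⟩ := hB.decay.exists_nonneg
  obtain ⟨M, hM, hχ⟩ := exists_norm_fderiv_cutoff_le (n := 3)
  obtain ⟨C2, hC2, h2⟩ := exists_lintegral_compl_ball_rpow_le (n := 3) (by norm_num) (a := μ + 1)
    (by push_cast; linarith)
  obtain ⟨N, hN⟩ := hgc.isCompact.isBounded.subset_closedBall 0
  obtain ⟨G, hG⟩ := hgc.exists_bound_of_continuous hg.continuous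
  have hgi : Integrable g := hg.continuous.integrable_of_hasCompactSupport hgc
  set f : E 3 → ℝ := fun x => g (inner ℝ (b 2) x) * inner ℝ (b 2) (B x)
  have hfi : Integrable f := by
    have hS := integrableOn_slab b hB hμ N
    have hm : AEStronglyMeasurable f :=
      (by fun_prop : Continuous fun x => g (inner ℝ (b 2) x)).aestronglyMeasurable.mul
        (aestronglyMeasurable_const.inner hB.aestronglyMeasurable)
    have h0 : ∀ x, x ∉ {x : E 3 | |inner ℝ (b 2) x| ≤ N} → f x = 0 := by
      intro x hx
      simp only [f]
      rw [show g (inner ℝ (b 2) x) = 0 from ?_, zero_mul]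
      by_contra hne
      exact hx (by simpa using hN (subset_tsupport g hne))
    rw [← integrableOn_iff_integrable_of_support_subset (s := {x : E 3 | |inner ℝ (b 2) x| ≤ N})
      fun x hx => by_contra fun hcon => hx (h0 x hcon)]
    refine (hS.norm.const_mul G).mono' hm.restrict (ae_of_all _ fun x => ?_)
    rw [norm_mul]
    refine mul_le_mul (hG _) ?_ (norm_nonneg _) ((norm_nonneg _).trans (hG 0))
    exact (norm_inner_le_norm _ _).trans (by simp)
  -- a bounded primitive of `g`
  set Θ : ℝ → ℝ := fun t => ∫ s in (0 : ℝ)..t, g s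
  have hΘd : ∀ t, HasDerivAt Θ (g t) t := fun t =>
    intervalIntegral.integral_hasDerivAt_right (hg.continuous.intervalIntegrable _ _)
      (hg.continuous.stronglyMeasurableAtFilter _ _) hg.continuous.continuousAt
  have hΘ : ContDiff ℝ ∞ Θ := by
    rw [contDiff_infty_iff_deriv]
    refine ⟨fun t => (hΘd t).differentiableAt, ?_⟩
    rwa [show deriv Θ = g from funext fun t => (hΘd t).deriv]
  set L : ℝ := ∫ s, ‖g s‖
  have hL : 0 ≤ L := integral_nonneg fun _ => norm_nonneg _
  have hΘb : ∀ t, ‖Θ t‖ ≤ L := fun t =>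
    intervalIntegral.norm_integral_le_integral_norm_uIoc.trans
      (setIntegral_le_integral hgi.norm (ae_of_all _ fun _ => norm_nonneg _))
  have hscale : ∀ (k : ℝ), 0 < k → ∀ x : E 3,
      HasFDerivAt (fun x : E 3 => cutoff (k⁻¹ • x)) (k⁻¹ • fderiv ℝ cutoff (k⁻¹ • x)) x := by
    intro k hk x
    have h1 := (contDiff_cutoff.differentiable (by simp) (k⁻¹ • x)).hasFDerivAt
    have h3 := h1.comp x ((hasFDerivAt_id x).const_smul k⁻¹)
    refine h3.congr_fderiv ?_
    ext v; simp
  have htest : ∀ k : ℝ, 0 < k → ∫ x, (cutoff (k⁻¹ • x) * f x + Θ (inner ℝ (b 2) x) *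
      (k⁻¹ * fderiv ℝ cutoff (k⁻¹ • x) (B x))) = 0 := by
    intro k hk
    set ψ : E 3 → ℝ := fun x => cutoff (k⁻¹ • x) * Θ (inner ℝ (b 2) x)
    have hψ : ContDiff ℝ ∞ ψ := by
      refine (contDiff_cutoff.comp (contDiff_const_smul k⁻¹)).mul (hΘ.comp ?_)
      exact (innerSL ℝ (b 2)).contDiff
    have hψc : HasCompactSupport ψ := by
      have h1 : HasCompactSupport fun x : E 3 => cutoff (k⁻¹ • x) :=
        hasCompactSupport_cutoff.comp_smul (inv_ne_zero hk.ne')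
      exact h1.mul_right
    have h1 := hdiv (hψc.toSchwartzMap hψ)
    simp only [Pi.zero_apply, zero_mul, integral_zero, neg_zero] at h1
    rw [← h1]
    refine integral_congr_ae (ae_of_all _ fun x => ?_)
    have h3 : HasFDerivAt (fun x => Θ (inner ℝ (b 2) x)) (g (inner ℝ (b 2) x) • innerSL ℝ (b 2))
        x := (hΘd _).comp_hasFDerivAt x (innerSL ℝ (b 2)).hasFDerivAt
    have h4 := (hscale k hk x).mul h3
    simp only
    rw [real_inner_comm (gradient _ x) (B x), inner_gradient_left]
    have h5 : fderiv ℝ (hψc.toSchwartzMap hψ) x = _ := h4.fderiv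
    rw [h5]
    simp [f]
  have hi2 : ∀ k : ℝ, 0 < k → Integrable fun x => cutoff (k⁻¹ • x) * f x := fun k hk =>
    hfi.bdd_mul (c := 1)
      (contDiff_cutoff.continuous.comp (continuous_const_smul k⁻¹)).aestronglyMeasurable
      (ae_of_all _ fun x => norm_cutoff_le _)
  have hrest : ∀ k : ℝ, R ≤ k → ∫⁻ x, ‖Θ (inner ℝ (b 2) x) *
      (k⁻¹ * fderiv ℝ cutoff (k⁻¹ • x) (B x))‖ₑ ≤
        ENNReal.ofReal (2 * L * M * C * C2 * k ^ (2 - μ)) := by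
    intro k hk
    have hk0 : 0 < k := by linarith
    have hball : MeasurableSet (Metric.ball (0 : E 3) k) := Metric.isOpen_ball.measurableSet
    calc _ ≤ ∫⁻ x, (Metric.ball (0 : E 3) k)ᶜ.indicator
          (fun x => ENNReal.ofReal (2 * L * M * C) * ENNReal.ofReal (‖x‖ ^ (-(μ + 1)))) x := by
          refine lintegral_mono_ae (hdec.mono fun x hx => ?_)
          by_cases h0 : fderiv ℝ cutoff (k⁻¹ • x) = 0
          · rw [h0]; simp
          have hn : ‖k⁻¹ • x‖ = ‖x‖ / k := by
            rw [norm_smul, Real.norm_of_nonneg (by positivity), div_eq_inv_mul]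
          have h1 : k ≤ ‖x‖ := by
            by_contra hcon
            exact h0 (fderiv_cutoff_of_norm_lt (by rw [hn, div_lt_one hk0]; linarith))
          have h4 : ‖x‖ ≤ 2 * k := by
            by_contra hcon
            refine h0 (fderiv_cutoff_of_lt_norm ?_)
            have h5 : 2 < ‖k⁻¹ • x‖ := by rw [hn, lt_div_iff₀ hk0]; linarith
            nlinarith
          have hx0 : 0 < ‖x‖ := by linarith
          rw [indicator_of_mem (by simpa using h1), ← ofReal_norm,
            ← ENNReal.ofReal_mul (by positivity)]
          refine ENNReal.ofReal_le_ofReal ?_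
          rw [norm_mul, norm_mul, norm_inv, Real.norm_of_nonneg hk0.le]
          have h6 : k⁻¹ ≤ 2 * ‖x‖⁻¹ := by
            rw [← div_eq_mul_inv, inv_eq_one_div, div_le_div_iff₀ hk0 hx0]; linarith
          calc _ ≤ L * ((2 * ‖x‖⁻¹) * (M * (C * ‖x‖ ^ (-μ)))) := by
                gcongr
                · exact hΘb _
                · exact ((fderiv ℝ cutoff _).le_opNorm _).trans
                    (mul_le_mul (hχ _) (hx (by linarith)) (norm_nonneg _) hM)
            _ = _ := by
                rw [show -(μ + 1) = -1 + -μ by ring, Real.rpow_add hx0, Real.rpow_neg_one]; ring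
      _ ≤ ENNReal.ofReal (2 * L * M * C) * ENNReal.ofReal (C2 * k ^ (((3 : ℕ) : ℝ) - (μ + 1))) := by
          rw [lintegral_indicator hball.compl, lintegral_const_mul' _ _ ENNReal.ofReal_ne_top]
          gcongr
          exact h2 k hk0
      _ = _ := by
          rw [← ENNReal.ofReal_mul (by positivity)]
          congr 1
          rw [show ((3 : ℕ) : ℝ) - (μ + 1) = 2 - μ by push_cast; ring]; ring
  have hbd : ∀ k : ℝ, R ≤ k → ‖∫ x, cutoff (k⁻¹ • x) * f x‖ ≤
      2 * L * M * C * C2 * k ^ (2 - μ) := by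
    intro k hk
    have hk0 : 0 < k := by linarith
    have hm : AEStronglyMeasurable fun x => Θ (inner ℝ (b 2) x) *
        (k⁻¹ * fderiv ℝ cutoff (k⁻¹ • x) (B x)) := by
      have h1 : Continuous fun x : E 3 => Θ (inner ℝ (b 2) x) :=
        hΘ.continuous.comp (by fun_prop)
      have h3 : Continuous fun x : E 3 => fderiv ℝ cutoff (k⁻¹ • x) :=
        continuous_fderiv_cutoff.comp (by fun_prop)
      exact h1.aestronglyMeasurable.mul (aestronglyMeasurable_const.mul
        (aestronglyMeasurable_clm_apply h3.aestronglyMeasurable hB.aestronglyMeasurable))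
    have hi3 : Integrable fun x => Θ (inner ℝ (b 2) x) *
        (k⁻¹ * fderiv ℝ cutoff (k⁻¹ • x) (B x)) :=
      ⟨hm, (hrest k hk).trans_lt ENNReal.ofReal_lt_top⟩
    have h1 := htest k hk0
    rw [integral_add (hi2 k hk0) hi3] at h1
    rw [eq_neg_of_add_eq_zero_left h1, norm_neg, ← ENNReal.ofReal_le_ofReal_iff (by positivity),
      ofReal_norm]
    exact (enorm_integral_le_lintegral_enorm _).trans (hrest k hk)
  have hlim1 : Tendsto (fun k : ℝ => ∫ x, cutoff (k⁻¹ • x) * f x) atTop (𝓝 (∫ x, f x)) := by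
    refine tendsto_integral_filter_of_dominated_convergence (fun x => ‖f x‖)
      (Eventually.of_forall fun k =>
        (contDiff_cutoff.continuous.comp (continuous_const_smul k⁻¹)).aestronglyMeasurable.mul
          hfi.1) (Eventually.of_forall fun k => ae_of_all _ fun x => ?_) hfi.norm
      (ae_of_all _ fun x => ?_)
    · rw [norm_mul]
      exact mul_le_of_le_one_left (norm_nonneg _) (norm_cutoff_le _)
    · refine tendsto_const_nhds.congr' ?_
      filter_upwards [eventually_ge_atTop (max 1 ‖x‖)] with k hk
      have hk0 : 0 < k := by linarith [le_max_left 1 ‖x‖]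
      rw [cutoff_of_norm_le, one_mul]
      rw [norm_smul, Real.norm_of_nonneg (by positivity), inv_mul_le_iff₀ hk0, mul_one]
      exact (le_max_right _ _).trans hk
  have hlim2 : Tendsto (fun k : ℝ => ∫ x, cutoff (k⁻¹ • x) * f x) atTop (𝓝 0) := by
    refine squeeze_zero_norm' ((eventually_ge_atTop R).mono hbd) ?_
    have h1 := (tendsto_rpow_neg_atTop (by linarith : 0 < μ - 2)).const_mul (2 * L * M * C * C2)
    rw [mul_zero] at h1
    simpa only [neg_sub] using h1
  exact tendsto_nhds_unique hlim1 hlim2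

lemma fluxVanishesAEPlane (hB : DecayField B μ) (hμ : 2 < μ) (hdiv : HasDistDiv B 0) :
    FluxVanishesAEPlane B := by
  intro b
  set Ψ : E 2 × ℝ → E 3 := fun q => q.1 0 • b 0 + q.1 1 • b 1 + q.2 • b 2
  have hΨ : MeasurePreserving Ψ ((volume : Measure (E 2)).prod volume) volume :=
    measurePreserving_planes b
  have hΨi : ∀ u c, inner ℝ (b 2) (Ψ (u, c)) = c := inner_planes b
  set f : E 3 → ℝ := fun x => inner ℝ (b 2) (B x)
  have hslab : ∀ N : ℝ, Integrable (fun q : E 2 × ℝ => (Icc (-N) N).indicator 1 q.2 * f (Ψ q))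
      ((volume : Measure (E 2)).prod volume) := by
    intro N
    have hS : MeasurableSet {x : E 3 | |inner ℝ (b 2) x| ≤ N} := by
      have : Continuous fun x : E 3 => |inner ℝ (b 2) x| := by fun_prop
      exact (isClosed_le this continuous_const).measurableSet
    have h1 : IntegrableOn f {x : E 3 | |inner ℝ (b 2) x| ≤ N} :=
      (integrableOn_slab b hB hμ N).const_inner (b 2)
    refine (hΨ.integrable_comp_of_integrable (h1.integrable_indicator hS)).congr
      (ae_of_all _ fun q => ?_)
    obtain ⟨u, c⟩ := q
    have hiff : Ψ (u, c) ∈ {x : E 3 | |inner ℝ (b 2) x| ≤ N} ↔ c ∈ Icc (-N) N := by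
      change |inner ℝ (b 2) (Ψ (u, c))| ≤ N ↔ _
      rw [hΨi, abs_le]; rfl
    simp only [Function.comp_apply]
    by_cases hc : c ∈ Icc (-N) N
    · rw [indicator_of_mem (hiff.2 hc), indicator_of_mem hc, Pi.one_apply, one_mul]
    · rw [indicator_of_notMem (fun h => hc (hiff.1 h)), indicator_of_notMem hc, zero_mul]
  have hint : ∀ᵐ c : ℝ, Integrable fun u : E 2 => f (Ψ (u, c)) := by
    have h1 : ∀ k : ℕ, ∀ᵐ c : ℝ, Integrable fun u : E 2 =>
      (Icc (-(k : ℝ)) k).indicator (1 : ℝ → ℝ) c * f (Ψ (u, c)) := fun k => (hslab k).prod_left_ae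
    filter_upwards [ae_all_iff.2 h1] with c hc
    obtain ⟨k, hk⟩ := exists_nat_ge |c|
    have h3 := hc k
    rw [indicator_of_mem (show c ∈ Icc (-(k : ℝ)) k from abs_le.1 hk)] at h3
    simpa using h3
  set F : ℝ → ℝ := fun c => ∫ u : E 2, f (Ψ (u, c))
  have hFi : ∀ N : ℝ, IntegrableOn F (Icc (-N) N) := by
    intro N
    have h1 := (hslab N).integral_prod_right
    rw [← integrable_indicator_iff measurableSet_Icc]
    refine h1.congr (ae_of_all _ fun c => ?_)
    simp only [integral_const_mul]
    by_cases hc : c ∈ Icc (-N) N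
    · rw [indicator_of_mem hc, indicator_of_mem hc, Pi.one_apply, one_mul]
    · rw [indicator_of_notMem hc, indicator_of_notMem hc, zero_mul]
  have hFl : LocallyIntegrable F := by
    intro c
    refine ⟨Icc (-(|c| + 1)) (|c| + 1), Icc_mem_nhds ?_ ?_, hFi _⟩
    · linarith [neg_abs_le c]
    · linarith [le_abs_self c]
  have hF0 : ∀ᵐ c, F c = 0 := by
    refine ae_eq_zero_of_integral_contDiff_smul_eq_zero hFl fun g hg hgc => ?_
    obtain ⟨N, hN⟩ := hgc.isCompact.isBounded.subset_closedBall 0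
    obtain ⟨G, hG⟩ := hgc.exists_bound_of_continuous hg.continuous
    have hgN : ∀ c, c ∉ Icc (-N) N → g c = 0 := by
      intro c hc
      by_contra hne
      have h3 := hN (subset_tsupport g hne)
      rw [mem_closedBall_zero_iff, Real.norm_eq_abs] at h3
      exact hc (abs_le.1 h3)
    have hi : Integrable (fun q : E 2 × ℝ => g q.2 * f (Ψ q))
        ((volume : Measure (E 2)).prod volume) := by
      refine ((hslab N).bdd_mul (c := G) (f := fun q => g q.2)
        (hg.continuous.comp continuous_snd).aestronglyMeasurable
        (ae_of_all _ fun q => hG _)).congr (ae_of_all _ fun q => ?_)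
      simp only
      by_cases hc : q.2 ∈ Icc (-N) N
      · rw [indicator_of_mem hc, Pi.one_apply, one_mul]
      · rw [hgN _ hc, zero_mul, zero_mul]
    have h1 : ∫ c, g c • F c = ∫ q, g q.2 * f (Ψ q) ∂((volume : Measure (E 2)).prod volume) := by
      rw [integral_prod_symm _ hi]
      refine integral_congr_ae (ae_of_all _ fun c => ?_)
      simp only [F, smul_eq_mul, integral_const_mul]
    rw [h1, ← integral_mul_inner_eq_zero b hB hμ hdiv hg hgc]
    have hm : AEStronglyMeasurable fun x : E 3 => g (inner ℝ (b 2) x) * inner ℝ (b 2) (B x) :=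
      (hg.continuous.comp (by fun_prop : Continuous
        fun x : E 3 => inner ℝ (b 2) x)).aestronglyMeasurable.mul
        (aestronglyMeasurable_const.inner hB.aestronglyMeasurable)
    conv_rhs => rw [← hΨ.map_eq]
    rw [integral_map hΨ.aemeasurable (by rw [hΨ.map_eq]; exact hm)]
    refine integral_congr_ae (ae_of_all _ fun q => ?_)
    simp only [hΨi q.1 q.2, f]
  filter_upwards [hint, hF0] with c h1 h2
  exact ⟨h1, h2⟩

end Flux

end

section

/-! ### A length scale growing like the square root of the distance -/

variable {n : ℕ}

/-- The inverse of the length scale `(1 + |y|²)^(1/4) / 4`. -/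
def invScale (y : E n) : ℝ := 4 * (1 + ‖y‖ ^ 2) ^ (-(1 / 4) : ℝ)

lemma one_le_one_add_norm_sq (y : E n) : 1 ≤ 1 + ‖y‖ ^ 2 := by
  have := sq_nonneg ‖y‖; linarith

lemma invScale_pos (y : E n) : 0 < invScale y := by
  have := one_le_one_add_norm_sq y
  unfold invScale; positivity

lemma invScale_le (y : E n) : invScale y ≤ 4 := by
  have := Real.rpow_le_one_of_one_le_of_nonpos (one_le_one_add_norm_sq y)
    (by norm_num : (-(1 / 4) : ℝ) ≤ 0)
  unfold invScale; linarith

lemma invScale_sq (y : E n) : invScale y ^ 2 = 16 * (1 + ‖y‖ ^ 2) ^ (-(1 / 2) : ℝ) := by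
  have h := one_le_one_add_norm_sq y
  rw [invScale, mul_pow, ← Real.rpow_natCast ((1 + ‖y‖ ^ 2) ^ (-(1 / 4) : ℝ)),
    ← Real.rpow_mul (by linarith)]
  norm_num

lemma contDiff_invScale : ContDiff ℝ ∞ (invScale : E n → ℝ) :=
  contDiff_const.mul ((contDiff_const.add (contDiff_norm_sq ℝ)).rpow_const_of_ne
    fun y => (by have := one_le_one_add_norm_sq y; positivity))

lemma norm_fderiv_invScale_le (y : E n) : ‖fderiv ℝ invScale y‖ ≤ invScale y ^ 2 := by
  have h := one_le_one_add_norm_sq y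
  set q := 1 + ‖y‖ ^ 2
  have hq : 0 < q := by linarith
  have h1 : HasFDerivAt (fun y : E n => 1 + ‖y‖ ^ 2) (2 • innerSL ℝ y) y :=
    (hasStrictFDerivAt_norm_sq y).hasFDerivAt.const_add 1
  have h2 := (h1.rpow_const (p := (-(1 / 4) : ℝ)) (Or.inl hq.ne')).const_mul 4
  have h3 : fderiv ℝ invScale y = _ := h2.fderiv
  have hy : ‖y‖ ≤ q ^ (1 / 2 : ℝ) := by
    rw [← Real.sqrt_eq_rpow]
    exact Real.le_sqrt_of_sq_le (by simp only [q]; linarith)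
  rw [h3, norm_smul, norm_smul, invScale_sq]
  calc _ ≤ ‖(4 : ℝ)‖ * ((1 / 4 * q ^ (-(1 / 4) - 1 : ℝ)) * (2 * q ^ (1 / 2 : ℝ))) := by
        gcongr
        · rw [norm_mul, norm_neg, Real.norm_of_nonneg (by norm_num : (0 : ℝ) ≤ 1 / 4),
            Real.norm_of_nonneg (by positivity)]
        · refine (norm_nsmul_le).trans ?_
          rw [innerSL_apply_norm]
          simpa using hy
    _ = 2 * q ^ (-(3 / 4) : ℝ) := by
        rw [show (-(3 / 4) : ℝ) = (-(1 / 4) - 1) + 1 / 2 by norm_num, Real.rpow_add hq]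
        norm_num; ring
    _ ≤ 16 * q ^ (-(1 / 2) : ℝ) := by
        refine mul_le_mul (by norm_num) (Real.rpow_le_rpow_of_exponent_le h (by norm_num))
          (by positivity) (by norm_num)

/-- On the support of the truncation, the distance to the source is at most of the order
`|x|^(1/2)`. -/
lemma eight_mul_norm_sub_sq_le {x y : E n} (h : ‖invScale y • (x - y)‖ ^ 2 ≤ 2) :
    8 * ‖x - y‖ ^ 2 ≤ 1 + ‖x‖ + ‖x - y‖ := by
  have hq := one_le_one_add_norm_sq y
  rw [norm_smul, Real.norm_of_nonneg (invScale_pos y).le, mul_pow, invScale_sq,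
    Real.rpow_neg (by linarith), ← Real.sqrt_eq_rpow] at h
  have h0 : 0 < Real.sqrt (1 + ‖y‖ ^ 2) := Real.sqrt_pos.2 (by linarith)
  have h1 : Real.sqrt (1 + ‖y‖ ^ 2) ≤ 1 + ‖y‖ := by
    rw [Real.sqrt_le_left (by positivity)]
    nlinarith [norm_nonneg y]
  have h2 : ‖y‖ ≤ ‖x‖ + ‖x - y‖ := by
    calc ‖y‖ = ‖x - (x - y)‖ := by rw [sub_sub_cancel]
      _ ≤ _ := norm_sub_le _ _
  have h3 : 16 * ‖x - y‖ ^ 2 ≤ 2 * Real.sqrt (1 + ‖y‖ ^ 2) := by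
    rw [← div_le_iff₀ h0]
    calc _ = 16 * (Real.sqrt (1 + ‖y‖ ^ 2))⁻¹ * ‖x - y‖ ^ 2 := by rw [div_eq_mul_inv]; ring
      _ ≤ 2 := h
  linarith

lemma norm_sub_sq_le_norm {x y : E n} (hx : 1 ≤ ‖x‖) (h : ‖invScale y • (x - y)‖ ^ 2 ≤ 2) :
    ‖x - y‖ ^ 2 ≤ ‖x‖ := by
  have h1 := eight_mul_norm_sub_sq_le h
  nlinarith [sq_nonneg (‖x - y‖ - 1)]

lemma norm_le_of_invScale {x y : E n} (h : ‖invScale y • (x - y)‖ ^ 2 ≤ 2) :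
    ‖y‖ ≤ 2 * ‖x‖ + 1 := by
  have h1 := eight_mul_norm_sub_sq_le h
  have h2 : ‖y‖ ≤ ‖x‖ + ‖x - y‖ := by
    calc ‖y‖ = ‖x - (x - y)‖ := by rw [sub_sub_cancel]
      _ ≤ _ := norm_sub_le _ _
  have h3 : ‖x - y‖ ≤ 1 + ‖x‖ := by
    by_contra hcon
    nlinarith [norm_nonneg x, norm_nonneg (x - y)]
  linarith

lemma invScale_le_rpow {x y : E n} (hx : 0 < ‖x‖) (h : ‖x - y‖ ≤ ‖x‖ / 2) :
    invScale y ≤ 8 * ‖x‖ ^ (-(1 / 2) : ℝ) := by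
  have hq := one_le_one_add_norm_sq y
  have h2 : ‖x‖ ≤ ‖x - y‖ + ‖y‖ := by
    calc ‖x‖ = ‖(x - y) + y‖ := by rw [sub_add_cancel]
      _ ≤ _ := norm_add_le _ _
  have hy : ‖x‖ / 2 ≤ ‖y‖ := by linarith
  refine le_of_sq_le_sq ?_ (by positivity)
  rw [invScale_sq, mul_pow, ← Real.rpow_natCast (‖x‖ ^ (-(1 / 2) : ℝ)), ← Real.rpow_mul hx.le,
    Real.rpow_neg (by linarith), ← Real.sqrt_eq_rpow]
  have h1 : ‖x‖ / 2 ≤ Real.sqrt (1 + ‖y‖ ^ 2) :=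
    hy.trans (Real.le_sqrt_of_sq_le (by linarith))
  have h3 : (Real.sqrt (1 + ‖y‖ ^ 2))⁻¹ ≤ (‖x‖ / 2)⁻¹ := by gcongr
  have h4 : ‖x‖ ^ (-(1 / 2) * ((2 : ℕ) : ℝ)) = ‖x‖⁻¹ := by norm_num [Real.rpow_neg_one]
  rw [h4]
  rw [inv_div] at h3
  have h5 : 0 < ‖x‖⁻¹ := inv_pos.2 hx
  rw [div_eq_mul_inv] at h3
  linarith

/-! ### Truncation at the length scale -/

/-- The Coulomb kernel is truncated at a distance of the order `|y|^(1/2)` from the source `y`. -/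
def scaleTruncation (y w : E n) : ℝ := cutoff (invScale y • w)

lemma hasFDerivAt_scaleTruncation_fst (y w : E n) :
    HasFDerivAt (fun y => scaleTruncation y w)
      (fderiv ℝ cutoff (invScale y • w) w • fderiv ℝ invScale y) y := by
  have h1 := ((contDiff_invScale (n := n)).differentiable (by simp) y).hasFDerivAt
  have h2 := ((contDiff_cutoff (n := n)).differentiable (by simp) (invScale y • w)).hasFDerivAt
  refine (h2.comp y (h1.smul_const w)).congr_fderiv ?_
  ext v
  simp [mul_comm]

lemma hasFDerivAt_scaleTruncation_snd (y w : E n) :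
    HasFDerivAt (scaleTruncation y) (invScale y • fderiv ℝ cutoff (invScale y • w)) w := by
  have h2 := ((contDiff_cutoff (n := n)).differentiable (by simp) (invScale y • w)).hasFDerivAt
  refine (h2.comp w ((hasFDerivAt_id w).const_smul (invScale y))).congr_fderiv ?_
  ext v
  simp

lemma fderiv_cutoff_apply_eq_zero {u v : E n} (h : inner ℝ u v = 0) :
    fderiv ℝ cutoff u v = 0 := by
  have h1 : HasFDerivAt (fun w : E n => 2 - ‖w‖ ^ 2) (-(2 • innerSL ℝ u)) u :=
    (hasStrictFDerivAt_norm_sq u).hasFDerivAt.const_sub 2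
  have h2 : HasDerivAt Real.smoothTransition _ (2 - ‖u‖ ^ 2) :=
    ((Real.smoothTransition.contDiff (n := ⊤)).differentiable (by simp) _).hasDerivAt
  have h3 : fderiv ℝ cutoff u = _ := (h2.comp_hasFDerivAt u h1).fderiv
  rw [h3]
  simp [h]

/-- The derivatives of the cutoff vanish at distances larger than the length scale. -/
lemma norm_fderiv_cutoff_apply_le {M : ℝ} (hM : ∀ w : E n, ‖fderiv ℝ cutoff w‖ ≤ M) (v : E n) :
    ‖fderiv ℝ cutoff v v‖ ≤ 2 * M := by
  have hM0 : 0 ≤ M := (norm_nonneg _).trans (hM 0)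
  by_cases hv : 2 < ‖v‖ ^ 2
  · rw [fderiv_cutoff_of_lt_norm hv]; simpa using hM0
  · have h1 : ‖v‖ ≤ 2 := by nlinarith
    calc _ ≤ M * 2 := (ContinuousLinearMap.le_opNorm _ _).trans
          (mul_le_mul (hM v) h1 (norm_nonneg _) hM0)
      _ = _ := mul_comm _ _

lemma truncation_scaleTruncation : Truncation (scaleTruncation : E n → E n → ℝ) where
  contDiff := contDiff_cutoff.comp ((contDiff_invScale.comp contDiff_fst).smul contDiff_snd)
  growth_fst w := by
    have h1 : ContDiff ℝ ∞ fun y : E n => 1 - scaleTruncation y w :=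
      contDiff_const.sub (contDiff_cutoff.comp (contDiff_invScale.smul contDiff_const))
    have h2 : HasCompactSupport fun y : E n => 1 - scaleTruncation y w := by
      refine HasCompactSupport.intro (isCompact_closedBall (0 : E n) (16 * ‖w‖ ^ 2))
        fun y hy => ?_
      rw [mem_closedBall_zero_iff, not_le] at hy
      rw [scaleTruncation, cutoff_of_norm_le, sub_self]
      have hq := one_le_one_add_norm_sq y
      have h0 : 0 < Real.sqrt (1 + ‖y‖ ^ 2) := Real.sqrt_pos.2 (by linarith)
      have h3 : ‖y‖ ≤ Real.sqrt (1 + ‖y‖ ^ 2) := Real.le_sqrt_of_sq_le (by linarith)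
      rw [← abs_of_nonneg (norm_nonneg (invScale y • w)), ← sq_le_one_iff_abs_le_one, norm_smul,
        Real.norm_of_nonneg (invScale_pos y).le, mul_pow, invScale_sq,
        Real.rpow_neg (by linarith), ← Real.sqrt_eq_rpow]
      calc _ = (16 * ‖w‖ ^ 2) / Real.sqrt (1 + ‖y‖ ^ 2) := by rw [div_eq_mul_inv]; ring
        _ ≤ 1 := by rw [div_le_one h0]; linarith
    have h3 := (Function.HasTemperateGrowth.const (E := E n) (1 : ℝ)).sub
      (h2.toSchwartzMap h1).hasTemperateGrowth
    convert h3 using 1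
    funext y
    simp
  growth_snd y := by
    have h1 : ContDiff ℝ ∞ (scaleTruncation y) := contDiff_cutoff.comp (contDiff_const_smul _)
    have h2 : HasCompactSupport (scaleTruncation y) :=
      hasCompactSupport_cutoff.comp_smul (invScale_pos y).ne'
    exact (h2.toSchwartzMap h1).hasTemperateGrowth
  norm_le y w := norm_cutoff_le _
  apply_zero y := by
    rw [scaleTruncation, smul_zero]; exact cutoff_of_norm_le (by simp)
  radial y w v h := by
    rw [(hasFDerivAt_scaleTruncation_snd y w).fderiv, smul_apply,
      fderiv_cutoff_apply_eq_zero (by rw [inner_smul_left, h, mul_zero]), smul_zero]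
  deriv_fst := by
    obtain ⟨M, hM, hχ⟩ := exists_norm_fderiv_cutoff_le (n := n)
    refine ⟨2 * M * 4, by positivity, fun y w => ?_⟩
    have hσ := invScale_pos y
    rw [(hasFDerivAt_scaleTruncation_fst y w).fderiv, norm_smul]
    calc _ ≤ ‖fderiv ℝ cutoff (invScale y • w) w‖ * invScale y ^ 2 := by
          gcongr; exact norm_fderiv_invScale_le y
      _ = ‖fderiv ℝ cutoff (invScale y • w) (invScale y • w)‖ * invScale y := by
          rw [map_smul, norm_smul, Real.norm_of_nonneg hσ.le]; ring
      _ ≤ 2 * M * 4 := by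
          gcongr
          · exact norm_fderiv_cutoff_apply_le hχ _
          · exact invScale_le y
  deriv_snd := by
    obtain ⟨M, hM, hχ⟩ := exists_norm_fderiv_cutoff_le (n := n)
    refine ⟨4 * M, by positivity, fun y w => ?_⟩
    rw [(hasFDerivAt_scaleTruncation_snd y w).fderiv, smul_apply, norm_smul,
      Real.norm_of_nonneg (invScale_pos y).le, mul_assoc]
    exact mul_le_mul (invScale_le y)
      ((ContinuousLinearMap.le_opNorm _ _).trans (by gcongr; exact hχ _))
      (norm_nonneg _) (by norm_num)

end

section

/-! ### Averages at the length scale -/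

variable {n : ℕ} {H G : Type*} [NormedAddCommGroup H] [InnerProductSpace ℝ H]
  [NormedAddCommGroup G] [NormedSpace ℝ G]

/-- The average of `D` with weight `g`, at the length scale of the source. Averaging does not change
the decay rate, and every derivative improves it by `1 / 2`. -/
def scaleAverage (g : E n → H →L[ℝ] G) (D : E n → H) (x : E n) : G :=
  ∫ y, invScale y ^ n • g (invScale y • (x - y)) (D y)

section ScaleAverage

variable {g : E n → H →L[ℝ] G} {D : E n → H} {μ : ℝ}

lemma contDiff_scaleAverage (hD : LocallyIntegrable D) (hg : ContDiff ℝ ∞ g)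
    (hg0 : ∀ v, 2 < ‖v‖ ^ 2 → g v = 0) : ContDiff ℝ ∞ (scaleAverage g D) := by
  refine contDiff_integral_clm (k := fun x y => invScale y ^ n • g (invScale y • (x - y))) hD ?_ ?_
  · have h1 : ContDiff ℝ ∞ fun q : E n × E n => invScale q.2 :=
      contDiff_invScale.comp contDiff_snd
    exact (h1.pow n).smul (hg.comp (h1.smul (contDiff_fst.sub contDiff_snd)))
  · refine fun R => ⟨2 * R + 1, fun x y hx hy => ?_⟩
    rw [hg0, smul_zero]
    by_contra hcon
    have := norm_le_of_invScale (not_lt.1 hcon)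
    linarith

lemma integrable_scaleAverage_kernel (hD : LocallyIntegrable D) (hg : ContDiff ℝ ∞ g)
    (hg0 : ∀ v, 2 < ‖v‖ ^ 2 → g v = 0) (x : E n) :
    Integrable fun y => invScale y ^ n • g (invScale y • (x - y)) (D y) := by
  have hc : Continuous fun y : E n => invScale y ^ n • g (invScale y • (x - y)) := by
    have h1 : Continuous (invScale : E n → ℝ) := contDiff_invScale.continuous
    have h2 := hg.continuous
    fun_prop
  have h0 : ∀ y, y ∉ Metric.closedBall (0 : E n) (2 * ‖x‖ + 1) →
      invScale y ^ n • g (invScale y • (x - y)) = 0 := by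
    intro y hy
    rw [hg0, smul_zero]
    by_contra hcon
    exact hy (by simpa using norm_le_of_invScale (not_lt.1 hcon))
  obtain ⟨M, hM⟩ := (HasCompactSupport.intro (isCompact_closedBall (0 : E n) _)
    h0).exists_bound_of_continuous hc
  have hi := hD.integrableOn_isCompact (isCompact_closedBall (0 : E n) (2 * ‖x‖ + 1))
  rw [← integrableOn_iff_integrable_of_support_subset (s := Metric.closedBall (0 : E n)
    (2 * ‖x‖ + 1)) fun y hy => by_contra fun hcon => hy (by
      rw [← smul_apply, h0 y hcon, zero_apply])]
  refine (hi.norm.const_mul M).mono' (aestronglyMeasurable_clm_apply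
    (hc.aestronglyMeasurable) hi.1) (ae_of_all _ fun y => ?_)
  rw [← smul_apply]
  exact (ContinuousLinearMap.le_opNorm _ _).trans (by gcongr; exact hM y)

lemma two_mul_rpow_half_le {r : ℝ} (hr : 16 ≤ r) : 2 * r ^ (1 / 2 : ℝ) ≤ r / 2 := by
  rw [← Real.sqrt_eq_rpow]
  have h0 := Real.sqrt_nonneg r
  have h1 := Real.mul_self_sqrt (by linarith : 0 ≤ r)
  have h2 : 4 ≤ Real.sqrt r := Real.le_sqrt_of_sq_le (by linarith)
  nlinarith

/-- Integrals over a ball around `x` whose radius is of the order `|x|^(1/2)`. -/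
lemma exists_norm_integral_le_of_invScale {H : Type*} [NormedAddCommGroup H] {D : E n → H}
    (hn : 1 ≤ n) (hD : DecayField D μ) (hμ : 0 ≤ μ)
    (j : ℕ) : ∃ C R : ℝ, 0 ≤ C ∧ 16 ≤ R ∧ ∀ x : E n, R ≤ ‖x‖ → ∀ L : ℝ, 0 ≤ L →
      ∀ f : E n → G, (∀ y, ‖f y‖ ≤ L * (invScale y ^ j * ‖D y‖)) →
        (∀ y, 2 * ‖x‖ ^ (1 / 2 : ℝ) ≤ ‖x - y‖ → f y = 0) →
          ‖∫ y, f y‖ ≤ L * (C * ‖x‖ ^ (((n : ℝ) - j) / 2 - μ)) := by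
  obtain ⟨C, R, hC, hR, h⟩ := hD.exists_lintegral_ball_le_of_le hn hμ
    (a := 0) (by exact_mod_cast (by omega : 0 < n))
  refine ⟨8 ^ j * (C * 2 ^ (n : ℝ)), max R 16, by positivity, le_max_right _ _,
    fun x hx L hL f hf hf0 => ?_⟩
  have hxR : R ≤ ‖x‖ := (le_max_left _ _).trans hx
  have hx16 : 16 ≤ ‖x‖ := (le_max_right _ _).trans hx
  have hx0 : 0 < ‖x‖ := by linarith
  have hr := two_mul_rpow_half_le hx16
  set r := 2 * ‖x‖ ^ (1 / 2 : ℝ) with hr_def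
  have hr0 : 0 < r := by positivity
  have h1 := h x r hxR hr0 hr
  simp only [neg_zero, Real.rpow_zero, ENNReal.ofReal_one, one_mul, sub_zero] at h1
  rw [← ENNReal.ofReal_le_ofReal_iff (by positivity), ofReal_norm]
  refine (enorm_integral_le_lintegral_enorm _).trans ?_
  calc _ ≤ ∫⁻ y, (Metric.ball x r).indicator (fun y => ENNReal.ofReal
        (L * (8 * ‖x‖ ^ (-(1 / 2) : ℝ)) ^ j) * ‖D y‖ₑ) y := by
        refine lintegral_mono fun y => ?_
        by_cases hy : y ∈ Metric.ball x r
        · rw [indicator_of_mem hy, ← ofReal_norm, ← ofReal_norm,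
            ← ENNReal.ofReal_mul (by positivity)]
          rw [mem_ball_iff_norm'] at hy
          refine ENNReal.ofReal_le_ofReal ((hf y).trans ?_)
          rw [mul_assoc]
          have h2 := invScale_le_rpow hx0 (hy.le.trans hr)
          have h3 := (invScale_pos y).le
          gcongr
        · rw [mem_ball_iff_norm', not_lt] at hy
          rw [hf0 y hy]; simp
    _ ≤ ENNReal.ofReal (L * (8 * ‖x‖ ^ (-(1 / 2) : ℝ)) ^ j) *
          ENNReal.ofReal (C * r ^ (n : ℝ) * ‖x‖ ^ (-μ)) := by
        rw [lintegral_indicator Metric.isOpen_ball.measurableSet,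
          lintegral_const_mul' _ _ ENNReal.ofReal_ne_top]
        gcongr
    _ = _ := by
        rw [← ENNReal.ofReal_mul (by positivity)]
        congr 1
        rw [hr_def, mul_pow, Real.mul_rpow (by norm_num) (by positivity),
          ← Real.rpow_natCast (‖x‖ ^ (-(1 / 2) : ℝ)), ← Real.rpow_mul hx0.le,
          ← Real.rpow_mul hx0.le, show ((n : ℝ) - j) / 2 - μ = (-(1 / 2) * j) + (1 / 2 * n) + -μ by
            ring, Real.rpow_add hx0, Real.rpow_add hx0]
        ring

lemma exists_norm_scaleAverage_le (hn : 1 ≤ n) (hD : DecayField D μ) (hμ : 0 ≤ μ)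
    (hg : ContDiff ℝ ∞ g) (hg0 : ∀ v, 2 < ‖v‖ ^ 2 → g v = 0) :
    ∃ C R : ℝ, ∀ x, R ≤ ‖x‖ → ‖scaleAverage g D x‖ ≤ C * ‖x‖ ^ (-μ) := by
  have hgc : HasCompactSupport g := by
    refine HasCompactSupport.intro (isCompact_closedBall (0 : E n) 2) fun w hw => hg0 w ?_
    rw [mem_closedBall_zero_iff, not_le] at hw
    nlinarith
  obtain ⟨M, hM⟩ := hgc.exists_bound_of_continuous hg.continuous
  have hM0 : 0 ≤ M := (norm_nonneg _).trans (hM 0)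
  obtain ⟨C, R, hC, hR, h⟩ := exists_norm_integral_le_of_invScale (G := G) hn hD hμ n
  refine ⟨M * C, R, fun x hx => ?_⟩
  have h1 := h x hx M hM0 (fun y => invScale y ^ n • g (invScale y • (x - y)) (D y))
    (fun y => ?_) fun y hy => ?_
  · rw [sub_self, zero_div, zero_sub] at h1
    rwa [mul_assoc]
  · have h2 := (invScale_pos y).le
    rw [norm_smul, norm_pow, Real.norm_of_nonneg h2]
    calc _ ≤ invScale y ^ n * (M * ‖D y‖) := by
          gcongr
          exact (ContinuousLinearMap.le_opNorm _ _).trans (by gcongr; exact hM _)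
      _ = _ := by ring
  · rw [hg0, zero_apply, smul_zero]
    by_contra hcon
    have h3 := norm_sub_sq_le_norm (by linarith) (not_lt.1 hcon)
    have h4 : ‖x - y‖ ≤ ‖x‖ ^ (1 / 2 : ℝ) := by
      rw [← Real.sqrt_eq_rpow]; exact Real.le_sqrt_of_sq_le h3
    have h5 : 0 < ‖x‖ ^ (1 / 2 : ℝ) := Real.rpow_pos_of_pos (by linarith) _
    linarith

lemma exists_norm_fderiv_scaleAverage_le (hn : 1 ≤ n) (hD : DecayField D μ) (hμ : 0 ≤ μ)
    (hg : ContDiff ℝ ∞ g) (hg0 : ∀ v, 2 < ‖v‖ ^ 2 → g v = 0) :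
    ∃ C R : ℝ, ∀ x, R ≤ ‖x‖ → ‖fderiv ℝ (scaleAverage g D) x‖ ≤ C * ‖x‖ ^ (-(μ + 1 / 2)) := by
  have hgc : HasCompactSupport g := by
    refine HasCompactSupport.intro (isCompact_closedBall (0 : E n) 2) fun w hw => hg0 w ?_
    rw [mem_closedBall_zero_iff, not_le] at hw
    nlinarith
  obtain ⟨L, hL⟩ := hg.lipschitzWith_of_hasCompactSupport hgc (by simp)
  have hDl := hD.locallyIntegrable hn
  obtain ⟨C, R, hC, hR, h⟩ := exists_norm_integral_le_of_invScale (G := G) hn hD hμ (n + 1)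
  refine ⟨L * C, R, fun x₀ hx₀ => norm_fderiv_le_of_lip' ℝ (by positivity) ?_⟩
  filter_upwards [Metric.ball_mem_nhds x₀ one_pos] with x hx
  rw [mem_ball_iff_norm] at hx
  have h1 := h x₀ hx₀ (L * ‖x - x₀‖) (by positivity)
    (fun y => invScale y ^ n • g (invScale y • (x - y)) (D y) -
      invScale y ^ n • g (invScale y • (x₀ - y)) (D y)) (fun y => ?_) fun y hy => ?_
  · rw [integral_sub (integrable_scaleAverage_kernel hDl hg hg0 x)
      (integrable_scaleAverage_kernel hDl hg hg0 x₀)] at h1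
    refine h1.trans_eq ?_
    rw [show ((n : ℝ) - ((n + 1 : ℕ) : ℝ)) / 2 - μ = -(μ + 1 / 2) by push_cast; ring]
    ring
  · have h2 := (invScale_pos y).le
    rw [← smul_sub, ← sub_apply, norm_smul, norm_pow, Real.norm_of_nonneg h2]
    have h3 : ‖g (invScale y • (x - y)) - g (invScale y • (x₀ - y))‖ ≤
        L * (invScale y * ‖x - x₀‖) := by
      refine (hL.norm_sub_le _ _).trans_eq ?_
      rw [← smul_sub, norm_smul, Real.norm_of_nonneg h2, sub_sub_sub_cancel_right]
    calc _ ≤ invScale y ^ n * ((L * (invScale y * ‖x - x₀‖)) * ‖D y‖) := by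
          gcongr
          exact (ContinuousLinearMap.le_opNorm _ _).trans (by gcongr)
      _ = _ := by ring
  · have hx₀0 : 0 ≤ ‖x₀‖ := norm_nonneg _
    have hdiff : ‖x‖ ≤ ‖x₀‖ + 1 ∧ ‖x₀‖ - 1 ≤ ‖x‖ := by
      have h2 := abs_le.1 ((abs_norm_sub_norm_le x x₀).trans hx.le)
      exact ⟨by linarith [h2.2], by linarith [h2.1]⟩
    have hdist : ‖x₀ - y‖ ≤ 1 + ‖x - y‖ := by
      have h2 : ‖x₀ - y‖ ≤ ‖x - x₀‖ + ‖x - y‖ := by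
        rw [← norm_neg (x - x₀)]
        exact (congrArg norm (by abel : x₀ - y = -(x - x₀) + (x - y))).trans_le (norm_add_le _ _)
      linarith
    rw [← Real.sqrt_eq_rpow] at hy
    have hs0 := Real.mul_self_sqrt hx₀0
    have hs1 : 4 ≤ Real.sqrt ‖x₀‖ := Real.le_sqrt_of_sq_le (by linarith)
    rw [hg0, hg0, zero_apply, smul_zero, sub_zero]
    · by_contra hcon
      have h3 := norm_sub_sq_le_norm (by linarith) (not_lt.1 hcon)
      nlinarith
    · by_contra hcon
      have h3 := norm_sub_sq_le_norm (by linarith) (not_lt.1 hcon)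
      nlinarith

end ScaleAverage

/-! ### The smooth part of the field -/

/-- The radial derivative of the cutoff, divided by the power of the norm in the Coulomb kernel. -/
def cutoffProfile (v : E n) : ℝ := (‖v‖ ^ n)⁻¹ * fderiv ℝ cutoff v v

lemma cutoffProfile_of_lt_norm {v : E n} (hv : 2 < ‖v‖ ^ 2) : cutoffProfile v = 0 := by
  rw [cutoffProfile, fderiv_cutoff_of_lt_norm hv, zero_apply, mul_zero]

lemma contDiff_cutoffProfile : ContDiff ℝ ∞ (cutoffProfile : E n → ℝ) := by
  rw [contDiff_iff_contDiffAt]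
  intro v
  by_cases hv : ‖v‖ < 1
  · have h : (cutoffProfile : E n → ℝ) =ᶠ[𝓝 v] fun _ => 0 := by
      filter_upwards [(isOpen_lt continuous_norm continuous_const).mem_nhds hv] with w hw
      rw [cutoffProfile, fderiv_cutoff_of_norm_lt hw, zero_apply, mul_zero]
    exact contDiffAt_const.congr_of_eventuallyEq h
  · have hv0 : 0 < ‖v‖ := by linarith
    have h1 : ContDiff ℝ ∞ (fderiv ℝ (cutoff : E n → ℝ)) :=
      contDiff_cutoff.fderiv_right (by simp)
    refine ContDiffAt.mul ?_ (h1.clm_apply contDiff_id).contDiffAt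
    exact ((contDiffAt_norm ℝ (norm_pos_iff.1 hv0)).pow n).inv (by positivity)

namespace CrossData

variable {F : Type*} [NormedAddCommGroup F] [InnerProductSpace ℝ F] (K : CrossData n F)
  {B : E n → F} {μ : ℝ}

/-- The component of the field along which the length scale varies. -/
def scaleGradient (B : E n → F) (y : E n) : ℝ :=
  (invScale y ^ 2)⁻¹ * fderiv ℝ invScale y (K.Q (B y))

lemma norm_scaleGradient_le (B : E n → F) (y : E n) :
    ‖K.scaleGradient B y‖ ≤ ‖K.Q‖ * ‖B y‖ := by
  have h := invScale_pos y
  rw [scaleGradient, norm_mul, norm_inv, norm_pow, Real.norm_of_nonneg h.le,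
    inv_mul_le_iff₀ (by positivity)]
  exact (ContinuousLinearMap.le_opNorm _ _).trans (mul_le_mul (norm_fderiv_invScale_le y)
    (K.Q.le_opNorm _) (norm_nonneg _) (by positivity))

lemma decayField_scaleGradient (hB : DecayField B μ) : DecayField (K.scaleGradient B) μ := by
  obtain ⟨p, hp, hBp⟩ := hB.memLp
  obtain ⟨C, R, hC, hR, hdec⟩ := hB.decay.exists_nonneg
  have hm : AEStronglyMeasurable (K.scaleGradient B) := by
    have h1 : Continuous (invScale : E n → ℝ) := contDiff_invScale.continuous
    have h2 : Continuous fun y : E n => (invScale y ^ 2)⁻¹ :=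
      (h1.pow 2).inv₀ fun y => (pow_pos (invScale_pos y) 2).ne'
    have h3 : Continuous (fderiv ℝ (invScale : E n → ℝ)) :=
      contDiff_invScale.continuous_fderiv (by simp)
    exact h2.aestronglyMeasurable.mul (aestronglyMeasurable_clm_apply h3.aestronglyMeasurable
      (K.Q.continuous.comp_aestronglyMeasurable hBp.1))
  refine ⟨⟨p, hp, hBp.of_le_mul hm (ae_of_all _ (K.norm_scaleGradient_le B))⟩, ‖K.Q‖ * C, R,
    hdec.mono fun y hy hyR => ?_⟩
  rw [mul_assoc]
  exact (K.norm_scaleGradient_le B y).trans (by gcongr; exact hy hyR)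

/-- The weight with which `scaleGradient` is averaged. -/
def gradientWeight (v : E n) : ℝ →L[ℝ] F :=
  ContinuousLinearMap.toSpanSingleton ℝ (cutoffProfile v • K.P v)

lemma contDiff_gradientWeight : ContDiff ℝ ∞ K.gradientWeight :=
  (ContinuousLinearMap.toSpanSingletonCLE (𝕜 := ℝ) (E := F)).contDiff.comp
    (contDiff_cutoffProfile.smul K.P.contDiff)

lemma gradientWeight_eq_zero (v : E n) (hv : 2 < ‖v‖ ^ 2) : K.gradientWeight v = 0 := by
  rw [gradientWeight, cutoffProfile_of_lt_norm hv, zero_smul,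
    ContinuousLinearMap.toSpanSingleton_zero]

lemma contDiff_cutoffProfile_smul_id :
    ContDiff ℝ ∞ fun v : E n => cutoffProfile v • ContinuousLinearMap.id ℝ F :=
  contDiff_cutoffProfile.smul contDiff_const

lemma cutoffProfile_smul_id_eq_zero (v : E n) (hv : 2 < ‖v‖ ^ 2) :
    cutoffProfile v • ContinuousLinearMap.id ℝ F = 0 := by
  rw [cutoffProfile_of_lt_norm hv, zero_smul]

/-- The field that is not accounted for by the truncated potential is an average at the length
scale. -/
lemma remainder_scaleTruncation (hn : 1 ≤ n) (hB : DecayField B μ) :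
    K.remainder scaleTruncation B = fun x => (1 / sphereArea n) •
      (scaleAverage K.gradientWeight (K.scaleGradient B) x -
        scaleAverage (fun v => cutoffProfile v • ContinuousLinearMap.id ℝ F) B x) := by
  funext x
  rw [remainder, scaleAverage, scaleAverage, ← integral_sub
    (integrable_scaleAverage_kernel ((K.decayField_scaleGradient hB).locallyIntegrable hn)
      K.contDiff_gradientWeight K.gradientWeight_eq_zero x)
    (integrable_scaleAverage_kernel (hB.locallyIntegrable hn) contDiff_cutoffProfile_smul_id
      cutoffProfile_smul_id_eq_zero x)]
  congr 1
  refine integral_congr_ae (ae_of_all _ fun y => ?_)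
  have hσ := invScale_pos y
  simp only
  rw [(hasFDerivAt_scaleTruncation_fst y (x - y)).fderiv,
    (hasFDerivAt_scaleTruncation_snd y (x - y)).fderiv]
  generalize x - y = w
  simp only [gradientWeight, cutoffProfile, scaleGradient, smul_apply, map_smul, norm_smul,
    smul_sub, smul_smul, ContinuousLinearMap.toSpanSingleton_apply, ContinuousLinearMap.id_apply,
    smul_eq_mul, Real.norm_of_nonneg hσ.le, mul_pow, mul_inv]
  congr 2 <;> field_simp

lemma contDiff_remainder (hn : 1 ≤ n) (hB : DecayField B μ) :
    ContDiff ℝ ∞ (K.remainder scaleTruncation B) := by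
  rw [K.remainder_scaleTruncation hn hB]
  exact contDiff_const.smul ((contDiff_scaleAverage
    ((K.decayField_scaleGradient hB).locallyIntegrable hn) K.contDiff_gradientWeight
      K.gradientWeight_eq_zero).sub
    (contDiff_scaleAverage (hB.locallyIntegrable hn) contDiff_cutoffProfile_smul_id
      cutoffProfile_smul_id_eq_zero))

lemma exists_norm_remainder_le (hn : 1 ≤ n) (hB : DecayField B μ) (hμ : 0 ≤ μ) :
    ∃ C R : ℝ, ∀ x, R ≤ ‖x‖ → ‖K.remainder scaleTruncation B x‖ ≤ C * ‖x‖ ^ (-μ) := by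
  have hω := sphereArea_pos hn
  obtain ⟨C₁, R₁, h₁⟩ := exists_norm_scaleAverage_le hn (K.decayField_scaleGradient hB) hμ
    K.contDiff_gradientWeight K.gradientWeight_eq_zero
  obtain ⟨C₂, R₂, h₂⟩ := exists_norm_scaleAverage_le hn hB hμ contDiff_cutoffProfile_smul_id
    cutoffProfile_smul_id_eq_zero
  refine ⟨1 / sphereArea n * (C₁ + C₂), max R₁ R₂, fun x hx => ?_⟩
  rw [K.remainder_scaleTruncation hn hB, norm_smul, Real.norm_of_nonneg (by positivity),
    mul_assoc, add_mul]
  refine mul_le_mul_of_nonneg_left ((norm_sub_le _ _).trans (add_le_add ?_ ?_)) (by positivity)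
  · exact h₁ x ((le_max_left _ _).trans hx)
  · exact h₂ x ((le_max_right _ _).trans hx)

lemma exists_norm_fderiv_remainder_le (hn : 1 ≤ n) (hB : DecayField B μ) (hμ : 0 ≤ μ) :
    ∃ C R : ℝ, ∀ x, R ≤ ‖x‖ →
      ‖fderiv ℝ (K.remainder scaleTruncation B) x‖ ≤ C * ‖x‖ ^ (-(μ + 1 / 2)) := by
  have hω := sphereArea_pos hn
  have hDl := (K.decayField_scaleGradient hB).locallyIntegrable hn
  have hBl := hB.locallyIntegrable hn
  obtain ⟨C₁, R₁, h₁⟩ := exists_norm_fderiv_scaleAverage_le hn (K.decayField_scaleGradient hB) hμ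
    K.contDiff_gradientWeight K.gradientWeight_eq_zero
  obtain ⟨C₂, R₂, h₂⟩ := exists_norm_fderiv_scaleAverage_le hn hB hμ contDiff_cutoffProfile_smul_id
    cutoffProfile_smul_id_eq_zero
  refine ⟨1 / sphereArea n * (C₁ + C₂), max R₁ R₂, fun x hx => ?_⟩
  have d₁ := (contDiff_scaleAverage hDl K.contDiff_gradientWeight
    K.gradientWeight_eq_zero).differentiable (by simp) x
  have d₂ := (contDiff_scaleAverage hBl contDiff_cutoffProfile_smul_id
    cutoffProfile_smul_id_eq_zero).differentiable (by simp) x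
  rw [K.remainder_scaleTruncation hn hB]
  change ‖fderiv ℝ ((1 / sphereArea n) • (scaleAverage K.gradientWeight (K.scaleGradient B) -
    scaleAverage (fun v => cutoffProfile v • ContinuousLinearMap.id ℝ F) B)) x‖ ≤ _
  rw [((d₁.hasFDerivAt.sub d₂.hasFDerivAt).const_smul (1 / sphereArea n)).fderiv, norm_smul,
    Real.norm_of_nonneg (by positivity), mul_assoc, add_mul]
  refine mul_le_mul_of_nonneg_left ((norm_sub_le _ _).trans (add_le_add ?_ ?_)) (by positivity)
  · exact h₁ x ((le_max_left _ _).trans hx)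
  · exact h₂ x ((le_max_right _ _).trans hx)

/-- The truncated potential decays faster than the potential by a factor `|x|^(-1/2)`, since the
integration is restricted to a ball of radius of the order `|x|^(1/2)`. -/
lemma exists_norm_potential_scaleTruncation_le (hn : 2 ≤ n) (hB : DecayField B μ) (hμ : 0 ≤ μ) :
    ∃ C R : ℝ, ∀ x, R ≤ ‖x‖ →
      ‖K.potential scaleTruncation B x‖ ≤ C * ‖x‖ ^ (-(μ - 1 / 2)) := by
  have hω := sphereArea_pos (n := n) (by omega)
  obtain ⟨C, R, hC, hR, h⟩ := hB.exists_lintegral_ball_le_of_le (by omega) hμ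
    (a := (n : ℝ) - 1) (by linarith)
  refine ⟨1 / sphereArea n * (C * 2), max R 16, fun x hx => ?_⟩
  have hxR : R ≤ ‖x‖ := (le_max_left _ _).trans hx
  have hx16 : 16 ≤ ‖x‖ := (le_max_right _ _).trans hx
  have hx0 : 0 < ‖x‖ := by linarith
  have hs : 0 < ‖x‖ ^ (1 / 2 : ℝ) := by positivity
  have h1 := h x (2 * ‖x‖ ^ (1 / 2 : ℝ)) hxR (by positivity) (two_mul_rpow_half_le hx16)
  rw [← ENNReal.ofReal_le_ofReal_iff (by positivity), ofReal_norm, potential, enorm_neg,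
    enorm_smul, ← ofReal_norm, Real.norm_of_nonneg (by positivity), mul_assoc,
    ENNReal.ofReal_mul (by positivity)]
  refine mul_le_mul' le_rfl ((enorm_integral_le_lintegral_enorm _).trans ?_)
  calc _ ≤ ∫⁻ y in Metric.ball x (2 * ‖x‖ ^ (1 / 2 : ℝ)),
        ENNReal.ofReal (‖x - y‖ ^ (-((n : ℝ) - 1))) * ‖B y‖ₑ := by
        rw [← lintegral_indicator Metric.isOpen_ball.measurableSet]
        refine lintegral_mono fun y => ?_
        by_cases hy : y ∈ Metric.ball x (2 * ‖x‖ ^ (1 / 2 : ℝ))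
        · rw [indicator_of_mem hy]
          exact K.enorm_kernel_le truncation_scaleTruncation x y
        · rw [mem_ball_iff_norm', not_lt] at hy
          rw [scaleTruncation, cutoff_of_le_norm, zero_mul, zero_smul, enorm_zero]
          · exact zero_le
          by_contra hcon
          have h3 := norm_sub_sq_le_norm (by linarith) (not_le.1 hcon).le
          have h4 : ‖x - y‖ ≤ ‖x‖ ^ (1 / 2 : ℝ) := by
            rw [← Real.sqrt_eq_rpow]; exact Real.le_sqrt_of_sq_le h3
          linarith
    _ ≤ _ := h1
    _ = _ := by
        rw [sub_sub_cancel, Real.rpow_one, show -(μ - 1 / 2) = 1 / 2 + -μ by ring,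
          Real.rpow_add hx0]
        congr 1; ring

/-- The curl of `P ∇ψ` vanishes, by the symmetry of the second derivative. -/
lemma cu_fderiv_P_gradient (ψ : 𝓢(E n, ℝ)) (x : E n) :
    K.cu (fderiv ℝ (fun y => K.P (gradient ψ y)) x) = 0 := by
  have hsmooth : ContDiff ℝ ∞ (ψ : E n → ℝ) := ψ.smooth ⊤
  have hd : HasFDerivAt (fderiv ℝ (ψ : E n → ℝ)) (fderiv ℝ (fderiv ℝ ψ) x) x :=
    ((hsmooth.fderiv_right (m := ∞) (by simp)).differentiable (by simp) x).hasFDerivAt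
  set L : (E n →L[ℝ] ℝ) →L[ℝ] E n :=
    (InnerProductSpace.toDual ℝ (E n)).symm.toContinuousLinearEquiv.toContinuousLinearMap
  have h1 : HasFDerivAt (fun y => K.P (gradient ψ y))
      ((K.P.comp L).comp (fderiv ℝ (fderiv ℝ ψ) x)) x :=
    (K.P.comp L).hasFDerivAt.comp x hd
  have hsymm : ∀ v w, fderiv ℝ (fderiv ℝ ψ) x v w = fderiv ℝ (fderiv ℝ ψ) x w v :=
    ((ψ.smooth 2).contDiffAt.isSymmSndFDerivAt (by simp)).eq
  have h2 : ∀ i, (L (fderiv ℝ (fderiv ℝ ψ) x (EuclideanSpace.single i 1))) =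
      ∑ j, fderiv ℝ (fderiv ℝ ψ) x (EuclideanSpace.single i 1) (EuclideanSpace.single j 1) •
        EuclideanSpace.single j (1 : ℝ) := by
    intro i
    conv_lhs => rw [← sum_smul_single (L _)]
    refine Finset.sum_congr rfl fun j _ => ?_
    congr 1
    have h3 : inner ℝ (L (fderiv ℝ (fderiv ℝ ψ) x (EuclideanSpace.single i 1)))
        (EuclideanSpace.single j (1 : ℝ)) = fderiv ℝ (fderiv ℝ ψ) x (EuclideanSpace.single i 1)
          (EuclideanSpace.single j 1) := InnerProductSpace.toDual_symm_apply
    rw [← h3, EuclideanSpace.inner_single_right]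
    simp
  rw [h1.fderiv, K.cu_apply]
  simp only [ContinuousLinearMap.comp_apply, h2, map_sum, map_smul]
  -- the sum is antisymmetric in the two indices
  have h4 : ∀ S : E n, S = -S → S = 0 := fun S hS => by
    have : (2 : ℝ) • S = 0 := by rw [two_smul]; nth_rewrite 2 [hS]; exact add_neg_cancel S
    simpa using this
  refine h4 _ ?_
  refine Finset.sum_comm.trans ?_
  simp_rw [← Finset.sum_neg_distrib]
  refine Finset.sum_congr rfl fun i _ => Finset.sum_congr rfl fun j _ => ?_
  rw [hsymm, K.cr_P_swap, smul_neg]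

/-- The remainder is the difference of the field and a curl. -/
lemma isDivFree_remainder [CompleteSpace F] {T : E n → E n → ℝ} (hn : 2 ≤ n) (hT : Truncation T)
    (hB : DecayField B μ) (hμ : 1 < μ) (hdiv : K.IsDivFree B) :
    K.IsDivFree (K.remainder T B) := by
  intro ψ
  set L : (E n →L[ℝ] ℝ) →L[ℝ] E n :=
    (InnerProductSpace.toDual ℝ (E n)).symm.toContinuousLinearEquiv.toContinuousLinearMap
  set φ : 𝓢(E n, F) := (SchwartzMap.fderivCLM ℝ (E n) ℝ ψ).postcompCLM (K.P.comp L)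
  have hφ : (φ : E n → F) = fun y => K.P (gradient ψ y) := rfl
  have h1 := K.integral_inner_potential_cu hn hT hB hμ hdiv φ
  have h2 : ∀ (b : F) x, inner ℝ b (φ x) = fderiv ℝ ψ x (K.Q b) := by
    intro b x
    rw [hφ]
    simp only
    rw [real_inner_comm, K.inner_P, inner_gradient_left]
  have h3 : ∀ x, K.cu (fderiv ℝ φ x) = 0 := fun x => by
    rw [hφ]; exact K.cu_fderiv_P_gradient ψ x
  simp only [h2, h3, inner_zero_right, integral_zero] at h1
  rw [hdiv ψ] at h1
  linarith

end CrossData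

end

section

/-! ### The special gauge -/

variable {n : ℕ}

/-- Integrals over `[0, 1]` of smooth functions depend smoothly on a parameter: they are
convolutions with an indicator function. -/
lemma contDiff_intervalIntegral {H : Type*} [NormedAddCommGroup H] [NormedSpace ℝ H]
    {f : E n → ℝ → H} (hf : ContDiff ℝ ∞ fun q : E n × ℝ => f q.1 q.2) :
    ContDiff ℝ ∞ fun x => ∫ s in (0 : ℝ)..1, f x s := by
  let β : ContDiffBump (0 : ℝ) := ⟨1, 2, one_pos, one_lt_two⟩
  have hβ : ContDiff ℝ ∞ fun q : E n × ℝ => β q.2 • f q.1 (-q.2) :=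
    (β.contDiff.comp contDiff_snd).smul (hf.comp (contDiff_fst.prodMk contDiff_snd.neg))
  have hone : LocallyIntegrable ((Ioc (0 : ℝ) 1).indicator fun _ => (1 : ℝ)) :=
    ((integrable_indicator_iff measurableSet_Ioc).2
      (integrableOn_const (by simp))).locallyIntegrable
  have h := contDiffOn_convolution_right_with_param_comp (μ := (volume : Measure ℝ)) (n := ⊤)
    (ContinuousLinearMap.lsmul ℝ ℝ : ℝ →L[ℝ] H →L[ℝ] H) (s := (univ : Set (E n)))
    (v := fun _ => (0 : ℝ)) contDiffOn_const (f := (Ioc (0 : ℝ) 1).indicator fun _ => (1 : ℝ))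
    (g := fun x u => β u • f x (-u)) isOpen_univ β.hasCompactSupport.isCompact
    (fun x u _ hu => by rw [image_eq_zero_of_notMem_tsupport hu, zero_smul]) hone hβ.contDiffOn
  rw [contDiffOn_univ] at h
  convert h using 1
  funext x
  rw [intervalIntegral.integral_of_le zero_le_one, convolution,
    ← integral_indicator measurableSet_Ioc]
  refine integral_congr_ae (ae_of_all _ fun s => ?_)
  simp only [zero_sub, neg_neg, ContinuousLinearMap.lsmul_apply]
  by_cases hs : s ∈ Ioc (0 : ℝ) 1
  · rw [indicator_of_mem hs, indicator_of_mem hs, one_smul, β.one_of_mem_closedBall, one_smul]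
    rw [mem_closedBall_zero_iff, norm_neg, Real.norm_of_nonneg hs.1.le]
    exact hs.2
  · rw [indicator_of_notMem hs, indicator_of_notMem hs, zero_smul]

lemma exists_norm_le_rpow_of_continuous {H : Type*} [NormedAddCommGroup H] {f : E n → H}
    (hf : Continuous f) {C R a : ℝ} (ha : 0 ≤ a) (h : ∀ x, R ≤ ‖x‖ → ‖f x‖ ≤ C * ‖x‖ ^ (-a)) :
    ∃ C', 0 ≤ C' ∧ ∀ x, x ≠ 0 → ‖f x‖ ≤ C' * ‖x‖ ^ (-a) := by
  set R' := max R 1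
  have hR' : 0 < R' := by positivity
  obtain ⟨M, hM⟩ := (isCompact_closedBall (0 : E n) R').exists_bound_of_continuousOn
    hf.continuousOn
  have hM0 : 0 ≤ M := (norm_nonneg _).trans (hM 0 (by simpa using hR'.le))
  refine ⟨|C| + M * R' ^ a, by positivity, fun x hx => ?_⟩
  have hx0 : 0 < ‖x‖ := norm_pos_iff.2 hx
  rcases le_or_gt R' ‖x‖ with hxR | hxR
  · refine (h x ((le_max_left _ _).trans hxR)).trans ?_
    gcongr
    have : 0 ≤ M * R' ^ a := by positivity
    linarith [le_abs_self C]
  · refine (hM x (by simpa using hxR.le)).trans ?_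
    have h1 : 1 ≤ R' ^ a * ‖x‖ ^ (-a) := by
      rw [Real.rpow_neg hx0.le, ← div_eq_mul_inv, one_le_div (by positivity)]
      gcongr
    calc M = M * 1 := (mul_one M).symm
      _ ≤ M * (R' ^ a * ‖x‖ ^ (-a)) := by gcongr
      _ ≤ _ := by
        rw [add_mul, mul_assoc]
        have : 0 ≤ |C| * ‖x‖ ^ (-a) := by positivity
        linarith

lemma exists_bound_of_decay {H : Type*} [NormedAddCommGroup H] {f : E n → H}
    (hf : Continuous f) {C R a : ℝ} (ha : 0 ≤ a) (h : ∀ x, R ≤ ‖x‖ → ‖f x‖ ≤ C * ‖x‖ ^ (-a)) :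
    ∃ M, ∀ x, ‖f x‖ ≤ M := by
  obtain ⟨M, hM⟩ := (isCompact_closedBall (0 : E n) (max R 1)).exists_bound_of_continuousOn
    hf.continuousOn
  refine ⟨max M |C|, fun x => ?_⟩
  rcases le_or_gt ‖x‖ (max R 1) with hx | hx
  · exact (hM x (by simpa using hx)).trans (le_max_left _ _)
  · have h1 : 1 ≤ ‖x‖ := (le_max_right R 1).trans hx.le
    refine (h x ((le_max_left R 1).trans hx.le)).trans (le_trans ?_ (le_max_right _ _))
    calc _ ≤ |C| * 1 := by
          gcongr
          · exact le_abs_self C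
          · exact Real.rpow_le_one_of_one_le_of_nonpos h1 (by linarith)
      _ = _ := mul_one _

lemma memLp_of_decay {H : Type*} [NormedAddCommGroup H] {f : E n → H} (hf : Continuous f)
    {C R a : ℝ} (ha : 1 ≤ a) (h : ∀ x, R ≤ ‖x‖ → ‖f x‖ ≤ C * ‖x‖ ^ (-a)) :
    MemLp f (ENNReal.ofReal ((n : ℝ) + 1)) := by
  obtain ⟨M, hM⟩ := exists_bound_of_decay hf (by linarith) h
  have hM0 : 0 ≤ M := (norm_nonneg _).trans (hM 0)
  have hn : (0 : ℝ) ≤ n := n.cast_nonneg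
  set R' := max R 1
  have hR' : 1 ≤ R' := le_max_right _ _
  have hw : MemLp (fun y : E n => (1 + ‖y‖) ^ (-(1 : ℝ))) (ENNReal.ofReal ((n : ℝ) + 1)) := by
    have hc : Continuous fun y : E n => (1 + ‖y‖) ^ (-(1 : ℝ)) :=
      Continuous.rpow_const (by fun_prop) fun y => Or.inl (by positivity)
    rw [← integrable_norm_rpow_iff hc.aestronglyMeasurable (by simp; positivity) (by simp),
      ENNReal.toReal_ofReal (by positivity)]
    have h1 : Integrable fun y : E n => (1 + ‖y‖) ^ (-((n : ℝ) + 1)) :=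
      integrable_one_add_norm (by rw [finrank_euclideanSpace_fin]; linarith)
    refine h1.congr (ae_of_all _ fun y => ?_)
    simp only
    rw [Real.norm_of_nonneg (by positivity), ← Real.rpow_mul (by positivity)]
    congr 1; ring
  refine (hw.const_mul (2 * |C| + M * (1 + R'))).mono' hf.aestronglyMeasurable
    (ae_of_all _ fun x => ?_)
  have hx0 := norm_nonneg x
  rw [Real.rpow_neg_one, ← div_eq_mul_inv, le_div_iff₀ (by positivity)]
  rcases le_or_gt R' ‖x‖ with hxR | hxR
  · have hx1 : 1 ≤ ‖x‖ := hR'.trans hxR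
    have h1 : ‖x‖ ^ (-a) ≤ ‖x‖⁻¹ := by
      rw [← Real.rpow_neg_one]
      exact Real.rpow_le_rpow_of_exponent_le hx1 (by linarith)
    calc _ ≤ (|C| * ‖x‖⁻¹) * (2 * ‖x‖) := by
          gcongr
          · exact (h x ((le_max_left _ _).trans hxR)).trans (by
              gcongr; exact le_abs_self C)
          · linarith
      _ = 2 * |C| := by field_simp
      _ ≤ _ := by
        have : 0 ≤ M * (1 + R') := by positivity
        linarith
  · calc _ ≤ M * (1 + R') := by gcongr; exact hM x
      _ ≤ _ := by
        have := abs_nonneg C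
        linarith

/-- Integration by parts against a Schwartz function, for a smooth bounded field with bounded
derivative. -/
lemma hasDistDiv_of_contDiff {A : E n → E n} (hA : ContDiff ℝ ∞ A) {M M' : ℝ}
    (hM : ∀ x, ‖A x‖ ≤ M) (hM' : ∀ x, ‖fderiv ℝ A x‖ ≤ M') :
    HasDistDiv A fun x => ∑ i, pd i A x i := by
  intro φ
  have hAc := hA.continuous
  have hA'c : Continuous (fderiv ℝ A) := hA.continuous_fderiv (by simp)
  have hM'0 : 0 ≤ M' := (norm_nonneg _).trans (hM' 0)
  have hφ' : Continuous (fderiv ℝ φ) := (φ.smooth ⊤).continuous_fderiv (by simp)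
  have hφi : Integrable φ := φ.integrable
  have hφ'i : Integrable (fderiv ℝ φ) := (SchwartzMap.fderivCLM ℝ (E n) ℝ φ).integrable
  have hd : ∀ i x, HasFDerivAt (fun x => A x i)
      ((EuclideanSpace.proj i : E n →L[ℝ] ℝ).comp (fderiv ℝ A x)) x := fun i x =>
    (EuclideanSpace.proj i : E n →L[ℝ] ℝ).hasFDerivAt.comp x
      (hA.differentiable (by simp) x).hasFDerivAt
  have hpd : ∀ i x, fderiv ℝ (fun x => A x i) x (EuclideanSpace.single i 1) = pd i A x i := by
    intro i x
    rw [(hd i x).fderiv]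
    rfl
  have hc : ∀ i x, ‖A x i‖ ≤ M := fun i x => (PiLp.norm_apply_le _ _).trans (hM x)
  have hcd : ∀ i x, ‖pd i A x i‖ ≤ M' := fun i x => by
    refine (PiLp.norm_apply_le _ _).trans ((ContinuousLinearMap.le_opNorm _ _).trans ?_)
    simpa using hM' x
  have hci : ∀ i, Continuous fun x => A x i := fun i => by fun_prop
  have hpi : ∀ i, Continuous fun x => pd i A x i := fun i => by
    unfold pd; fun_prop
  have i1 : ∀ i, Integrable fun x => pd i A x i * φ x := fun i =>
    hφi.bdd_mul (hpi i).aestronglyMeasurable (ae_of_all _ (hcd i))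
  have i2 : ∀ i, Integrable fun x => A x i * fderiv ℝ φ x (EuclideanSpace.single i 1) := fun i =>
    (hφ'i.apply_continuousLinearMap _).bdd_mul (hci i).aestronglyMeasurable (ae_of_all _ (hc i))
  have i3 : ∀ i, Integrable fun x => A x i * φ x := fun i =>
    hφi.bdd_mul (hci i).aestronglyMeasurable (ae_of_all _ (hc i))
  have h1 : ∀ x, inner ℝ (A x) (gradient φ x) =
      ∑ i, A x i * fderiv ℝ φ x (EuclideanSpace.single i 1) := by
    intro x
    rw [real_inner_comm, inner_gradient_left]
    conv_lhs => rw [← CrossData.sum_smul_single (A x), map_sum]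
    simp
  simp_rw [h1, Finset.sum_mul]
  rw [integral_finsetSum _ fun i _ => i2 i, integral_finsetSum _ fun i _ => i1 i,
    ← Finset.sum_neg_distrib]
  refine Finset.sum_congr rfl fun i _ => ?_
  rw [integral_mul_fderiv_eq_neg_fderiv_mul_of_integrable (f := fun x => A x i) (g := φ)
    (by simpa only [hpd] using i1 i) (i2 i) (i3 i)
    (fun x _ => (hd i x).differentiableAt) (fun x _ => φ.differentiableAt)]
  simp only [hpd]

end

section

variable {n : ℕ} {F : Type*} [NormedAddCommGroup F] [InnerProductSpace ℝ F]

namespace CrossData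

variable (K : CrossData n F) {B : E n → F} {μ : ℝ}

lemma contDiff_radialGauge_dirac (hB : ContDiff ℝ ∞ B) :
    ContDiff ℝ ∞ (K.radialGauge (Measure.dirac 0) (fun _ => 1) B) := by
  have h : ContDiff ℝ ∞ fun q : E n × ℝ => K.cr q.1 (q.2 • B (q.2 • q.1)) :=
    (K.cr.contDiff.comp contDiff_fst).clm_apply
      (contDiff_snd.smul (hB.comp (contDiff_snd.smul contDiff_fst)))
  simp_rw [show K.radialGauge (Measure.dirac 0) (fun _ => 1) B = fun x =>
    -∫ s in (0 : ℝ)..1, K.cr x (s • B (s • x)) from funext (K.radialGauge_dirac B)]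
  exact (contDiff_intervalIntegral h).neg

/-- The derivative of the transversal gauge decays like the field, provided that the derivative of
the field decays faster by a full power. -/
lemma exists_norm_fderiv_radialGauge_dirac_le (hB : ContDiff ℝ ∞ B) {a C₁ C₂ : ℝ} (ha0 : 0 ≤ a)
    (ha : a < 2) (hC₁ : 0 ≤ C₁) (hC₂ : 0 ≤ C₂) (h₁ : ∀ y, y ≠ 0 → ‖B y‖ ≤ C₁ * ‖y‖ ^ (-a))
    (h₂ : ∀ y, y ≠ 0 → ‖fderiv ℝ B y‖ ≤ C₂ * ‖y‖ ^ (-(a + 1))) :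
    ∃ C : ℝ, ∀ x, x ≠ 0 →
      ‖fderiv ℝ (K.radialGauge (Measure.dirac 0) (fun _ => 1) B) x‖ ≤ C * ‖x‖ ^ (-a) := by
  have hBc := hB.continuous
  set I : ℝ := ∫ s in (0 : ℝ)..1, s ^ (1 - a)
  have hI : 0 ≤ I := intervalIntegral.integral_nonneg zero_le_one
    fun s hs => Real.rpow_nonneg hs.1 _
  refine ⟨(C₁ + 4 * 2 ^ a * C₂) * I, fun x₀ hx₀ => norm_fderiv_le_of_lip' ℝ (by positivity) ?_⟩
  have hr : 0 < ‖x₀‖ := norm_pos_iff.2 hx₀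
  filter_upwards [Metric.ball_mem_nhds x₀ (half_pos hr)] with x hx
  rw [mem_ball_iff_norm] at hx
  have hx2 : ‖x‖ ≤ 2 * ‖x₀‖ := by
    have h2 := (abs_le.1 ((abs_norm_sub_norm_le x x₀).trans hx.le)).2
    linarith
  have hint : ∀ x, IntervalIntegrable (fun s : ℝ => K.cr x (s • B (s • x))) volume 0 1 :=
    fun x => (by fun_prop : Continuous fun s : ℝ => K.cr x (s • B (s • x))).intervalIntegrable _ _
  rw [radialGauge_dirac, radialGauge_dirac, neg_sub_neg,
    ← intervalIntegral.integral_sub (hint x₀) (hint x), show (C₁ + 4 * 2 ^ a * C₂) * I *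
      ‖x₀‖ ^ (-a) * ‖x - x₀‖ = ∫ s in (0 : ℝ)..1, (C₁ + 4 * 2 ^ a * C₂) * ‖x₀‖ ^ (-a) *
        ‖x - x₀‖ * s ^ (1 - a) by rw [intervalIntegral.integral_const_mul]; ring]
  refine intervalIntegral.norm_integral_le_of_norm_le zero_le_one
    (ae_of_all _ fun s hs => ?_)
    ((intervalIntegral.intervalIntegrable_rpow' (by linarith)).const_mul _)
  have hs0 : 0 < s := hs.1
  have hsr : 0 < s * ‖x₀‖ := by positivity
  have hlip : ‖B (s • x) - B (s • x₀)‖ ≤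
      C₂ * (s * ‖x₀‖ / 2) ^ (-(a + 1)) * ‖s • x - s • x₀‖ := by
    refine (convex_ball (s • x₀) (s * ‖x₀‖ / 2)).norm_image_sub_le_of_norm_fderiv_le (𝕜 := ℝ)
      (fun y _ => hB.differentiable (by simp) y) (fun y hy => ?_)
      (Metric.mem_ball_self (by positivity)) ?_
    · rw [mem_ball_iff_norm] at hy
      have h3 : s * ‖x₀‖ / 2 ≤ ‖y‖ := by
        have h4 := (abs_le.1 ((abs_norm_sub_norm_le y (s • x₀)).trans hy.le)).1
        rw [norm_smul, Real.norm_of_nonneg hs0.le] at h4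
        linarith
      have hy0 : 0 < ‖y‖ := by linarith
      refine (h₂ y (norm_pos_iff.1 hy0)).trans (mul_le_mul_of_nonneg_left ?_ hC₂)
      exact Real.rpow_le_rpow_of_nonpos (by positivity) h3 (by linarith)
    · rw [mem_ball_iff_norm, ← smul_sub, norm_smul, Real.norm_of_nonneg hs0.le]
      calc _ < s * (‖x₀‖ / 2) := by gcongr
        _ = _ := by ring
  have hsplit : K.cr x₀ (s • B (s • x₀)) - K.cr x (s • B (s • x)) =
      -(K.cr (x - x₀) (s • B (s • x₀)) + K.cr x (s • (B (s • x) - B (s • x₀)))) := by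
    simp only [map_sub, sub_apply, smul_sub]; abel
  have e1 : (s * ‖x₀‖ / 2) ^ (-(a + 1)) = 2 * 2 ^ a * (s ^ (-a) * s⁻¹) *
      (‖x₀‖ ^ (-a) * ‖x₀‖⁻¹) := by
    rw [Real.div_rpow hsr.le (by norm_num), Real.mul_rpow hs0.le hr.le,
      show -(a + 1) = -a + -1 by ring, Real.rpow_add hs0, Real.rpow_add hr,
      Real.rpow_add (by norm_num : (0 : ℝ) < 2), Real.rpow_neg_one, Real.rpow_neg_one,
      Real.rpow_neg_one, Real.rpow_neg (by norm_num : (0 : ℝ) ≤ 2)]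
    have : (0 : ℝ) < 2 ^ a := by positivity
    field_simp
  have e2 : s ^ (1 - a) = s * s ^ (-a) := by
    rw [sub_eq_add_neg, Real.rpow_add hs0, Real.rpow_one]
  rw [hsplit, norm_neg]
  calc _ ≤ ‖x - x₀‖ * (s * (C₁ * ‖s • x₀‖ ^ (-a))) + (2 * ‖x₀‖) * (s *
        (C₂ * (s * ‖x₀‖ / 2) ^ (-(a + 1)) * ‖s • x - s • x₀‖)) := by
        refine (norm_add_le _ _).trans (add_le_add ((K.norm_cr_le _ _).trans ?_)
          ((K.norm_cr_le _ _).trans ?_))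
        · rw [norm_smul, Real.norm_of_nonneg hs0.le]
          gcongr
          exact h₁ _ (smul_ne_zero hs0.ne' hx₀)
        · rw [norm_smul, Real.norm_of_nonneg hs0.le]
          gcongr
    _ = _ := by
        rw [← smul_sub, norm_smul, norm_smul, Real.norm_of_nonneg hs0.le,
          Real.mul_rpow hs0.le hr.le, e1, e2]
        field_simp
        ring

/-- The truncated Coulomb potential of the field is short-range, and the transversal gauge of the
remaining smooth field has a derivative that decays faster than `1 / |x|`. The former is
divergence-free, so that the divergence of the sum is the classical one of the latter. -/
lemma exists_isSpecialGauge [CompleteSpace F] (hn : 2 ≤ n) (hB : DecayField B μ) (hμ : 3 / 2 < μ)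
    (hμ2 : μ < 2) (hdiv : K.IsDivFree B) :
    ∃ A As Ar : E n → E n, K.HasCurl A B ∧ IsSpecialGauge A As Ar := by
  have hn1 : 1 ≤ n := by omega
  have hT : Truncation (scaleTruncation : E n → E n → ℝ) := truncation_scaleTruncation
  set As := K.potential scaleTruncation B
  set Br := K.remainder scaleTruncation B
  set Ar := K.radialGauge (Measure.dirac 0) (fun _ => 1) Br
  have hBr : ContDiff ℝ ∞ Br := K.contDiff_remainder hn1 hB
  have hAr : ContDiff ℝ ∞ Ar := K.contDiff_radialGauge_dirac hBr
  -- decay of the two parts of the potential and of the field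
  obtain ⟨Cs, Rs, hsdec⟩ := K.exists_norm_potential_scaleTruncation_le hn hB (by linarith)
  obtain ⟨Ms, -, hsbd⟩ := K.exists_norm_potential_le hn hT hB (by linarith)
  obtain ⟨Cr, Rr, hrdec⟩ := K.exists_norm_remainder_le hn1 hB (by linarith)
  obtain ⟨Cd, Rd, hddec⟩ := K.exists_norm_fderiv_remainder_le hn1 hB (by linarith)
  obtain ⟨C₁, hC₁, h₁⟩ := exists_norm_le_rpow_of_continuous hBr.continuous (C := |Cr|)
    (R := max Rr 1) (a := μ - 1 / 2) (by linarith) fun x hx => by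
      refine (hrdec x ((le_max_left _ _).trans hx)).trans ?_
      gcongr
      · exact le_abs_self Cr
      · exact (le_max_right _ _).trans hx
      · linarith
  obtain ⟨C₂, hC₂, h₂⟩ := exists_norm_le_rpow_of_continuous
    (hBr.continuous_fderiv (by simp)) (by linarith) hddec
  obtain ⟨C, hC⟩ := K.exists_norm_fderiv_radialGauge_dirac_le hBr (a := μ - 1 / 2) (by linarith)
    (by linarith) hC₁ hC₂ h₁ fun y hy => by
      rw [show μ - 1 / 2 + 1 = μ + 1 / 2 by ring]; exact h₂ y hy
  have hdecBr : DecaysAE Br μ := ⟨Cr, Rr, ae_of_all _ hrdec⟩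
  have hbr := radialBound_dirac K hBr.continuous (by linarith : 0 ≤ μ) hdecBr
  have hmr : MediumRange Ar := hbr.mediumRange_radialGauge hμ hμ2
  have hs : ShortRange As := ⟨K.continuous_potential hn hT hB (by linarith),
    decaysIntegrably_of_le (by linarith) hsdec hsbd⟩
  have hAs : IsBigOInv As (μ - 1) := by
    refine isBigOInv_of_le (C := |Cs|) (R := max Rs 1) fun x hx => ?_
    refine (hsdec x ((le_max_left _ _).trans hx)).trans ?_
    gcongr
    · exact le_abs_self Cs
    · exact (le_max_right _ _).trans hx
    · linarith
  have hms : MediumRange As := hs.mediumRange (by linarith) hAs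
  have hA'c : Continuous (fderiv ℝ Ar) := hAr.continuous_fderiv (by simp)
  have hA'dec : ∀ x, 1 ≤ ‖x‖ → ‖fderiv ℝ Ar x‖ ≤ C * ‖x‖ ^ (-(μ - 1 / 2)) := fun x hx =>
    hC x (norm_pos_iff.1 (by linarith))
  obtain ⟨M', hM'⟩ := exists_bound_of_decay hA'c (by linarith) hA'dec
  obtain ⟨M, -, hM⟩ := hmr.exists_bound
  have hpd : ∀ i k x, |pd i Ar x k| ≤ ‖fderiv ℝ Ar x‖ := fun i k x => by
    rw [← Real.norm_eq_abs]
    refine (PiLp.norm_apply_le _ _).trans ((ContinuousLinearMap.le_opNorm _ _).trans ?_)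
    simp
  have hsum : ∀ x, ‖∑ i, pd i Ar x i‖ ≤ n * ‖fderiv ℝ Ar x‖ := fun x =>
    (norm_sum_le_of_le _ fun i _ => hpd i i x).trans (by simp)
  refine ⟨fun x => As x + Ar x, As, Ar, ?_, ?_⟩
  · intro φ
    have hφ : Integrable (φ : E n → F) := φ.integrable
    have hφ' : Integrable (fderiv ℝ φ) := (SchwartzMap.fderivCLM ℝ (E n) F φ).integrable
    have hcu : Integrable fun x => K.cu (fderiv ℝ φ x) := K.cu.integrable_comp hφ'
    have hi : ∀ (A : E n → E n), Continuous A → ∀ N, (∀ x, ‖A x‖ ≤ N) →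
        Integrable fun x => inner ℝ (A x) (K.cu (fderiv ℝ φ x)) := by
      intro A hA N hN
      refine (hcu.norm.const_mul N).mono' (hA.aestronglyMeasurable.inner hcu.1)
        (ae_of_all _ fun x => (norm_inner_le_norm _ _).trans ?_)
      gcongr; exact hN x
    have h3 := K.integral_inner_potential_cu hn hT hB (by linarith) hdiv φ
    have h4 := hbr.hasCurl_radialGauge hn (p := (n : ℝ) + 1) (by linarith)
      (memLp_of_decay hBr.continuous (by linarith) hrdec)
      (K.isDivFree_remainder hn hT hB (by linarith) hdiv) (by simp) (by simp) φ
    simp only [inner_add_left]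
    rw [integral_add (hi As hs.continuous Ms hsbd) (hi Ar hAr.continuous M hM), h3, h4,
      sub_add_cancel]
  · refine ⟨⟨hms.continuous.add hmr.continuous, ⟨μ - 1, by linarith, ?_⟩, ?_⟩, fun _ => rfl, hs,
      K.isTransversal_radialGauge_dirac Br, hAr, ⟨C, μ - 1 / 2, by linarith, fun i k x hx =>
        (hpd i k x).trans (hC x hx)⟩, fun x => ∑ i, pd i Ar x i, ?_, ?_, ?_⟩
    · exact hAs.add (hbr.isBigOInv_radialGauge (by linarith) hμ2)
    · have h3 := hms.longitudinal.add hmr.longitudinal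
      simpa only [inner_add_left, add_div] using h3
    · intro φ
      have hgr : Continuous fun x => gradient (φ : E n → ℝ) x :=
        (InnerProductSpace.toDual ℝ (E n)).symm.continuous.comp
          ((φ.smooth ⊤).continuous_fderiv (by simp))
      have hφ' : Integrable (fderiv ℝ φ) := (SchwartzMap.fderivCLM ℝ (E n) ℝ φ).integrable
      have hgn : ∀ x, ‖gradient (φ : E n → ℝ) x‖ = ‖fderiv ℝ φ x‖ := fun x =>
        (InnerProductSpace.toDual ℝ (E n)).symm.norm_map _
      have hi : ∀ (A : E n → E n), Continuous A → ∀ N, (∀ x, ‖A x‖ ≤ N) →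
          Integrable fun x => inner ℝ (A x) (gradient (φ : E n → ℝ) x) := by
        intro A hA N hN
        refine (hφ'.norm.const_mul N).mono' (hA.inner hgr).aestronglyMeasurable
          (ae_of_all _ fun x => (norm_inner_le_norm _ _).trans ?_)
        rw [hgn]
        gcongr; exact hN x
      have h3 := K.hasDistDiv_potential hn hT hB (by linarith) φ
      have h4 := hasDistDiv_of_contDiff hAr hM hM' φ
      simp only [inner_add_left]
      rw [integral_add (hi As hs.continuous Ms hsbd) (hi Ar hAr.continuous M hM), h3, h4]
      simp
    · unfold pd; fun_prop
    · refine decaysIntegrably_of_le (C := n * C) (R := 1) (K := n * M') (a := μ - 1 / 2)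
        (by linarith) (fun x hx => (hsum x).trans ?_) fun x => (hsum x).trans ?_
      · rw [mul_assoc]
        gcongr; exact hA'dec x hx
      · gcongr; exact hM' x

end CrossData

end

section

/-! ### Fields of medium decay -/

namespace CrossData

variable {n : ℕ} {F : Type*} [NormedAddCommGroup F] [InnerProductSpace ℝ F] [CompleteSpace F]
  (K : CrossData n F) {B : E n → F} {μ : ℝ}

lemma griesinger_spec (hn : 2 ≤ n) (hB : DecayField B μ) (hμ : 3 / 2 < μ) (hμ2 : μ < 2)
    (hdiv : K.IsDivFree B) {h : E n → ℝ} (hh : IsMollifier h) :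
    K.HasCurl (K.radialGauge volume h B) B ∧ MediumRange (K.radialGauge volume h B) ∧
      ∀ ν : ℝ, 3 / 2 < ν → ν < 2 → DecaysAE B ν →
        IsBigOInv (K.radialGauge volume h B) (ν - 1) := by
  have hb := radialBound_mollifier K hn hh (by linarith) hB
  obtain ⟨p, hp, hBp⟩ := hB.memLp
  refine ⟨hb.hasCurl_radialGauge hn hp hBp hdiv hh.lintegral_ne_top hh.integral_eq_one,
    hb.mediumRange_radialGauge hμ hμ2, fun ν hν hν2 hd => ?_⟩
  exact (radialBound_mollifier K hn hh (by linarith) ⟨hB.memLp, hd⟩).isBigOInv_radialGauge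
    (by linarith) hν2

lemma transversal_spec (hn : 2 ≤ n) (hB : DecayField B μ) (hμ : 3 / 2 < μ) (hμ2 : μ < 2)
    (hdiv : K.IsDivFree B) (hBc : Continuous B) :
    K.HasCurl (K.radialGauge (Measure.dirac 0) (fun _ => 1) B) B ∧
      IsTransversal (K.radialGauge (Measure.dirac 0) (fun _ => 1) B) ∧
      MediumRange (K.radialGauge (Measure.dirac 0) (fun _ => 1) B) ∧
      ∀ ν : ℝ, 3 / 2 < ν → ν < 2 → DecaysAE B ν →
        IsBigOInv (K.radialGauge (Measure.dirac 0) (fun _ => 1) B) (ν - 1) := by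
  have hb := radialBound_dirac K hBc (by linarith : 0 ≤ μ) hB.decay
  obtain ⟨p, hp, hBp⟩ := hB.memLp
  refine ⟨hb.hasCurl_radialGauge hn hp hBp hdiv (by simp) (by simp),
    K.isTransversal_radialGauge_dirac B, hb.mediumRange_radialGauge hμ hμ2,
    fun ν hν hν2 hd => ?_⟩
  exact (radialBound_dirac K hBc (by linarith : 0 ≤ ν) hd).isBigOInv_radialGauge (by linarith) hν2

lemma hasCurl_coulomb (hn : 2 ≤ n) (hB : DecayField B μ) (hμ : 1 < μ) (hdiv : K.IsDivFree B) :
    K.HasCurl (K.potential (fun _ _ => 1) B) B := by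
  intro φ
  rw [K.integral_inner_potential_cu hn truncation_one hB hμ hdiv φ]
  simp [remainder]

end CrossData

/-- The decay rate of a field of medium decay may be taken less than `2`. -/
lemma exists_decayField {n : ℕ} {H : Type*} [NormedAddCommGroup H] {B : E n → H} {p : ℝ≥0∞}
    (hp : n < p) (hBp : MemLp B p) {μ : ℝ} (hμ : 3 / 2 < μ) (hB : DecaysAE B μ) :
    ∃ ν : ℝ, 3 / 2 < ν ∧ ν < 2 ∧ DecayField B ν :=
  ⟨min μ (7 / 4), lt_min hμ (by norm_num), (min_le_right _ _).trans_lt (by norm_num),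
    exists_memLp_ofReal hp hBp (by linarith) hB, hB.mono (min_le_left _ _)⟩

/-- A decay rate greater than `2` may be taken less than `3`. -/
lemma exists_decayField_of_two_lt {n : ℕ} {H : Type*} [NormedAddCommGroup H] {B : E n → H}
    {p : ℝ≥0∞} (hp : n < p) (hBp : MemLp B p) {μ : ℝ} (hμ : 2 < μ) (hB : DecaysAE B μ) :
    ∃ ν : ℝ, 2 < ν ∧ ν < 3 ∧ DecayField B ν :=
  ⟨min μ (5 / 2), lt_min hμ (by norm_num), (min_le_right _ _).trans_lt (by norm_num),
    exists_memLp_ofReal hp hBp (by linarith) hB, hB.mono (min_le_left _ _)⟩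

/-! ### The plane -/

lemma norm_cross2 (w : E 2) (b : ℝ) : ‖cross2 w b‖ = ‖w‖ * ‖b‖ := by
  rw [← sq_eq_sq₀ (norm_nonneg _) (by positivity), mul_pow, EuclideanSpace.norm_sq_eq,
    EuclideanSpace.norm_sq_eq]
  simp [cross2, Fin.sum_univ_two, mul_pow]
  ring

/-- The vector product in the plane, as a continuous bilinear map. -/
def cross2L : E 2 →L[ℝ] ℝ →L[ℝ] E 2 :=
  (LinearMap.mk₂ ℝ cross2 (by intros; ext i; fin_cases i <;> simp [cross2] <;> ring)
    (by intros; ext i; fin_cases i <;> simp [cross2] <;> ring)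
    (by intros; ext i; fin_cases i <;> simp [cross2] <;> ring)
    (by intros; ext i; fin_cases i <;> simp [cross2] <;> ring)).mkContinuous₂ 1
      fun w b => ((norm_cross2 w b).trans (by rw [one_mul])).le

lemma cross2L_apply (w : E 2) (b : ℝ) : cross2L w b = cross2 w b := rfl

/-- The vector product in the plane, where `P` and `Q` vanish. -/
def planeCross : CrossData 2 ℝ where
  cr := cross2L
  P := 0
  Q := 0
  norm_cr_le w b := (norm_cross2 w b).le
  inner_cr_swap w b v := by
    simp [cross2L_apply, cross2, PiLp.inner_apply, Fin.sum_univ_two]; ring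
  P_Q b := by simp
  inner_P v b := by simp
  cr_P_swap v w := by simp
  inner_cr_cr w b v f := by
    simp [cross2L_apply, cross2, PiLp.inner_apply, Fin.sum_univ_two]; ring
  exists_inner_cr i k hik := by
    rcases (by omega : (i = 0 ∧ k = 1) ∨ (i = 1 ∧ k = 0)) with ⟨rfl, rfl⟩ | ⟨rfl, rfl⟩
    · exact ⟨1, fun v g =>
        by simp [cross2L_apply, cross2, PiLp.inner_apply, Fin.sum_univ_two]; ring⟩
    · exact ⟨-1, fun v g =>
        by simp [cross2L_apply, cross2, PiLp.inner_apply, Fin.sum_univ_two]; ring⟩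

lemma planeCross_cr (w : E 2) (b : ℝ) : planeCross.cr w b = cross2 w b := rfl

lemma planeCross_cu (φ : 𝓢(E 2, ℝ)) (x : E 2) :
    planeCross.cu (fderiv ℝ φ x) = scalarCurl2 φ x := by
  rw [CrossData.cu_apply, Fin.sum_univ_two, planeCross_cr, planeCross_cr]
  ext i
  fin_cases i <;> simp [cross2, scalarCurl2, pd]

lemma planeCross_isDivFree (B : E 2 → ℝ) : planeCross.IsDivFree B := fun ψ => by
  simp [planeCross]

lemma distCurl2_eq (A : E 2 → E 2) (φ : 𝓢(E 2, ℝ)) :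
    distCurl2 A φ = ∫ x, inner ℝ (A x) (planeCross.cu (fderiv ℝ φ x)) := by
  simp_rw [planeCross_cu]; rfl

lemma hasDistCurl2_iff (A : E 2 → E 2) (B : E 2 → ℝ) :
    HasDistCurl2 A B ↔ planeCross.HasCurl A B := by
  refine forall_congr' fun φ => ?_
  rw [distCurl2_eq]
  simp [mul_comm]

lemma griesinger2_eq (h : E 2 → ℝ) (B : E 2 → ℝ) :
    griesinger2 h B = planeCross.radialGauge volume h B := rfl

lemma transversal2_eq {B : E 2 → ℝ} (hB : Continuous B) :
    transversal2 B = planeCross.radialGauge (Measure.dirac 0) (fun _ => 1) B := by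
  funext x
  have hi : IntervalIntegrable (fun s : ℝ => s • B (s • x)) volume 0 1 :=
    (by fun_prop : Continuous fun s : ℝ => s • B (s • x)).intervalIntegrable _ _
  rw [CrossData.radialGauge_dirac, (planeCross.cr x).intervalIntegral_comp_comm hi]
  rfl

lemma sphereArea_two : sphereArea 2 = 2 * Real.pi := by
  rw [sphereArea, Measure.real, EuclideanSpace.volume_ball_fin_two]
  simp [Real.pi_pos.le]

lemma coulomb2_eq (B : E 2 → ℝ) : coulomb2 B = planeCross.potential (fun _ _ => 1) B := by
  funext x
  rw [coulomb2, CrossData.potential, sphereArea_two]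
  congr 2
  refine integral_congr_ae (ae_of_all _ fun y => ?_)
  simp only
  rw [← planeCross_cr, map_smul, smul_apply, one_mul, one_div]

/-! ### Space -/

lemma norm_cross3_sq (w b : E 3) :
    ‖cross3 w b‖ ^ 2 = ‖w‖ ^ 2 * ‖b‖ ^ 2 - (inner ℝ w b) ^ 2 := by
  simp only [EuclideanSpace.norm_sq_eq, PiLp.inner_apply, cross3, cross_apply, Fin.sum_univ_three]
  simp
  ring

lemma norm_cross3_le (w b : E 3) : ‖cross3 w b‖ ≤ ‖w‖ * ‖b‖ := by
  refine le_of_sq_le_sq ?_ (by positivity)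
  rw [norm_cross3_sq, mul_pow]
  nlinarith [sq_nonneg (inner ℝ w b)]

/-- The vector product in space, as a continuous bilinear map. -/
def cross3L : E 3 →L[ℝ] E 3 →L[ℝ] E 3 :=
  (LinearMap.mk₂ ℝ cross3
    (by intros; ext i; fin_cases i <;> simp [cross3, cross_apply])
    (by intros; ext i; fin_cases i <;> simp [cross3, cross_apply])
    (by intros; ext i; fin_cases i <;> simp [cross3, cross_apply] <;> ring)
    (by intros; ext i; fin_cases i <;> simp [cross3, cross_apply])).mkContinuous₂ 1
      fun w b => (norm_cross3_le w b).trans (by rw [one_mul])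

lemma cross3L_apply (w b : E 3) : cross3L w b = cross3 w b := rfl

/-- The vector product in space, where `P` and `Q` are the identity. -/
def spaceCross : CrossData 3 (E 3) where
  cr := cross3L
  P := ContinuousLinearMap.id ℝ (E 3)
  Q := ContinuousLinearMap.id ℝ (E 3)
  norm_cr_le := norm_cross3_le
  inner_cr_swap w b v := by
    simp [cross3L_apply, cross3, cross_apply, PiLp.inner_apply, Fin.sum_univ_three]; ring
  P_Q b := by norm_num
  inner_P v b := rfl
  cr_P_swap v w := by
    ext i
    fin_cases i <;> simp [cross3L_apply, cross3, cross_apply] <;> ring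
  inner_cr_cr w b v f := by
    simp [cross3L_apply, cross3, cross_apply, PiLp.inner_apply, Fin.sum_univ_three]; ring
  exists_inner_cr i k hik := by
    -- the remaining coordinate vector, up to its sign
    refine ⟨cross3 (EuclideanSpace.single i 1) (EuclideanSpace.single k 1), fun v g => ?_⟩
    fin_cases i <;> fin_cases k <;>
      first
        | exact absurd rfl hik
        | (simp [cross3L_apply, cross3, cross_apply, PiLp.inner_apply,
            Fin.sum_univ_three]; try ring)

lemma spaceCross_cr (w b : E 3) : spaceCross.cr w b = cross3 w b := rfl

lemma spaceCross_cu (φ : 𝓢(E 3, E 3)) (x : E 3) :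
    spaceCross.cu (fderiv ℝ φ x) = curl3 φ x := by
  rw [CrossData.cu_apply, Fin.sum_univ_three, spaceCross_cr, spaceCross_cr, spaceCross_cr]
  ext i
  fin_cases i <;> simp [cross3, cross_apply, curl3, pd] <;> ring

lemma spaceCross_isDivFree {B : E 3 → E 3} (hB : HasDistDiv B 0) : spaceCross.IsDivFree B := by
  intro ψ
  have h := hB ψ
  simp only [Pi.zero_apply, zero_mul, integral_zero, neg_zero] at h
  rw [← h]
  refine integral_congr_ae (ae_of_all _ fun x => ?_)
  simp only
  rw [real_inner_comm, inner_gradient_left]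
  rfl

lemma distCurl3_eq (A : E 3 → E 3) (φ : 𝓢(E 3, E 3)) :
    distCurl3 A φ = ∫ x, inner ℝ (A x) (spaceCross.cu (fderiv ℝ φ x)) := by
  simp_rw [spaceCross_cu]; rfl

lemma hasDistCurl3_iff (A B : E 3 → E 3) : HasDistCurl3 A B ↔ spaceCross.HasCurl A B :=
  forall_congr' fun φ => by rw [distCurl3_eq]

lemma griesinger3_eq (h : E 3 → ℝ) (B : E 3 → E 3) :
    griesinger3 h B = spaceCross.radialGauge volume h B := rfl

lemma transversal3_eq {B : E 3 → E 3} (hB : Continuous B) :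
    transversal3 B = spaceCross.radialGauge (Measure.dirac 0) (fun _ => 1) B := by
  funext x
  have hi : IntervalIntegrable (fun s : ℝ => s • B (s • x)) volume 0 1 :=
    (by fun_prop : Continuous fun s : ℝ => s • B (s • x)).intervalIntegrable _ _
  rw [CrossData.radialGauge_dirac, (spaceCross.cr x).intervalIntegral_comp_comm hi]
  rfl

lemma sphereArea_three : sphereArea 3 = 4 * Real.pi := by
  rw [sphereArea, Measure.real, EuclideanSpace.volume_ball_fin_three]
  rw [ENNReal.toReal_mul, ENNReal.toReal_pow, ENNReal.toReal_ofReal zero_le_one,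
    ENNReal.toReal_ofReal (by positivity)]
  push_cast
  ring

lemma coulomb3_eq (B : E 3 → E 3) : coulomb3 B = spaceCross.potential (fun _ _ => 1) B := by
  funext x
  rw [coulomb3, CrossData.potential, sphereArea_three]
  congr 2
  refine integral_congr_ae (ae_of_all _ fun y => ?_)
  simp only
  rw [← spaceCross_cr, map_smul, smul_apply, one_mul, one_div]

end

end VectorPotential

end

theorem theorem1 :
    -- the plane
    ((∀ A A' : E 2 → E 2,
        MediumRange A → MediumRange A' →
        (∀ φ, distCurl2 A' φ = distCurl2 A φ) →
        ∃ l : E 2 → ℝ, ContDiff ℝ 1 l ∧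
          (∀ x, A' x = A x + gradient l x) ∧
          ∃ Λ : E 2 → ℝ, HasRadialLimit l Λ) ∧
      ∀ B : E 2 → ℝ, MediumDecay2 B →
        -- the Griesinger gauge and the transversal gauge
        (∀ h : E 2 → ℝ, IsMollifier h →
          HasDistCurl2 (griesinger2 h B) B ∧
          MediumRange (griesinger2 h B) ∧
          ∀ μ : ℝ, 3 / 2 < μ → μ < 2 → DecaysAE B μ →
            IsBigOInv (griesinger2 h B) (μ - 1)) ∧
        (Continuous B →
          HasDistCurl2 (transversal2 B) B ∧
          IsTransversal (transversal2 B) ∧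
          MediumRange (transversal2 B) ∧
          ∀ μ : ℝ, 3 / 2 < μ → μ < 2 → DecaysAE B μ →
            IsBigOInv (transversal2 B) (μ - 1)) ∧
        -- stronger decay
        (∀ μ : ℝ, 2 < μ → DecaysAE B μ →
          (HasDistCurl2 (coulomb2 B) B ∧
            HasDistDiv (coulomb2 B) 0 ∧
            MediumRange (coulomb2 B)) ∧
          BoundedByInv (coulomb2 B) ∧
          (∀ h : E 2 → ℝ, IsMollifier h →
            BoundedByInv (griesinger2 h B)) ∧
          (Continuous B → BoundedByInv (transversal2 B)) ∧
          Integrable B ∧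
          (ShortRange (coulomb2 B) ↔ ∫ x, B x = 0)) ∧
        -- the special gauge
        ∃ A As Ar : E 2 → E 2,
          HasDistCurl2 A B ∧ IsSpecialGauge A As Ar) ∧
    -- space
    ((∀ A A' : E 3 → E 3,
        MediumRange A → MediumRange A' →
        (∀ φ, distCurl3 A' φ = distCurl3 A φ) →
        ∃ l : E 3 → ℝ, ContDiff ℝ 1 l ∧
          (∀ x, A' x = A x + gradient l x) ∧
          ∃ Λ : E 3 → ℝ, HasRadialLimit l Λ) ∧
      ∀ B : E 3 → E 3, MediumDecay3 B →
        -- the Griesinger gauge and the transversal gauge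
        (∀ h : E 3 → ℝ, IsMollifier h →
          HasDistCurl3 (griesinger3 h B) B ∧
          MediumRange (griesinger3 h B) ∧
          ∀ μ : ℝ, 3 / 2 < μ → μ < 2 → DecaysAE B μ →
            IsBigOInv (griesinger3 h B) (μ - 1)) ∧
        (Continuous B →
          HasDistCurl3 (transversal3 B) B ∧
          IsTransversal (transversal3 B) ∧
          MediumRange (transversal3 B) ∧
          ∀ μ : ℝ, 3 / 2 < μ → μ < 2 → DecaysAE B μ →
            IsBigOInv (transversal3 B) (μ - 1)) ∧
        -- stronger decay
        (∀ μ : ℝ, 2 < μ → DecaysAE B μ →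
          (HasDistCurl3 (coulomb3 B) B ∧
            HasDistDiv (coulomb3 B) 0 ∧
            MediumRange (coulomb3 B)) ∧
          BoundedByInv (coulomb3 B) ∧
          (∀ h : E 3 → ℝ, IsMollifier h →
            BoundedByInv (griesinger3 h B)) ∧
          (Continuous B → BoundedByInv (transversal3 B)) ∧
          FluxVanishesAEPlane B ∧
          ShortRange (coulomb3 B)) ∧
        -- the special gauge
        ∃ A As Ar : E 3 → E 3,
          HasDistCurl3 A B ∧ IsSpecialGauge A As Ar) := by
  refine ⟨⟨fun A A' hA hA' h => ?_, fun B hB => ?_⟩, fun A A' hA hA' h => ?_, fun B hB => ?_⟩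
  · exact planeCross.exists_gauge hA hA' fun φ => by rw [← distCurl2_eq, ← distCurl2_eq, h]
  · obtain ⟨p, hp, hBp⟩ := hB.memLp
    obtain ⟨μ₀, hμ₀, hdec₀⟩ := hB.decay
    have hdiv := planeCross_isDivFree B
    obtain ⟨μ, hμ, hμ2, hD⟩ := exists_decayField (by exact_mod_cast hp) hBp hμ₀ hdec₀
    refine ⟨fun h hh => ?_, fun hBc => ?_, fun ν hν hdec => ?_, ?_⟩
    · rw [hasDistCurl2_iff, griesinger2_eq]
      exact planeCross.griesinger_spec le_rfl hD hμ hμ2 hdiv hh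
    · rw [hasDistCurl2_iff, transversal2_eq hBc]
      exact planeCross.transversal_spec le_rfl hD hμ hμ2 hdiv hBc
    · obtain ⟨ν', hν', hν3, hD'⟩ := exists_decayField_of_two_lt (by exact_mod_cast hp) hBp hν hdec
      rw [hasDistCurl2_iff, coulomb2_eq]
      refine ⟨⟨planeCross.hasCurl_coulomb le_rfl hD' (by linarith) hdiv,
        planeCross.hasDistDiv_potential le_rfl truncation_one hD' (by linarith),
        planeCross.mediumRange_coulomb_plane hD' hν' hν3⟩,
        planeCross.boundedByInv_coulomb_plane hD' hν' hν3, fun h hh => ?_, fun hBc => ?_,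
        hD'.integrable (by norm_num) (by exact_mod_cast hν'),
        planeCross.shortRange_coulomb_plane_iff hD' hν' hν3 norm_cross2⟩
      · rw [griesinger2_eq]
        exact (radialBound_mollifier _ le_rfl hh (by linarith) hD').boundedByInv_radialGauge hν'
      · rw [transversal2_eq hBc]
        exact (radialBound_dirac _ hBc (by linarith) hD'.decay).boundedByInv_radialGauge hν'
    · simp_rw [hasDistCurl2_iff]
      exact planeCross.exists_isSpecialGauge le_rfl hD hμ hμ2 hdiv
  · exact spaceCross.exists_gauge hA hA' fun φ => by rw [← distCurl3_eq, ← distCurl3_eq, h]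
  · obtain ⟨p, hp, hBp⟩ := hB.memLp
    obtain ⟨μ₀, hμ₀, hdec₀⟩ := hB.decay
    have hdiv := spaceCross_isDivFree hB.div_eq_zero
    have h23 : 2 ≤ 3 := by norm_num
    obtain ⟨μ, hμ, hμ2, hD⟩ := exists_decayField (by exact_mod_cast hp) hBp hμ₀ hdec₀
    refine ⟨fun h hh => ?_, fun hBc => ?_, fun ν hν hdec => ?_, ?_⟩
    · rw [hasDistCurl3_iff, griesinger3_eq]
      exact spaceCross.griesinger_spec h23 hD hμ hμ2 hdiv hh
    · rw [hasDistCurl3_iff, transversal3_eq hBc]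
      exact spaceCross.transversal_spec h23 hD hμ hμ2 hdiv hBc
    · obtain ⟨ν', hν', hν3, hD'⟩ := exists_decayField_of_two_lt (by exact_mod_cast hp) hBp hν hdec
      have hν3' : ν' < (3 : ℕ) := by exact_mod_cast hν3
      rw [hasDistCurl3_iff, coulomb3_eq]
      refine ⟨⟨spaceCross.hasCurl_coulomb h23 hD' (by linarith) hdiv,
        spaceCross.hasDistDiv_potential h23 truncation_one hD' (by linarith),
        spaceCross.mediumRange_potential h23 truncation_one hD' hν' hν3'⟩,
        spaceCross.boundedByInv_potential h23 truncation_one hD' hν' hν3', fun h hh => ?_,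
        fun hBc => ?_, fluxVanishesAEPlane hD' hν' hB.div_eq_zero,
        spaceCross.shortRange_potential h23 truncation_one hD' hν' hν3'⟩
      · rw [griesinger3_eq]
        exact (radialBound_mollifier _ h23 hh (by linarith) hD').boundedByInv_radialGauge hν'
      · rw [transversal3_eq hBc]
        exact (radialBound_dirac _ hBc (by linarith) hD'.decay).boundedByInv_radialGauge hν'
    · simp_rw [hasDistCurl3_iff]
      exact spaceCross.exists_isSpecialGauge h23 hD hμ hμ2 hdiv
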